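/- A \emph{noncommutative rational formula} over $\mathbb{Q}$ in $x_1,\dots,x_n$ is a tree whose leaves are labelled by variables $x_i$ or constants $c\in\mathbb{Q}$ and whose inner gates are binary additions, binary multiplications and unary inversions. On a tuple $(p_1,\dots,p_n)$ of $\ell\times\ell$ matrices over $\mathbb{Q}$ it is evaluated gate by gate (a constant $c$ has the value $cI_\ell$); it is \emph{undefined} on the tuple if some inversion gate is applied to a subformula whose value is a singular matrix. \textbf{Lemma.} There is an $\mathrm{NC}^4$ algorithm which, given (in binary encoding) a noncommutative rational formula $\Phi$ over $\mathbb{Q}$ in $n$ variables and a tuple $(p_1,\dots,p_n)$ of $\ell\times\ell$ matrices over $\mathbb{Q}$, where $\Phi$, $n$, $\ell$ and the tuple are all part of the input, outputs the matrix $\Phi(p_1,\dots,p_n)$ if $\Phi$ is defined on $(p_1,\dots,p_n)$, and reports that $\Phi$ is undefined on it otherwise. That is, there is a logspace-uniform family of Boolean circuits of fan-in at most $2$, whose size is polynomial in $N$ and whose depth is $O(\log^4 N)$, where $N$ is the bit length of the input, that solves this evaluation problem. A rational number is written as a quotient of binary integers with nonzero denominator, not necessarily in lowest terms. -/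

import Mathlib

namespace RatEval

/-! ### Noncommutative rational formulas over `ℚ` and their evaluation at matrix tuples -/

/-- Noncommutative rational formulas in the variables `x_0, …, x_{n-1}` over `ℚ`: trees whose
leaves are rational constants or variables and whose gates are `+`, `×` and inversion. -/
inductive Formula (n : ℕ) where
  | const (c : ℚ)
  | var (i : Fin n)
  | add (Φ Ψ : Formula n)
  | mul (Φ Ψ : Formula n)
  | inv (Φ : Formula n)

/-- The size of a formula: the number of its gates, leaves included. -/
def Formula.size {n : ℕ} : Formula n → ℕ
  | .const _ => 1
  | .var _ => 1
  | .add Φ Ψ => Φ.size + Ψ.size + 1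
  | .mul Φ Ψ => Φ.size + Ψ.size + 1
  | .inv Φ => Φ.size + 1

open Classical in
/-- Evaluation at a tuple of `ℓ × ℓ` matrices. The result is `none` (undefined) exactly when some
inversion gate is applied to a subformula whose value is a singular matrix. -/
noncomputable def Formula.eval {n ℓ : ℕ} (P : Fin n → Matrix (Fin ℓ) (Fin ℓ) ℚ) :
    Formula n → Option (Matrix (Fin ℓ) (Fin ℓ) ℚ)
  | .const c => some (Matrix.scalar (Fin ℓ) c)
  | .var i => some (P i)
  | .add Φ Ψ => (Φ.eval P).bind fun A => (Ψ.eval P).bind fun B => some (A + B)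
  | .mul Φ Ψ => (Φ.eval P).bind fun A => (Ψ.eval P).bind fun B => some (A * B)
  | .inv Φ => (Φ.eval P).bind fun A => if IsUnit A then some A⁻¹ else none

/-! ### Binary encoding of instances and of results -/

/-- One entry of the gate table of a formula; gates refer to their inputs by position. -/
inductive Node (n : ℕ) where
  | const (c : ℚ)
  | var (i : Fin n)
  | add (l r : ℕ)
  | mul (l r : ℕ)
  | inv (a : ℕ)

/-- The gates of a formula in postorder, numbered from `k` on. The gate of a subformula is the last
gate of its table, hence the one numbered `k + size - 1`. -/
def Formula.nodes {n : ℕ} : Formula n → ℕ → List (Node n)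
  | .const c, _ => [.const c]
  | .var i, _ => [.var i]
  | .add Φ Ψ, k => Φ.nodes k ++ Ψ.nodes (k + Φ.size) ++
      [.add (k + Φ.size - 1) (k + Φ.size + Ψ.size - 1)]
  | .mul Φ Ψ, k => Φ.nodes k ++ Ψ.nodes (k + Φ.size) ++
      [.mul (k + Φ.size - 1) (k + Φ.size + Ψ.size - 1)]
  | .inv Φ, k => Φ.nodes k ++ [.inv (k + Φ.size - 1)]

/-- The number `v` in unary, closed by a `0`. -/
def unary (v : ℕ) : List Bool := List.replicate v true ++ [false]

/-- The `b` lowest binary digits of `v`, least significant digit first. -/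
def natBits (b v : ℕ) : List Bool := (List.range b).map fun i => v.testBit i

/-- `w` is a `b`-bit encoding of the rational number `c`: a sign, a `b`-bit numerator and a nonzero
`b`-bit denominator. The fraction need not be in lowest terms. -/
def EncodesRat (b : ℕ) (c : ℚ) (w : List Bool) : Prop :=
  ∃ (neg : Bool) (p q : ℕ), p < 2 ^ b ∧ 0 < q ∧ q < 2 ^ b ∧
    c = (if neg then -(p : ℚ) else (p : ℚ)) / (q : ℚ) ∧
    w = neg :: (natBits b p ++ natBits b q)

/-- `w` encodes an entry of a gate table: three bits for the kind of the gate, followed by a field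
of `2 b + 1` bits for the constant, the index of the variable, or the positions of the inputs. -/
def EncodesNode {n : ℕ} (b : ℕ) : Node n → List Bool → Prop
  | .const c, w => ∃ u, EncodesRat b c u ∧ w = [false, false, false] ++ u
  | .var i, w => (i : ℕ) < 2 ^ b ∧
      w = [true, false, false] ++ false :: (natBits b i ++ natBits b 0)
  | .add l r, w => l < 2 ^ b ∧ r < 2 ^ b ∧
      w = [false, true, false] ++ false :: (natBits b l ++ natBits b r)
  | .mul l r, w => l < 2 ^ b ∧ r < 2 ^ b ∧
      w = [true, true, false] ++ false :: (natBits b l ++ natBits b r)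
  | .inv a, w => a < 2 ^ b ∧
      w = [false, false, true] ++ false :: (natBits b a ++ natBits b 0)

/-- The entries of a matrix, row by row. -/
def entries {ℓ : ℕ} (A : Matrix (Fin ℓ) (Fin ℓ) ℚ) : List ℚ :=
  (List.finRange ℓ).flatMap fun i => (List.finRange ℓ).map fun j => A i j

/-- `w` encodes a list of rational numbers, each with `b`-bit numerator and denominator. -/
def EncodesRats (b : ℕ) (l : List ℚ) (w : List Bool) : Prop :=
  ∃ ws : List (List Bool), List.Forall₂ (EncodesRat b) l ws ∧ w = ws.flatten

/-- The bit string `x` encodes the formula `Φ` in `n` variables together with the tuple `P` of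
`ℓ × ℓ` matrices: `n`, `ℓ`, the size of `Φ` and the width `b` of all binary fields in unary, then
the gate table of `Φ`, then the entries of the matrices. -/
def EncodesInstance (x : List Bool) {n ℓ : ℕ} (Φ : Formula n)
    (P : Fin n → Matrix (Fin ℓ) (Fin ℓ) ℚ) : Prop :=
  ∃ (b : ℕ) (gs : List (List Bool)) (m : List Bool),
    List.Forall₂ (EncodesNode b) (Φ.nodes 0) gs ∧
    EncodesRats b ((List.finRange n).flatMap fun k => entries (P k)) m ∧
    x = unary n ++ unary ℓ ++ unary Φ.size ++ unary b ++ gs.flatten ++ m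

/-- The bit string `y` reports the result of an evaluation: its first bit says whether the value is
defined, and a value is written as the width `w` of all binary fields in unary, followed by the
entries of the matrix and by arbitrary padding. -/
def EncodesResult (y : List Bool) {ℓ : ℕ} : Option (Matrix (Fin ℓ) (Fin ℓ) ℚ) → Prop
  | none => ∃ pad : List Bool, y = false :: pad
  | some A => ∃ (w : ℕ) (m pad : List Bool),
      EncodesRats w (entries A) m ∧ y = true :: (unary w ++ m ++ pad)

/-- The evaluation problem: `y` is a correct answer on the input string `x`. Nothing is asked of
strings that do not encode a formula and a matrix tuple. -/
def EvaluationProblem (x y : List Bool) : Prop :=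
  ∀ (n ℓ : ℕ) (Φ : Formula n) (P : Fin n → Matrix (Fin ℓ) (Fin ℓ) ℚ),
    EncodesInstance x Φ P → EncodesResult y (Φ.eval P)

/-! ### Boolean circuits of bounded fan-in -/

/-- A gate of a Boolean circuit; it refers to its inputs by their numbers. -/
inductive Gate where
  | const (v : Bool)
  | input (i : ℕ)
  | not (a : ℕ)
  | and (a b : ℕ)
  | or (a b : ℕ)

/-- The gate numbered `g` of a circuit with `N` input bits reads only existing input bits and
only gates with a smaller number. -/
def Gate.WellPlaced (N g : ℕ) : Gate → Prop
  | .const _ => True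
  | .input i => i < N
  | .not a => a < g
  | .and a b => a < g ∧ b < g
  | .or a b => a < g ∧ b < g

/-- The numerical description of a gate: its kind and its two arguments. -/
def Gate.kind : Gate → ℕ
  | .const false => 0
  | .const true => 1
  | .input _ => 2
  | .not _ => 3
  | .and _ _ => 4
  | .or _ _ => 5

/-- The first argument of a gate (`0` if there is none). -/
def Gate.fst : Gate → ℕ
  | .const _ => 0
  | .input i => i
  | .not a => a
  | .and a _ => a
  | .or a _ => a

/-- The second argument of a gate (`0` if there is none). -/
def Gate.snd : Gate → ℕ
  | .and _ b => b
  | .or _ b => b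
  | _ => 0

/-- The value of gate number `g` of the circuit `G` on the input bits `x`. -/
def gateVal (G : ℕ → Gate) (x : List Bool) (g : ℕ) : Bool :=
  match G g with
  | .const v => v
  | .input i => x.getD i false
  | .not a => if _h : a < g then !gateVal G x a else false
  | .and a b => if _h : a < g ∧ b < g then gateVal G x a && gateVal G x b else false
  | .or a b => if _h : a < g ∧ b < g then gateVal G x a || gateVal G x b else false
termination_by g

/-- The depth of gate number `g` of the circuit `G`: the length of a longest path to it. -/
def gateDepth (G : ℕ → Gate) (g : ℕ) : ℕ :=
  match G g with
  | .const _ => 0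
  | .input _ => 0
  | .not a => if _h : a < g then gateDepth G a + 1 else 0
  | .and a b => if _h : a < g ∧ b < g then max (gateDepth G a) (gateDepth G b) + 1 else 0
  | .or a b => if _h : a < g ∧ b < g then max (gateDepth G a) (gateDepth G b) + 1 else 0
termination_by g

/-- A family of circuits, one for each input length `N`. The `N`-th circuit has the gates
`gate N 0, …, gate N (size N - 1)` in topological order; its last `numOut N` gates are the outputs. -/
structure CircuitFamily where
  size : ℕ → ℕ
  numOut : ℕ → ℕ
  gate : ℕ → ℕ → Gate
  numOut_le : ∀ N, numOut N ≤ size N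
  wellPlaced : ∀ N g, g < size N → (gate N g).WellPlaced N g

/-- The output of the circuit family on the bit string `x`. -/
def CircuitFamily.output (C : CircuitFamily) (x : List Bool) : List Bool :=
  (List.range (C.numOut x.length)).map fun j =>
    gateVal (C.gate x.length) x (C.size x.length - C.numOut x.length + j)

/-! ### Logarithmic space

Programs with a fixed finite set of registers for natural numbers. Computing with values that are
polynomially bounded in `N` means computing with `O(log N)` bits of memory. -/

/-- Arithmetic expressions over registers. -/
inductive Expr where
  | lit (v : ℕ)
  | reg (i : ℕ)
  | add (e f : Expr)
  | sub (e f : Expr)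
  | mul (e f : Expr)
  | div (e f : Expr)
  | mod (e f : Expr)

/-- The value of an expression (truncated subtraction, integer division). -/
def Expr.eval (σ : ℕ → ℕ) : Expr → ℕ
  | .lit v => v
  | .reg i => σ i
  | .add e f => e.eval σ + f.eval σ
  | .sub e f => e.eval σ - f.eval σ
  | .mul e f => e.eval σ * f.eval σ
  | .div e f => e.eval σ / f.eval σ
  | .mod e f => e.eval σ % f.eval σ

/-- Register programs; a test succeeds if the value of its expression is not `0`. -/
inductive Prog where
  | skip
  | assign (i : ℕ) (e : Expr)
  | seq (p q : Prog)
  | ite (e : Expr) (p q : Prog)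
  | while (e : Expr) (p : Prog)

/-- `Run B p σ τ`: started with the register contents `σ`, the program `p` halts with the contents
`τ`, and never stores a number larger than `B`. -/
inductive Run (B : ℕ) : Prog → (ℕ → ℕ) → (ℕ → ℕ) → Prop where
  | skip (σ : ℕ → ℕ) : Run B .skip σ σ
  | assign (i : ℕ) (e : Expr) (σ : ℕ → ℕ) (h : e.eval σ ≤ B) :
      Run B (.assign i e) σ (Function.update σ i (e.eval σ))
  | seq {p q : Prog} {σ τ ρ : ℕ → ℕ} (hp : Run B p σ τ) (hq : Run B q τ ρ) :
      Run B (.seq p q) σ ρ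
  | ite_true {e : Expr} {p q : Prog} {σ τ : ℕ → ℕ} (h : e.eval σ ≠ 0) (hp : Run B p σ τ) :
      Run B (.ite e p q) σ τ
  | ite_false {e : Expr} {p q : Prog} {σ τ : ℕ → ℕ} (h : e.eval σ = 0) (hq : Run B q σ τ) :
      Run B (.ite e p q) σ τ
  | while_true {e : Expr} {p : Prog} {σ τ ρ : ℕ → ℕ} (h : e.eval σ ≠ 0) (hp : Run B p σ τ)
      (hw : Run B (.while e p) τ ρ) : Run B (.while e p) σ ρ
  | while_false {e : Expr} {p : Prog} {σ : ℕ → ℕ} (h : e.eval σ = 0) :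
      Run B (.while e p) σ σ

/-- Registers `0` and `1` hold the two arguments, all other registers hold `0`. -/
def initRegs (N g : ℕ) : ℕ → ℕ
  | 0 => N
  | 1 => g
  | _ => 0

/-- `f N g` is computable from `N` and `g < dom N` in space `O(log N)`, the number `N` being the
input length: some program computes it (in register `0`) with values polynomially bounded in `N`. -/
def LogSpace (dom : ℕ → ℕ) (f : ℕ → ℕ → ℕ) : Prop :=
  ∃ (p : Prog) (c : ℕ), ∀ N g, g < dom N →
    ∃ τ, Run (c * N ^ c + c) p (initRegs N g) τ ∧ τ 0 = f N g

/-- Logspace uniformity: the number of gates, the number of outputs, and the description of each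
gate of the `N`-th circuit are computable in space `O(log N)`. -/
def CircuitFamily.Uniform (C : CircuitFamily) : Prop :=
  LogSpace (fun _ => 1) (fun N _ => C.size N) ∧
  LogSpace (fun _ => 1) (fun N _ => C.numOut N) ∧
  LogSpace C.size (fun N g => (C.gate N g).kind) ∧
  LogSpace C.size (fun N g => (C.gate N g).fst) ∧
  LogSpace C.size (fun N g => (C.gate N g).snd)

/-- The problem `R` (find, for the input string `x`, a string `y` with `R x y`) is solved by an
`NC^k` algorithm: a logspace-uniform family of Boolean circuits of fan-in at most two, of size
polynomial in `N` and of depth `O((log N)^k)`, where `N` is the length of the input. -/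
def SolvableInNC (k : ℕ) (R : List Bool → List Bool → Prop) : Prop :=
  ∃ C : CircuitFamily, C.Uniform ∧
    (∃ c : ℕ, ∀ N, C.size N ≤ c * N ^ c + c) ∧
    (∃ c : ℕ, ∀ N g, g < C.size N → gateDepth (C.gate N) g ≤ c * (Nat.log 2 N) ^ k + c) ∧
    ∀ x : List Bool, R x (C.output x)

end RatEval

/-! The value of a formula is read off from a linear system with integer coefficients, so that no
intermediate matrix is ever computed and the depth of the formula does not matter. Every gate
carries two vectors of length `ℓ`, an input port and an output port, and the equations force: input
port = value of the gate times output port. A sum shares its output port with both summands and adds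
their input ports; a product passes its output port to the right factor, the input port of the right
factor to the output port of the left factor, and takes the input port of the left factor as its
own; an inversion just exchanges the two ports of its argument. A leaf has one further unknown for
each matrix entry, so that each denominator is cleared separately.

List the gates in postorder and, for each `g`, take the system of the gates up to `g`, with output
ports set to `0` when their parent is missing. If the formula is defined, all these systems are
regular, because a vanishing output port forces everything below it to vanish (`Table.det_ne_zero`).
If it is undefined, some inversion gate `g` is applied to a singular value, and regularity of the
system up to `g` would make that singular matrix surjective (`Table.exists_det_eq_zero`). So being
defined means that polynomially many integer determinants are nonzero, and each entry of the value
is a quotient of two such determinants by Cramer's rule (`Table.det_cramer`).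

Determinants are computed without divisions. For nilpotent `z`, the inverse of `det (1 - z A)` is
the product of the corner entries of the Neumann series of the leading principal submatrices, by
telescoping; inverting this product is again a geometric sum (`det_one_sub_eq`). Over the integers
modulo `2 ^ W` the element `z = 2 ^ m` is nilpotent, and `det (1 + 2 ^ m A)` is dominated by `2 ^ (m
D) det A`, so that `det A` appears in a window of binary digits after rounding (`div_mod_eq_det`).
Powers of matrices need `O(log N)` squarings, each a tree of `O(log N)` additions, and one addition
or multiplication takes `O(log² N)` rounds: this is the fourth power of the logarithm.

The algorithm is written as a recursive Boolean procedure whose calls are lists of boundedly many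
numbers of polynomial size. Unrolled over `O(log⁴ N)` rounds, it becomes a circuit with a block of
16 gates for each call and round. The description of a gate is an arithmetic expression in `N`, the
gate number and `log N`, whence logspace uniformity (`Machine.solvableInNC`). The parameters of the
instance are unknown to the circuit; all candidates are tried in parallel, and the header of the
input selects the only correct one (`header_unique`). -/

namespace RatEval

/-! ### Arithmetic expressions -/

namespace Expr

instance : Add Expr := ⟨.add⟩
instance : Sub Expr := ⟨.sub⟩
instance : Mul Expr := ⟨.mul⟩
instance : Div Expr := ⟨.div⟩
instance : Mod Expr := ⟨.mod⟩
instance (v : ℕ) : OfNat Expr v := ⟨.lit v⟩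

/-- The power of an expression with a fixed exponent. -/
def npow (e : Expr) : ℕ → Expr
  | 0 => 1
  | k + 1 => npow e k * e

/-- `1` if the two values agree and `0` otherwise. -/
def eq (e f : Expr) : Expr := 1 - ((e - f) + (f - e))

/-- `1` if the first value is smaller and `0` otherwise. -/
def lt (e f : Expr) : Expr := 1 - (1 - (f - e))

/-- The value of `a` if the value of `c` is not `0`, otherwise the value of `b`. -/
def ite (c a b : Expr) : Expr := a * (1 - (1 - c)) + b * (1 - c)

/-- Replace register `i` by the expression `s i`. -/
def subst (s : ℕ → Expr) : Expr → Expr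
  | .lit v => .lit v
  | .reg i => s i
  | .add e f => .add (e.subst s) (f.subst s)
  | .sub e f => .sub (e.subst s) (f.subst s)
  | .mul e f => .mul (e.subst s) (f.subst s)
  | .div e f => .div (e.subst s) (f.subst s)
  | .mod e f => .mod (e.subst s) (f.subst s)

variable (σ : ℕ → ℕ) (e f g : Expr)

@[simp] theorem eval_add' : (e + f).eval σ = e.eval σ + f.eval σ := rfl
@[simp] theorem eval_sub' : (e - f).eval σ = e.eval σ - f.eval σ := rfl
@[simp] theorem eval_mul' : (e * f).eval σ = e.eval σ * f.eval σ := rfl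
@[simp] theorem eval_div' : (e / f).eval σ = e.eval σ / f.eval σ := rfl
@[simp] theorem eval_mod' : (e % f).eval σ = e.eval σ % f.eval σ := rfl
@[simp] theorem eval_lit' (v : ℕ) : (Expr.lit v).eval σ = v := rfl
@[simp] theorem eval_reg' (i : ℕ) : (Expr.reg i).eval σ = σ i := rfl
@[simp] theorem eval_ofNat (v : ℕ) :
    (no_index (OfNat.ofNat v : Expr)).eval σ = OfNat.ofNat v := rfl
theorem eval_zero : (0 : Expr).eval σ = 0 := rfl
theorem eval_one : (1 : Expr).eval σ = 1 := rfl

@[simp] theorem eval_npow (k : ℕ) : (e.npow k).eval σ = e.eval σ ^ k := by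
  induction k with
  | zero => rfl
  | succ k ih => simp [npow, ih, pow_succ]

@[simp] theorem eval_eq : (eq e f).eval σ = if e.eval σ = f.eval σ then 1 else 0 := by
  simp only [eq, eval_sub', eval_add', eval_ofNat]
  split_ifs <;> omega

@[simp] theorem eval_lt : (lt e f).eval σ = if e.eval σ < f.eval σ then 1 else 0 := by
  simp only [lt, eval_sub', eval_ofNat]
  split_ifs <;> omega

@[simp] theorem eval_ite : (ite g e f).eval σ = if g.eval σ = 0 then f.eval σ else e.eval σ := by
  simp only [ite, eval_sub', eval_add', eval_ofNat, eval_mul']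
  split_ifs with h
  · simp [h]
  · have : 1 - g.eval σ = 0 := by omega
    simp [this]

theorem eval_subst (s : ℕ → Expr) : (e.subst s).eval σ = e.eval fun i => (s i).eval σ := by
  induction e <;> simp_all [subst, Expr.eval]

end Expr

/-! ### Logarithmic space -/

/-- The registers with the input length, a number and the logarithm of the input length. -/
def logRegs (N g : ℕ) : ℕ → ℕ
  | 0 => N
  | 1 => g
  | 2 => Nat.log 2 N
  | _ => 0

/-- The program that computes the binary logarithm of register `0` in register `2`, using
register `3`, which it clears at the end. -/
def logProg : Prog :=
  .seq (.assign 3 (.reg 0)) (.seq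
    (.while (.reg 3 / 2) (.seq (.assign 3 (.reg 3 / 2)) (.assign 2 (.reg 2 + 1))))
    (.assign 3 0))

/-- One pass halves register `3`, so strong induction on its content applies to the state after the
pass. The final content `v` is left open because `logProg` clears that register afterwards. -/
theorem run_log_loop (B : ℕ) (M : ℕ) : ∀ σ : ℕ → ℕ, σ 3 = M → M ≤ B → σ 2 + Nat.log 2 M ≤ B →
    ∃ v, Run B (.while (.reg 3 / 2) (.seq (.assign 3 (.reg 3 / 2)) (.assign 2 (.reg 2 + 1)))) σ
      (Function.update (Function.update σ 2 (σ 2 + Nat.log 2 M)) 3 v) := by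
  induction M using Nat.strong_induction_on with
  | _ M ih =>
    intro σ h3 hM h2
    by_cases hM2 : M < 2
    · have hl : Nat.log 2 M = 0 := Nat.log_of_lt hM2
      refine ⟨M, ?_⟩
      have : Function.update (Function.update σ 2 (σ 2 + Nat.log 2 M)) 3 M = σ := by
        funext i
        by_cases h : i = 3
        · subst h; simp [h3]
        · by_cases h' : i = 2
          · subst h'; simp [hl]
          · simp [h, h']
      rw [this]
      apply Run.while_false
      simp [h3]
      omega
    · have hl : Nat.log 2 M = Nat.log 2 (M / 2) + 1 := Nat.log_of_one_lt_of_le (by norm_num) (by omega)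
      set τ := Function.update (Function.update σ 3 (M / 2)) 2 (σ 2 + 1) with hτ
      obtain ⟨v, hv⟩ := ih (M / 2) (by omega) τ (by simp [hτ]) (by omega) (by simp [hτ]; omega)
      refine ⟨v, ?_⟩
      have e : Function.update (Function.update τ 2 (τ 2 + Nat.log 2 (M / 2))) 3 v =
          Function.update (Function.update σ 2 (σ 2 + Nat.log 2 M)) 3 v := by
        funext i
        by_cases h : i = 3
        · subst h; simp
        · by_cases h' : i = 2
          · subst h'; simp only [hτ, ne_eq, Nat.reduceEqDiff, not_false_eq_true,
              Function.update_of_ne, Function.update_self]; omega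
          · simp [h, h', hτ]
      rw [e] at hv
      refine Run.while_true (by simp [h3]; omega) (Run.seq (Run.assign _ _ _ ?_) (?_ : Run _ _ _ τ)) hv
      · simp [h3]; omega
      · have := Run.assign (B := B) 2 (.reg 2 + 1)
          (Function.update σ 3 ((Expr.reg 3 / 2).eval σ)) (by simp; omega)
        simpa [hτ, h3] using this

theorem run_logProg (B N g : ℕ) (hN : N ≤ B) : Run B logProg (initRegs N g) (logRegs N g) := by
  set σ := Function.update (initRegs N g) 3 N with hσ
  obtain ⟨v, hv⟩ := run_log_loop B N σ (by simp [hσ]) hN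
    (by simpa [hσ, initRegs] using (Nat.log_le_self 2 N).trans hN)
  refine Run.seq (τ := σ) ?_ (Run.seq hv ?_)
  · exact Run.assign 3 (.reg 0) _ hN
  · have := Run.assign (B := B) 3 0
      (Function.update (Function.update σ 2 (σ 2 + Nat.log 2 N)) 3 v) (by simp)
    convert this using 1
    funext i
    match i with
    | 0 => simp [logRegs, hσ, initRegs]
    | 1 => simp [logRegs, hσ, initRegs]
    | 2 => simp [logRegs, hσ, initRegs]
    | 3 => simp [logRegs]
    | i + 4 => simp [logRegs, hσ, initRegs]

/-- All data of the uniform circuits will be fixed expressions in `N`, `g` and `Nat.log 2 N`. `Run`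
bounds only numbers that are stored, so apart from `N` and its logarithm only the result needs a
bound, not the intermediate values of the expression. -/
theorem logSpace_of_expr {dom : ℕ → ℕ} {f : ℕ → ℕ → ℕ} (e : Expr)
    (he : ∀ N g, g < dom N → e.eval (logRegs N g) = f N g)
    (hb : ∃ c, ∀ N g, g < dom N → f N g ≤ c * N ^ c + c) : LogSpace dom f := by
  obtain ⟨c, hc⟩ := hb
  -- The exponent `c + 1` instead of `c` makes the bound at least `N` even if `c = 0`.
  refine ⟨.seq logProg (.assign 0 e), c + 1, fun N g hg => ?_⟩
  have hN : N ≤ (c + 1) * N ^ (c + 1) + (c + 1) := by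
    rcases Nat.eq_zero_or_pos N with rfl | h
    · simp
    · calc N = N ^ 1 := (pow_one N).symm
        _ ≤ N ^ (c + 1) := Nat.pow_le_pow_right h (by omega)
        _ ≤ (c + 1) * N ^ (c + 1) := Nat.le_mul_of_pos_left _ (by omega)
        _ ≤ _ := Nat.le_add_right _ _
  refine ⟨_, Run.seq (run_logProg _ N g hN) (Run.assign 0 e _ ?_), ?_⟩
  · rw [he N g hg]
    refine (hc N g hg).trans ?_
    rcases Nat.eq_zero_or_pos N with rfl | h
    · rcases Nat.eq_zero_or_pos c with rfl | h'
      · simp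
      · simp [h'.ne']
    · have : N ^ c ≤ N ^ (c + 1) := Nat.pow_le_pow_right h (by omega)
      nlinarith [Nat.zero_le (N ^ (c + 1)), Nat.mul_le_mul_left c this]
  · simp [he N g hg]

end RatEval

namespace RatEval

/-! ### Recursive Boolean procedures -/

/-- The Boolean function of three arguments with truth table `τ`. -/
def lut (τ : ℕ) (a b e : Bool) : Bool := τ.testBit (4 * a.toNat + 2 * b.toNat + e.toNat)

/-- The body of a recursive Boolean procedure: a constant, an input bit, or a function of the values
of three calls, selected by tests on the registers. A call is a list of numbers. -/
inductive Step where
  | const (b : Bool)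
  | input (e : Expr)
  | lut (τ : ℕ) (k₁ k₂ k₃ : List Expr)
  | cond (e : Expr) (s t : Step)

/-- The value of a body in terms of the values `V` of the calls. -/
def Step.run (x : List Bool) (V : List ℕ → Bool) (σ : ℕ → ℕ) : Step → Bool
  | .const b => b
  | .input e => x.getD (e.eval σ) false
  | .lut τ k₁ k₂ k₃ => RatEval.lut τ (V (k₁.map (Expr.eval σ))) (V (k₂.map (Expr.eval σ)))
      (V (k₃.map (Expr.eval σ)))
  | .cond e s t => if e.eval σ = 0 then t.run x V σ else s.run x V σ

/-- The number with base `Q` digits `a`. -/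
def enc (Q : ℕ) : List ℕ → ℕ
  | [] => 0
  | a :: l => a + Q * enc Q l

/-- The registers in a call with arguments `a`. -/
def regs (N : ℕ) (a : List ℕ) : ℕ → ℕ
  | 0 => N
  | i + 1 => a.getD i 0

/-- The registers in the call encoded by `c`. -/
def regsOf (N Q c : ℕ) : ℕ → ℕ
  | 0 => N
  | i + 1 => c / Q ^ i % Q

theorem enc_lt {Q : ℕ} : ∀ {a : List ℕ}, (∀ d ∈ a, d < Q) → enc Q a < Q ^ a.length
  | [], _ => by simp [enc]
  | d :: a, h => by
    have h1 := enc_lt (Q := Q) (a := a) fun d hd => h d (by simp [hd])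
    have h2 := h d (by simp)
    simp only [enc, List.length_cons, pow_succ]
    nlinarith

theorem enc_div_mod {Q : ℕ} : ∀ {a : List ℕ} (i : ℕ), (∀ d ∈ a, d < Q) →
    enc Q a / Q ^ i % Q = a.getD i 0
  | [], i, _ => by simp [enc]
  | d :: a, 0, h => by
    have h2 := h d (by simp)
    simp [enc, Nat.mod_eq_of_lt h2]
  | d :: a, i + 1, h => by
    have h2 := h d (by simp)
    have h1 := enc_div_mod (Q := Q) (a := a) i fun d hd => h d (by simp [hd])
    rw [pow_succ', ← Nat.div_div_eq_div_mul, enc, Nat.add_mul_div_left _ _ (by omega),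
      Nat.div_eq_of_lt h2, zero_add, h1]
    simp

/-- Missing digits read as `0`, which is also the default content of the registers beyond the
arguments; trailing zeros of a call are therefore invisible to `enc` and to `regs` alike. -/
theorem regsOf_enc {N Q : ℕ} {a : List ℕ} (h : ∀ d ∈ a, d < Q) :
    regsOf N Q (enc Q a) = regs N a := by
  funext i
  cases i with
  | zero => rfl
  | succ i => exact enc_div_mod i h

/-- A recursive procedure with the numerical parameters of the circuits that evaluate it. Calls are
encoded by at most `digits` digits in base `(N + 2) ^ expo`. -/
structure Machine where
  prog : Step
  expo : ℕ
  digits : ℕ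
  speed : ℕ
  numOut : ℕ → ℕ
  numOutE : Expr
  outTag : ℕ
  eval_numOutE : ∀ N g, numOutE.eval (logRegs N g) = numOut N
  numOut_le : ∀ N, numOut N ≤ (N + 2) ^ expo

namespace Machine

variable (M : Machine)

/-- The base of the digits of a call. -/
def base (N : ℕ) : ℕ := (N + 2) ^ M.expo

/-- The number of calls. -/
def calls (N : ℕ) : ℕ := M.base N ^ M.digits

/-- The number of rounds. -/
def time (N : ℕ) : ℕ := M.speed * (Nat.log 2 N + 1) ^ 4

theorem base_pos (N : ℕ) : 0 < M.base N := by unfold base; positivity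
theorem calls_pos (N : ℕ) : 0 < M.calls N := pow_pos (M.base_pos N) _

/-- The value of the call encoded by `c` after `t` rounds. -/
def val (x : List Bool) : ℕ → ℕ → Bool
  | 0, _ => false
  | t + 1, c => M.prog.run x (fun a => val x t (enc (M.base x.length) a % M.calls x.length))
      (regsOf x.length (M.base x.length) c)

/-- The call `a` has admissible arguments. -/
def InRange (N : ℕ) (a : List ℕ) : Prop := a.length ≤ M.digits ∧ ∀ d ∈ a, d < M.base N

/-- From round `T` on, the call `a` has the value `v`. -/
def HasVal (x : List Bool) (T : ℕ) (a : List ℕ) (v : Bool) : Prop :=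
  M.InRange x.length a ∧ ∀ t, T ≤ t → M.val x t (enc (M.base x.length) a) = v

variable {M}

theorem InRange.enc_lt {N : ℕ} {a : List ℕ} (h : M.InRange N a) :
    enc (M.base N) a < M.calls N :=
  (RatEval.enc_lt h.2).trans_le (Nat.pow_le_pow_right (M.base_pos N) h.1)

theorem HasVal.mono {x : List Bool} {T T' : ℕ} {a : List ℕ} {v : Bool} (h : M.HasVal x T a v)
    (hT : T ≤ T') : M.HasVal x T' a v :=
  ⟨h.1, fun t ht => h.2 t (hT.trans ht)⟩

/-- The rule behind all later correctness proofs: values known after `T` rounds serve as an oracle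
`V`, and a run of the body against every such oracle costs one more round. Nothing is assumed of `V`
on other calls, so meaningless calls are harmless as long as the result does not depend on them. -/
theorem HasVal.of_run {x : List Bool} {T : ℕ} {a : List ℕ} {v : Bool} (ha : M.InRange x.length a)
    (h : ∀ V : List ℕ → Bool, (∀ a' v', M.HasVal x T a' v' → V a' = v') →
      M.prog.run x V (regs x.length a) = v) : M.HasVal x (T + 1) a v := by
  refine ⟨ha, fun t ht => ?_⟩
  obtain ⟨t, rfl⟩ : ∃ s, t = s + 1 := ⟨t - 1, by omega⟩
  rw [val, regsOf_enc ha.2]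
  refine h _ fun a' v' h' => ?_
  rw [Nat.mod_eq_of_lt h'.1.enc_lt]
  exact h'.2 t (by omega)

end Machine

/-! ### The numerical description of the circuits -/

/-- The gate with the given numerical description. -/
def mkGate (k a b : ℕ) : Gate :=
  if k = 0 then .const false else if k = 1 then .const true else if k = 2 then .input a
  else if k = 3 then .not a else if k = 4 then .and a b else .or a b

theorem kind_mkGate (k a b : ℕ) (h : k ≤ 5) : (mkGate k a b).kind = k := by
  unfold mkGate; split_ifs <;> simp_all [Gate.kind]; omega

theorem fst_mkGate (k a b : ℕ) : (mkGate k a b).fst = if k < 2 then 0 else a := by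
  unfold mkGate; split_ifs <;> simp_all [Gate.fst]; omega

theorem snd_mkGate (k a b : ℕ) : (mkGate k a b).snd = if k < 4 then 0 else b := by
  unfold mkGate; split_ifs <;> simp_all [Gate.snd]; omega

/-- The expression number `j` of a list. -/
def sel (j : Expr) : List Expr → ℕ → Expr
  | [], _ => 0
  | e :: l, k => Expr.ite (Expr.eq j (.lit k)) e (sel j l (k + 1))

theorem eval_sel_add (σ : ℕ → ℕ) (j : Expr) : ∀ (l : List Expr) (k i : ℕ), j.eval σ = k + i →
    (sel j l k).eval σ = (l.getD i 0).eval σ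
  | [], k, i, h => by simp [sel]
  | e :: l, k, 0, h => by simp [sel, h]
  | e :: l, k, i + 1, h => by
    have := eval_sel_add σ j l (k + 1) i (by omega)
    simp [sel, h, this]

@[simp] theorem eval_sel (σ : ℕ → ℕ) (j : Expr) (l : List Expr) :
    (sel j l 0).eval σ = (l.getD (j.eval σ) 0).eval σ :=
  eval_sel_add σ j l 0 _ (by simp)

/-- The code of a list of expressions in base `Q`. -/
def encE (Q : Expr) : List Expr → Expr
  | [] => 0
  | e :: l => e + Q * encE Q l

@[simp] theorem eval_encE (Q : Expr) (σ : ℕ → ℕ) (l : List Expr) :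
    (encE Q l).eval σ = enc (Q.eval σ) (l.map (Expr.eval σ)) := by
  induction l with
  | nil => rfl
  | cons e l ih => simp [encE, enc, ih]

namespace Step

/-- The truth table of a body; `256` stands for an input bit. -/
def table : Step → Expr
  | .const b => .lit (if b then 255 else 0)
  | .input _ => 256
  | .lut τ _ _ _ => .lit (τ % 256)
  | .cond e s t => .ite e s.table t.table

/-- The position of the input bit. -/
def inputPos : Step → Expr
  | .input e => e
  | .cond e s t => .ite e s.inputPos t.inputPos
  | _ => 0

/-- The code of call number `i`. -/
def kid (Q : Expr) (i : Fin 3) : Step → Expr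
  | .lut _ k₁ k₂ k₃ => encE Q (![k₁, k₂, k₃] i)
  | .cond e s t => .ite e (s.kid Q i) (t.kid Q i)
  | _ => 0

end Step

theorem lut_mod (τ : ℕ) (a b e : Bool) : lut (τ % 256) a b e = lut τ a b e := by
  unfold lut
  rw [show (256 : ℕ) = 2 ^ 8 by norm_num, Nat.testBit_mod_two_pow]
  cases a <;> cases b <;> cases e <;> simp

theorem lut_const (c a b e : Bool) : lut (if c then 255 else 0) a b e = c := by
  cases c <;> cases a <;> cases b <;> cases e <;> decide

/-- The tests in a body depend on the registers and not on input bits, so they can be moved into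
arithmetic expressions. What is left is either an input bit or a truth table with three arguments;
`256` is not an 8-bit table and can mark the input bits. -/
theorem Step.run_eq (Q : Expr) (s : Step) (σ : ℕ → ℕ) (x : List Bool) (V : ℕ → Bool) :
    s.run x (fun a => V (enc (Q.eval σ) a)) σ =
      if s.table.eval σ = 256 then x.getD (s.inputPos.eval σ) false
      else RatEval.lut (s.table.eval σ) (V ((s.kid Q 0).eval σ)) (V ((s.kid Q 1).eval σ))
        (V ((s.kid Q 2).eval σ)) := by
  induction s with
  | const b =>
    have : ¬ (if b then 255 else 0) = 256 := by cases b <;> simp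
    simp [table, run, this, lut_const]
  | input e => simp [table, run, inputPos]
  | lut τ k₁ k₂ k₃ =>
    have : ¬ τ % 256 = 256 := by omega
    simp [table, run, this, lut_mod, kid]
  | cond e s t hs ht =>
    simp only [run, table, inputPos, kid, Expr.eval_ite]
    by_cases h : e.eval σ = 0
    · simp only [h, if_true]; exact ht
    · simp only [h, if_false]; exact hs

end RatEval

/-! ### Layered circuits that unroll a recursive procedure -/

namespace RatEval

namespace Machine

variable (M : Machine)

/-- The base of the digits of a call. -/
def baseE : Expr := (Expr.reg 0 + 2).npow M.expo
/-- The number of calls. -/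
def callsE : Expr := M.baseE.npow M.digits
/-- The number of the first output gate. -/
def topE : Expr := (.lit M.speed * (Expr.reg 2 + 1).npow 4 + 1) * M.callsE * 16
/-- The round of a gate. -/
def roundE : Expr := Expr.reg 1 / 16 / M.callsE
/-- The call of a gate. -/
def callE : Expr := Expr.reg 1 / 16 % M.callsE
/-- The number of a gate in the block of its call. -/
def slotE : Expr := Expr.reg 1 % 16

/-- An expression in the registers of the call of a gate. -/
def inCall (e : Expr) : Expr :=
  e.subst fun i => match i with
    | 0 => .reg 0
    | i + 1 => M.callE / M.baseE.npow i % M.baseE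

/-- The gate with the value of call number `i` in the previous round. -/
def refE (i : Fin 3) : Expr :=
  ((M.roundE - 1) * M.callsE + M.inCall (M.prog.kid M.baseE i) % M.callsE) * 16 + 15

/-- Gate `j` in the same block. -/
def selfE (j : ℕ) : Expr := Expr.reg 1 - slotE + .lit j

/-- The truth table of a call. -/
def tableE : Expr := M.inCall M.prog.table

/-- The input bit read by a call. -/
def posE : Expr := M.inCall M.prog.inputPos

/-- The kind of the gate for the restriction of a truth table to its last argument. -/
def unaryKind (d : Expr) : Expr := sel d [0, 3, 4, 1] 0

/-- The kind of a gate in the block of a call. -/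
def slotKind : Expr :=
  sel slotE [3, 3, unaryKind (M.tableE % 4), unaryKind (M.tableE / 4 % 4),
    unaryKind (M.tableE / 16 % 4), unaryKind (M.tableE / 64 % 4), 4, 4, 5, 4, 4, 5, 4, 4, 5,
    Expr.ite (Expr.eq M.tableE 256 * Expr.lt M.posE (.reg 0)) 2 4] 0

/-- The first argument of a gate in the block of a call. -/
def slotFst : Expr :=
  sel slotE [M.refE 0, M.refE 1, M.refE 2, M.refE 2, M.refE 2, M.refE 2, selfE 3, selfE 2, selfE 6,
    selfE 5, selfE 4, selfE 9, selfE 11, selfE 8, selfE 12,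
    Expr.ite (Expr.eq M.tableE 256 * Expr.lt M.posE (.reg 0)) M.posE (selfE 14)] 0

/-- The second argument of a gate in the block of a call. -/
def slotSnd : Expr :=
  sel slotE [0, 0, M.refE 2, M.refE 2, M.refE 2, M.refE 2, M.refE 1, selfE 1, selfE 7,
    M.refE 1, selfE 1, selfE 10, M.refE 0, selfE 0, selfE 13, selfE 14] 0

/-- The gate with the value of an output. -/
def outE : Expr :=
  (.lit M.speed * (Expr.reg 2 + 1).npow 4 * M.callsE +
    (.lit M.outTag + M.baseE * (.reg 1 - M.topE)) % M.callsE) * 16 + 15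

/-- The kind of a gate. -/
def kindE : Expr := Expr.ite (Expr.lt (.reg 1) M.topE) (Expr.ite M.roundE M.slotKind 0) 4
/-- The first argument of a gate. -/
def fstE : Expr := Expr.ite (Expr.lt (.reg 1) M.topE) M.slotFst M.outE
/-- The second argument of a gate. -/
def sndE : Expr := Expr.ite (Expr.lt (.reg 1) M.topE) M.slotSnd M.outE

/-- The gates of the circuits. -/
def gate (N g : ℕ) : Gate :=
  mkGate (M.kindE.eval (logRegs N g)) (M.fstE.eval (logRegs N g)) (M.sndE.eval (logRegs N g))

/-- The number of the first output gate. -/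
def top (N : ℕ) : ℕ := (M.time N + 1) * M.calls N * 16

variable (N g : ℕ)

@[simp] theorem eval_baseE : M.baseE.eval (logRegs N g) = M.base N := by
  simp [baseE, base, logRegs]

@[simp] theorem eval_callsE : M.callsE.eval (logRegs N g) = M.calls N := by
  simp [callsE, calls]

@[simp] theorem eval_topE : M.topE.eval (logRegs N g) = M.top N := by
  simp [topE, top, time, logRegs]

@[simp] theorem eval_roundE : M.roundE.eval (logRegs N g) = g / 16 / M.calls N := by
  simp [roundE, logRegs]

@[simp] theorem eval_slotE : slotE.eval (logRegs N g) = g % 16 := by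
  simp [slotE, logRegs]

@[simp] theorem eval_selfE (j : ℕ) : (selfE j).eval (logRegs N g) = g - g % 16 + j := by
  simp [selfE, logRegs]

@[simp] theorem eval_inCall (e : Expr) :
    (M.inCall e).eval (logRegs N g) = e.eval (regsOf N (M.base N) (g / 16 % M.calls N)) := by
  rw [inCall, Expr.eval_subst]
  congr 1
  funext i
  cases i with
  | zero => simp [logRegs, regsOf]
  | succ i => simp [regsOf, callE, logRegs]

theorem eval_baseE_regsOf (c : ℕ) : M.baseE.eval (regsOf N (M.base N) c) = M.base N := by
  simp [baseE, base, regsOf]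

theorem lt_top_iff {t : ℕ} : g / 16 / M.calls N = t → (g < M.top N ↔ t ≤ M.time N) := by
  rintro rfl
  have hP := M.calls_pos N
  rw [top, ← Nat.div_lt_iff_lt_mul (by norm_num), ← Nat.div_lt_iff_lt_mul hP, Nat.lt_succ_iff]

/-- Gate `a` is an earlier gate of the block of gate `g`, or it holds the value of a call in the
round before that of `g`. -/
def Feeds (a : ℕ) : Prop :=
  (a / 16 = g / 16 ∧ a % 16 < g % 16) ∨
    (a / 16 / M.calls N + 1 = g / 16 / M.calls N ∧ a % 16 = 15)

/-- A bound on the depth of a gate. -/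
def level : ℕ := if g < M.top N then 16 * (g / 16 / M.calls N) + g % 16 else 16 * (M.time N + 1)

variable {M N g}

theorem Feeds.lt {a : ℕ} (h : M.Feeds N g a) : a < g := by
  rcases h with ⟨h1, h2⟩ | ⟨h1, -⟩
  · omega
  · by_contra hc
    have := Nat.div_le_div_right (c := M.calls N) (Nat.div_le_div_right (c := 16) (not_lt.1 hc))
    omega

/-- A wire either stays in its block and leads to a higher slot, or it enters from slot 15 of the
previous round; `16 * round + slot` increases in both cases. -/
theorem Feeds.level_lt {a : ℕ} (h : M.Feeds N g a) (hg : g < M.top N) :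
    M.level N a < M.level N g := by
  have := h.lt
  rw [level, level, if_pos hg, if_pos (this.trans hg)]
  rcases h with ⟨h1, h2⟩ | ⟨h1, h2⟩
  · rw [h1]; omega
  · omega

theorem feeds_self {j : ℕ} (hj : j < g % 16) : M.Feeds N g (g - g % 16 + j) := by
  left; omega

theorem feeds_ref {v : ℕ} (hv : v < M.calls N) (ht : 0 < g / 16 / M.calls N) :
    M.Feeds N g (((g / 16 / M.calls N - 1) * M.calls N + v) * 16 + 15) := by
  right
  have hP := M.calls_pos N
  refine ⟨?_, by omega⟩
  have e : (((g / 16 / M.calls N - 1) * M.calls N + v) * 16 + 15) / 16 =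
      v + M.calls N * (g / 16 / M.calls N - 1) := by
    rw [mul_comm (M.calls N)]; omega
  rw [e, Nat.add_mul_div_left _ _ hP, Nat.div_eq_of_lt hv]
  omega

variable (M N g)

/-- The gate with the value of call number `i` in the previous round. -/
def ref (i : Fin 3) : ℕ :=
  ((g / 16 / M.calls N - 1) * M.calls N +
    (M.prog.kid M.baseE i).eval (regsOf N (M.base N) (g / 16 % M.calls N)) % M.calls N) * 16 + 15

@[simp] theorem eval_refE (i : Fin 3) : (M.refE i).eval (logRegs N g) = M.ref N g i := by
  simp [refE, ref]

theorem feeds_ref' (ht : 0 < g / 16 / M.calls N) (i : Fin 3) : M.Feeds N g (M.ref N g i) :=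
  feeds_ref (Nat.mod_lt _ (M.calls_pos N)) ht

/-- The kind of the gate for the restriction of a truth table to its last argument. -/
def unaryGate (d a : ℕ) : Gate := mkGate ([0, 3, 4, 1].getD d 0) a a

theorem gate_of_top_le (h : M.top N ≤ g) : M.gate N g =
    .and ((M.time N * M.calls N + (M.outTag + M.base N * (g - M.top N)) % M.calls N) * 16 + 15)
      ((M.time N * M.calls N + (M.outTag + M.base N * (g - M.top N)) % M.calls N) * 16 + 15) := by
  have h1 : (Expr.lt (.reg 1) M.topE).eval (logRegs N g) = 0 := by
    simp [logRegs]; omega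
  have h2 : M.outE.eval (logRegs N g) = ((M.time N * M.calls N +
      (M.outTag + M.base N * (g - M.top N)) % M.calls N) * 16 + 15) := by
    simp [outE, time, logRegs]
  simp only [gate, kindE, fstE, sndE, Expr.eval_ite, h1, if_true, h2, mkGate, Expr.eval_ofNat]
  simp

theorem gate_of_round_zero (h : g / 16 / M.calls N = 0) : M.gate N g = .const false := by
  have h1 : (Expr.lt (.reg 1) M.topE).eval (logRegs N g) ≠ 0 := by
    have := (M.lt_top_iff N g h).2 (Nat.zero_le _)
    simp [logRegs, this]
  have h2 : M.kindE.eval (logRegs N g) = 0 := by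
    rw [kindE, Expr.eval_ite, if_neg h1, Expr.eval_ite, eval_roundE, if_pos h, Expr.eval_ofNat]
  simp [gate, h2, mkGate]

theorem gate_of_slot (h : g / 16 / M.calls N ≠ 0) (hg : g < M.top N) : M.gate N g =
    mkGate (M.slotKind.eval (logRegs N g)) (M.slotFst.eval (logRegs N g))
      (M.slotSnd.eval (logRegs N g)) := by
  have h1 : (Expr.lt (.reg 1) M.topE).eval (logRegs N g) ≠ 0 := by
    simp [logRegs, hg]
  simp only [gate, kindE, fstE, sndE, Expr.eval_ite, h1, if_false, eval_roundE, h]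

/-- The truth table of the call of a gate. -/
def tableOf : ℕ := M.prog.table.eval (regsOf N (M.base N) (g / 16 % M.calls N))

/-- The input bit for the call of a gate. -/
def posOf : ℕ := M.prog.inputPos.eval (regsOf N (M.base N) (g / 16 % M.calls N))

theorem eval_unaryKind (σ : ℕ → ℕ) (d : ℕ) :
    (([0, 3, 4, 1] : List Expr).getD d 0).eval σ = ([0, 3, 4, 1] : List ℕ).getD d 0 := by
  match d with
  | 0 | 1 | 2 | 3 => rfl
  | d + 4 => rfl

/-- The gates in the block of a call. -/
def blockGate : ℕ → Gate
  | 0 => .not (M.ref N g 0)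
  | 1 => .not (M.ref N g 1)
  | 2 => unaryGate (M.tableOf N g % 4) (M.ref N g 2)
  | 3 => unaryGate (M.tableOf N g / 4 % 4) (M.ref N g 2)
  | 4 => unaryGate (M.tableOf N g / 16 % 4) (M.ref N g 2)
  | 5 => unaryGate (M.tableOf N g / 64 % 4) (M.ref N g 2)
  | 6 => .and (g - g % 16 + 3) (M.ref N g 1)
  | 7 => .and (g - g % 16 + 2) (g - g % 16 + 1)
  | 8 => .or (g - g % 16 + 6) (g - g % 16 + 7)
  | 9 => .and (g - g % 16 + 5) (M.ref N g 1)
  | 10 => .and (g - g % 16 + 4) (g - g % 16 + 1)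
  | 11 => .or (g - g % 16 + 9) (g - g % 16 + 10)
  | 12 => .and (g - g % 16 + 11) (M.ref N g 0)
  | 13 => .and (g - g % 16 + 8) (g - g % 16 + 0)
  | 14 => .or (g - g % 16 + 12) (g - g % 16 + 13)
  | _ => if M.tableOf N g = 256 ∧ M.posOf N g < N then .input (M.posOf N g)
      else .and (g - g % 16 + 14) (g - g % 16 + 14)

/-- Layout of a block: slots 0 and 1 negate the first two calls; slots 2 to 5 are the four
restrictions of the truth table to the third call; slots 6 to 8 and 9 to 11 are multiplexers
controlled by the second call, slots 12 to 14 a multiplexer controlled by the first; slot 15 is the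
value of the block. -/
theorem gate_eq_blockGate (h : g / 16 / M.calls N ≠ 0) (hg : g < M.top N) :
    M.gate N g = M.blockGate N g (g % 16) := by
  rw [M.gate_of_slot N g h hg, slotKind, slotFst, slotSnd]
  simp only [eval_sel, eval_slotE]
  have hj : g % 16 < 16 := Nat.mod_lt _ (by norm_num)
  generalize hj' : g % 16 = j at *
  interval_cases j <;>
    simp only [List.getD_cons_zero, List.getD_cons_succ, eval_refE, eval_selfE, hj', blockGate,
      Expr.eval_ofNat, unaryKind, eval_sel, unaryGate, tableE, eval_inCall, posE, Expr.eval_mod',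
      Expr.eval_div', tableOf, Expr.eval_ite, Expr.eval_mul', Expr.eval_eq, Expr.eval_lt,
      Expr.eval_reg', logRegs, posOf]
  all_goals first
    | rw [eval_unaryKind]
    | rfl
    | (by_cases h1 : M.prog.table.eval (regsOf N (M.base N) (g / 16 % M.calls N)) = 256 <;>
      by_cases h2 : M.prog.inputPos.eval (regsOf N (M.base N) (g / 16 % M.calls N)) < N <;>
      simp [h1, h2, mkGate])

/-! ### Values of the gates -/

section

variable {G : ℕ → Gate} {x : List Bool} {g a b : ℕ}

theorem gateVal_const {v : Bool} (h : G g = .const v) : gateVal G x g = v := by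
  rw [gateVal, h]

theorem gateVal_input {i : ℕ} (h : G g = .input i) : gateVal G x g = x.getD i false := by
  rw [gateVal, h]

theorem gateVal_not (h : G g = .not a) (ha : a < g) : gateVal G x g = !gateVal G x a := by
  rw [gateVal, h]; simp [ha]

theorem gateVal_and (h : G g = .and a b) (ha : a < g) (hb : b < g) :
    gateVal G x g = (gateVal G x a && gateVal G x b) := by
  rw [gateVal, h]; simp [ha, hb]

theorem gateVal_or (h : G g = .or a b) (ha : a < g) (hb : b < g) :
    gateVal G x g = (gateVal G x a || gateVal G x b) := by
  rw [gateVal, h]; simp [ha, hb]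

/-- The low bit of `d` is the value at `false` and the high bit the value at `true`, so `d = 0, 1,
2, 3` are the constant false, the negation, the identity (a conjunction of a gate with itself) and
the constant true. -/
theorem gateVal_unaryGate {d : ℕ} (hd : d < 4) (h : G g = unaryGate d a) (ha : a < g) :
    gateVal G x g = if gateVal G x a then decide (d / 2 = 1) else decide (d % 2 = 1) := by
  interval_cases d
  · rw [gateVal_const (v := false) h]; simp
  · rw [gateVal_not (a := a) h ha]; simp
  · rw [gateVal_and (a := a) (b := a) h ha ha]; simp
  · rw [gateVal_const (v := true) h]; simp

/-- The depth of a gate is at most any weight that increases along the wires. -/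
theorem gateDepth_le (d : ℕ → ℕ) (hnot : ∀ g a, G g = .not a → d a < d g)
    (hand : ∀ g a b, G g = .and a b → d a < d g ∧ d b < d g)
    (hor : ∀ g a b, G g = .or a b → d a < d g ∧ d b < d g) (g : ℕ) : gateDepth G g ≤ d g := by
  induction g using Nat.strong_induction_on with
  | _ g ih =>
    rw [gateDepth]
    split
    · simp
    · simp
    · rename_i a h
      split_ifs with ha
      · have := ih a ha; have := hnot g a h; omega
      · simp
    · rename_i a b h
      split_ifs with ha
      · have := ih a ha.1; have := ih b ha.2; have := hand g a b h; omega
      · simp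
    · rename_i a b h
      split_ifs with ha
      · have := ih a ha.1; have := ih b ha.2; have := hor g a b h; omega
      · simp

end

end Machine
end RatEval

/-! ### Correctness, depth, size and uniformity of the circuits -/

namespace RatEval

namespace Machine

variable (M : Machine) (N : ℕ)

/-- Lets a whole block be described from its first gate, as `gateVal_block` does. -/
theorem blockGate_congr {g g' : ℕ} (h : g / 16 = g' / 16) (k : ℕ) :
    M.blockGate N g k = M.blockGate N g' k := by
  have h1 : g - g % 16 = g' - g' % 16 := by omega
  unfold blockGate ref tableOf posOf
  simp only [h, h1]

/-- Shannon expansion: the digit number `2 a + b` of the table in base 4 is a truth table in the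
third argument. Slots 2 to 14 of a block follow this formula. -/
theorem lut_eq (τ : ℕ) (a b e : Bool) : lut τ a b e =
    if a then (if b then (if e then decide (τ / 64 % 4 / 2 = 1) else decide (τ / 64 % 4 % 2 = 1))
      else (if e then decide (τ / 16 % 4 / 2 = 1) else decide (τ / 16 % 4 % 2 = 1)))
    else (if b then (if e then decide (τ / 4 % 4 / 2 = 1) else decide (τ / 4 % 4 % 2 = 1))
      else (if e then decide (τ % 4 / 2 = 1) else decide (τ % 4 % 2 = 1))) := by
  unfold lut
  rw [Nat.testBit_eq_decide_div_mod_eq]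
  cases a <;> cases b <;> cases e <;> simp <;> omega

theorem gateVal_block {x : List Bool} {s : ℕ} (hs : s % 16 = 0) (h0 : s / 16 / M.calls N ≠ 0)
    (hT : s / 16 / M.calls N ≤ M.time N) :
    gateVal (M.gate N) x (s + 15) =
      if M.tableOf N s = 256 ∧ M.posOf N s < N then x.getD (M.posOf N s) false
      else lut (M.tableOf N s) (gateVal (M.gate N) x (M.ref N s 0))
        (gateVal (M.gate N) x (M.ref N s 1)) (gateVal (M.gate N) x (M.ref N s 2)) := by
  have key : ∀ j < 16, M.gate N (s + j) = M.blockGate N s j := by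
    intro j hj
    have e : (s + j) / 16 = s / 16 := by omega
    rw [M.gate_eq_blockGate N (s + j) (by rwa [e]) ((M.lt_top_iff N _ rfl).2 (by rwa [e])),
      M.blockGate_congr N e, show (s + j) % 16 = j by omega]
  have hs' : s - s % 16 = s := by omega
  have hr : ∀ i, M.ref N s i < s := fun i =>
    (M.feeds_ref' N s (Nat.pos_of_ne_zero h0) i).lt
  have r0 := hr 0
  have r1 := hr 1
  have r2 := hr 2
  have g0 := gateVal_not (x := x) (key 0 (by norm_num)) (by omega)
  have g1 := gateVal_not (x := x) (key 1 (by norm_num)) (by omega)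
  have g2 := gateVal_unaryGate (x := x) (Nat.mod_lt _ (by norm_num)) (key 2 (by norm_num)) (by omega)
  have g3 := gateVal_unaryGate (x := x) (Nat.mod_lt _ (by norm_num)) (key 3 (by norm_num)) (by omega)
  have g4 := gateVal_unaryGate (x := x) (Nat.mod_lt _ (by norm_num)) (key 4 (by norm_num)) (by omega)
  have g5 := gateVal_unaryGate (x := x) (Nat.mod_lt _ (by norm_num)) (key 5 (by norm_num)) (by omega)
  have g6 := gateVal_and (x := x) (key 6 (by norm_num)) (by omega) (by omega)
  have g7 := gateVal_and (x := x) (key 7 (by norm_num)) (by omega) (by omega)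
  have g8 := gateVal_or (x := x) (key 8 (by norm_num)) (by omega) (by omega)
  have g9 := gateVal_and (x := x) (key 9 (by norm_num)) (by omega) (by omega)
  have g10 := gateVal_and (x := x) (key 10 (by norm_num)) (by omega) (by omega)
  have g11 := gateVal_or (x := x) (key 11 (by norm_num)) (by omega) (by omega)
  have g12 := gateVal_and (x := x) (key 12 (by norm_num)) (by omega) (by omega)
  have g13 := gateVal_and (x := x) (key 13 (by norm_num)) (by omega) (by omega)
  have g14 := gateVal_or (x := x) (key 14 (by norm_num)) (by omega) (by omega)
  rw [hs'] at g6 g7 g8 g9 g10 g11 g12 g13 g14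
  have k15 := key 15 (by norm_num)
  by_cases hin : M.tableOf N s = 256 ∧ M.posOf N s < N
  · rw [if_pos hin]
    exact gateVal_input (k15.trans (if_pos hin))
  · rw [if_neg hin, gateVal_and (k15.trans (if_neg hin)) (by omega) (by omega), hs', g14, g12, g13,
      g11, g8, g9, g10, g6, g7, g5, g4, g3, g2, g1, g0, lut_eq]
    generalize gateVal (M.gate N) x (M.ref N s 0) = va
    generalize gateVal (M.gate N) x (M.ref N s 1) = vb
    generalize gateVal (M.gate N) x (M.ref N s 2) = ve
    cases va <;> cases vb <;> cases ve <;> simp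

/-- Block number `t * calls + c` belongs to call `c` in round `t`. Round `0` consists of constants,
in agreement with `val x 0 c = false`, and each later block reads three values of the round before.
-/
theorem gateVal_eq_val {x : List Bool} (hN : x.length = N) : ∀ t ≤ M.time N, ∀ c < M.calls N,
    gateVal (M.gate N) x ((t * M.calls N + c) * 16 + 15) = M.val x t c := by
  subst hN
  set N := x.length with hN
  have hP := M.calls_pos N
  intro t
  induction t with
  | zero =>
    intro _ c hc
    rw [val]
    refine gateVal_const (M.gate_of_round_zero N _ ?_)
    rw [show ((0 * M.calls N + c) * 16 + 15) / 16 = c by omega]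
    exact Nat.div_eq_of_lt hc
  | succ t ih =>
    intro ht c hc
    have e1 : ((t + 1) * M.calls N + c) * 16 / 16 = c + M.calls N * (t + 1) := by
      rw [Nat.mul_div_cancel _ (by norm_num), mul_comm, add_comm]
    have e2 : ((t + 1) * M.calls N + c) * 16 / 16 / M.calls N = t + 1 := by
      rw [e1, Nat.add_mul_div_left _ _ hP, Nat.div_eq_of_lt hc, zero_add]
    have e3 : ((t + 1) * M.calls N + c) * 16 / 16 % M.calls N = c := by
      rw [e1, Nat.add_mul_mod_self_left, Nat.mod_eq_of_lt hc]
    rw [M.gateVal_block N (Nat.mul_mod_left _ _) (by rw [e2]; omega) (by rw [e2]; exact ht)]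
    have href : ∀ i, gateVal (M.gate N) x (M.ref N (((t + 1) * M.calls N + c) * 16) i) =
        M.val x t ((M.prog.kid M.baseE i).eval (regsOf N (M.base N) c) % M.calls N) := by
      intro i
      rw [ref, e2, e3, Nat.add_sub_cancel]
      exact ih (by omega) _ (Nat.mod_lt _ hP)
    rw [href, href, href, tableOf, posOf, e3, val, ← hN]
    have := Step.run_eq M.baseE M.prog (regsOf N (M.base N) c) x fun a => M.val x t (a % M.calls N)
    rw [eval_baseE_regsOf] at this
    rw [this]
    by_cases h1 : M.prog.table.eval (regsOf N (M.base N) c) = 256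
    · by_cases h2 : M.prog.inputPos.eval (regsOf N (M.base N) c) < N
      · simp [h1, h2]
      -- A read beyond the input falls through to the truth table `256`, whose eight low bits
      -- vanish; the result `false` is also the default of `getD`.
      · have h3 : ∀ a b e, lut 256 a b e = false := by decide
        simp only [h1, h2, and_false, if_false, h3, if_true]
        rw [List.getD_eq_default _ _ (by rw [← hN]; omega)]
    · simp [h1]

/-- The arguments of a gate come from below. -/
theorem gate_spec (g : ℕ) : match M.gate N g with
    | .const _ => True
    | .input i => i < N
    | .not a => a < g ∧ M.level N a < M.level N g
    | .and a b | .or a b => (a < g ∧ M.level N a < M.level N g) ∧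
        (b < g ∧ M.level N b < M.level N g) := by
  by_cases hg : g < M.top N
  · by_cases h0 : g / 16 / M.calls N = 0
    · simp [M.gate_of_round_zero N g h0]
    · rw [M.gate_eq_blockGate N g h0 hg]
      have hr : ∀ i, M.ref N g i < g ∧ M.level N (M.ref N g i) < M.level N g := fun i =>
        have := M.feeds_ref' N g (Nat.pos_of_ne_zero h0) i
        ⟨this.lt, this.level_lt hg⟩
      have hself : ∀ j, j < g % 16 →
          g - g % 16 + j < g ∧ M.level N (g - g % 16 + j) < M.level N g := fun j hj =>
        have := M.feeds_self (N := N) hj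
        ⟨this.lt, this.level_lt hg⟩
      have hun : ∀ d, match unaryGate (d % 4) (M.ref N g 2) with
          | .const _ => True
          | .input i => i < N
          | .not a => a < g ∧ M.level N a < M.level N g
          | .and a b | .or a b => (a < g ∧ M.level N a < M.level N g) ∧
              (b < g ∧ M.level N b < M.level N g) := by
        intro d
        have hd : d % 4 < 4 := Nat.mod_lt _ (by norm_num)
        generalize d % 4 = d at hd
        interval_cases d
        · trivial
        · exact hr 2
        · exact ⟨hr 2, hr 2⟩
        · trivial
      have hj : g % 16 < 16 := Nat.mod_lt _ (by norm_num)
      generalize hj' : g % 16 = j at *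
      interval_cases j <;> simp only [blockGate, hj', hr, hun, and_self]
      all_goals first
        | exact ⟨hself _ (by norm_num), hself _ (by norm_num)⟩
        | exact ⟨hself _ (by norm_num), trivial⟩
        | (split_ifs with h
           · exact h.2
           · exact ⟨hself _ (by norm_num), hself _ (by norm_num)⟩)
  · rw [M.gate_of_top_le N g (not_lt.1 hg)]
    have hP := M.calls_pos N
    set v := (M.outTag + M.base N * (g - M.top N)) % M.calls N with hv
    have hv' : v < M.calls N := Nat.mod_lt _ hP
    -- An output gate copies slot 15 of a block of the last round; the output gates form one extra
    -- level above that round.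
    have h1 : (M.time N * M.calls N + v) * 16 + 15 < M.top N := by
      rw [top]; nlinarith
    have h2 : ((M.time N * M.calls N + v) * 16 + 15) / 16 / M.calls N = M.time N := by
      rw [show ((M.time N * M.calls N + v) * 16 + 15) / 16 = v + M.calls N * M.time N by
        rw [mul_comm (M.calls N)]; omega, Nat.add_mul_div_left _ _ hP, Nat.div_eq_of_lt hv', zero_add]
    have h3 : M.level N ((M.time N * M.calls N + v) * 16 + 15) < M.level N g := by
      rw [level, level, if_pos h1, if_neg hg, h2]; omega
    exact ⟨⟨by omega, h3⟩, ⟨by omega, h3⟩⟩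

theorem level_le (g : ℕ) : M.level N g ≤ 16 * (M.time N + 1) := by
  rw [level]
  split_ifs with h
  · have := (M.lt_top_iff N g rfl).1 h; omega
  · exact le_rfl

theorem kindE_le (g : ℕ) : M.kindE.eval (logRegs N g) ≤ 5 := by
  have h1 : ∀ (l : List Expr), (∀ e ∈ l, e.eval (logRegs N g) ≤ 5) → ∀ j : Expr,
      (sel j l 0).eval (logRegs N g) ≤ 5 := by
    intro l hl j
    rw [eval_sel, List.getD_eq_getElem?_getD]
    cases h : l[j.eval (logRegs N g)]? with
    | none => simp
    | some e => simpa using hl e (List.mem_of_getElem? h)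
  have h2 : ∀ d, (unaryKind d).eval (logRegs N g) ≤ 5 := fun d => h1 _ (by simp) d
  rw [kindE, Expr.eval_ite]
  split_ifs
  · simp
  · rw [Expr.eval_ite]
    split_ifs
    · simp
    · refine h1 _ ?_ _
      simp only [List.mem_cons, List.not_mem_nil, or_false, forall_eq_or_imp, forall_eq, h2,
        Expr.eval_ofNat, Expr.eval_ite]
      refine ⟨by norm_num, by norm_num, trivial, trivial, trivial, trivial, by norm_num,
        by norm_num, by norm_num, by norm_num, by norm_num, by norm_num, by norm_num, by norm_num,
        by norm_num, ?_⟩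
      split_ifs <;> norm_num

/-- The circuits that evaluate a recursive procedure. -/
def circuits : CircuitFamily where
  size N := M.top N + M.numOut N
  numOut := M.numOut
  gate := M.gate
  numOut_le N := Nat.le_add_left _ _
  wellPlaced N g _ := by
    have := M.gate_spec N g
    revert this
    cases M.gate N g <;> simp +contextual [Gate.WellPlaced]

theorem gateDepth_gate_le (g : ℕ) : gateDepth (M.gate N) g ≤ M.level N g := by
  refine gateDepth_le (M.level N) ?_ ?_ ?_ g
  · intro g a h; have := M.gate_spec N g; rw [h] at this; exact this.2
  · intro g a b h; have := M.gate_spec N g; rw [h] at this; exact ⟨this.1.2, this.2.2⟩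
  · intro g a b h; have := M.gate_spec N g; rw [h] at this; exact ⟨this.1.2, this.2.2⟩

/-- The natural bound is a power of `N + 2`. For `N ≥ 1` it is turned into the required form by `N +
2 ≤ 3 * N`, and the additive constant takes care of `N = 0`. -/
theorem exists_size_le : ∃ c, ∀ N, M.top N + M.numOut N ≤ c * N ^ c + c := by
  have hlog : ∀ N, Nat.log 2 N + 1 ≤ N + 2 := fun N => by
    have := Nat.log_le_self 2 N; omega
  have h : ∀ N, M.top N + M.numOut N ≤
      ((M.speed + 1) * 16 + 1) * (N + 2) ^ (4 + M.expo * M.digits + M.expo) := by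
    intro N
    have hpos : 0 < N + 2 := by omega
    have h1 : M.time N + 1 ≤ (M.speed + 1) * (N + 2) ^ 4 := by
      have h1 : (Nat.log 2 N + 1) ^ 4 ≤ (N + 2) ^ 4 := Nat.pow_le_pow_left (hlog N) 4
      have h2 : 1 ≤ (N + 2) ^ 4 := Nat.one_le_pow _ _ hpos
      have h3 := Nat.mul_le_mul_left M.speed h1
      rw [time, add_mul, one_mul]; omega
    have h2 : M.calls N = (N + 2) ^ (M.expo * M.digits) := by rw [calls, base, pow_mul]
    have h3 : M.numOut N ≤ (N + 2) ^ (4 + M.expo * M.digits + M.expo) :=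
      (M.numOut_le N).trans (Nat.pow_le_pow_right hpos (by omega))
    have h4 : M.top N ≤ (M.speed + 1) * 16 * (N + 2) ^ (4 + M.expo * M.digits + M.expo) := by
      calc M.top N ≤ (M.speed + 1) * (N + 2) ^ 4 * (N + 2) ^ (M.expo * M.digits) * 16 := by
            rw [top, h2]; gcongr
        _ = (M.speed + 1) * 16 * (N + 2) ^ (4 + M.expo * M.digits) := by rw [pow_add]; ring
        _ ≤ _ := Nat.mul_le_mul_left _ (Nat.pow_le_pow_right hpos (by omega))
    rw [add_mul, one_mul]; omega
  set C := (M.speed + 1) * 16 + 1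
  set k := 4 + M.expo * M.digits + M.expo
  refine ⟨C * 3 ^ k + k, fun N => (h N).trans ?_⟩
  rcases Nat.eq_zero_or_pos N with rfl | hN
  · have : 2 ^ k ≤ 3 ^ k := Nat.pow_le_pow_left (by norm_num) k
    have := Nat.mul_le_mul_left C this
    simp only [zero_add]; omega
  · have h1 : (N + 2) ^ k ≤ 3 ^ k * N ^ (C * 3 ^ k + k) := by
      calc (N + 2) ^ k ≤ (3 * N) ^ k := Nat.pow_le_pow_left (by omega) k
        _ = 3 ^ k * N ^ k := mul_pow _ _ _
        _ ≤ _ := Nat.mul_le_mul_left _ (Nat.pow_le_pow_right hN (by omega))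
    calc C * (N + 2) ^ k ≤ C * (3 ^ k * N ^ (C * 3 ^ k + k)) := Nat.mul_le_mul_left _ h1
      _ = (C * 3 ^ k) * N ^ (C * 3 ^ k + k) := by ring
      _ ≤ (C * 3 ^ k + k) * N ^ (C * 3 ^ k + k) := Nat.mul_le_mul_right _ (by omega)
      _ ≤ _ := Nat.le_add_right _ _

/-- Kind and arguments of a gate are expressions by construction. They are polynomially bounded
because kinds are at most `5`, wires come from smaller gate numbers and input positions are below
`N`. -/
theorem uniform_circuits : M.circuits.Uniform := by
  obtain ⟨c, hc⟩ := M.exists_size_le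
  have hspec := M.gate_spec
  have hsmall : ∀ N, 5 ≤ (c + 6) * N ^ (c + 6) + (c + 6) := fun N => by omega
  have hbig : ∀ N a, a ≤ c * N ^ c + c + N → a ≤ (c + 6) * N ^ (c + 6) + (c + 6) := by
    intro N a ha
    rcases Nat.eq_zero_or_pos N with rfl | hN
    · rcases Nat.eq_zero_or_pos c with rfl | h'
      · simp at ha; omega
      · simp [h'.ne'] at ha; omega
    · have h1 : N ^ c ≤ N ^ (c + 6) := Nat.pow_le_pow_right hN (by omega)
      have h2 : N ^ 1 ≤ N ^ (c + 6) := Nat.pow_le_pow_right hN (by omega)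
      nlinarith [Nat.mul_le_mul_left c h1]
  refine ⟨?_, ?_, ?_, ?_, ?_⟩
  · exact logSpace_of_expr (M.topE + M.numOutE) (fun N g _ => by simp [circuits, M.eval_numOutE])
      ⟨c, fun N g _ => hc N⟩
  · exact logSpace_of_expr M.numOutE (fun N g _ => by simp [circuits, M.eval_numOutE])
      ⟨c, fun N g _ => (Nat.le_add_left _ _).trans (hc N)⟩
  · refine logSpace_of_expr M.kindE (fun N g _ => ?_) ⟨c + 6, fun N g _ => ?_⟩
    · exact (kind_mkGate _ _ _ (M.kindE_le N g)).symm
    · exact le_trans (by change (M.gate N g).kind ≤ 5; rw [gate, kind_mkGate _ _ _ (M.kindE_le N g)]; exact M.kindE_le N g) (hsmall N)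
  · refine logSpace_of_expr (Expr.ite (Expr.lt M.kindE 2) 0 M.fstE) (fun N g _ => ?_)
      ⟨c + 6, fun N g hg => hbig N _ ?_⟩
    · change _ = (M.gate N g).fst
      rw [gate, fst_mkGate]
      by_cases h : M.kindE.eval (logRegs N g) < 2 <;> simp [h]
    · have := hspec N g
      have hg' : g ≤ c * N ^ c + c := (Nat.le_of_lt hg).trans (hc N)
      change (M.gate N g).fst ≤ _
      revert this
      cases M.gate N g <;> simp only [Gate.fst] <;> intro this <;> omega
  · refine logSpace_of_expr (Expr.ite (Expr.lt M.kindE 4) 0 M.sndE) (fun N g _ => ?_)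
      ⟨c + 6, fun N g hg => hbig N _ ?_⟩
    · change _ = (M.gate N g).snd
      rw [gate, snd_mkGate]
      by_cases h : M.kindE.eval (logRegs N g) < 4 <;> simp [h]
    · have := hspec N g
      have hg' : g ≤ c * N ^ c + c := (Nat.le_of_lt hg).trans (hc N)
      change (M.gate N g).snd ≤ _
      revert this
      cases M.gate N g <;> simp only [Gate.snd] <;> intro this <;> omega

/-- `outTag + base * j` is the code of the call `[outTag, j]`, so output gate `j` shows the value of
this call after the last round. -/
theorem output_circuits {x y : List Bool} (hy : y.length = M.numOut x.length)
    (h : ∀ j < M.numOut x.length, M.HasVal x (M.time x.length) [M.outTag, j] (y.getD j false)) :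
    M.circuits.output x = y := by
  refine List.ext_getElem (by simp [CircuitFamily.output, circuits, hy]) fun j hj hj' => ?_
  have hj2 : j < M.numOut x.length := hy ▸ hj'
  have h1 := h j hj2
  simp only [CircuitFamily.output, List.getElem_map, List.getElem_range]
  change gateVal (M.gate x.length) x (M.top x.length + M.numOut x.length - M.numOut x.length + j) = _
  rw [Nat.add_sub_cancel]
  have h2 := M.gate_of_top_le x.length (M.top x.length + j) (Nat.le_add_right _ _)
  have h3 : (M.outTag + M.base x.length * (M.top x.length + j - M.top x.length)) =
      enc (M.base x.length) [M.outTag, j] := by simp [enc]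
  rw [h3, Nat.mod_eq_of_lt h1.1.enc_lt] at h2
  have hlt := h1.1.enc_lt
  have h4 : (M.time x.length * M.calls x.length + enc (M.base x.length) [M.outTag, j]) * 16 + 15 <
      M.top x.length + j := by
    rw [top]; nlinarith
  rw [gateVal_and h2 h4 h4, Bool.and_self, M.gateVal_eq_val x.length rfl _ le_rfl _ hlt,
    h1.2 _ le_rfl, List.getD_eq_getElem _ _ hj']

theorem solvableInNC {R : List Bool → List Bool → Prop} (h : ∀ x, R x (M.circuits.output x)) :
    SolvableInNC 4 R := by
  refine ⟨M.circuits, M.uniform_circuits, M.exists_size_le, ⟨16 * (8 * M.speed + 1) + 256 * M.speed + 256, fun N g _ => ?_⟩, h⟩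
  refine (M.gateDepth_gate_le N g).trans ((M.level_le N g).trans ?_)
  -- Convexity of the fourth power: `((L + 1) / 2) ^ 4 ≤ (L ^ 4 + 1) / 2`.
  have : (Nat.log 2 N + 1) ^ 4 ≤ 8 * (Nat.log 2 N) ^ 4 + 8 := by
    generalize Nat.log 2 N = L
    zify
    nlinarith [sq_nonneg ((L : ℤ) - 1), sq_nonneg ((L : ℤ) ^ 2 - 1), sq_nonneg ((L : ℤ) ^ 2 - L), sq_nonneg (L : ℤ)]
  have h2 := Nat.mul_le_mul_left M.speed this
  rw [time]
  nlinarith [Nat.zero_le (Nat.log 2 N ^ 4), Nat.zero_le (M.speed * Nat.log 2 N ^ 4)]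

end Machine
end RatEval

namespace RatEval

/-! ### Truth tables -/

@[simp] theorem lut_xor3 (a b e : Bool) : lut 150 a b e = (a ^^ (b ^^ e)) := by revert a b e; decide
@[simp] theorem lut_and (a b e : Bool) : lut 192 a b e = (a && b) := by revert a b e; decide
@[simp] theorem lut_and3 (a b e : Bool) : lut 128 a b e = (a && b && e) := by revert a b e; decide
@[simp] theorem lut_copy (a b e : Bool) : lut 240 a b e = a := by revert a b e; decide
@[simp] theorem lut_gen (a b e : Bool) : lut 248 a b e = (a || (b && e)) := by revert a b e; decide
@[simp] theorem lut_xor (a b e : Bool) : lut 60 a b e = (a ^^ b) := by revert a b e; decide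
@[simp] theorem lut_or (a b e : Bool) : lut 252 a b e = (a || b) := by revert a b e; decide
@[simp] theorem lut_mux (a b e : Bool) : lut 202 a b e = if a then b else e := by
  revert a b e; decide
@[simp] theorem lut_not (a b e : Bool) : lut 15 a b e = !a := by revert a b e; decide
@[simp] theorem lut_and_not (a b e : Bool) : lut 48 a b e = (a && !b) := by revert a b e; decide
@[simp] theorem lut_nor (a b e : Bool) : lut 3 a b e = (!a && !b) := by revert a b e; decide
@[simp] theorem lut_and_not_and (a b e : Bool) : lut 32 a b e = (a && !b && e) := by
  revert a b e; decide

@[simp] theorem regs_zero (N : ℕ) (a : List ℕ) : regs N a 0 = N := rfl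
@[simp] theorem regs_cons_one (N d : ℕ) (a : List ℕ) : regs N (d :: a) 1 = d := rfl

/-! ### Carries -/

/-- The carry out of the positions `lo, …, lo + len - 1` of the sum of two bit sequences. -/
def carry (f g : ℕ → Bool) (lo : ℕ) : ℕ → Bool → Bool
  | 0, c => c
  | len + 1, c => (f (lo + len) && g (lo + len)) ||
      ((f (lo + len) ^^ g (lo + len)) && carry f g lo len c)

/-- The positions `lo, …, lo + len - 1` of the sum of two bit sequences propagate carries. -/
def propagate (f g : ℕ → Bool) (lo : ℕ) : ℕ → Bool
  | 0 => true
  | len + 1 => (f (lo + len) ^^ g (lo + len)) && propagate f g lo len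

variable (f g : ℕ → Bool)

theorem carry_add (lo a b : ℕ) (c : Bool) :
    carry f g lo (a + b) c = carry f g (lo + a) b (carry f g lo a c) := by
  induction b with
  | zero => rfl
  | succ b ih => rw [← add_assoc]; simp only [carry, ih, add_assoc]

theorem propagate_add (lo a b : ℕ) :
    propagate f g lo (a + b) = (propagate f g (lo + a) b && propagate f g lo a) := by
  induction b with
  | zero => simp [propagate]
  | succ b ih => rw [← add_assoc]; simp only [propagate, ih, Bool.and_assoc, add_assoc]

/-- Carry lookahead: an incoming carry matters only if the whole range propagates. With `carry_add`
this gives the carry of a range from the generate and propagate bits of its halves, hence in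
logarithmically many rounds. -/
theorem carry_eq (lo len : ℕ) (c : Bool) :
    carry f g lo len c = (carry f g lo len false || (propagate f g lo len && c)) := by
  induction len with
  | zero => simp [carry, propagate]
  | succ n ih =>
    simp only [carry, propagate]
    rw [ih]
    cases f (lo + n) <;> cases g (lo + n) <;> simp

/-- Taken from bit vectors of width `i + 1`, whose carry is a majority of three bits; the majority
equals "generate, or propagate an incoming carry". -/
theorem testBit_add_eq (X Y i : ℕ) :
    (X + Y).testBit i = (X.testBit i ^^ (Y.testBit i ^^ carry X.testBit Y.testBit 0 i false)) := by
  have h := BitVec.getLsbD_add (w := i + 1) (i := i) (by omega) (BitVec.ofNat _ X) (BitVec.ofNat _ Y)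
  have hc : ∀ j ≤ i, BitVec.carry j (BitVec.ofNat (i + 1) X) (BitVec.ofNat (i + 1) Y) false =
      carry X.testBit Y.testBit 0 j false := by
    intro j
    induction j with
    | zero => intro _; simp [carry]
    | succ j ih =>
      intro hj
      rw [BitVec.carry_succ, ih (by omega), carry]
      have : j < i + 1 := by omega
      simp only [BitVec.getLsbD_ofNat, this, decide_true, Bool.true_and, zero_add]
      cases X.testBit j <;> cases Y.testBit j <;> simp [Bool.atLeastTwo]
  rw [hc i le_rfl, ← BitVec.ofNat_add] at h
  simpa only [BitVec.getLsbD_ofNat, Nat.lt_succ_self, decide_true, Bool.true_and] using h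

theorem testBit_congr {a b W i : ℕ} (h : a % 2 ^ W = b % 2 ^ W) (hi : i < W) :
    a.testBit i = b.testBit i := by
  have := congrArg (fun v => v.testBit i) h
  simpa [Nat.testBit_mod_two_pow, hi] using this

/-! ### Arithmetic procedures modulo powers of two -/

/-- The body of a recursive procedure with integer values modulo a power of two: a sum or a product
of two calls, a call, or a number whose bits are given by a Boolean body. -/
inductive AStep where
  | add (l r : List Expr)
  | mul (l r : List Expr)
  | goto (k : List Expr)
  | leaf (s : Step)
  | cond (e : Expr) (s t : AStep)

/-- The operation selected by the tests of a body, with its calls. -/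
inductive ANode where
  | add (l r : List ℕ)
  | mul (l r : List ℕ)
  | goto (k : List ℕ)
  | leaf (s : Step)

/-- The operation selected by the tests of a body. -/
def AStep.resolve (σ : ℕ → ℕ) : AStep → ANode
  | .add l r => .add (l.map (Expr.eval σ)) (r.map (Expr.eval σ))
  | .mul l r => .mul (l.map (Expr.eval σ)) (r.map (Expr.eval σ))
  | .goto k => .goto (k.map (Expr.eval σ))
  | .leaf s => .leaf s
  | .cond e s t => if e.eval σ = 0 then t.resolve σ else s.resolve σ

section

variable (w : Expr)

/-- The registers of the present arithmetic call. -/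
def selfRegs : List Expr :=
  [.reg 6, .reg 7, .reg 8, .reg 9, .reg 10, .reg 11, .reg 12, .reg 13, .reg 14]

/-- Bit `i` of the value of an arithmetic call. -/
def bitOf (i : Expr) (k : List Expr) : List Expr := 0 :: i :: 0 :: 0 :: w :: k

/-- Bit `i` of a part of the present product: the first factor times the digits
`lo, …, lo + len - 1` of the second factor. -/
def bitOfPart (i lo len : Expr) : List Expr := 0 :: i :: 0 :: lo :: len :: selfRegs

/-- A Boolean function of bit `i` of the two summands of the present call. -/
def AStep.summands (τ : ℕ) (i : Expr) (third : List Expr) : AStep → Step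
  | .add l r => .lut τ (bitOf w i l) (bitOf w i r) third
  | .mul _ _ => .lut τ (bitOfPart i (.reg 4) (.reg 5 / 2))
      (bitOfPart i (.reg 4 + .reg 5 / 2) (.reg 5 - .reg 5 / 2)) third
  | .goto _ => .const false
  | .leaf _ => .const false
  | .cond e s t => .cond e (s.summands τ i third) (t.summands τ i third)

/-- Bit `reg 2` of the present call. -/
def AStep.bitStep : AStep → Step
  | .add l r => .lut 150 (bitOf w (.reg 2) l) (bitOf w (.reg 2) r)
      (1 :: 0 :: .reg 2 :: .reg 4 :: .reg 5 :: selfRegs)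
  | .mul l r => .cond (.reg 5)
      (.cond (.reg 5 - 1)
        (.lut 150 (bitOfPart (.reg 2) (.reg 4) (.reg 5 / 2))
          (bitOfPart (.reg 2) (.reg 4 + .reg 5 / 2) (.reg 5 - .reg 5 / 2))
          (1 :: 0 :: .reg 2 :: .reg 4 :: .reg 5 :: selfRegs))
        (.cond (Expr.lt (.reg 2) (.reg 4)) (.const false)
          (.lut 192 (bitOf w (.reg 2 - .reg 4) l) (bitOf w (.reg 4) r) (bitOf w (.reg 4) r))))
      (.const false)
  | .goto k => .lut 240 (bitOf w (.reg 2) k) (bitOf w (.reg 2) k) (bitOf w (.reg 2) k)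
  | .leaf s => s
  | .cond e s t => .cond e s.bitStep t.bitStep

/-- The call of mode `m` for `len` positions of the present call from `lo` on. -/
def rangeCall (m lo len : Expr) : List Expr := m :: lo :: len :: .reg 4 :: .reg 5 :: selfRegs

/-- The carry generated by the positions `lo, …, lo + len - 1` of the present sum. -/
def AStep.genStep (A : AStep) : Step :=
  .cond (.reg 3)
    (.cond (.reg 3 - 1)
      (.lut 248 (rangeCall 1 (.reg 2 + .reg 3 / 2) (.reg 3 - .reg 3 / 2))
        (rangeCall 2 (.reg 2 + .reg 3 / 2) (.reg 3 - .reg 3 / 2))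
        (rangeCall 1 (.reg 2) (.reg 3 / 2)))
      (A.summands w 192 (.reg 2) []))
    (.const false)

/-- Whether the positions `lo, …, lo + len - 1` of the present sum propagate carries. -/
def AStep.propStep (A : AStep) : Step :=
  .cond (.reg 3)
    (.cond (.reg 3 - 1)
      (.lut 192 (rangeCall 2 (.reg 2 + .reg 3 / 2) (.reg 3 - .reg 3 / 2))
        (rangeCall 2 (.reg 2) (.reg 3 / 2)) [])
      (A.summands w 60 (.reg 2) []))
    (.const true)

end

/-- A machine whose procedures with the numbers `0`, `1` and `2` compute the bits of the values of
the arithmetic procedure `body` modulo `2 ^ width`. -/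
structure ArithMachine extends Machine where
  body : AStep
  widthE : Expr
  width : ℕ → ℕ
  eval_widthE : ∀ σ, widthE.eval σ = width (σ 0)
  width_lt : ∀ N, width N < toMachine.base N
  fourteen_le : 14 ≤ digits
  expo_pos : 2 ≤ expo
  run_bit : ∀ x V N a, prog.run x V (regs N (0 :: a)) = (body.bitStep widthE).run x V (regs N (0 :: a))
  run_gen : ∀ x V N a, prog.run x V (regs N (1 :: a)) = (body.genStep widthE).run x V (regs N (1 :: a))
  run_prop : ∀ x V N a,
    prog.run x V (regs N (2 :: a)) = (body.propStep widthE).run x V (regs N (2 :: a))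

/-! ### Addition and multiplication with carry lookahead -/

namespace ArithMachine

variable (M : ArithMachine) (x : List Bool)

/-- The arithmetic call `α` performs the operation `n`. -/
def IsNode (α : List ℕ) (n : ANode) : Prop :=
  (α.length = 9 ∧ ∀ d ∈ α, d < M.base x.length) ∧ ∀ c₁ c₂ c₃ c₄ c₅,
    M.body.resolve (regs x.length (c₁ :: c₂ :: c₃ :: c₄ :: c₅ :: α)) = n

/-- From round `T` on, the part `lo, …, lo + len - 1` of the call `α` has the value `v`. -/
def PVal (T lo len : ℕ) (α : List ℕ) (v : ℕ) : Prop :=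
  ∀ i < M.width x.length, M.HasVal x T (0 :: i :: 0 :: lo :: len :: α) (v.testBit i)

/-- From round `T` on, the arithmetic call `α` has the value `v` modulo `2 ^ width`. -/
def AVal (T : ℕ) (α : List ℕ) (v : ℕ) : Prop := M.PVal x T 0 (M.width x.length) α v

variable {M x}

theorem two_lt_base (N : ℕ) : 2 < M.base N := by
  have h : (N + 2) ^ 2 ≤ (N + 2) ^ M.expo := Nat.pow_le_pow_right (by omega) M.expo_pos
  have : 2 < (N + 2) ^ 2 := lt_of_lt_of_le (by norm_num) (Nat.pow_le_pow_left (Nat.le_add_left 2 N) 2)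
  exact this.trans_le h

/-- A call consists of five control arguments (mode, two for a bit or a range, two for a part of a
product) and the nine registers of the arithmetic call: fourteen digits in all. -/
theorem inRange {α : List ℕ} {n : ANode} (h : M.IsNode x α n) {m i c lo len : ℕ} (hm : m ≤ 2)
    (hi : i ≤ M.width x.length) (hc : c ≤ M.width x.length) (hl : lo ≤ M.width x.length)
    (hlen : len ≤ M.width x.length) : M.InRange x.length (m :: i :: c :: lo :: len :: α) := by
  have := M.width_lt x.length
  have h2 := M.two_lt_base x.length
  refine ⟨by simp [h.1.1]; exact M.fourteen_le, ?_⟩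
  simp only [List.mem_cons, forall_eq_or_imp]
  exact ⟨by omega, by omega, by omega, by omega, by omega, h.1.2⟩

theorem eval_selfRegs (N c₁ c₂ c₃ c₄ c₅ : ℕ) {α : List ℕ} (h : α.length = 9) :
    selfRegs.map (Expr.eval (regs N (c₁ :: c₂ :: c₃ :: c₄ :: c₅ :: α))) = α := by
  match α, h with
  | [a, b, c, d, e, f, g, h, i], _ => rfl

theorem PVal.mono {T T' lo len : ℕ} {α : List ℕ} {v : ℕ} (h : M.PVal x T lo len α v)
    (hT : T ≤ T') : M.PVal x T' lo len α v := fun i hi => (h i hi).mono hT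

theorem PVal.congr {T lo len : ℕ} {α : List ℕ} {v v' : ℕ} (h : M.PVal x T lo len α v)
    (hv : v % 2 ^ M.width x.length = v' % 2 ^ M.width x.length) : M.PVal x T lo len α v' :=
  fun i hi => testBit_congr hv hi ▸ h i hi

/-- The calls `l` and `r` compute the bits of two numbers whose sum is the value of the part
`lo, …, lo + len - 1` of the call `α`. -/
structure IsSum (M : ArithMachine) (x : List Bool) (lo len : ℕ) (α : List ℕ)
    (l r : ℕ → List ℕ) : Prop where
  run_bit : ∀ V i, M.prog.run x V (regs x.length (0 :: i :: 0 :: lo :: len :: α)) =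
    (V (l i) ^^ (V (r i) ^^ V (1 :: 0 :: i :: lo :: len :: α)))
  run_gen : ∀ V i, M.prog.run x V (regs x.length (1 :: i :: 1 :: lo :: len :: α)) =
    (V (l i) && V (r i))
  run_prop : ∀ V i, M.prog.run x V (regs x.length (2 :: i :: 1 :: lo :: len :: α)) =
    (V (l i) ^^ V (r i))

section

variable {lo len : ℕ} {α : List ℕ} {n : ANode}

theorem run_gen_ge_two (h : M.IsNode x α n) {c : ℕ} (hc : 2 ≤ c) (V : List ℕ → Bool) (i : ℕ) :
    M.prog.run x V (regs x.length (1 :: i :: c :: lo :: len :: α)) =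
      (V (1 :: (i + c / 2) :: (c - c / 2) :: lo :: len :: α) ||
        (V (2 :: (i + c / 2) :: (c - c / 2) :: lo :: len :: α) &&
          V (1 :: i :: (c / 2) :: lo :: len :: α))) := by
  have h1 : c ≠ 0 := by omega
  have h2 : c - 1 ≠ 0 := by omega
  rw [M.run_gen, AStep.genStep]
  simp [Step.run, regs, h2, h1, rangeCall, eval_selfRegs _ _ _ _ _ _ h.1.1]

theorem run_prop_ge_two (h : M.IsNode x α n) {c : ℕ} (hc : 2 ≤ c) (V : List ℕ → Bool) (i : ℕ) :
    M.prog.run x V (regs x.length (2 :: i :: c :: lo :: len :: α)) =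
      (V (2 :: (i + c / 2) :: (c - c / 2) :: lo :: len :: α) &&
        V (2 :: i :: (c / 2) :: lo :: len :: α)) := by
  have h1 : c ≠ 0 := by omega
  have h2 : c - 1 ≠ 0 := by omega
  rw [M.run_prop, AStep.propStep]
  simp [Step.run, regs, h2, h1, rangeCall, eval_selfRegs _ _ _ _ _ _ h.1.1]

/-- Generate and propagate bits are treated together, since the generate bit of a range needs the
propagate bit of its upper half. Each doubling of the length costs one round. -/
theorem hasVal_carry (h : M.IsNode x α n) {l r : ℕ → List ℕ} (hs : IsSum M x lo len α l r)
    (hlo : lo ≤ M.width x.length) (hlen : len ≤ M.width x.length) {T X Y : ℕ}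
    (hX : ∀ i < M.width x.length, M.HasVal x T (l i) (X.testBit i))
    (hY : ∀ i < M.width x.length, M.HasVal x T (r i) (Y.testBit i)) (k : ℕ) :
    ∀ i c, c ≤ 2 ^ k → i + c ≤ M.width x.length →
      M.HasVal x (T + k + 1) (1 :: i :: c :: lo :: len :: α)
        (carry X.testBit Y.testBit i c false) ∧
      M.HasVal x (T + k + 1) (2 :: i :: c :: lo :: len :: α)
        (propagate X.testBit Y.testBit i c) := by
  have hr : ∀ m i c, m ≤ 2 → i + c ≤ M.width x.length →
      M.InRange x.length (m :: i :: c :: lo :: len :: α) :=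
    fun m i c hm hi => M.inRange h hm (by omega) (by omega) hlo hlen
  have base : ∀ i c, c ≤ 1 → i + c ≤ M.width x.length →
      M.HasVal x (T + 1) (1 :: i :: c :: lo :: len :: α)
        (carry X.testBit Y.testBit i c false) ∧
      M.HasVal x (T + 1) (2 :: i :: c :: lo :: len :: α)
        (propagate X.testBit Y.testBit i c) := by
    intro i c hc hi
    obtain rfl | rfl : c = 0 ∨ c = 1 := by omega
    · refine ⟨.of_run (hr _ _ _ (by norm_num) hi) fun V hV => ?_,
        .of_run (hr _ _ _ (by norm_num) hi) fun V hV => ?_⟩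
      · rw [M.run_gen, AStep.genStep]
        simp [Step.run, regs, carry]
      · rw [M.run_prop, AStep.propStep]
        simp [Step.run, regs, propagate]
    · refine ⟨.of_run (hr _ _ _ (by norm_num) hi) fun V hV => ?_,
        .of_run (hr _ _ _ (by norm_num) hi) fun V hV => ?_⟩
      · rw [hs.run_gen, hV _ _ (hX i (by omega)), hV _ _ (hY i (by omega))]
        simp [carry]
      · rw [hs.run_prop, hV _ _ (hX i (by omega)), hV _ _ (hY i (by omega))]
        simp [propagate]
  induction k with
  | zero => exact base
  | succ k ih =>
    intro i c hc hi
    by_cases hc1 : c ≤ 1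
    · exact ⟨(base i c hc1 hi).1.mono (by omega), (base i c hc1 hi).2.mono (by omega)⟩
    have h1 := ih i (c / 2) (by rw [pow_succ] at hc; omega) (by omega)
    have h2 := ih (i + c / 2) (c - c / 2) (by rw [pow_succ] at hc; omega) (by omega)
    have e : c = c / 2 + (c - c / 2) := by omega
    refine ⟨.of_run (hr _ _ _ (by norm_num) hi) fun V hV => ?_,
        .of_run (hr _ _ _ (by norm_num) hi) fun V hV => ?_⟩
    -- The body computes: generated above, or propagated above and generated below. By `carry_eq`
    -- this is the carry of the upper half with the carry of the lower half as input.
    · rw [run_gen_ge_two h (by omega), hV _ _ h2.1, hV _ _ h2.2, hV _ _ h1.1, ← carry_eq,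
        ← carry_add, ← e]
    · rw [run_prop_ge_two h (by omega), hV _ _ h2.2, hV _ _ h1.2, ← propagate_add, ← e]

/-- A sum bit is the exclusive or of the two summand bits and the carry out of the lower positions,
which is available after `k + 1` further rounds. -/
theorem PVal.sum (h : M.IsNode x α n) {l r : ℕ → List ℕ} (hs : IsSum M x lo len α l r)
    (hlo : lo ≤ M.width x.length) (hlen : len ≤ M.width x.length) {T X Y k : ℕ}
    (hk : M.width x.length ≤ 2 ^ k)
    (hX : ∀ i < M.width x.length, M.HasVal x T (l i) (X.testBit i))
    (hY : ∀ i < M.width x.length, M.HasVal x T (r i) (Y.testBit i)) :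
    M.PVal x (T + k + 2) lo len α (X + Y) := by
  intro i hi
  refine .of_run (M.inRange h (by norm_num) hi.le (by omega) hlo hlen) fun V hV => ?_
  rw [hs.run_bit, hV _ _ ((hX i hi).mono (by omega)), hV _ _ ((hY i hi).mono (by omega)),
    hV _ _ ((hasVal_carry h hs hlo hlen hX hY k 0 i (by omega) (by omega)).1), testBit_add_eq]

theorem summands_run (τ : ℕ) (i : Expr) (third : List Expr) (V : List ℕ → Bool) (σ : ℕ → ℕ)
    (A : AStep) : (A.summands M.widthE τ i third).run x V σ =
      match A.resolve σ with
      | .add l r => lut τ (V (0 :: i.eval σ :: 0 :: 0 :: M.width (σ 0) :: l))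
          (V (0 :: i.eval σ :: 0 :: 0 :: M.width (σ 0) :: r)) (V (third.map (Expr.eval σ)))
      | .mul _ _ => lut τ (V (0 :: i.eval σ :: 0 :: σ 4 :: σ 5 / 2 :: selfRegs.map (Expr.eval σ)))
          (V (0 :: i.eval σ :: 0 :: (σ 4 + σ 5 / 2) :: (σ 5 - σ 5 / 2) ::
            selfRegs.map (Expr.eval σ))) (V (third.map (Expr.eval σ)))
      | _ => false := by
  induction A with
  | cond e s t hs ht =>
    simp only [AStep.summands, Step.run, AStep.resolve]
    split_ifs
    · exact ht
    · exact hs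
  | _ => simp [AStep.summands, Step.run, AStep.resolve, bitOf, bitOfPart, M.eval_widthE]

theorem bitStep_run (V : List ℕ → Bool) (σ : ℕ → ℕ) (A : AStep) :
    (A.bitStep M.widthE).run x V σ =
      match A.resolve σ with
      | .add l r => (V (0 :: σ 2 :: 0 :: 0 :: M.width (σ 0) :: l) ^^
          (V (0 :: σ 2 :: 0 :: 0 :: M.width (σ 0) :: r) ^^
          (V (1 :: 0 :: σ 2 :: σ 4 :: σ 5 :: selfRegs.map (Expr.eval σ)))))
      | .mul l r => if σ 5 = 0 then false else if σ 5 - 1 = 0 then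
            if σ 2 < σ 4 then false else
              V (0 :: (σ 2 - σ 4) :: 0 :: 0 :: M.width (σ 0) :: l) &&
              V (0 :: σ 4 :: 0 :: 0 :: M.width (σ 0) :: r)
          else (V (0 :: σ 2 :: 0 :: σ 4 :: σ 5 / 2 :: selfRegs.map (Expr.eval σ)) ^^
            (V (0 :: σ 2 :: 0 :: (σ 4 + σ 5 / 2) :: (σ 5 - σ 5 / 2) ::
              selfRegs.map (Expr.eval σ)) ^^
            (V (1 :: 0 :: σ 2 :: σ 4 :: σ 5 :: selfRegs.map (Expr.eval σ)))))
      | .goto k => V (0 :: σ 2 :: 0 :: 0 :: M.width (σ 0) :: k)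
      | .leaf s => s.run x V σ := by
  induction A with
  | cond e s t hs ht =>
    simp only [AStep.bitStep, Step.run, AStep.resolve]
    by_cases h : e.eval σ = 0
    · rw [if_pos h, if_pos h]; exact ht
    · rw [if_neg h, if_neg h]; exact hs
  | mul l r =>
    simp only [AStep.bitStep, Step.run, AStep.resolve, Expr.eval_reg', Expr.eval_sub',
      Expr.eval_ofNat, Expr.eval_lt]
    by_cases h : σ 2 < σ 4 <;> simp only [h, if_true, if_false] <;> split_ifs <;>
      simp_all [bitOf, bitOfPart, M.eval_widthE]
  | _ => simp [AStep.bitStep, Step.run, AStep.resolve, bitOf, M.eval_widthE]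

theorem run_bit_eq (h : M.IsNode x α n) (V : List ℕ → Bool) (i : ℕ) :
    M.prog.run x V (regs x.length (0 :: i :: 0 :: lo :: len :: α)) =
      match n with
      | .add l r => (V (0 :: i :: 0 :: 0 :: M.width x.length :: l) ^^
          (V (0 :: i :: 0 :: 0 :: M.width x.length :: r) ^^
          (V (1 :: 0 :: i :: lo :: len :: α))))
      | .mul l r => if len = 0 then false else if len - 1 = 0 then
            if i < lo then false else
              V (0 :: (i - lo) :: 0 :: 0 :: M.width x.length :: l) &&
              V (0 :: lo :: 0 :: 0 :: M.width x.length :: r)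
          else (V (0 :: i :: 0 :: lo :: len / 2 :: α) ^^
            (V (0 :: i :: 0 :: (lo + len / 2) :: (len - len / 2) :: α) ^^
            (V (1 :: 0 :: i :: lo :: len :: α))))
      | .goto k => V (0 :: i :: 0 :: 0 :: M.width x.length :: k)
      | .leaf s => s.run x V (regs x.length (0 :: i :: 0 :: lo :: len :: α)) := by
  rw [M.run_bit, bitStep_run, h.2]
  cases n <;> simp [regs, eval_selfRegs _ _ _ _ _ _ h.1.1]

theorem run_summands_eq (h : M.IsNode x α n) (V : List ℕ → Bool) (m i τ : ℕ) :
    (M.body.summands M.widthE τ (.reg 2) []).run x V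
        (regs x.length (m :: i :: 1 :: lo :: len :: α)) =
      match n with
      | .add l r => lut τ (V (0 :: i :: 0 :: 0 :: M.width x.length :: l))
          (V (0 :: i :: 0 :: 0 :: M.width x.length :: r)) (V [])
      | .mul _ _ => lut τ (V (0 :: i :: 0 :: lo :: len / 2 :: α))
          (V (0 :: i :: 0 :: (lo + len / 2) :: (len - len / 2) :: α)) (V [])
      | _ => false := by
  rw [summands_run, h.2]
  cases n <;> simp [regs, eval_selfRegs _ _ _ _ _ _ h.1.1]

/-- The registers `lo` and `len` play no role for an addition: every part of it is the full sum. -/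
theorem isSum_add {l r : List ℕ} (h : M.IsNode x α (.add l r)) :
    IsSum M x lo len α (fun i => 0 :: i :: 0 :: 0 :: M.width x.length :: l)
      (fun i => 0 :: i :: 0 :: 0 :: M.width x.length :: r) where
  run_bit V i := run_bit_eq h V i
  run_gen V i := by
    rw [M.run_gen, AStep.genStep]
    simp [Step.run, regs, run_summands_eq h]
  run_prop V i := by
    rw [M.run_prop, AStep.propStep]
    simp [Step.run, regs, run_summands_eq h]

/-- A partial product over at least two digits is the sum of the partial products over the two
halves, which are parts of the same call `α`. Hence products can share the carry procedures with
sums. -/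
theorem isSum_mul {l r : List ℕ} (h : M.IsNode x α (.mul l r)) (hlen : 2 ≤ len) :
    IsSum M x lo len α (fun i => 0 :: i :: 0 :: lo :: len / 2 :: α)
      (fun i => 0 :: i :: 0 :: (lo + len / 2) :: (len - len / 2) :: α) where
  run_bit V i := by
    rw [run_bit_eq h V i]
    simp [show len ≠ 0 by omega, show len - 1 ≠ 0 by omega]
  run_gen V i := by
    rw [M.run_gen, AStep.genStep]
    simp [Step.run, regs, run_summands_eq h]
  run_prop V i := by
    rw [M.run_prop, AStep.propStep]
    simp [Step.run, regs, run_summands_eq h]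

theorem AVal.add' {l r : List ℕ} (h : M.IsNode x α (.add l r)) {T X Y k : ℕ}
    (hk : M.width x.length ≤ 2 ^ k) (hX : M.AVal x T l X) (hY : M.AVal x T r Y) :
    M.AVal x (T + k + 2) α (X + Y) :=
  PVal.sum h (isSum_add h) (Nat.zero_le _) le_rfl hk hX hY

/-- School multiplication as a balanced tree: the part `lo, len` is `X` times the digits `lo, …, lo
+ len - 1` of `Y`, left in place. A single digit gives a shifted copy of `X` or `0`, and each of the
`j` levels above is one addition with `k + 2` rounds. -/
theorem PVal.mul {l r : List ℕ} (h : M.IsNode x α (.mul l r)) {T X Y k : ℕ}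
    (hk : M.width x.length ≤ 2 ^ k) (hX : M.AVal x T l X) (hY : M.AVal x T r Y) (j : ℕ) :
    ∀ lo len, len ≤ 2 ^ j → lo + len ≤ M.width x.length →
      M.PVal x (T + 1 + j * (k + 2)) lo len α (X * (Y / 2 ^ lo % 2 ^ len * 2 ^ lo)) := by
  have base : ∀ lo len, len ≤ 1 → lo + len ≤ M.width x.length →
      M.PVal x (T + 1) lo len α (X * (Y / 2 ^ lo % 2 ^ len * 2 ^ lo)) := by
    intro lo len h1 h2 i hi
    refine .of_run (M.inRange h (by norm_num) hi.le (by omega) (by omega) (by omega)) fun V hV => ?_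
    rw [run_bit_eq h]
    obtain rfl | rfl : len = 0 ∨ len = 1 := by omega
    · simp [Nat.mod_one]
    · have hY' := hV _ _ (hY lo (by omega))
      rw [Nat.testBit_eq_decide_div_mod_eq] at hY'
      have hm : Y / 2 ^ lo % 2 = 0 ∨ Y / 2 ^ lo % 2 = 1 := by omega
      simp only [one_ne_zero, if_false, Nat.sub_self, if_true, pow_one]
      split_ifs with hlt
      · rw [← mul_assoc, Nat.testBit_mul_two_pow]; simp [hlt]
      · rw [hV _ _ (hX (i - lo) (by omega)), hY', ← mul_assoc, Nat.testBit_mul_two_pow]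
        rcases hm with hm | hm <;> simp [hm]
        omega
  induction j with
  | zero => simpa using base
  | succ j ih =>
    intro lo len hlen hle
    by_cases h1 : len ≤ 1
    · exact (base lo len h1 hle).mono (by omega)
    rw [pow_succ] at hlen
    have i1 := ih lo (len / 2) (by omega) (by omega)
    have i2 := ih (lo + len / 2) (len - len / 2) (by omega) (by omega)
    have := PVal.sum h (isSum_mul h (lo := lo) (by omega)) (by omega) (by omega) hk i1 i2
    -- The digits of `Y` in the range are those of the lower half plus the shifted ones of the upper
    -- half.
    have e : X * (Y / 2 ^ lo % 2 ^ (len / 2) * 2 ^ lo) +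
        X * (Y / 2 ^ (lo + len / 2) % 2 ^ (len - len / 2) * 2 ^ (lo + len / 2)) =
        X * (Y / 2 ^ lo % 2 ^ len * 2 ^ lo) := by
      have e1 : 2 ^ len = 2 ^ (len / 2) * 2 ^ (len - len / 2) := by rw [← pow_add]; congr 1; omega
      rw [e1, Nat.mod_mul, Nat.div_div_eq_div_mul, ← pow_add, pow_add 2 lo (len / 2)]
      ring
    rw [e] at this
    exact this.mono (by rw [add_mul]; omega)

/-- A bound on the number of rounds of an arithmetic operation. -/
def opCost (k : ℕ) : ℕ := (k + 2) ^ 2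

theorem AVal.add {l r : List ℕ} (h : M.IsNode x α (.add l r)) {T X Y k : ℕ}
    (hk : M.width x.length ≤ 2 ^ k) (hX : M.AVal x T l X) (hY : M.AVal x T r Y) :
    M.AVal x (T + opCost k) α (X + Y) :=
  (AVal.add' h hk hX hY).mono (by rw [opCost]; nlinarith)

/-- Only the lowest `width` digits of `Y` enter, which suffices modulo `2 ^ width`. The `k` levels
of additions account for the quadratic `opCost`. -/
theorem AVal.mul {l r : List ℕ} (h : M.IsNode x α (.mul l r)) {T X Y k : ℕ}
    (hk : M.width x.length ≤ 2 ^ k) (hX : M.AVal x T l X) (hY : M.AVal x T r Y) :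
    M.AVal x (T + opCost k) α (X * Y) := by
  have := PVal.mul h hk hX hY k 0 _ hk (by omega)
  refine (this.mono (by rw [opCost]; nlinarith)).congr ?_
  rw [pow_zero, Nat.div_one, mul_one, Nat.mul_mod, Nat.mod_mod, ← Nat.mul_mod]

theorem AVal.goto {l : List ℕ} (h : M.IsNode x α (.goto l)) {T X k : ℕ}
    (hX : M.AVal x T l X) : M.AVal x (T + opCost k) α X := by
  intro i hi
  refine Machine.HasVal.mono (T := T + 1) (.of_run
    (M.inRange h (by norm_num) hi.le (by omega) (by omega) le_rfl) fun V hV => ?_)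
    (by rw [opCost]; have := Nat.one_le_pow 2 (k + 2) (by omega); omega)
  rw [run_bit_eq h]
  exact hV _ _ (hX i hi)

theorem AVal.leaf {s : Step} (h : M.IsNode x α (.leaf s)) {T X : ℕ}
    (hX : ∀ i < M.width x.length, ∀ V : List ℕ → Bool, (∀ a v, M.HasVal x T a v → V a = v) →
      s.run x V (regs x.length (0 :: i :: 0 :: 0 :: M.width x.length :: α)) = X.testBit i) :
    M.AVal x (T + 1) α X := by
  intro i hi
  refine .of_run (M.inRange h (by norm_num) hi.le (by omega) (by omega) le_rfl) fun V hV => ?_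
  rw [run_bit_eq h]
  exact hX i hi V hV

end

end ArithMachine

end RatEval

namespace RatEval

/-! ### Determinants without divisions -/

section

variable {R : Type*} [CommRing R]

/-- The leading principal submatrix of size `k`. -/
def leading (X : ℕ → ℕ → R) (k : ℕ) : Matrix (Fin k) (Fin k) R := Matrix.of fun i j => X i j

/-- The geometric sum is the inverse of `1 - A`. By the adjugate formula its last diagonal entry
times the determinant is the minor without the last row and column. -/
theorem geom_mul_det (X : ℕ → ℕ → R) (k E : ℕ) (hE : leading X (k + 1) ^ E = 0) :
    (∑ e ∈ Finset.range E, (leading X (k + 1) ^ e) (Fin.last k) (Fin.last k)) *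
      (1 - leading X (k + 1)).det = (1 - leading X k).det := by
  set A := leading X (k + 1)
  have h1 : (∑ e ∈ Finset.range E, A ^ e) * (1 - A) = 1 := by
    rw [geom_sum_mul_neg, hE, sub_zero]
  have h2 : (1 - A).det • (∑ e ∈ Finset.range E, A ^ e) = (1 - A).adjugate := by
    calc (1 - A).det • (∑ e ∈ Finset.range E, A ^ e)
        = (∑ e ∈ Finset.range E, A ^ e) * ((1 - A) * (1 - A).adjugate) := by
          rw [Matrix.mul_adjugate]; simp
      _ = _ := by rw [← mul_assoc, h1, one_mul]
  have h3 := congrFun (congrFun h2 (Fin.last k)) (Fin.last k)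
  rw [Matrix.adjugate_fin_succ_eq_det_submatrix, Matrix.smul_apply, Matrix.sum_apply] at h3
  rw [mul_comm, ← smul_eq_mul, h3, ← two_mul, pow_mul, neg_one_sq, one_pow, one_mul]
  congr 1
  ext i j
  simp [A, leading, Matrix.one_apply, Fin.ext_iff]

/-- `geom_mul_det` telescopes from size `D` down to the empty determinant. -/
theorem prod_geom_mul_det (X : ℕ → ℕ → R) (E : ℕ) (hE : ∀ k, leading X k ^ E = 0) (D : ℕ) :
    (∏ k ∈ Finset.range D, ∑ e ∈ Finset.range E,
      (leading X (k + 1) ^ e) (Fin.last k) (Fin.last k)) * (1 - leading X D).det = 1 := by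
  induction D with
  | zero => simp
  | succ D ih => rw [Finset.prod_range_succ, mul_assoc, geom_mul_det X D E (hE _), ih]

/-- Both `d` and the geometric sum in the nilpotent element `1 - F` are inverses of `F`. -/
theorem sum_pow_eq_of_mul_eq_one {F d : R} {E : ℕ} (h : F * d = 1) (hE : (1 - F) ^ E = 0) :
    ∑ e ∈ Finset.range E, (1 - F) ^ e = d := by
  have h1 : F * ∑ e ∈ Finset.range E, (1 - F) ^ e = 1 := by
    have := mul_neg_geom_sum (1 - F) E
    rwa [hE, sub_zero, sub_sub_cancel] at this
  calc _ = (F * d) * ∑ e ∈ Finset.range E, (1 - F) ^ e := by rw [h, one_mul]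
    _ = d * (F * ∑ e ∈ Finset.range E, (1 - F) ^ e) := by ring
    _ = d := by rw [h1, mul_one]

/-- The determinant of `1 - X` for a matrix `X` with nilpotent entries, computed with additions and
multiplications only. -/
theorem det_one_sub_eq (z : R) (A : ℕ → ℕ → R) (E : ℕ) (hE0 : E ≠ 0) (hz : z ^ E = 0) (D : ℕ) :
    ∑ e ∈ Finset.range E, (1 - ∏ k ∈ Finset.range D, ∑ e ∈ Finset.range E,
      (leading (fun i j => z * A i j) (k + 1) ^ e) (Fin.last k) (Fin.last k)) ^ e =
      (1 - leading (fun i j => z * A i j) D).det := by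
  have hl : ∀ k, leading (fun i j => z * A i j) k = z • leading A k := fun k => by
    ext i j; simp [leading]
  have hE : ∀ k, leading (fun i j => z * A i j) k ^ E = 0 := fun k => by
    rw [hl, smul_pow, hz, zero_smul]
  refine sum_pow_eq_of_mul_eq_one (prod_geom_mul_det _ E hE D) ?_
  -- Modulo `z` the matrices vanish, so each geometric sum reduces to its term `e = 0`, which is `1`
  -- on the diagonal. Hence `1 - F` is a multiple of `z` and nilpotent with it.
  suffices h : z ∣ 1 - ∏ k ∈ Finset.range D, ∑ e ∈ Finset.range E,
      (leading (fun i j => z * A i j) (k + 1) ^ e) (Fin.last k) (Fin.last k) by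
    obtain ⟨c, hc⟩ := h
    rw [hc, mul_pow, hz, zero_mul]
  rw [← Ideal.mem_span_singleton, ← Ideal.Quotient.eq_zero_iff_mem, map_sub, map_one, map_prod,
    Finset.prod_eq_one, sub_self]
  intro k _
  rw [← sub_eq_zero, ← map_one (Ideal.Quotient.mk (Ideal.span {z})), ← map_sub,
    Ideal.Quotient.eq_zero_iff_mem, Ideal.mem_span_singleton]
  -- The term `e = 0` is present because `E ≠ 0`.
  obtain ⟨E, rfl⟩ := Nat.exists_eq_succ_of_ne_zero hE0
  rw [Finset.sum_range_succ', pow_zero, Matrix.one_apply_eq, add_sub_cancel_right]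
  refine Finset.dvd_sum fun e _ => ?_
  rw [hl, smul_pow, Matrix.smul_apply, pow_succ, smul_eq_mul]
  exact ⟨z ^ e * (leading A (k + 1) ^ (e + 1)) (Fin.last k) (Fin.last k), by ring⟩

end

/-! ### Extraction of the determinant -/

/-- Exchange the factors one at a time; each exchange changes the product by at most `K ^ (s.card -
1)`. -/
theorem abs_prod_sub_prod_le {ι : Type*} (s : Finset ι) (a b : ι → ℤ) (K : ℤ)
    (ha : ∀ i ∈ s, |a i| ≤ K) (hb : ∀ i ∈ s, |b i| ≤ K) (hab : ∀ i ∈ s, |a i - b i| ≤ 1) :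
    |∏ i ∈ s, a i - ∏ i ∈ s, b i| ≤ s.card * K ^ (s.card - 1) := by
  classical
  induction s using Finset.induction_on with
  | empty => simp
  | insert i s hi ih =>
    have hK : 0 ≤ K := (abs_nonneg _).trans (ha i (Finset.mem_insert_self i s))
    have ih := ih (fun j hj => ha j (Finset.mem_insert_of_mem hj))
      (fun j hj => hb j (Finset.mem_insert_of_mem hj))
      (fun j hj => hab j (Finset.mem_insert_of_mem hj))
    rw [Finset.prod_insert hi, Finset.prod_insert hi, Finset.card_insert_of_notMem hi]
    have e : a i * ∏ x ∈ s, a x - b i * ∏ x ∈ s, b x =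
        a i * (∏ x ∈ s, a x - ∏ x ∈ s, b x) + (a i - b i) * ∏ x ∈ s, b x := by ring
    have hp : |∏ x ∈ s, b x| ≤ K ^ s.card := by
      rw [Finset.abs_prod]
      rw [← Finset.prod_const]
      exact Finset.prod_le_prod (fun _ _ => abs_nonneg _) fun j hj => hb j (Finset.mem_insert_of_mem hj)
    have h1 : |a i| * |∏ x ∈ s, a x - ∏ x ∈ s, b x| ≤ s.card * K ^ s.card := by
      rcases Nat.eq_zero_or_pos s.card with h0 | h0
      · rw [Finset.card_eq_zero.1 h0]; simp
      · calc _ ≤ K * (s.card * K ^ (s.card - 1)) :=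
              mul_le_mul (ha i (Finset.mem_insert_self i s)) ih (abs_nonneg _) hK
          _ = s.card * K ^ s.card := by
              conv_rhs => rw [← Nat.sub_add_cancel h0, pow_succ]
              rw [Nat.sub_add_cancel h0]; ring
    have h2 : |a i - b i| * |∏ x ∈ s, b x| ≤ 1 * K ^ s.card :=
      mul_le_mul (hab i (Finset.mem_insert_self i s)) hp (abs_nonneg _) zero_le_one
    rw [e]
    refine (abs_add_le _ _).trans ?_
    rw [abs_mul, abs_mul]
    push_cast
    linarith

/-- As a polynomial in `z`, `det (1 + z A)` has leading term `z ^ D det A`; this bounds the rest.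
The permutation expansions of `1 + z A` and `z A` are compared product by product: the entries are
at most `2 z a` and differ by entries of `1`. -/
theorem abs_det_one_add_sub_le (D : ℕ) (A : Matrix (Fin D) (Fin D) ℤ) (a z : ℤ) (hz : 1 ≤ z)
    (ha : 1 ≤ a) (hA : ∀ i j, |A i j| ≤ a) :
    |(1 + z • A).det - z ^ D * A.det| ≤ D.factorial * (D * (2 * z * a) ^ (D - 1)) := by
  have h1 : z ^ D * A.det = (z • A).det := by rw [Matrix.det_smul, Fintype.card_fin]
  rw [h1, Matrix.det_apply, Matrix.det_apply, ← Finset.sum_sub_distrib]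
  refine (Finset.abs_sum_le_sum_abs _ _).trans ?_
  have hza : 1 ≤ z * a := one_le_mul_of_one_le_of_one_le hz ha
  have h : ∀ σ ∈ (Finset.univ : Finset (Equiv.Perm (Fin D))),
      |Equiv.Perm.sign σ • ∏ i, (1 + z • A) (σ i) i - Equiv.Perm.sign σ • ∏ i, (z • A) (σ i) i| ≤
        D * (2 * z * a) ^ (D - 1) := by
    intro σ _
    have h2 : ∀ i, |(z • A) (σ i) i| ≤ z * a := fun i => by
      rw [Matrix.smul_apply, smul_eq_mul, abs_mul, abs_of_pos (by linarith : 0 < z)]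
      exact mul_le_mul_of_nonneg_left (hA _ _) (by linarith)
    have h3 : ∀ i, |(1 : Matrix (Fin D) (Fin D) ℤ) (σ i) i| ≤ 1 := fun i => by
      rw [Matrix.one_apply]; split_ifs <;> simp
    have := abs_prod_sub_prod_le Finset.univ (fun i => (1 + z • A) (σ i) i)
      (fun i => (z • A) (σ i) i) (2 * z * a)
      (fun i _ => by
        rw [Matrix.add_apply]
        refine (abs_add_le _ _).trans ?_
        linarith [h2 i, h3 i])
      (fun i _ => by linarith [h2 i])
      (fun i _ => by rw [Matrix.add_apply, add_sub_cancel_right]; exact h3 i)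
    rw [Finset.card_univ, Fintype.card_fin] at this
    rw [← smul_sub]
    rcases Int.units_eq_one_or (Equiv.Perm.sign σ) with h | h <;> rw [h] <;> simpa [abs_sub_comm] using this
  refine (Finset.sum_le_card_nsmul _ _ _ h).trans ?_
  rw [Finset.card_univ, Fintype.card_perm, Fintype.card_fin, nsmul_eq_mul]

theorem abs_det_le (D : ℕ) (A : Matrix (Fin D) (Fin D) ℤ) (a : ℤ) (hA : ∀ i j, |A i j| ≤ a) :
    |A.det| ≤ D.factorial * a ^ D := by
  rw [Matrix.det_apply]
  refine (Finset.abs_sum_le_sum_abs _ _).trans ?_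
  refine (Finset.sum_le_card_nsmul _ _ (a ^ D) fun σ _ => ?_).trans ?_
  · have : |∏ i, A (σ i) i| ≤ a ^ D := by
      rw [Finset.abs_prod]
      refine (Finset.prod_le_prod (fun _ _ => abs_nonneg _) fun i _ => hA _ _).trans ?_
      simp
    rcases Int.units_eq_one_or (Equiv.Perm.sign σ) with h | h <;> rw [h] <;> simpa using this
  · rw [Finset.card_univ, Fintype.card_perm, Fintype.card_fin, nsmul_eq_mul]

theorem factorial_le_two_pow (D : ℕ) : D.factorial ≤ 2 ^ (D ^ 2) := by
  calc D.factorial ≤ D ^ D := Nat.factorial_le_pow D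
    _ ≤ (2 ^ D) ^ D := Nat.pow_le_pow_left (Nat.lt_two_pow_self).le D
    _ = _ := by rw [← pow_mul, sq]

/-- The binary digits `m D, …, m D + m - 1` of `det (1 + 2 ^ m A)`, rounded, are those of `det A`. -/
theorem div_mod_eq_det {D m N W : ℕ} {A : Matrix (Fin D) (Fin D) ℤ} (hA : ∀ i j, |A i j| ≤ 2 ^ N)
    (hm : D ^ 2 + D + (N + 1) * D + 2 ≤ m) (hD : 1 ≤ D) (hW : m * (D + 1) ≤ W) {v : ℕ}
    (hv : (v : ℤ) ≡ (1 + (2 ^ m : ℤ) • A).det + 2 ^ (m * D - 1) [ZMOD 2 ^ W]) :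
    ((v / 2 ^ (m * D) % 2 ^ m : ℕ) : ℤ) = A.det % 2 ^ m := by
  have hmD : 1 ≤ m * D := Nat.one_le_iff_ne_zero.2 (Nat.mul_ne_zero (by omega) (by omega))
  have hr := abs_det_one_add_sub_le D A (2 ^ N) (2 ^ m) (one_le_pow₀ (by norm_num))
    (one_le_pow₀ (by norm_num)) hA
  set r := (1 + (2 ^ m : ℤ) • A).det - (2 ^ m) ^ D * A.det with hr'
  -- The remainder has one factor `2 ^ m` less than the leading term, and `m` outweighs all other
  -- contributions; so it is less than half of `2 ^ (m * D)`.
  have hb : |r| < 2 ^ (m * D - 1) := by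
    refine hr.trans_lt ?_
    have h1 : (D.factorial : ℤ) ≤ 2 ^ (D ^ 2) := by exact_mod_cast factorial_le_two_pow D
    have h2 : (D : ℤ) ≤ 2 ^ D := by exact_mod_cast (Nat.lt_two_pow_self).le
    have h3 : (2 * 2 ^ m * 2 ^ N : ℤ) ^ (D - 1) = 2 ^ ((m + N + 1) * (D - 1)) := by
      rw [pow_mul]; congr 1; ring
    rw [h3]
    calc (D.factorial : ℤ) * (D * 2 ^ ((m + N + 1) * (D - 1)))
        ≤ 2 ^ (D ^ 2) * (2 ^ D * 2 ^ ((m + N + 1) * (D - 1))) := by gcongr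
      _ = 2 ^ (D ^ 2 + (D + (m + N + 1) * (D - 1))) := by rw [← pow_add, ← pow_add]
      _ < 2 ^ (m * D - 1) := by
          apply pow_lt_pow_right₀ (by norm_num)
          obtain ⟨d, rfl⟩ : ∃ d, D = d + 1 := ⟨D - 1, by omega⟩
          rw [Nat.add_sub_cancel]
          have : m * (d + 1) = m * d + m := by ring
          nlinarith [Nat.sub_add_cancel hmD]
  obtain ⟨q, hq⟩ := (Int.modEq_iff_dvd.1 hv.symm)
  -- The modulus lies above the window of digits `m D, …, m D + m - 1`, so its multiples do not
  -- disturb the window.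
  have hsplit : (2 : ℤ) ^ W = 2 ^ (m * D) * (2 ^ m * 2 ^ (W - m * (D + 1))) := by
    rw [← pow_add, ← pow_add]; congr 1; rw [mul_add, mul_one] at hW ⊢; omega
  have h2 : (2 : ℤ) ^ (m * D) = 2 * 2 ^ (m * D - 1) := by
    rw [← pow_succ', Nat.sub_add_cancel hmD]
  have hve : (v : ℤ) = (r + 2 ^ (m * D - 1)) +
      2 ^ (m * D) * (A.det + 2 ^ m * (2 ^ (W - m * (D + 1)) * q)) := by
    have : (v : ℤ) = 2 ^ W * q + ((1 + (2 ^ m : ℤ) • A).det + 2 ^ (m * D - 1)) := by linarith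
    rw [this, hsplit, hr', ← pow_mul]; ring
  -- Half a unit of the window was added so that a negative remainder does not borrow from the
  -- quotient.
  have hs0 : 0 ≤ r + 2 ^ (m * D - 1) := by linarith [(abs_lt.1 hb).1]
  have hs1 : r + 2 ^ (m * D - 1) < 2 ^ (m * D) := by linarith [(abs_lt.1 hb).2]
  push_cast
  rw [hve, Int.add_mul_ediv_left _ _ (by positivity), Int.ediv_eq_zero_of_lt hs0 hs1, zero_add,
    Int.add_mul_emod_self_left]

/-- One bit below the modulus is left free, so that the residue modulo `2 ^ m` determines the sign.
-/
theorem abs_det_lt {D m N : ℕ} {A : Matrix (Fin D) (Fin D) ℤ} (hA : ∀ i j, |A i j| ≤ 2 ^ N)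
    (hm : D ^ 2 + D + (N + 1) * D + 2 ≤ m) : |A.det| < 2 ^ (m - 1) := by
  refine (abs_det_le D A _ hA).trans_lt ?_
  have h1 : (D.factorial : ℤ) ≤ 2 ^ (D ^ 2) := by exact_mod_cast factorial_le_two_pow D
  calc (D.factorial : ℤ) * (2 ^ N) ^ D ≤ 2 ^ (D ^ 2) * (2 ^ N) ^ D := by gcongr
    _ = 2 ^ (D ^ 2 + N * D) := by rw [← pow_mul, ← pow_add]
    _ < 2 ^ (m - 1) := pow_lt_pow_right₀ (by norm_num) (by
      have : (N + 1) * D = N * D + D := by ring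
      omega)

/-- Two's complement: a negative `c` has the residue `c + 2 ^ m`, which is at least `2 ^ (m - 1)`.
-/
theorem testBit_sign {m v : ℕ} {c : ℤ} (hm : 1 ≤ m) (hc : |c| < 2 ^ (m - 1))
    (hv : (v : ℤ) = c % 2 ^ m) : v.testBit (m - 1) = decide (c < 0) := by
  obtain ⟨k, rfl⟩ : ∃ k, m = k + 1 := ⟨m - 1, by omega⟩
  rw [Nat.add_sub_cancel] at hc ⊢
  have hk : (2 : ℤ) ^ (k + 1) = 2 * 2 ^ k := pow_succ' _ _
  have hc' := abs_lt.1 hc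
  rw [Nat.testBit_eq_decide_div_mod_eq]
  congr 1
  have hv' : ((v / 2 ^ k % 2 : ℕ) : ℤ) = (c % 2 ^ (k + 1)) / 2 ^ k % 2 := by
    push_cast; rw [hv]
  have key : (c % 2 ^ (k + 1)) / 2 ^ k % 2 = if c < 0 then 1 else 0 := by
    split_ifs with h
    · have : c % 2 ^ (k + 1) = (c + 2 ^ k) + 2 ^ k * 1 := by
        rw [← Int.add_emod_right, Int.emod_eq_of_lt] <;> linarith
      rw [this, Int.add_mul_ediv_left _ _ (by positivity),
        Int.ediv_eq_zero_of_lt (by linarith) (by linarith)]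
      norm_num
    · have : c % 2 ^ (k + 1) = c := Int.emod_eq_of_lt (by linarith) (by linarith)
      rw [this, Int.ediv_eq_zero_of_lt (by linarith) (by linarith), Int.zero_emod]
  rw [key] at hv'
  apply propext
  split_ifs at hv' with h <;> simp only [h, iff_true, iff_false] <;> omega

/-- For negative `c` the magnitude is the residue of `-c`. The number `u` needs to be right modulo
`2 ^ m` only, since it will come from arithmetic with a larger modulus. -/
theorem magnitude_eq {m v u : ℕ} {c : ℤ} (hm : 1 ≤ m) (hc : |c| < 2 ^ (m - 1))
    (hv : (v : ℤ) = c % 2 ^ m) (hu : (u : ℤ) ≡ -v [ZMOD 2 ^ m]) :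
    (if c < 0 then u else v) % 2 ^ m = c.natAbs := by
  have h2 : (2 : ℤ) ^ (m - 1) < 2 ^ m := pow_lt_pow_right₀ (by norm_num) (by omega)
  have hc' := abs_lt.1 hc
  zify
  split_ifs with h
  · have : (u : ℤ) ≡ -c [ZMOD 2 ^ m] := hu.trans (Int.ModEq.neg (by rw [hv]; exact Int.mod_modEq _ _))
    rw [this, abs_of_neg h, Int.emod_eq_of_lt (by linarith) (by linarith)]
  · rw [hv, Int.emod_emod, abs_of_nonneg (not_lt.1 h), Int.emod_eq_of_lt (by linarith) (by linarith)]

end RatEval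

namespace RatEval

/-! ### The linear system of a formula -/

/-- The data of a gate table: three bits for the kind of each gate, its left input, and sign,
numerator and denominator of the entries of the leaves. -/
structure Table where
  k₀ : ℕ → Bool
  k₁ : ℕ → Bool
  k₂ : ℕ → Bool
  lft : ℕ → ℕ
  neg : ℕ → ℕ → ℕ → Bool
  num : ℕ → ℕ → ℕ → ℕ
  den : ℕ → ℕ → ℕ → ℕ

/-- The position of an unknown: gate `h`, type `t` (`0` for the input port, `1` for the inner
unknowns of a leaf, `2` for the output port), indices `i` and `j`. -/
def idx (N h t i j : ℕ) : ℕ := ((h * 3 + t) * N + i) * N + j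

/-- The gate of an unknown. -/
def gateIx (N R : ℕ) : ℕ := R / (N * N * 3)
/-- The type of an unknown. -/
def typeIx (N R : ℕ) : ℕ := R / (N * N) % 3
/-- The first index of an unknown. -/
def rowIx (N R : ℕ) : ℕ := R / N % N
/-- The second index of an unknown. -/
def colIx (N R : ℕ) : ℕ := R % N

section

variable {N h t i j : ℕ}

theorem idx_div (hj : j < N) : idx N h t i j / N = (h * 3 + t) * N + i := by
  rw [idx, mul_comm _ N, Nat.mul_add_div (by omega), Nat.div_eq_of_lt hj, add_zero]

theorem idx_div_div (hi : i < N) (hj : j < N) : idx N h t i j / (N * N) = h * 3 + t := by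
  rw [← Nat.div_div_eq_div_mul, idx_div hj, mul_comm _ N, Nat.mul_add_div (by omega),
    Nat.div_eq_of_lt hi, add_zero]

theorem gateIx_idx (ht : t < 3) (hi : i < N) (hj : j < N) : gateIx N (idx N h t i j) = h := by
  rw [gateIx, ← Nat.div_div_eq_div_mul, idx_div_div hi hj]; omega

theorem typeIx_idx (ht : t < 3) (hi : i < N) (hj : j < N) : typeIx N (idx N h t i j) = t := by
  rw [typeIx, idx_div_div hi hj]; omega

theorem rowIx_idx (hi : i < N) (hj : j < N) : rowIx N (idx N h t i j) = i := by
  rw [rowIx, idx_div hj, add_comm, Nat.add_mul_mod_self_right, Nat.mod_eq_of_lt hi]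

theorem colIx_idx (hj : j < N) : colIx N (idx N h t i j) = j := by
  rw [colIx, idx, add_comm, Nat.add_mul_mod_self_right, Nat.mod_eq_of_lt hj]

theorem idx_ixs (R : ℕ) :
    idx N (gateIx N R) (typeIx N R) (rowIx N R) (colIx N R) = R := by
  have h1 := Nat.div_add_mod (R / (N * N)) 3
  have h2 := Nat.div_add_mod (R / N) N
  have h3 := Nat.div_add_mod R N
  rw [Nat.div_div_eq_div_mul] at h1 h2
  rw [idx, gateIx, typeIx, rowIx, colIx, mul_comm _ 3, h1, mul_comm (R / (N * N)), h2,
    mul_comm (R / N), h3]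

end

namespace Table

variable (τ : Table) (N ℓ g : ℕ)

/-- A gate of the table is a leaf. -/
def leaf (h : ℕ) : Bool := !τ.k₁ h && !τ.k₂ h

/-- The unknown `R` occurs in the system of the gates up to `g`. -/
def Valid (R : ℕ) : Prop :=
  gateIx N R ≤ g ∧ rowIx N R < ℓ ∧ if typeIx N R = 1 then colIx N R < ℓ else colIx N R = 0

instance (R : ℕ) : Decidable (Valid N ℓ g R) := by unfold Valid; infer_instance

/-- The positive part of the coefficient of an unknown in an equation. -/
def posCoeff (h t i j h' t' i' j' : ℕ) : ℕ :=
  if t = 0 ∧ t' = 0 then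
    if i = i' then
      if h = h' then (!τ.k₂ h).toNat else if h' + 1 = h then (τ.k₂ h).toNat else 0
    else 0
  else if t = 1 ∧ t' = 1 then
    if h = h' ∧ i = i' ∧ j = j' then if τ.leaf h then τ.den h i j else 1 else 0
  else if t = 1 ∧ t' = 2 then
    if h = h' ∧ j = i' then if τ.leaf h && τ.neg h i j then τ.num h i j else 0 else 0
  else if t = 2 ∧ t' = 2 then if h = h' ∧ i = i' then 1 else 0
  else 0

/-- The negative part of the coefficient of an unknown in an equation. -/
def negCoeff (h t i j h' t' i' : ℕ) : ℕ :=
  if t = 0 ∧ t' = 0 then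
    if i = i' then
      if h' + 1 = h then (τ.k₁ h && !τ.k₀ h).toNat else (τ.k₁ h && decide (τ.lft h = h')).toNat
    else 0
  else if t = 0 ∧ t' = 1 then if h = h' ∧ i = i' then (τ.leaf h).toNat else 0
  else if t = 0 ∧ t' = 2 then if h = h' ∧ i = i' then (τ.k₂ h).toNat else 0
  else if t = 1 ∧ t' = 2 then
    if h = h' ∧ j = i' then if τ.leaf h && !τ.neg h i j then τ.num h i j else 0 else 0
  else if t = 2 ∧ t' = 2 then
    if i = i' then
      if h + 1 = h' then (τ.k₁ h').toNat
      else (τ.k₁ h' && !τ.k₀ h' && decide (τ.lft h' = h)).toNat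
    else 0
  else if t = 2 ∧ t' = 0 then
    if i = i' then
      ((decide (h + 1 = h') && τ.k₂ h') ||
        (decide (h' + 1 ≤ g) && (τ.k₀ (h' + 1) && τ.k₁ (h' + 1) && decide (τ.lft (h' + 1) = h)))).toNat
    else 0
  else 0

/-- The positive part of an entry of the matrix of the system of the gates up to `g`. -/
def posEntry (R C : ℕ) : ℕ :=
  if Valid N ℓ g R ∧ Valid N ℓ g C then
    τ.posCoeff (gateIx N R) (typeIx N R) (rowIx N R) (colIx N R)
      (gateIx N C) (typeIx N C) (rowIx N C) (colIx N C)
  else if R = C then 1 else 0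

/-- The negative part of an entry of the matrix of the system of the gates up to `g`. -/
def negEntry (R C : ℕ) : ℕ :=
  if Valid N ℓ g R ∧ Valid N ℓ g C then
    τ.negCoeff g (gateIx N R) (typeIx N R) (rowIx N R) (colIx N R)
      (gateIx N C) (typeIx N C) (rowIx N C)
  else 0

/-- An entry of the matrix of the system of the gates up to `g`. -/
def entry (R C : ℕ) : ℤ := (τ.posEntry N ℓ g R C : ℤ) - τ.negEntry N ℓ g R C

/-- The left-hand side of equation `R` of the system of the gates up to `g`. -/
def row (D : ℕ) (x : ℕ → ℚ) (R : ℕ) : ℚ :=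
  ∑ C ∈ Finset.range D, (τ.entry N ℓ g R C : ℚ) * x C

variable {τ N ℓ g}

theorem valid_idx {h t i j : ℕ} (hN : ℓ ≤ N) (ht : t < 3) (hh : h ≤ g) (hi : i < ℓ)
    (hj : if t = 1 then j < ℓ else j = 0) : Valid N ℓ g (idx N h t i j) := by
  have hj' : j < N := by split_ifs at hj <;> omega
  rw [Valid, gateIx_idx ht (by omega) hj', typeIx_idx ht (by omega) hj',
    rowIx_idx (by omega) hj', colIx_idx hj']
  exact ⟨hh, hi, hj⟩

theorem typeIx_lt (R : ℕ) : typeIx N R < 3 := Nat.mod_lt _ (by norm_num)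

/-- A sum over all unknowns. -/
theorem sum_eq {D : ℕ} (hN : ℓ ≤ N) (hD : (g + 1) * 3 * N * N ≤ D) (F : ℕ → ℚ)
    (hF : ∀ C, ¬ Valid N ℓ g C → F C = 0) :
    ∑ C ∈ Finset.range D, F C = ∑ h ∈ Finset.range (g + 1), ((∑ i ∈ Finset.range ℓ,
      F (idx N h 0 i 0)) + (∑ i ∈ Finset.range ℓ, ∑ j ∈ Finset.range ℓ, F (idx N h 1 i j)) +
      ∑ i ∈ Finset.range ℓ, F (idx N h 2 i 0)) := by
  -- Only unknowns of type `1` have a second index; for the ports it is fixed to `0`.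
  set s := ((Finset.range (g + 1) ×ˢ Finset.range 3) ×ˢ (Finset.range ℓ ×ˢ Finset.range ℓ)).filter
    fun p => p.1.2 = 1 ∨ p.2.2 = 0 with hs
  have hmem : ∀ p ∈ s, p.1.1 ≤ g ∧ p.1.2 < 3 ∧ p.2.1 < ℓ ∧ p.2.2 < ℓ ∧ (p.1.2 = 1 ∨ p.2.2 = 0) := by
    intro p hp
    simp only [hs, Finset.mem_filter, Finset.mem_product, Finset.mem_range] at hp
    omega
  have h1 : ∑ p ∈ s, F (idx N p.1.1 p.1.2 p.2.1 p.2.2) = ∑ C ∈ Finset.range D, F C := by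
    refine Finset.sum_of_injOn (fun p : (ℕ × ℕ) × (ℕ × ℕ) => idx N p.1.1 p.1.2 p.2.1 p.2.2)
      ?_ ?_ ?_ fun _ _ => rfl
    · intro p hp q hq hpq
      have a := hmem p hp
      have b := hmem q hq
      simp only at hpq
      have e1 := congrArg (gateIx N) hpq
      have e2 := congrArg (typeIx N) hpq
      have e3 := congrArg (rowIx N) hpq
      have e4 := congrArg (colIx N) hpq
      rw [gateIx_idx (by omega) (by omega) (by omega), gateIx_idx (by omega) (by omega) (by omega)] at e1
      rw [typeIx_idx (by omega) (by omega) (by omega), typeIx_idx (by omega) (by omega) (by omega)] at e2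
      rw [rowIx_idx (by omega) (by omega), rowIx_idx (by omega) (by omega)] at e3
      rw [colIx_idx (by omega), colIx_idx (by omega)] at e4
      exact Prod.ext (Prod.ext e1 e2) (Prod.ext e3 e4)
    · intro p hp
      have a := hmem p hp
      simp only [Finset.coe_range, Set.mem_Iio, idx]
      refine lt_of_lt_of_le ?_ hD
      have h1 : p.1.1 * 3 + p.1.2 + 1 ≤ (g + 1) * 3 := by omega
      have h2 : (p.1.1 * 3 + p.1.2) * N + p.2.1 + 1 ≤ (g + 1) * 3 * N := by nlinarith
      nlinarith
    · intro C hC hC'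
      refine hF C fun hv => hC' ?_
      refine ⟨((gateIx N C, typeIx N C), (rowIx N C, colIx N C)), ?_, idx_ixs C⟩
      have := typeIx_lt (N := N) C
      simp only [hs, Finset.coe_filter, Finset.mem_product, Finset.mem_range, Set.mem_ofPred_eq]
      obtain ⟨v1, v2, v3⟩ := hv
      split_ifs at v3 <;> omega
  rw [← h1, hs, Finset.sum_filter, Finset.sum_product, Finset.sum_product]
  refine Finset.sum_congr rfl fun h _ => ?_
  rw [Finset.sum_range_succ, Finset.sum_range_succ, Finset.sum_range_succ, Finset.sum_range_zero,
    zero_add]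
  simp only [Finset.sum_product]
  rcases Nat.eq_zero_or_pos ℓ with rfl | hℓ
  · simp
  · simp [Finset.sum_ite_eq', hℓ]

theorem entry_idx {h t i j h' t' i' j' : ℕ} (hN : ℓ ≤ N) (ht : t < 3) (hh : h ≤ g) (hi : i < ℓ)
    (hj : if t = 1 then j < ℓ else j = 0) (ht' : t' < 3) (hh' : h' ≤ g) (hi' : i' < ℓ)
    (hj' : if t' = 1 then j' < ℓ else j' = 0) :
    τ.entry N ℓ g (idx N h t i j) (idx N h' t' i' j') =
      (τ.posCoeff h t i j h' t' i' j' : ℤ) - τ.negCoeff g h t i j h' t' i' := by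
  have a : j < N := by split_ifs at hj <;> omega
  have a' : j' < N := by split_ifs at hj' <;> omega
  rw [entry, posEntry, negEntry, if_pos ⟨valid_idx hN ht hh hi hj, valid_idx hN ht' hh' hi' hj'⟩,
    if_pos ⟨valid_idx hN ht hh hi hj, valid_idx hN ht' hh' hi' hj'⟩,
    gateIx_idx ht (by omega) a, gateIx_idx ht' (by omega) a',
    typeIx_idx ht (by omega) a, typeIx_idx ht' (by omega) a',
    rowIx_idx (by omega) a, rowIx_idx (by omega) a', colIx_idx a, colIx_idx a']

/-- Positions without an unknown carry rows of the identity matrix, and valid rows vanish in their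
columns. So the matrix can be padded to one common dimension `D` without affecting regularity. -/
theorem entry_of_not_valid_left {R : ℕ} (h : ¬ Valid N ℓ g R) (C : ℕ) :
    τ.entry N ℓ g R C = if R = C then 1 else 0 := by
  have hn : ¬ (Valid N ℓ g R ∧ Valid N ℓ g C) := fun a => h a.1
  rw [entry, posEntry, negEntry, if_neg hn, if_neg hn]
  split_ifs <;> simp

theorem entry_of_not_valid_right {R C : ℕ} (h : ¬ Valid N ℓ g C) (hR : Valid N ℓ g R) :
    τ.entry N ℓ g R C = 0 := by
  have hn : ¬ (Valid N ℓ g R ∧ Valid N ℓ g C) := fun a => h a.2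
  rw [entry, posEntry, negEntry, if_neg hn, if_neg hn, if_neg (by rintro rfl; exact h hR)]
  simp

theorem row_of_not_valid {D R : ℕ} (x : ℕ → ℚ) (h : ¬ Valid N ℓ g R) (hR : R < D) :
    τ.row N ℓ g D x R = x R := by
  simp [row, entry_of_not_valid_left h, hR]

section rows

variable {D : ℕ} (x : ℕ → ℚ) (hN : ℓ ≤ N) (hD : (g + 1) * 3 * N * N ≤ D)

include hN hD in
theorem row_eq {h t i j : ℕ} (ht : t < 3) (hh : h ≤ g) (hi : i < ℓ)
    (hj : if t = 1 then j < ℓ else j = 0) :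
    τ.row N ℓ g D x (idx N h t i j) = ∑ h' ∈ Finset.range (g + 1),
      ((∑ i' ∈ Finset.range ℓ, ((τ.posCoeff h t i j h' 0 i' 0 : ℤ) - τ.negCoeff g h t i j h' 0 i' : ℤ) *
        x (idx N h' 0 i' 0)) +
      (∑ i' ∈ Finset.range ℓ, ∑ j' ∈ Finset.range ℓ,
        ((τ.posCoeff h t i j h' 1 i' j' : ℤ) - τ.negCoeff g h t i j h' 1 i' : ℤ) *
        x (idx N h' 1 i' j')) +
      ∑ i' ∈ Finset.range ℓ, ((τ.posCoeff h t i j h' 2 i' 0 : ℤ) - τ.negCoeff g h t i j h' 2 i' : ℤ) *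
        x (idx N h' 2 i' 0)) := by
  rw [row, sum_eq hN hD _ fun C hC => by
    rw [entry_of_not_valid_right hC (valid_idx hN ht hh hi hj)]; simp]
  refine Finset.sum_congr rfl fun h' hh' => ?_
  have hh' : h' ≤ g := by simpa [Nat.lt_succ_iff] using hh'
  congr 1
  · congr 1
    · refine Finset.sum_congr rfl fun i' hi' => ?_
      rw [entry_idx hN ht hh hi hj (by norm_num) hh' (by simpa using hi') (by simp)]
    · refine Finset.sum_congr rfl fun i' hi' => Finset.sum_congr rfl fun j' hj' => ?_
      rw [entry_idx hN ht hh hi hj (by norm_num) hh' (by simpa using hi') (by simpa using hj')]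
  · refine Finset.sum_congr rfl fun i' hi' => ?_
    rw [entry_idx hN ht hh hi hj (by norm_num) hh' (by simpa using hi') (by simp)]

-- The unknown `(h, 1, i, j)` of a leaf stands for entry `i, j` times component `j` of the output
-- port. With one equation for each entry the coefficients stay the given numerators and
-- denominators, and no common denominator is formed. At other gates these unknowns are set to `0`.
include hN hD in
theorem row_mid {h i j : ℕ} (hh : h ≤ g) (hi : i < ℓ) (hj : j < ℓ) :
    τ.row N ℓ g D x (idx N h 1 i j) = if τ.leaf h then
      τ.den h i j * x (idx N h 1 i j) -
        (if τ.neg h i j then -(τ.num h i j : ℚ) else τ.num h i j) * x (idx N h 2 j 0)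
      else x (idx N h 1 i j) := by
  rw [row_eq x hN hD (by norm_num) hh hi (by simpa using hj)]
  have hh' : h < g + 1 := by omega
  simp only [posCoeff, negCoeff]
  cases h1 : τ.leaf h <;> cases h2 : τ.neg h i j <;>
  simp [Finset.sum_add_distrib, ite_and, Finset.sum_ite_eq, hh', hi, hj, sub_eq_add_neg]

-- `k₂` marks inversions, `k₁` binary gates, and `k₀` tells products from sums. The input port of a
-- leaf is the sum of its inner unknowns; that of a binary gate is the one of the left argument,
-- plus the one of the right argument for a sum. At an inversion gate `h` the row instead equates
-- the input port of `h - 1` with the output port of `h`.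
include hN hD in
theorem row_in {h i : ℕ} (hh : h ≤ g) (hi : i < ℓ) :
    τ.row N ℓ g D x (idx N h 0 i 0) =
      (∑ h' ∈ Finset.range (g + 1),
        (((if h = h' then (!τ.k₂ h).toNat else if h' + 1 = h then (τ.k₂ h).toNat else 0 : ℕ) : ℚ) -
          (if h' + 1 = h then (τ.k₁ h && !τ.k₀ h).toNat
            else (τ.k₁ h && decide (τ.lft h = h')).toNat : ℕ)) * x (idx N h' 0 i 0)) -
      (τ.leaf h).toNat * ∑ j ∈ Finset.range ℓ, x (idx N h 1 i j) -
      (τ.k₂ h).toNat * x (idx N h 2 i 0) := by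
  rw [row_eq x hN hD (by norm_num) hh hi (by simp)]
  have hh' : h < g + 1 := by omega
  simp only [posCoeff, negCoeff]
  rw [Finset.sum_add_distrib, Finset.sum_add_distrib, sub_eq_add_neg, sub_eq_add_neg]
  congr 1
  · congr 1
    · refine Finset.sum_congr rfl fun h' _ => ?_
      rw [Finset.sum_eq_single i (fun i' _ hne => by simp [hne.symm]) (by simp [hi])]
      simp
    · rw [Finset.sum_eq_single h (fun h' _ hne => by simp [hne.symm]) (by simp [hh']),
        Finset.sum_eq_single i (fun i' _ hne => by simp [hne.symm]) (by simp [hi])]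
      simp [Finset.mul_sum]
  · rw [Finset.sum_eq_single h (fun h' _ hne => by simp [hne.symm]) (by simp [hh']),
        Finset.sum_eq_single i (fun i' _ hne => by simp [hne.symm]) (by simp [hi])]
    simp

-- The parent dictates the equation of an output port: equality with the output port of the parent
-- (arguments of a sum, right factor), with the input port of the right factor (left factor), or
-- with the input port of the parent (argument of an inversion). Without a parent up to `g` the port
-- is `0`. The test `h' + 1 ≤ g` ensures this for a left factor, because the right factor `h'` may
-- be present while the product gate `h' + 1` is not.
include hN hD in
theorem row_out {h i : ℕ} (hh : h ≤ g) (hi : i < ℓ) :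
    τ.row N ℓ g D x (idx N h 2 i 0) = x (idx N h 2 i 0) -
      (∑ h' ∈ Finset.range (g + 1),
        ((if h + 1 = h' then (τ.k₁ h').toNat
          else (τ.k₁ h' && !τ.k₀ h' && decide (τ.lft h' = h)).toNat : ℕ) : ℚ) * x (idx N h' 2 i 0)) -
      ∑ h' ∈ Finset.range (g + 1),
        (((decide (h + 1 = h') && τ.k₂ h') || (decide (h' + 1 ≤ g) &&
          (τ.k₀ (h' + 1) && τ.k₁ (h' + 1) && decide (τ.lft (h' + 1) = h)))).toNat : ℚ) *
          x (idx N h' 0 i 0) := by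
  rw [row_eq x hN hD (by norm_num) hh hi (by simp)]
  have hh' : h < g + 1 := by omega
  simp only [posCoeff, negCoeff]
  have e1 : x (idx N h 2 i 0) = ∑ h' ∈ Finset.range (g + 1), (if h = h' then 1 else 0) *
      x (idx N h' 2 i 0) := by simp [hh']
  conv_rhs => rw [e1]
  rw [← Finset.sum_sub_distrib, ← Finset.sum_sub_distrib]
  refine Finset.sum_congr rfl fun h' _ => ?_
  rw [Finset.sum_eq_single i (fun i' _ hne => by simp [hne.symm]) (by simp [hi]),
    Finset.sum_eq_zero (fun i' _ => Finset.sum_eq_zero fun j' _ => by simp),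
    Finset.sum_eq_single i (fun i' _ hne => by simp [hne.symm]) (by simp [hi])]
  by_cases a1 : h = h' <;> by_cases a2 : h + 1 = h' <;> simp [a1, a2] <;> ring

end rows

end Table

end RatEval

/-! ### Gate tables of formulas and the equations they produce -/

namespace RatEval

theorem Formula.size_pos {n : ℕ} (Φ : Formula n) : 0 < Φ.size := by
  cases Φ <;> simp [Formula.size]

namespace Table

variable (τ : Table)

/-- The number at position `i`, `j` of leaf `h`. -/
def val (h i j : ℕ) : ℚ := (if τ.neg h i j then -(τ.num h i j : ℚ) else τ.num h i j) / τ.den h i j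

/-- The gates from `k` on are those of the formula `Φ`. -/
def Fits {n ℓ : ℕ} (P : Fin n → Matrix (Fin ℓ) (Fin ℓ) ℚ) : Formula n → ℕ → Prop
  | .const c, k => τ.k₁ k = false ∧ τ.k₂ k = false ∧
      ∀ i j : Fin ℓ, τ.den k i j ≠ 0 ∧ τ.val k i j = Matrix.scalar (Fin ℓ) c i j
  | .var v, k => τ.k₁ k = false ∧ τ.k₂ k = false ∧
      ∀ i j : Fin ℓ, τ.den k i j ≠ 0 ∧ τ.val k i j = P v i j
  | .add Φ Ψ, k => Fits P Φ k ∧ Fits P Ψ (k + Φ.size) ∧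
      τ.k₀ (k + Φ.size + Ψ.size) = false ∧ τ.k₁ (k + Φ.size + Ψ.size) = true ∧
      τ.k₂ (k + Φ.size + Ψ.size) = false ∧ τ.lft (k + Φ.size + Ψ.size) = k + Φ.size - 1
  | .mul Φ Ψ, k => Fits P Φ k ∧ Fits P Ψ (k + Φ.size) ∧
      τ.k₀ (k + Φ.size + Ψ.size) = true ∧ τ.k₁ (k + Φ.size + Ψ.size) = true ∧
      τ.k₂ (k + Φ.size + Ψ.size) = false ∧ τ.lft (k + Φ.size + Ψ.size) = k + Φ.size - 1
  | .inv Φ, k => Fits P Φ k ∧ τ.k₁ (k + Φ.size) = false ∧ τ.k₂ (k + Φ.size) = true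

/-- In the part `k, …, e - 1` of the table every gate has at most one parent. -/
structure IsForest (k e : ℕ) : Prop where
  not_both : ∀ h, k ≤ h → h < e → τ.k₁ h = true → τ.k₂ h = false
  lft_ge : ∀ h, k ≤ h → h < e → τ.k₁ h = true → k ≤ τ.lft h ∧ τ.lft h + 1 < h
  leaf_lft : ∀ h, k ≤ h → h < e → τ.k₁ h = true → τ.leaf (τ.lft h + 1) = true
  inj : ∀ h h', k ≤ h → h < e → k ≤ h' → h' < e → τ.k₁ h = true → τ.k₁ h' = true →
    τ.lft h = τ.lft h' → h = h'

variable {τ}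

/-- In postorder a subformula begins with its leftmost leaf. So the gate after a left argument is a
leaf, whereas the gate after a right argument or after the argument of an inversion is its parent;
this keeps the kinds of arguments apart. -/
theorem Fits.leaf_first {n ℓ : ℕ} {P : Fin n → Matrix (Fin ℓ) (Fin ℓ) ℚ} {Φ : Formula n} {k : ℕ}
    (h : τ.Fits P Φ k) : τ.leaf k = true := by
  induction Φ generalizing k with
  | const c => simp [leaf, h.1, h.2.1]
  | var v => simp [leaf, h.1, h.2.1]
  | add Φ Ψ ih _ => exact ih h.1
  | mul Φ Ψ ih _ => exact ih h.1
  | inv Φ ih => exact ih h.1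

/-- The new gate `e` points to `m - 1`, which is not a left argument yet: inside the left part `lft
h + 1 < h`, and left arguments inside the right part are at least `m`. -/
theorem IsForest.node {k m e : ℕ} (h₁ : τ.IsForest k m) (h₂ : τ.IsForest m e) (hkm : k < m)
    (hme : m < e) (hleaf : τ.leaf m = true) (h2 : τ.k₂ e = false)
    (hl : τ.lft e = m - 1) : τ.IsForest k (e + 1) where
  not_both h ha hb hc := by
    rcases lt_or_ge h m with h' | h'
    · exact h₁.not_both h ha h' hc
    · rcases (Nat.lt_succ_iff.1 hb).lt_or_eq with h'' | rfl
      · exact h₂.not_both h h' h'' hc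
      · exact h2
  lft_ge h ha hb hc := by
    rcases lt_or_ge h m with h' | h'
    · exact h₁.lft_ge h ha h' hc
    · rcases (Nat.lt_succ_iff.1 hb).lt_or_eq with h'' | rfl
      · have := h₂.lft_ge h h' h'' hc; omega
      · omega
  leaf_lft h ha hb hc := by
    rcases lt_or_ge h m with h' | h'
    · exact h₁.leaf_lft h ha h' hc
    · rcases (Nat.lt_succ_iff.1 hb).lt_or_eq with h'' | rfl
      · exact h₂.leaf_lft h h' h'' hc
      · rw [hl, Nat.sub_add_cancel (by omega)]; exact hleaf
  inj h h' ha hb ha' hb' hc hc' heq := by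
    rcases lt_or_ge h m with a | a
    · have b1 := h₁.lft_ge h ha a hc
      rcases lt_or_ge h' m with a' | a'
      · exact h₁.inj h h' ha a ha' a' hc hc' heq
      · rcases (Nat.lt_succ_iff.1 hb').lt_or_eq with a'' | rfl
        · have := h₂.lft_ge h' a' a'' hc'; omega
        · omega
    · rcases (Nat.lt_succ_iff.1 hb).lt_or_eq with a0 | rfl
      · have b1 := h₂.lft_ge h a a0 hc
        rcases lt_or_ge h' m with a' | a'
        · have := h₁.lft_ge h' ha' a' hc'; omega
        · rcases (Nat.lt_succ_iff.1 hb').lt_or_eq with a'' | rfl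
          · exact h₂.inj h h' a a0 a' a'' hc hc' heq
          · omega
      · rcases lt_or_ge h' m with a' | a'
        · have := h₁.lft_ge h' ha' a' hc'; omega
        · rcases (Nat.lt_succ_iff.1 hb').lt_or_eq with a'' | rfl
          · have := h₂.lft_ge h' a' a'' hc'; omega
          · rfl

theorem IsForest.snoc {k e : ℕ} (h : τ.IsForest k e) (h1 : τ.k₁ e = false) :
    τ.IsForest k (e + 1) := by
  have key : ∀ h, h < e + 1 → τ.k₁ h = true → h < e := by
    intro h hb hc
    rcases (Nat.lt_succ_iff.1 hb).lt_or_eq with a | rfl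
    · exact a
    · simp [h1] at hc
  exact ⟨fun a ha hb hc => h.not_both a ha (key a hb hc) hc,
    fun a ha hb hc => h.lft_ge a ha (key a hb hc) hc,
    fun a ha hb hc => h.leaf_lft a ha (key a hb hc) hc,
    fun a b ha hb ha' hb' hc hc' => h.inj a b ha (key a hb hc) ha' (key b hb' hc') hc hc'⟩

theorem isForest_empty (k : ℕ) : τ.IsForest k k where
  not_both h ha hb := by omega
  lft_ge h ha hb := by omega
  leaf_lft h ha hb := by omega
  inj h h' ha hb := by omega

theorem Fits.isForest {n ℓ : ℕ} {P : Fin n → Matrix (Fin ℓ) (Fin ℓ) ℚ} {Φ : Formula n} {k : ℕ}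
    (h : τ.Fits P Φ k) : τ.IsForest k (k + Φ.size) := by
  induction Φ generalizing k with
  | const c => exact (isForest_empty k).snoc h.1
  | var v => exact (isForest_empty k).snoc h.1
  | add Φ Ψ ih₁ ih₂ =>
    obtain ⟨h1, h2, h3, h4, h5, h6⟩ := h
    have := Φ.size_pos
    have := Ψ.size_pos
    simpa [Formula.size, ← add_assoc] using
      (ih₁ h1).node (ih₂ h2) (by omega) (by omega) h2.leaf_first h5 h6
  | mul Φ Ψ ih₁ ih₂ =>
    obtain ⟨h1, h2, h3, h4, h5, h6⟩ := h
    have := Φ.size_pos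
    have := Ψ.size_pos
    simpa [Formula.size, ← add_assoc] using
      (ih₁ h1).node (ih₂ h2) (by omega) (by omega) h2.leaf_first h5 h6
  | inv Φ ih => simpa [Formula.size, ← add_assoc] using (ih h.1).snoc h.2.1

section rows

variable {N ℓ g D S : ℕ} {x : ℕ → ℚ}

theorem row_in_leaf (hN : ℓ ≤ N) (hD : (g + 1) * 3 * N * N ≤ D) {h i : ℕ} (hh : h ≤ g) (hi : i < ℓ)
    (h1 : τ.k₁ h = false) (h2 : τ.k₂ h = false) : τ.row N ℓ g D x (idx N h 0 i 0) =
      x (idx N h 0 i 0) - ∑ j ∈ Finset.range ℓ, x (idx N h 1 i j) := by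
  rw [row_in x hN hD hh hi]
  simp [h1, h2, leaf, hh]

theorem row_in_inv (hN : ℓ ≤ N) (hD : (g + 1) * 3 * N * N ≤ D) {h i : ℕ} (hh : h + 1 ≤ g)
    (hi : i < ℓ) (h1 : τ.k₁ (h + 1) = false) (h2 : τ.k₂ (h + 1) = true) :
    τ.row N ℓ g D x (idx N (h + 1) 0 i 0) = x (idx N h 0 i 0) - x (idx N (h + 1) 2 i 0) := by
  rw [row_in x hN hD hh hi, Finset.sum_eq_single h]
  · simp [h1, h2, leaf]
  · intro b _ hb
    simp [h1, h2, hb]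
  · simp; omega

theorem row_in_add (hN : ℓ ≤ N) (hD : (g + 1) * 3 * N * N ≤ D) {h i l : ℕ} (hh : h + 1 ≤ g)
    (hi : i < ℓ) (h0 : τ.k₀ (h + 1) = false) (h1 : τ.k₁ (h + 1) = true) (h2 : τ.k₂ (h + 1) = false)
    (hl : τ.lft (h + 1) = l) (hlh : l < h) : τ.row N ℓ g D x (idx N (h + 1) 0 i 0) =
      x (idx N (h + 1) 0 i 0) - x (idx N l 0 i 0) - x (idx N h 0 i 0) := by
  rw [row_in x hN hD hh hi]
  have e : ∀ h' ∈ Finset.range (g + 1), (((if h + 1 = h' then (!τ.k₂ (h + 1)).toNat else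
      if h' + 1 = h + 1 then (τ.k₂ (h + 1)).toNat else 0 : ℕ) : ℚ) -
      (if h' + 1 = h + 1 then (τ.k₁ (h + 1) && !τ.k₀ (h + 1)).toNat
        else (τ.k₁ (h + 1) && decide (τ.lft (h + 1) = h')).toNat : ℕ)) * x (idx N h' 0 i 0) =
      ((if h + 1 = h' then x (idx N h' 0 i 0) else 0) - (if l = h' then x (idx N h' 0 i 0) else 0)) -
        (if h = h' then x (idx N h' 0 i 0) else 0) := by
    intro h' _
    by_cases a1 : h = h'
    · subst a1; simp [h0, h1, h2, hlh.ne]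
    · by_cases a2 : h + 1 = h'
      · subst a2; simp [h1, h2, hl, show ¬ l = h + 1 by omega]
      · by_cases a3 : l = h' <;> simp [a1, a2, a3, h1, hl, Ne.symm a1]
  rw [Finset.sum_congr rfl e, Finset.sum_sub_distrib, Finset.sum_sub_distrib,
    Finset.sum_ite_eq, Finset.sum_ite_eq, Finset.sum_ite_eq]
  simp [h1, h2, leaf, show h < g by omega, show l < g + 1 by omega, show h < g + 1 by omega]

theorem row_in_mul (hN : ℓ ≤ N) (hD : (g + 1) * 3 * N * N ≤ D) {h i l : ℕ} (hh : h + 1 ≤ g)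
    (hi : i < ℓ) (h0 : τ.k₀ (h + 1) = true) (h1 : τ.k₁ (h + 1) = true) (h2 : τ.k₂ (h + 1) = false)
    (hl : τ.lft (h + 1) = l) (hlh : l < h) : τ.row N ℓ g D x (idx N (h + 1) 0 i 0) =
      x (idx N (h + 1) 0 i 0) - x (idx N l 0 i 0) := by
  rw [row_in x hN hD hh hi]
  have e : ∀ h' ∈ Finset.range (g + 1), (((if h + 1 = h' then (!τ.k₂ (h + 1)).toNat else
      if h' + 1 = h + 1 then (τ.k₂ (h + 1)).toNat else 0 : ℕ) : ℚ) -
      (if h' + 1 = h + 1 then (τ.k₁ (h + 1) && !τ.k₀ (h + 1)).toNat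
        else (τ.k₁ (h + 1) && decide (τ.lft (h + 1) = h')).toNat : ℕ)) * x (idx N h' 0 i 0) =
      ((if h + 1 = h' then x (idx N h' 0 i 0) else 0) - (if l = h' then x (idx N h' 0 i 0) else 0)) := by
    intro h' _
    by_cases a1 : h = h'
    · subst a1; simp [h0, h2, hlh.ne]
    · by_cases a2 : h + 1 = h'
      · subst a2; simp [h1, h2, hl, show ¬ l = h + 1 by omega]
      · by_cases a3 : l = h' <;> simp [a2, a3, h1, hl, Ne.symm a1]
  rw [Finset.sum_congr rfl e, Finset.sum_sub_distrib, Finset.sum_ite_eq, Finset.sum_ite_eq]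
  simp [h1, h2, leaf, show h < g by omega, show l < g + 1 by omega]

theorem leaf_eq_true {h : ℕ} : τ.leaf h = true ↔ τ.k₁ h = false ∧ τ.k₂ h = false := by
  simp [leaf]

/-- The equation of an output port that is connected to the gate `p` as its left input. -/
theorem row_out_left (hN : ℓ ≤ N) (hD : (g + 1) * 3 * N * N ≤ D) (hT : τ.IsForest 0 S) (hS : g < S)
    {p i : ℕ} (hp : p ≤ g) (hi : i < ℓ) (h1 : τ.k₁ p = true) :
    τ.row N ℓ g D x (idx N (τ.lft p) 2 i 0) = x (idx N (τ.lft p) 2 i 0) -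
      if τ.k₀ p then x (idx N (p - 1) 0 i 0) else x (idx N p 2 i 0) := by
  have hlt := hT.lft_ge p (Nat.zero_le _) (by omega) h1
  have hleaf := leaf_eq_true.1 (hT.leaf_lft p (Nat.zero_le _) (by omega) h1)
  rw [row_out x hN hD (by omega) hi, sub_sub]
  congr 1
  -- By `inj` no gate other than `p` has this left argument. The gate `lft p + 1` could be a parent
  -- by position, but it is a leaf.
  have hne : ∀ h' ≤ g, τ.k₁ h' = true → τ.lft h' = τ.lft p → h' = p := fun h' h2 h3 h4 =>
    hT.inj h' p (Nat.zero_le _) (by omega) (Nat.zero_le _) (by omega) h3 h1 h4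
  rw [Finset.sum_eq_single p, Finset.sum_eq_single (p - 1)]
  · have e : p - 1 + 1 = p := by omega
    have e2 : ¬ τ.lft p + 1 = p := by omega
    have e3 : (decide (τ.lft p + 1 = p - 1) && τ.k₂ (p - 1)) = false := by
      by_cases a : τ.lft p + 1 = p - 1
      · rw [← a, hleaf.2]; simp
      · simp [a]
    rw [e3]
    cases h0 : τ.k₀ p <;> simp [e, e2, h0, h1, hp]
  · intro b hb hbp
    have hb' : b < g + 1 := by simpa using hb
    have e3 : (decide (τ.lft p + 1 = b) && τ.k₂ b) = false := by
      by_cases a : τ.lft p + 1 = b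
      · rw [← a, hleaf.2]; simp
      · simp [a]
    rw [e3]
    by_cases a : b + 1 ≤ g ∧ τ.k₁ (b + 1) = true ∧ τ.lft (b + 1) = τ.lft p
    · have := hne _ a.1 a.2.1 a.2.2; omega
    · have e4 : (decide (b + 1 ≤ g) && (τ.k₀ (b + 1) && τ.k₁ (b + 1) &&
          decide (τ.lft (b + 1) = τ.lft p))) = false := by
        by_contra hc
        simp only [Bool.not_eq_false, Bool.and_eq_true, decide_eq_true_eq] at hc
        exact a ⟨hc.1, hc.2.1.2, hc.2.2⟩
      rw [e4]; simp
  · simp; omega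
  · intro b hb hbp
    have hb' : b < g + 1 := by simpa using hb
    split_ifs with a
    · rw [← a, hleaf.1]; simp
    · have e4 : (τ.k₁ b && !τ.k₀ b && decide (τ.lft b = τ.lft p)) = false := by
        by_contra hc
        simp only [Bool.not_eq_false, Bool.and_eq_true, decide_eq_true_eq] at hc
        exact hbp (hne b (by omega) hc.1.1 hc.2)
      rw [e4]; simp
  · simp; omega

theorem sum_mul_left_eq_zero (c : ℕ) (i : ℕ) (hne : ∀ p ≤ g, τ.k₁ p = true → τ.lft p ≠ c)
    (h2 : c + 1 ≤ g → τ.k₂ (c + 1) = false) : ∑ h' ∈ Finset.range (g + 1),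
      (((decide (c + 1 = h') && τ.k₂ h') || (decide (h' + 1 ≤ g) &&
        (τ.k₀ (h' + 1) && τ.k₁ (h' + 1) && decide (τ.lft (h' + 1) = c)))).toNat : ℚ) *
          x (idx N h' 0 i 0) = 0 := by
  refine Finset.sum_eq_zero fun b hb => ?_
  have hb' : b < g + 1 := by simpa using hb
  have e3 : (decide (c + 1 = b) && τ.k₂ b) = false := by
    by_cases a : c + 1 = b
    · rw [← a, h2 (by omega)]; simp
    · simp [a]
  have e4 : (decide (b + 1 ≤ g) && (τ.k₀ (b + 1) && τ.k₁ (b + 1) &&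
      decide (τ.lft (b + 1) = c))) = false := by
    by_contra hc
    simp only [Bool.not_eq_false, Bool.and_eq_true, decide_eq_true_eq] at hc
    exact hne _ hc.1 hc.2.1.2 hc.2.2
  rw [e3, e4]; simp

theorem sum_add_left_eq_zero (c : ℕ) (i : ℕ) (hne : ∀ p ≤ g, τ.k₁ p = true → τ.lft p ≠ c)
    (h1 : c + 1 ≤ g → τ.k₁ (c + 1) = false) : ∑ h' ∈ Finset.range (g + 1),
      ((if c + 1 = h' then (τ.k₁ h').toNat
        else (τ.k₁ h' && !τ.k₀ h' && decide (τ.lft h' = c)).toNat : ℕ) : ℚ) * x (idx N h' 2 i 0) =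
      0 := by
  refine Finset.sum_eq_zero fun b hb => ?_
  have hb' : b < g + 1 := by simpa using hb
  split_ifs with a
  · rw [← a, h1 (by omega)]; simp
  · have e4 : (τ.k₁ b && !τ.k₀ b && decide (τ.lft b = c)) = false := by
      by_contra hc
      simp only [Bool.not_eq_false, Bool.and_eq_true, decide_eq_true_eq] at hc
      exact hne b (by omega) hc.1.1 hc.2
    rw [e4]; simp

/-- The equation of an output port without connections. -/
theorem row_out_root (hN : ℓ ≤ N) (hD : (g + 1) * 3 * N * N ≤ D) {c i : ℕ} (hc : c ≤ g) (hi : i < ℓ)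
    (hne : ∀ p ≤ g, τ.k₁ p = true → τ.lft p ≠ c) (h1 : c + 1 ≤ g → τ.leaf (c + 1) = true) :
    τ.row N ℓ g D x (idx N c 2 i 0) = x (idx N c 2 i 0) := by
  rw [row_out x hN hD hc hi, sum_mul_left_eq_zero c i hne fun h => (leaf_eq_true.1 (h1 h)).2,
    sum_add_left_eq_zero c i hne fun h => (leaf_eq_true.1 (h1 h)).1, sub_zero, sub_zero]

/-- Contrapositive of `leaf_lft`; it excludes a second parent in `row_out_right` and `row_out_inv`.
-/
theorem ne_lft_of_not_leaf (hT : τ.IsForest 0 S) (hS : g < S) {c : ℕ} (hl : τ.leaf (c + 1) = false) :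
    ∀ p ≤ g, τ.k₁ p = true → τ.lft p ≠ c := by
  rintro p hp h1 rfl
  have := hT.leaf_lft p (Nat.zero_le _) (by omega) h1
  rw [hl] at this
  exact Bool.false_ne_true this

/-- The equation of an output port that is connected to the next gate as its right input. -/
theorem row_out_right (hN : ℓ ≤ N) (hD : (g + 1) * 3 * N * N ≤ D) (hT : τ.IsForest 0 S) (hS : g < S)
    {c i : ℕ} (hp : c + 1 ≤ g) (hi : i < ℓ) (h1 : τ.k₁ (c + 1) = true) :
    τ.row N ℓ g D x (idx N c 2 i 0) = x (idx N c 2 i 0) - x (idx N (c + 1) 2 i 0) := by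
  have hne := ne_lft_of_not_leaf hT hS (c := c) (by simp [leaf, h1])
  rw [row_out x hN hD (by omega) hi, sum_mul_left_eq_zero c i hne fun _ =>
    hT.not_both _ (Nat.zero_le _) (by omega) h1, sub_zero, Finset.sum_eq_single (c + 1)]
  · simp [h1]
  · intro b hb hbc
    have hb' : b < g + 1 := by simpa using hb
    rw [if_neg (Ne.symm hbc)]
    have e4 : (τ.k₁ b && !τ.k₀ b && decide (τ.lft b = c)) = false := by
      by_contra hc
      simp only [Bool.not_eq_false, Bool.and_eq_true, decide_eq_true_eq] at hc
      exact hne b (by omega) hc.1.1 hc.2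
    rw [e4]; simp
  · simp; omega

/-- The equation of an output port that is connected to an inversion gate. -/
theorem row_out_inv (hN : ℓ ≤ N) (hD : (g + 1) * 3 * N * N ≤ D) (hT : τ.IsForest 0 S) (hS : g < S)
    {c i : ℕ} (hp : c + 1 ≤ g) (hi : i < ℓ) (h1 : τ.k₁ (c + 1) = false) (h2 : τ.k₂ (c + 1) = true) :
    τ.row N ℓ g D x (idx N c 2 i 0) = x (idx N c 2 i 0) - x (idx N (c + 1) 0 i 0) := by
  have hne := ne_lft_of_not_leaf hT hS (c := c) (by simp [leaf, h2])
  rw [row_out x hN hD (by omega) hi, sum_add_left_eq_zero c i hne fun _ => h1, sub_zero,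
    Finset.sum_eq_single (c + 1)]
  · simp [h2]
  · intro b hb hbc
    have hb' : b < g + 1 := by simpa using hb
    have e4 : (decide (b + 1 ≤ g) && (τ.k₀ (b + 1) && τ.k₁ (b + 1) &&
        decide (τ.lft (b + 1) = c))) = false := by
      by_contra hc
      simp only [Bool.not_eq_false, Bool.and_eq_true, decide_eq_true_eq] at hc
      exact hne _ hc.1 hc.2.1.2 hc.2.2
    rw [e4]; simp [Ne.symm hbc]
  · simp; omega

end rows

end Table

end RatEval

/-! ### Solutions of the linear system of a formula -/

namespace RatEval

namespace Table

variable {τ : Table} {N ℓ g D S n : ℕ} {P : Fin n → Matrix (Fin ℓ) (Fin ℓ) ℚ} {x : ℕ → ℚ}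

/-- The equations of a leaf. -/
def SolLeaf (τ : Table) (N ℓ : ℕ) (x : ℕ → ℚ) (k : ℕ) : Prop :=
  ∀ i < ℓ, x (idx N k 0 i 0) = ∑ j ∈ Finset.range ℓ, x (idx N k 1 i j) ∧
    ∀ j < ℓ, τ.den k i j * x (idx N k 1 i j) =
      (if τ.neg k i j then -(τ.num k i j : ℚ) else τ.num k i j) * x (idx N k 2 j 0)

/-- The equations for the unknowns of a subformula. -/
def Sol (τ : Table) (N ℓ : ℕ) (x : ℕ → ℚ) {n : ℕ} : Formula n → ℕ → Prop
  | .const _, k => SolLeaf τ N ℓ x k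
  | .var _, k => SolLeaf τ N ℓ x k
  | .add Φ Ψ, k => Sol τ N ℓ x Φ k ∧ Sol τ N ℓ x Ψ (k + Φ.size) ∧ ∀ i < ℓ,
      x (idx N (k + Φ.size + Ψ.size) 0 i 0) =
        x (idx N (k + Φ.size - 1) 0 i 0) + x (idx N (k + Φ.size + Ψ.size - 1) 0 i 0) ∧
      x (idx N (k + Φ.size - 1) 2 i 0) = x (idx N (k + Φ.size + Ψ.size) 2 i 0) ∧
      x (idx N (k + Φ.size + Ψ.size - 1) 2 i 0) = x (idx N (k + Φ.size + Ψ.size) 2 i 0) ∧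
      ∀ j < ℓ, x (idx N (k + Φ.size + Ψ.size) 1 i j) = 0
  | .mul Φ Ψ, k => Sol τ N ℓ x Φ k ∧ Sol τ N ℓ x Ψ (k + Φ.size) ∧ ∀ i < ℓ,
      x (idx N (k + Φ.size + Ψ.size) 0 i 0) = x (idx N (k + Φ.size - 1) 0 i 0) ∧
      x (idx N (k + Φ.size - 1) 2 i 0) = x (idx N (k + Φ.size + Ψ.size - 1) 0 i 0) ∧
      x (idx N (k + Φ.size + Ψ.size - 1) 2 i 0) = x (idx N (k + Φ.size + Ψ.size) 2 i 0) ∧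
      ∀ j < ℓ, x (idx N (k + Φ.size + Ψ.size) 1 i j) = 0
  | .inv Φ, k => Sol τ N ℓ x Φ k ∧ ∀ i < ℓ,
      x (idx N (k + Φ.size - 1) 0 i 0) = x (idx N (k + Φ.size) 2 i 0) ∧
      x (idx N (k + Φ.size - 1) 2 i 0) = x (idx N (k + Φ.size) 0 i 0) ∧
      ∀ j < ℓ, x (idx N (k + Φ.size) 1 i j) = 0

/-- The values of the ports of type `t` of gate `h`. -/
def port (N ℓ : ℕ) (x : ℕ → ℚ) (h t : ℕ) : Fin ℓ → ℚ := fun i => x (idx N h t i 0)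

theorem SolLeaf.mid_eq {k i j : ℕ} (hs : SolLeaf τ N ℓ x k) (hi : i < ℓ) (hj : j < ℓ)
    (hd : τ.den k i j ≠ 0) : x (idx N k 1 i j) = τ.val k i j * x (idx N k 2 j 0) := by
  have h := (hs i hi).2 j hj
  have hd' : (τ.den k i j : ℚ) ≠ 0 := by exact_mod_cast hd
  rw [val, div_mul_eq_mul_div, eq_div_iff hd', mul_comm, h]

theorem SolLeaf.in_eq {k : ℕ} {A : Matrix (Fin ℓ) (Fin ℓ) ℚ} (hs : SolLeaf τ N ℓ x k)
    (hA : ∀ i j : Fin ℓ, τ.den k i j ≠ 0 ∧ τ.val k i j = A i j) :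
    port N ℓ x k 0 = A.mulVec (port N ℓ x k 2) := by
  funext i
  rw [port, (hs i i.2).1, Matrix.mulVec, dotProduct, Finset.sum_range]
  refine Finset.sum_congr rfl fun j _ => ?_
  rw [hs.mid_eq i.2 j.2 (hA i j).1, (hA i j).2, port]

/-- The input port of a subformula is the value of the subformula times its output port. -/
theorem Sol.in_eq {Φ : Formula n} {k : ℕ} {A : Matrix (Fin ℓ) (Fin ℓ) ℚ} (hf : τ.Fits P Φ k)
    (hs : Sol τ N ℓ x Φ k) (hA : Φ.eval P = some A) :
    port N ℓ x (k + Φ.size - 1) 0 = A.mulVec (port N ℓ x (k + Φ.size - 1) 2) := by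
  induction Φ generalizing k A with
  | const c =>
    simp only [Formula.eval, Option.some.injEq] at hA
    subst hA
    exact SolLeaf.in_eq hs hf.2.2
  | var v =>
    simp only [Formula.eval, Option.some.injEq] at hA
    subst hA
    exact SolLeaf.in_eq hs hf.2.2
  | add Φ Ψ ih₁ ih₂ =>
    simp only [Formula.eval, Option.bind_eq_some_iff, Option.some.injEq] at hA
    obtain ⟨A₁, h1, A₂, h2, rfl⟩ := hA
    obtain ⟨s1, s2, s3⟩ := hs
    have e : k + (Formula.add Φ Ψ).size - 1 = k + Φ.size + Ψ.size := by
      simp only [Formula.size]; omega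
    have i1 := ih₁ hf.1 s1 h1
    have i2 := ih₂ hf.2.1 s2 h2
    have p1 : port N ℓ x (k + Φ.size - 1) 2 = port N ℓ x (k + Φ.size + Ψ.size) 2 :=
      funext fun i => (s3 i i.2).2.1
    have p2 : port N ℓ x (k + Φ.size + Ψ.size - 1) 2 = port N ℓ x (k + Φ.size + Ψ.size) 2 :=
      funext fun i => (s3 i i.2).2.2.1
    rw [e, Matrix.add_mulVec, ← p1, ← i1, p1, ← p2, ← i2]
    exact funext fun i => (s3 i i.2).1
  | mul Φ Ψ ih₁ ih₂ =>
    simp only [Formula.eval, Option.bind_eq_some_iff, Option.some.injEq] at hA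
    obtain ⟨A₁, h1, A₂, h2, rfl⟩ := hA
    obtain ⟨s1, s2, s3⟩ := hs
    have e : k + (Formula.mul Φ Ψ).size - 1 = k + Φ.size + Ψ.size := by
      simp only [Formula.size]; omega
    have i1 := ih₁ hf.1 s1 h1
    have i2 := ih₂ hf.2.1 s2 h2
    have p1 : port N ℓ x (k + Φ.size - 1) 2 = port N ℓ x (k + Φ.size + Ψ.size - 1) 0 :=
      funext fun i => (s3 i i.2).2.1
    have p2 : port N ℓ x (k + Φ.size + Ψ.size - 1) 2 = port N ℓ x (k + Φ.size + Ψ.size) 2 :=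
      funext fun i => (s3 i i.2).2.2.1
    -- The right factor acts first, and its input port is the output port of the left factor.
    rw [e, ← Matrix.mulVec_mulVec, ← p2, ← i2, ← p1, ← i1]
    exact funext fun i => (s3 i i.2).1
  | inv Φ ih =>
    simp only [Formula.eval, Option.bind_eq_some_iff, Option.ite_none_right_eq_some,
      Option.some.injEq] at hA
    obtain ⟨B, h1, hB, rfl⟩ := hA
    have e : k + (Formula.inv Φ).size - 1 = k + Φ.size := by
      simp only [Formula.size]; omega
    have i1 := ih hf.1 hs.1 h1
    have p1 : port N ℓ x (k + Φ.size - 1) 0 = port N ℓ x (k + Φ.size) 2 :=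
      funext fun i => (hs.2 i i.2).1
    have p2 : port N ℓ x (k + Φ.size - 1) 2 = port N ℓ x (k + Φ.size) 0 :=
      funext fun i => (hs.2 i i.2).2.1
    -- The argument `B` has its ports exchanged: the output port of the inversion gate is `B` times
    -- its input port, and `B⁻¹` solves for the latter.
    rw [e, ← p1, i1, p2, Matrix.mulVec_mulVec,
      Matrix.nonsing_inv_mul _ ((Matrix.isUnit_iff_isUnit_det _).1 hB), Matrix.one_mulVec]

/-- The unknowns of gate `h` vanish. -/
def Vanish (N ℓ : ℕ) (x : ℕ → ℚ) (h : ℕ) : Prop :=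
  ∀ i < ℓ, x (idx N h 0 i 0) = 0 ∧ x (idx N h 2 i 0) = 0 ∧ ∀ j < ℓ, x (idx N h 1 i j) = 0

theorem SolLeaf.vanish {k : ℕ} {A : Matrix (Fin ℓ) (Fin ℓ) ℚ} (hs : SolLeaf τ N ℓ x k)
    (hA : ∀ i j : Fin ℓ, τ.den k i j ≠ 0 ∧ τ.val k i j = A i j) (h0 : port N ℓ x k 2 = 0) :
    Vanish N ℓ x k := by
  have h2 : ∀ i < ℓ, x (idx N k 2 i 0) = 0 := fun i hi => congrFun h0 ⟨i, hi⟩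
  intro i hi
  have h1 := hs.in_eq hA
  rw [h0, Matrix.mulVec_zero] at h1
  refine ⟨congrFun h1 ⟨i, hi⟩, h2 i hi, fun j hj => ?_⟩
  rw [hs.mid_eq hi hj (hA ⟨i, hi⟩ ⟨j, hj⟩).1, h2 j hj, mul_zero]

/-- If the output port of a subformula with a value vanishes, so do all its unknowns. -/
theorem Sol.vanish {Φ : Formula n} {k : ℕ} (hf : τ.Fits P Φ k)
    (hs : Sol τ N ℓ x Φ k) (hA : Φ.eval P ≠ none) (h0 : port N ℓ x (k + Φ.size - 1) 2 = 0) :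
    ∀ h, k ≤ h → h < k + Φ.size → Vanish N ℓ x h := by
  rw [Option.ne_none_iff_exists'] at hA
  obtain ⟨A, hA⟩ := hA
  -- The vanishing input port is carried through the induction, because it is the output port of the
  -- argument of an inversion.
  have hin := hs.in_eq hf hA
  rw [h0, Matrix.mulVec_zero] at hin
  induction Φ generalizing k A with
  | const c =>
    intro h h1 h2
    obtain rfl : h = k := by simp only [Formula.size] at h2; omega
    exact SolLeaf.vanish hs hf.2.2 h0
  | var v =>
    intro h h1 h2
    obtain rfl : h = k := by simp only [Formula.size] at h2; omega
    exact SolLeaf.vanish hs hf.2.2 h0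
  | add Φ Ψ ih₁ ih₂ =>
    simp only [Formula.eval, Option.bind_eq_some_iff, Option.some.injEq] at hA
    obtain ⟨A₁, h1, A₂, h2, rfl⟩ := hA
    obtain ⟨s1, s2, s3⟩ := hs
    have e : k + (Formula.add Φ Ψ).size - 1 = k + Φ.size + Ψ.size := by
      simp only [Formula.size]; omega
    rw [e] at h0 hin
    have p1 : port N ℓ x (k + Φ.size - 1) 2 = 0 := (show port N ℓ x _ 2 = port N ℓ x _ 2 from
      funext fun i : Fin ℓ => (s3 i i.2).2.1).trans h0
    have p2 : port N ℓ x (k + Φ.size + Ψ.size - 1) 2 = 0 :=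
      (show port N ℓ x _ 2 = port N ℓ x _ 2 from
        funext fun i : Fin ℓ => (s3 i i.2).2.2.1).trans h0
    have i1 := ih₁ hf.1 s1 p1 A₁ h1 (by rw [s1.in_eq hf.1 h1, p1, Matrix.mulVec_zero])
    have i2 := ih₂ hf.2.1 s2 p2 A₂ h2 (by rw [s2.in_eq hf.2.1 h2, p2, Matrix.mulVec_zero])
    intro h ha hb
    simp only [Formula.size] at hb
    rcases lt_or_ge h (k + Φ.size) with hc | hc
    · exact i1 h ha hc
    rcases lt_or_ge h (k + Φ.size + Ψ.size) with hd | hd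
    · exact i2 h hc hd
    obtain rfl : h = k + Φ.size + Ψ.size := by omega
    exact fun i hi => ⟨congrFun hin ⟨i, hi⟩, congrFun h0 ⟨i, hi⟩, (s3 i hi).2.2.2⟩
  | mul Φ Ψ ih₁ ih₂ =>
    simp only [Formula.eval, Option.bind_eq_some_iff, Option.some.injEq] at hA
    obtain ⟨A₁, h1, A₂, h2, rfl⟩ := hA
    obtain ⟨s1, s2, s3⟩ := hs
    have e : k + (Formula.mul Φ Ψ).size - 1 = k + Φ.size + Ψ.size := by
      simp only [Formula.size]; omega
    rw [e] at h0 hin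
    have p2 : port N ℓ x (k + Φ.size + Ψ.size - 1) 2 = 0 :=
      (show port N ℓ x _ 2 = port N ℓ x _ 2 from
        funext fun i : Fin ℓ => (s3 i i.2).2.2.1).trans h0
    have q2 : port N ℓ x (k + Φ.size + Ψ.size - 1) 0 = 0 := by
      rw [s2.in_eq hf.2.1 h2, p2, Matrix.mulVec_zero]
    have p1 : port N ℓ x (k + Φ.size - 1) 2 = 0 := (show port N ℓ x _ 2 = port N ℓ x _ 0 from
      funext fun i : Fin ℓ => (s3 i i.2).2.1).trans q2
    have i1 := ih₁ hf.1 s1 p1 A₁ h1 (by rw [s1.in_eq hf.1 h1, p1, Matrix.mulVec_zero])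
    have i2 := ih₂ hf.2.1 s2 p2 A₂ h2 q2
    intro h ha hb
    simp only [Formula.size] at hb
    rcases lt_or_ge h (k + Φ.size) with hc | hc
    · exact i1 h ha hc
    rcases lt_or_ge h (k + Φ.size + Ψ.size) with hd | hd
    · exact i2 h hc hd
    obtain rfl : h = k + Φ.size + Ψ.size := by omega
    exact fun i hi => ⟨congrFun hin ⟨i, hi⟩, congrFun h0 ⟨i, hi⟩, (s3 i hi).2.2.2⟩
  | inv Φ ih =>
    simp only [Formula.eval, Option.bind_eq_some_iff, Option.ite_none_right_eq_some,
      Option.some.injEq] at hA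
    obtain ⟨B, h1, hB, rfl⟩ := hA
    have e : k + (Formula.inv Φ).size - 1 = k + Φ.size := by
      simp only [Formula.size]; omega
    rw [e] at h0 hin
    have p2 : port N ℓ x (k + Φ.size - 1) 2 = 0 := (show port N ℓ x _ 2 = port N ℓ x _ 0 from
      funext fun i : Fin ℓ => (hs.2 i i.2).2.1).trans hin
    have i1 := ih hf.1 hs.1 p2 B h1 (by rw [hs.1.in_eq hf.1 h1, p2, Matrix.mulVec_zero])
    intro h ha hb
    simp only [Formula.size] at hb
    rcases lt_or_ge h (k + Φ.size) with hc | hc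
    · exact i1 h ha hc
    obtain rfl : h = k + Φ.size := by omega
    exact fun i hi => ⟨congrFun hin ⟨i, hi⟩, congrFun h0 ⟨i, hi⟩, (hs.2 i hi).2.2⟩

/-- The equations of gate `h`, without those of its output port, are homogeneous. -/
def Inner (τ : Table) (N ℓ g D : ℕ) (x : ℕ → ℚ) (h : ℕ) : Prop :=
  ∀ i < ℓ, τ.row N ℓ g D x (idx N h 0 i 0) = 0 ∧ ∀ j < ℓ, τ.row N ℓ g D x (idx N h 1 i j) = 0

/-- The equations of the output port of gate `h` are homogeneous. -/
def Outer (τ : Table) (N ℓ g D : ℕ) (x : ℕ → ℚ) (h : ℕ) : Prop :=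
  ∀ i < ℓ, τ.row N ℓ g D x (idx N h 2 i 0) = 0

theorem Inner.solLeaf (hN : ℓ ≤ N) (hD : (g + 1) * 3 * N * N ≤ D) {h : ℕ} (hh : h ≤ g)
    (h1 : τ.k₁ h = false) (h2 : τ.k₂ h = false) (hi : Inner τ N ℓ g D x h) :
    SolLeaf τ N ℓ x h := by
  intro i hil
  have a := (hi i hil).1
  rw [row_in_leaf hN hD hh hil h1 h2] at a
  refine ⟨sub_eq_zero.1 a, fun j hj => ?_⟩
  have b := (hi i hil).2 j hj
  rw [row_mid x hN hD hh hil hj, if_pos (leaf_eq_true.2 ⟨h1, h2⟩)] at b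
  exact sub_eq_zero.1 b

theorem Inner.mid_eq_zero (hN : ℓ ≤ N) (hD : (g + 1) * 3 * N * N ≤ D) {h : ℕ} (hh : h ≤ g)
    (hl : τ.leaf h = false) (hi : Inner τ N ℓ g D x h) {i j : ℕ} (hil : i < ℓ) (hj : j < ℓ) :
    x (idx N h 1 i j) = 0 := by
  have b := (hi i hil).2 j hj
  rwa [row_mid x hN hD hh hil hj, hl, if_neg Bool.false_ne_true] at b

/-- Homogeneous equations for a subformula. -/
theorem sol_of_rows (hN : ℓ ≤ N) (hD : (g + 1) * 3 * N * N ≤ D) (hT : τ.IsForest 0 S) (hS : g < S)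
    {Φ : Formula n} {k : ℕ} (hf : τ.Fits P Φ k) (hk : k + Φ.size ≤ g + 1)
    (hi : ∀ h, k ≤ h → h < k + Φ.size → Inner τ N ℓ g D x h)
    (ho : ∀ h, k ≤ h → h + 1 < k + Φ.size → Outer τ N ℓ g D x h) : Sol τ N ℓ x Φ k := by
  induction Φ generalizing k with
  | const c =>
    simp only [Formula.size] at hk hi
    exact (hi k le_rfl (by omega)).solLeaf hN hD (by omega) hf.1 hf.2.1
  | var v =>
    simp only [Formula.size] at hk hi
    exact (hi k le_rfl (by omega)).solLeaf hN hD (by omega) hf.1 hf.2.1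
  | add Φ Ψ ih₁ ih₂ =>
    simp only [Formula.size] at hk hi ho
    obtain ⟨f1, f2, h0, h1, h2, hl⟩ := hf
    have z1 := Φ.size_pos
    have z2 := Ψ.size_pos
    refine ⟨ih₁ f1 (by omega) (fun h ha hb => hi h ha (by omega)) fun h ha hb => ho h ha (by omega),
      ih₂ f2 (by omega) (fun h ha hb => hi h (by omega) (by omega)) fun h ha hb =>
        ho h (by omega) (by omega), fun i hil => ?_⟩
    obtain ⟨p, hp⟩ : ∃ p, k + Φ.size + Ψ.size = p + 1 := ⟨k + Φ.size + Ψ.size - 1, by omega⟩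
    rw [hp] at h0 h1 h2 hl ⊢
    rw [Nat.add_sub_cancel]
    have a1 := (hi (p + 1) (by omega) (by omega) i hil).1
    rw [row_in_add hN hD (by omega) hil h0 h1 h2 hl (by omega)] at a1
    have a2 := ho (k + Φ.size - 1) (by omega) (by omega) i hil
    rw [← hl, row_out_left hN hD hT hS (by omega) hil h1, hl, h0, if_neg Bool.false_ne_true] at a2
    have a3 := ho p (by omega) (by omega) i hil
    rw [row_out_right hN hD hT hS (by omega) hil h1] at a3
    refine ⟨by linarith, by linarith, by linarith, fun j hj => ?_⟩
    exact (hi (p + 1) (by omega) (by omega)).mid_eq_zero hN hD (by omega) (by simp [leaf, h1]) hil hj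
  | mul Φ Ψ ih₁ ih₂ =>
    simp only [Formula.size] at hk hi ho
    obtain ⟨f1, f2, h0, h1, h2, hl⟩ := hf
    have z1 := Φ.size_pos
    have z2 := Ψ.size_pos
    refine ⟨ih₁ f1 (by omega) (fun h ha hb => hi h ha (by omega)) fun h ha hb => ho h ha (by omega),
      ih₂ f2 (by omega) (fun h ha hb => hi h (by omega) (by omega)) fun h ha hb =>
        ho h (by omega) (by omega), fun i hil => ?_⟩
    obtain ⟨p, hp⟩ : ∃ p, k + Φ.size + Ψ.size = p + 1 := ⟨k + Φ.size + Ψ.size - 1, by omega⟩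
    rw [hp] at h0 h1 h2 hl ⊢
    rw [Nat.add_sub_cancel]
    have a1 := (hi (p + 1) (by omega) (by omega) i hil).1
    rw [row_in_mul hN hD (by omega) hil h0 h1 h2 hl (by omega)] at a1
    have a2 := ho (k + Φ.size - 1) (by omega) (by omega) i hil
    rw [← hl, row_out_left hN hD hT hS (by omega) hil h1, hl, h0, if_pos rfl,
      Nat.add_sub_cancel] at a2
    have a3 := ho p (by omega) (by omega) i hil
    rw [row_out_right hN hD hT hS (by omega) hil h1] at a3
    refine ⟨by linarith, by linarith, by linarith, fun j hj => ?_⟩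
    exact (hi (p + 1) (by omega) (by omega)).mid_eq_zero hN hD (by omega) (by simp [leaf, h1]) hil hj
  | inv Φ ih =>
    simp only [Formula.size] at hk hi ho
    obtain ⟨f1, h1, h2⟩ := hf
    have z1 := Φ.size_pos
    refine ⟨ih f1 (by omega) (fun h ha hb => hi h ha (by omega)) fun h ha hb => ho h ha (by omega),
      fun i hil => ?_⟩
    obtain ⟨p, hp⟩ : ∃ p, k + Φ.size = p + 1 := ⟨k + Φ.size - 1, by omega⟩
    rw [hp] at h1 h2 ⊢
    rw [Nat.add_sub_cancel]
    have a1 := (hi (p + 1) (by omega) (by omega) i hil).1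
    rw [row_in_inv hN hD (by omega) hil h1 h2] at a1
    have a3 := ho p (by omega) (by omega) i hil
    rw [row_out_inv hN hD hT hS (by omega) hil h1 h2] at a3
    refine ⟨by linarith, by linarith, fun j hj => ?_⟩
    exact (hi (p + 1) (by omega) (by omega)).mid_eq_zero hN hD (by omega) (by simp [leaf, h2]) hil hj

/-- A solution of the homogeneous system of the gates up to `g` vanishes on every subformula. -/
theorem vanish_of_rows (hN : ℓ ≤ N) (hD : (g + 1) * 3 * N * N ≤ D) (hT : τ.IsForest 0 S) (hS : g < S)
    (hi : ∀ h ≤ g, Inner τ N ℓ g D x h) (ho : ∀ h ≤ g, Outer τ N ℓ g D x h)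
    {Φ : Formula n} {k : ℕ} (hf : τ.Fits P Φ k) (hk : k + Φ.size ≤ S) (hA : Φ.eval P ≠ none)
    (h0 : k + Φ.size ≤ g + 1 → port N ℓ x (k + Φ.size - 1) 2 = 0) :
    ∀ h, k ≤ h → h < k + Φ.size → h ≤ g → Vanish N ℓ x h := by
  -- `Sol.vanish` settles a subformula that lies completely below `g + 1`. One that is cut off
  -- splits into its arguments: a complete one has an output port without a parent, which vanishes,
  -- and the others are cut off again or lie beyond `g`.
  by_cases hg : k + Φ.size ≤ g + 1
  · intro h ha hb _
    exact (sol_of_rows hN hD hT hS hf hg (fun h _ _ => hi h (by omega))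
      fun h _ _ => ho h (by omega)).vanish hf hA (h0 hg) h ha hb
  have hroot : ∀ c ≤ g, (∀ p ≤ g, τ.k₁ p = true → τ.lft p ≠ c) →
      (c + 1 ≤ g → τ.leaf (c + 1) = true) → port N ℓ x c 2 = 0 := by
    intro c hc h1 h2
    funext i
    have := ho c hc i i.2
    rwa [row_out_root hN hD hc i.2 h1 h2] at this
  induction Φ generalizing k with
  | const c => simp only [Formula.size] at hg ⊢; intros; omega
  | var v => simp only [Formula.size] at hg ⊢; intros; omega
  | add Φ Ψ ih₁ ih₂ =>
    simp only [Formula.eval, ne_eq, Option.bind_eq_none_iff, not_forall, reduceCtorEq,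
      not_false_eq_true] at hA
    obtain ⟨A₁, e1, A₂, e2, -⟩ := hA
    obtain ⟨f1, f2, k0, k1, k2, hl⟩ := hf
    have z1 := Φ.size_pos
    have z2 := Ψ.size_pos
    simp only [Formula.size] at hk hg ⊢
    -- The parent of the left argument is the last gate of the formula, which lies beyond `g`, and
    -- `inj` excludes any other.
    have hleft : ∀ c, c = k + Φ.size - 1 → c ≤ g → port N ℓ x c 2 = 0 := by
      rintro c hc hcg
      refine hroot c hcg (fun p hp hp1 hp2 => ?_) fun _ => ?_
      · have := hT.inj p (k + Φ.size + Ψ.size) (Nat.zero_le _) (by omega) (Nat.zero_le _) (by omega)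
          hp1 k1 (by omega)
        omega
      · rw [hc, Nat.sub_add_cancel (by omega)]; exact f2.leaf_first
    have hright : k + Φ.size + Ψ.size - 1 ≤ g → port N ℓ x (k + Φ.size + Ψ.size - 1) 2 = 0 := by
      intro hcg
      refine hroot _ hcg (ne_lft_of_not_leaf hT hS ?_) (by omega)
      rw [Nat.sub_add_cancel (by omega)]; simp [leaf, k1]
    intro h ha hb hhg
    rcases lt_or_ge h (k + Φ.size) with hc | hc
    · by_cases hg1 : k + Φ.size ≤ g + 1
      · exact (sol_of_rows hN hD hT hS f1 hg1 (fun h _ _ => hi h (by omega))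
          fun h _ _ => ho h (by omega)).vanish f1 (by simp [e1]) (hleft _ rfl (by omega)) h ha hc
      · exact ih₁ f1 (by omega) (by simp [e1]) (fun h => absurd h hg1) hg1 h ha hc hhg
    · by_cases hg1 : k + Φ.size + Ψ.size ≤ g + 1
      · exact (sol_of_rows hN hD hT hS f2 hg1 (fun h _ _ => hi h (by omega))
          fun h _ _ => ho h (by omega)).vanish f2 (by simp [e2]) (hright (by omega)) h hc (by omega)
      · exact ih₂ f2 (by omega) (by simp [e2]) (fun h => absurd h hg1) hg1 h hc (by omega) hhg
  | mul Φ Ψ ih₁ ih₂ =>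
    simp only [Formula.eval, ne_eq, Option.bind_eq_none_iff, not_forall, reduceCtorEq,
      not_false_eq_true] at hA
    obtain ⟨A₁, e1, A₂, e2, -⟩ := hA
    obtain ⟨f1, f2, k0, k1, k2, hl⟩ := hf
    have z1 := Φ.size_pos
    have z2 := Ψ.size_pos
    simp only [Formula.size] at hk hg ⊢
    have hleft : ∀ c, c = k + Φ.size - 1 → c ≤ g → port N ℓ x c 2 = 0 := by
      rintro c hc hcg
      refine hroot c hcg (fun p hp hp1 hp2 => ?_) fun _ => ?_
      · have := hT.inj p (k + Φ.size + Ψ.size) (Nat.zero_le _) (by omega) (Nat.zero_le _) (by omega)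
          hp1 k1 (by omega)
        omega
      · rw [hc, Nat.sub_add_cancel (by omega)]; exact f2.leaf_first
    have hright : k + Φ.size + Ψ.size - 1 ≤ g → port N ℓ x (k + Φ.size + Ψ.size - 1) 2 = 0 := by
      intro hcg
      refine hroot _ hcg (ne_lft_of_not_leaf hT hS ?_) (by omega)
      rw [Nat.sub_add_cancel (by omega)]; simp [leaf, k1]
    intro h ha hb hhg
    rcases lt_or_ge h (k + Φ.size) with hc | hc
    · by_cases hg1 : k + Φ.size ≤ g + 1
      · exact (sol_of_rows hN hD hT hS f1 hg1 (fun h _ _ => hi h (by omega))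
          fun h _ _ => ho h (by omega)).vanish f1 (by simp [e1]) (hleft _ rfl (by omega)) h ha hc
      · exact ih₁ f1 (by omega) (by simp [e1]) (fun h => absurd h hg1) hg1 h ha hc hhg
    · by_cases hg1 : k + Φ.size + Ψ.size ≤ g + 1
      · exact (sol_of_rows hN hD hT hS f2 hg1 (fun h _ _ => hi h (by omega))
          fun h _ _ => ho h (by omega)).vanish f2 (by simp [e2]) (hright (by omega)) h hc (by omega)
      · exact ih₂ f2 (by omega) (by simp [e2]) (fun h => absurd h hg1) hg1 h hc (by omega) hhg
  | inv Φ ih =>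
    simp only [Formula.eval, ne_eq, Option.bind_eq_none_iff, not_forall] at hA
    obtain ⟨A₁, e1, -⟩ := hA
    obtain ⟨f1, k1, k2⟩ := hf
    have z1 := Φ.size_pos
    simp only [Formula.size] at hk hg ⊢
    intro h ha hb hhg
    by_cases hg1 : k + Φ.size ≤ g + 1
    · refine (sol_of_rows hN hD hT hS f1 hg1 (fun h _ _ => hi h (by omega))
        fun h _ _ => ho h (by omega)).vanish f1 (by simp [e1]) ?_ h ha (by omega)
      refine hroot _ (by omega) (ne_lft_of_not_leaf hT hS ?_) (by omega)
      rw [Nat.sub_add_cancel (by omega)]; simp [leaf, k2]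
    · exact ih f1 (by omega) (by simp [e1]) (fun h => absurd h hg1) hg1 h ha (by omega) hhg

/-- If a formula has no value, some inversion gate is applied to a singular matrix. -/
theorem exists_singular {Φ : Formula n} {k : ℕ} (hf : τ.Fits P Φ k) (hA : Φ.eval P = none) :
    ∃ (Ψ : Formula n) (k' : ℕ) (A : Matrix (Fin ℓ) (Fin ℓ) ℚ), k ≤ k' ∧
      k' + Ψ.size < k + Φ.size ∧ τ.Fits P Ψ k' ∧ Ψ.eval P = some A ∧ ¬ IsUnit A ∧
      τ.k₁ (k' + Ψ.size) = false ∧ τ.k₂ (k' + Ψ.size) = true := by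
  induction Φ generalizing k with
  | const c => simp [Formula.eval] at hA
  | var v => simp [Formula.eval] at hA
  | add Φ Ψ ih₁ ih₂ =>
    cases h1 : Φ.eval P with
    | none =>
      obtain ⟨Θ, k', A, a, b, c⟩ := ih₁ hf.1 h1
      exact ⟨Θ, k', A, a, by simp only [Formula.size]; omega, c⟩
    | some A₁ =>
      cases h2 : Ψ.eval P with
      | none =>
        obtain ⟨Θ, k', A, a, b, c⟩ := ih₂ hf.2.1 h2
        exact ⟨Θ, k', A, by omega, by simp only [Formula.size]; omega, c⟩
      | some A₂ => simp [Formula.eval, h1, h2] at hA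
  | mul Φ Ψ ih₁ ih₂ =>
    cases h1 : Φ.eval P with
    | none =>
      obtain ⟨Θ, k', A, a, b, c⟩ := ih₁ hf.1 h1
      exact ⟨Θ, k', A, a, by simp only [Formula.size]; omega, c⟩
    | some A₁ =>
      cases h2 : Ψ.eval P with
      | none =>
        obtain ⟨Θ, k', A, a, b, c⟩ := ih₂ hf.2.1 h2
        exact ⟨Θ, k', A, by omega, by simp only [Formula.size]; omega, c⟩
      | some A₂ => simp [Formula.eval, h1, h2] at hA
  | inv Φ ih =>
    cases h1 : Φ.eval P with
    | none =>
      obtain ⟨Θ, k', A, a, b, c⟩ := ih hf.1 h1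
      exact ⟨Θ, k', A, a, by simp only [Formula.size]; omega, c⟩
    | some A₁ =>
      refine ⟨Φ, k, A₁, le_rfl, by simp only [Formula.size]; omega, hf.1, h1, ?_, hf.2.1, hf.2.2⟩
      intro hu
      simp [Formula.eval, h1, hu] at hA

end Table

end RatEval

/-! ### Regular and singular systems, and Cramer's rule -/

namespace RatEval

namespace Table

variable {τ : Table} {N ℓ g D S n : ℕ} {P : Fin n → Matrix (Fin ℓ) (Fin ℓ) ℚ}

/-- The matrix of the system of the gates up to `g`. -/
def matrix (τ : Table) (N ℓ g D : ℕ) : Matrix (Fin D) (Fin D) ℤ :=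
  Matrix.of fun R C => τ.entry N ℓ g R C

/-- A vector, continued by `0`. -/
def extend (x : Fin D → ℚ) (R : ℕ) : ℚ := if h : R < D then x ⟨R, h⟩ else 0

theorem row_extend (x : Fin D → ℚ) (R : Fin D) :
    τ.row N ℓ g D (extend x) R = ((τ.matrix N ℓ g D).map (Int.castRingHom ℚ)).mulVec x R := by
  rw [row, Finset.sum_range, Matrix.mulVec, dotProduct]
  simp [matrix, extend]

theorem idx_lt {h t i j : ℕ} (hD : (g + 1) * 3 * N * N ≤ D) (hh : h ≤ g) (ht : t < 3) (hi : i < N)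
    (hj : j < N) : idx N h t i j < D := by
  refine lt_of_lt_of_le ?_ hD
  rw [idx]
  have h1 : h * 3 + t + 1 ≤ (g + 1) * 3 := by omega
  have h2 : (h * 3 + t) * N + i + 1 ≤ (g + 1) * 3 * N := by nlinarith
  nlinarith

theorem det_cast (M : Matrix (Fin D) (Fin D) ℤ) :
    (M.map (Int.castRingHom ℚ)).det = (M.det : ℚ) := by
  rw [← RingHom.mapMatrix_apply, ← RingHom.map_det]; simp

/-- The systems of a formula with a value are regular. -/
theorem det_ne_zero (hN : ℓ < N) {Φ : Formula n} (hf : τ.Fits P Φ 0)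
    (hA : Φ.eval P ≠ none) (hg : g < Φ.size) (hD : (g + 1) * 3 * N * N ≤ D) :
    (τ.matrix N ℓ g D).det ≠ 0 := by
  intro h0
  have h0' : ((τ.matrix N ℓ g D).map (Int.castRingHom ℚ)).det = 0 := by rw [det_cast, h0]; simp
  obtain ⟨x, hx, hx'⟩ := Matrix.exists_mulVec_eq_zero_iff.2 h0'
  have hrow : ∀ R < D, τ.row N ℓ g D (extend x) R = 0 := fun R hR => by
    have := row_extend (τ := τ) (N := N) (ℓ := ℓ) (g := g) x ⟨R, hR⟩
    rw [hx'] at this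
    exact this
  have hT : τ.IsForest 0 Φ.size := by simpa using hf.isForest
  have hi : ∀ h ≤ g, Inner τ N ℓ g D (extend x) h := fun h hh i hi =>
    ⟨hrow _ (idx_lt hD hh (by norm_num) (by omega) (by omega)), fun j hj =>
      hrow _ (idx_lt hD hh (by norm_num) (by omega) (by omega))⟩
  have ho : ∀ h ≤ g, Outer τ N ℓ g D (extend x) h := fun h hh i hi =>
    hrow _ (idx_lt hD hh (by norm_num) (by omega) (by omega))
  -- When the system contains the last gate of the formula, its output port has no parent: left
  -- arguments lie at least two places before their gates.
  have hv := vanish_of_rows hN.le hD hT hg hi ho hf (by omega) hA (fun hs => by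
    funext i
    have h1 := ho (0 + Φ.size - 1) (by omega) i i.2
    rwa [row_out_root hN.le hD (by omega) i.2 (fun p hp h1 h2 => by
      have := hT.lft_ge p (Nat.zero_le _) (by omega) h1
      omega) (by omega)] at h1)
  refine hx (funext fun R => ?_)
  have hR : x R = extend x R := by simp [extend]
  rw [hR]
  by_cases hval : Valid N ℓ g R
  · obtain ⟨v1, v2, v3⟩ := hval
    have := hv (gateIx N R) (Nat.zero_le _) (by omega) v1 (rowIx N R) v2
    rw [← idx_ixs (N := N) (R : ℕ)]
    have ht := typeIx_lt (N := N) R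
    rcases (by omega : typeIx N R = 0 ∨ typeIx N R = 1 ∨ typeIx N R = 2) with e | e | e <;>
      rw [e] at v3 ⊢
    · rw [if_neg (by norm_num)] at v3
      rw [v3]; exact this.1
    · rw [if_pos rfl] at v3
      exact this.2.2 _ v3
    · rw [if_neg (by norm_num)] at v3
      rw [v3]; exact this.2.1
  · rw [← row_of_not_valid (τ := τ) (extend x) hval R.2]
    exact hrow R R.2

/-- One of the systems of a formula without a value is singular. -/
theorem exists_det_eq_zero (hN : ℓ < N) {Φ : Formula n} (hf : τ.Fits P Φ 0)
    (hA : Φ.eval P = none) (hD : Φ.size * 3 * N * N ≤ D) :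
    ∃ g < Φ.size, (τ.matrix N ℓ g D).det = 0 := by
  obtain ⟨Ψ, k, A, -, hk, hf', hA', hu, h1, h2⟩ := exists_singular hf hA
  have hT : τ.IsForest 0 Φ.size := by simpa using hf.isForest
  have hz := Ψ.size_pos
  set g := k + Ψ.size with hgdef
  have hg : g < Φ.size := by omega
  have hD' : (g + 1) * 3 * N * N ≤ D := le_trans (by gcongr; omega) hD
  refine ⟨g, hg, by_contra fun h0 => hu ?_⟩
  have hM : IsUnit ((τ.matrix N ℓ g D).map (Int.castRingHom ℚ)) := by
    rw [Matrix.isUnit_iff_isUnit_det, det_cast, isUnit_iff_ne_zero]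
    exact_mod_cast h0
  rw [← Matrix.mulVec_surjective_iff_isUnit] at hM ⊢
  intro b
  -- Put `b` on the right of the equations for the input port of the inversion gate `g`, and `0`
  -- elsewhere. The output port of `g` has no parent and vanishes, so these equations make the input
  -- port of the argument equal to `b`. It is also `A` times an output port; hence `A` is
  -- surjective.
  obtain ⟨x, hx⟩ := hM fun R =>
    if typeIx N R = 0 ∧ gateIx N R = g then (if h : rowIx N R < ℓ then b ⟨_, h⟩ else 0) else 0
  have hrow : ∀ h t i j, h ≤ g → t < 3 → i < N → j < N →
      τ.row N ℓ g D (extend x) (idx N h t i j) =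
        if t = 0 ∧ h = g then (if h : i < ℓ then b ⟨i, h⟩ else 0) else 0 := by
    intro h t i j hh ht hi hj
    have := row_extend (τ := τ) (N := N) (ℓ := ℓ) (g := g) x ⟨_, idx_lt hD' hh ht hi hj⟩
    rw [hx] at this
    simp only [gateIx_idx ht hi hj, typeIx_idx ht hi hj, rowIx_idx hi hj] at this
    exact this
  have hs : Sol τ N ℓ (extend x) Ψ k := by
    refine sol_of_rows hN.le hD' hT hg hf' (by omega) (fun h ha hb i hi => ⟨?_, fun j hj => ?_⟩)
      fun h ha hb i hi => ?_
    · rw [hrow _ _ _ _ (by omega) (by norm_num) (by omega) (by omega), if_neg (by omega)]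
    · rw [hrow _ _ _ _ (by omega) (by norm_num) (by omega) (by omega), if_neg (by omega)]
    · rw [hrow _ _ _ _ (by omega) (by norm_num) (by omega) (by omega), if_neg (by omega)]
  have hin := hs.in_eq hf' hA'
  refine ⟨_, hin.symm.trans (funext fun i => ?_)⟩
  obtain ⟨p, hp⟩ : ∃ p, g = p + 1 := ⟨g - 1, by omega⟩
  have r1 := hrow g 0 i 0 le_rfl (by norm_num) (by omega) (by omega)
  have r2 := hrow g 2 i 0 le_rfl (by norm_num) (by omega) (by omega)
  rw [row_out_root hN.le hD' le_rfl i.2 (fun p hp h1 h2 => by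
      have := hT.lft_ge p (Nat.zero_le _) (by omega) h1
      omega) (by omega), if_neg (by norm_num)] at r2
  rw [if_pos ⟨rfl, rfl⟩, dif_pos i.2] at r1
  have e : τ.row N ℓ g D (extend x) (idx N g 0 i 0) =
      extend x (idx N p 0 i 0) - extend x (idx N g 2 i 0) := by
    have := row_in_inv (x := extend x) hN.le hD' (h := p) (by omega) i.2 (hp ▸ h1) (hp ▸ h2)
    rw [hp] at this ⊢
    exact this
  rw [e, r2, sub_zero] at r1
  rw [port, show k + Ψ.size - 1 = p by omega]
  exact r1

/-- The matrix of the whole system, with the column of one unknown replaced. -/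
def cramer (τ : Table) (N ℓ g D i j : ℕ) : Matrix (Fin D) (Fin D) ℤ :=
  Matrix.of fun R C => if (C : ℕ) = idx N g 0 i 0 then
    if (R : ℕ) = idx N g 2 j 0 then 1 else 0 else τ.entry N ℓ g R C

/-- The value of a formula by Cramer's rule. -/
theorem det_cramer (hN : ℓ < N) {Φ : Formula n} (hf : τ.Fits P Φ 0)
    {A : Matrix (Fin ℓ) (Fin ℓ) ℚ} (hA : Φ.eval P = some A) (hD : Φ.size * 3 * N * N ≤ D)
    (i j : Fin ℓ) :
    ((τ.cramer N ℓ (Φ.size - 1) D i j).det : ℚ) =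
      (τ.matrix N ℓ (Φ.size - 1) D).det * A i j := by
  have hz := Φ.size_pos
  have hT : τ.IsForest 0 Φ.size := by simpa using hf.isForest
  obtain ⟨g, hg⟩ : ∃ g, Φ.size = g + 1 := ⟨Φ.size - 1, by omega⟩
  rw [hg] at hD
  rw [show Φ.size - 1 = g by omega]
  set M := (τ.matrix N ℓ g D).map (Int.castRingHom ℚ) with hM
  have hc : idx N g 0 i 0 < D := idx_lt hD le_rfl (by norm_num) (by omega) (by omega)
  have hr : idx N g 2 j 0 < D := idx_lt hD le_rfl (by norm_num) (by omega) (by omega)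
  -- `M.cramer b` solves `M x = det M • b`, so that no division is needed. Here `b` makes the last
  -- output port `det M` times the unit vector `j`, and its input port is then `det M` times column
  -- `j` of the value.
  set x := M.cramer (Pi.single ⟨idx N g 2 j 0, hr⟩ 1) with hx
  have hx' := Matrix.mulVec_cramer M (Pi.single ⟨idx N g 2 j 0, hr⟩ 1)
  rw [← hx] at hx'
  have hrow : ∀ h t i' j', h ≤ g → t < 3 → i' < N → j' < N →
      τ.row N ℓ g D (extend x) (idx N h t i' j') =
        if h = g ∧ t = 2 ∧ i' = j ∧ j' = 0 then M.det else 0 := by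
    intro h t i' j' hh ht hi hj
    have := row_extend (τ := τ) (N := N) (ℓ := ℓ) (g := g) x ⟨_, idx_lt hD hh ht hi hj⟩
    rw [← hM, hx'] at this
    refine this.trans ?_
    simp only [Pi.smul_apply, Pi.single_apply, Fin.mk.injEq, smul_eq_mul, mul_ite, mul_one, mul_zero]
    refine if_congr ⟨fun he => ?_, ?_⟩ rfl rfl
    · have e1 := congrArg (gateIx N) he
      have e2 := congrArg (typeIx N) he
      have e3 := congrArg (rowIx N) he
      have e4 := congrArg (colIx N) he
      rw [gateIx_idx ht hi hj, gateIx_idx (by norm_num) (by omega) (by omega)] at e1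
      rw [typeIx_idx ht hi hj, typeIx_idx (by norm_num) (by omega) (by omega)] at e2
      rw [rowIx_idx hi hj, rowIx_idx (by omega) (by omega)] at e3
      rw [colIx_idx hj, colIx_idx (by omega)] at e4
      exact ⟨e1, e2, e3, e4⟩
    · rintro ⟨rfl, rfl, rfl, rfl⟩; rfl
  have hs : Sol τ N ℓ (extend x) Φ 0 := by
    refine sol_of_rows hN.le hD hT (g := g) (by omega) hf (by omega)
      (fun h ha hb i hi => ⟨?_, fun j hj => ?_⟩) fun h ha hb i hi => ?_
    · rw [hrow _ _ _ _ (by omega) (by norm_num) (by omega) (by omega), if_neg (by omega)]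
    · rw [hrow _ _ _ _ (by omega) (by norm_num) (by omega) (by omega), if_neg (by omega)]
    · rw [hrow _ _ _ _ (by omega) (by norm_num) (by omega) (by omega), if_neg (by omega)]
  have hin := hs.in_eq hf hA
  rw [show 0 + Φ.size - 1 = g by omega] at hin
  have hout : port N ℓ (extend x) g 2 = Pi.single j M.det := by
    funext i'
    have r2 := hrow g 2 i' 0 le_rfl (by norm_num) (by omega) (by omega)
    rw [row_out_root hN.le hD le_rfl i'.2 (fun p hp h1 h2 => by
      have := hT.lft_ge p (Nat.zero_le _) (by omega) h1
      omega) (by omega)] at r2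
    rw [port, r2, Pi.single_apply]
    simp [Fin.ext_iff]
  rw [hout] at hin
  have h1 := congrFun hin i
  simp only [port, Matrix.mulVec_single, extend, dif_pos hc] at h1
  have h2 : x ⟨idx N g 0 i 0, hc⟩ = ((τ.cramer N ℓ g D i j).det : ℚ) := by
    rw [hx, Matrix.cramer_apply, ← det_cast]
    congr 1
    ext R C
    simp only [Matrix.updateCol_apply, Matrix.map_apply, cramer, Matrix.of_apply, hM, matrix,
      Fin.ext_iff, Pi.single_apply]
    split_ifs <;> simp
  rw [← h2, h1, ← det_cast, ← hM]
  simp [mul_comm]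

end Table

end RatEval

namespace RatEval

/-! ### Selection of procedures -/

/-- The body selected by the value of an expression. -/
def Step.switch (e : Expr) : List Step → ℕ → Step
  | [], _ => .const false
  | s :: l, k => .cond (Expr.eq e (.lit k)) s (switch e l (k + 1))

theorem Step.run_switch (x : List Bool) (V : List ℕ → Bool) (σ : ℕ → ℕ) (e : Expr) :
    ∀ (l : List Step) (k i : ℕ), e.eval σ = k + i →
      (Step.switch e l k).run x V σ = (l.getD i (.const false)).run x V σ
  | [], k, i, _ => by simp [switch]
  | s :: l, k, 0, h => by simp [switch, run, h]
  | s :: l, k, i + 1, h => by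
    rw [switch, run, run_switch x V σ e l (k + 1) i (by omega)]
    simp [h]

/-- The body selected by the value of an expression. -/
def AStep.switch (e : Expr) : List AStep → ℕ → AStep
  | [], _ => .leaf (.const false)
  | s :: l, k => .cond (Expr.eq e (.lit k)) s (switch e l (k + 1))

theorem AStep.resolve_switch (σ : ℕ → ℕ) (e : Expr) :
    ∀ (l : List AStep) (k i : ℕ), e.eval σ = k + i →
      (AStep.switch e l k).resolve σ = (l.getD i (.leaf (.const false))).resolve σ
  | [], k, i, _ => by simp [switch]
  | s :: l, k, 0, h => by simp [switch, resolve, h]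
  | s :: l, k, i + 1, h => by
    rw [switch, resolve, resolve_switch σ e l (k + 1) i (by omega)]
    simp [h]

/-- A conjunction or a disjunction over the range of `reg 3` numbers from `reg 2` on. -/
def Step.range (τ : ℕ) (v : Bool) (self : Expr → Expr → List Expr) (s : Step) : Step :=
  .cond (.reg 3) (.cond (.reg 3 - 1) (.lut τ (self (.reg 2) (.reg 3 / 2))
    (self (.reg 2 + .reg 3 / 2) (.reg 3 - .reg 3 / 2)) []) s) (.const v)

/-- Whether a predicate holds somewhere in a range. -/
def anyIn (f : ℕ → Bool) (lo len : ℕ) : Bool := (List.range len).any fun i => f (lo + i)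

/-- Whether a predicate holds everywhere in a range. -/
def allIn (f : ℕ → Bool) (lo len : ℕ) : Bool := (List.range len).all fun i => f (lo + i)

theorem anyIn_add (f : ℕ → Bool) (lo a b : ℕ) :
    anyIn f lo (a + b) = (anyIn f lo a || anyIn f (lo + a) b) := by
  simp only [anyIn, List.range_add, List.any_append, List.any_map, Function.comp_def, add_assoc]

theorem allIn_add (f : ℕ → Bool) (lo a b : ℕ) :
    allIn f lo (a + b) = (allIn f lo a && allIn f (lo + a) b) := by
  simp only [allIn, List.range_add, List.all_append, List.all_map, Function.comp_def, add_assoc]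

theorem anyIn_eq_true {f : ℕ → Bool} {lo len : ℕ} :
    anyIn f lo len = true ↔ ∃ i < len, f (lo + i) = true := by simp [anyIn]

theorem allIn_eq_true {f : ℕ → Bool} {lo len : ℕ} :
    allIn f lo len = true ↔ ∀ i < len, f (lo + i) = true := by simp [allIn]

namespace Machine

variable {M : Machine} {x : List Bool}

/-- Folding at most `2 ^ k` items by halving takes `k` rounds beyond the base case. The law `F_add`
is the only fact about longer ranges that enters, and items need known values below `K` only. -/
theorem hasVal_range {op : Bool → Bool → Bool} {z : Bool} {F : (ℕ → Bool) → ℕ → ℕ → Bool}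
    (F_zero : ∀ f lo, F f lo 0 = z) (F_one : ∀ f lo, F f lo 1 = f lo)
    (F_add : ∀ f lo a b, F f lo (a + b) = op (F f lo a) (F f (lo + a) b))
    {α : ℕ → ℕ → List ℕ} {K T : ℕ} {s : (List ℕ → Bool) → ℕ → Bool} {f : ℕ → Bool}
    (hr : ∀ lo len, lo + len ≤ K → M.InRange x.length (α lo len))
    (hrun : ∀ V lo len, M.prog.run x V (regs x.length (α lo len)) = if len = 0 then z else
      if len = 1 then s V lo else op (V (α lo (len / 2))) (V (α (lo + len / 2) (len - len / 2))))
    (hs : ∀ i < K, ∀ V : List ℕ → Bool, (∀ a v, M.HasVal x T a v → V a = v) → s V i = f i)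
    (k : ℕ) : ∀ lo len, len ≤ 2 ^ k → lo + len ≤ K → M.HasVal x (T + k + 1) (α lo len) (F f lo len) := by
  have base : ∀ lo len, len ≤ 1 → lo + len ≤ K → M.HasVal x (T + 1) (α lo len) (F f lo len) := by
    intro lo len h1 h2
    refine .of_run (hr lo len h2) fun V hV => ?_
    rw [hrun]
    obtain rfl | rfl : len = 0 ∨ len = 1 := by omega
    · simp [F_zero]
    · simp [F_one, hs lo (by omega) V hV]
  induction k with
  | zero => exact base
  | succ k ih =>
    intro lo len hlen h2
    by_cases h1 : len ≤ 1
    · exact (base lo len h1 h2).mono (by omega)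
    rw [pow_succ] at hlen
    refine .of_run (hr lo len h2) fun V hV => ?_
    rw [hrun, if_neg (by omega), if_neg (by omega), hV _ _ (ih lo (len / 2) (by omega) (by omega)),
      hV _ _ (ih (lo + len / 2) (len - len / 2) (by omega) (by omega)), ← F_add]
    congr 1
    omega

theorem hasVal_any {α : ℕ → ℕ → List ℕ} {K T : ℕ} {s : (List ℕ → Bool) → ℕ → Bool} {f : ℕ → Bool}
    (hr : ∀ lo len, lo + len ≤ K → M.InRange x.length (α lo len))
    (hrun : ∀ V lo len, M.prog.run x V (regs x.length (α lo len)) = if len = 0 then false else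
      if len = 1 then s V lo else (V (α lo (len / 2)) || V (α (lo + len / 2) (len - len / 2))))
    (hs : ∀ i < K, ∀ V : List ℕ → Bool, (∀ a v, M.HasVal x T a v → V a = v) → s V i = f i)
    {k lo len : ℕ} (hk : len ≤ 2 ^ k) (h : lo + len ≤ K) :
    M.HasVal x (T + k + 1) (α lo len) (anyIn f lo len) :=
  hasVal_range (op := or) (z := false) (fun f lo => by simp [anyIn]) (fun f lo => by simp [anyIn])
    anyIn_add hr hrun hs k lo len hk h

theorem hasVal_all {α : ℕ → ℕ → List ℕ} {K T : ℕ} {s : (List ℕ → Bool) → ℕ → Bool} {f : ℕ → Bool}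
    (hr : ∀ lo len, lo + len ≤ K → M.InRange x.length (α lo len))
    (hrun : ∀ V lo len, M.prog.run x V (regs x.length (α lo len)) = if len = 0 then true else
      if len = 1 then s V lo else (V (α lo (len / 2)) && V (α (lo + len / 2) (len - len / 2))))
    (hs : ∀ i < K, ∀ V : List ℕ → Bool, (∀ a v, M.HasVal x T a v → V a = v) → s V i = f i)
    {k lo len : ℕ} (hk : len ≤ 2 ^ k) (h : lo + len ≤ K) :
    M.HasVal x (T + k + 1) (α lo len) (allIn f lo len) :=
  hasVal_range (op := and) (z := true) (fun f lo => by simp [allIn]) (fun f lo => by simp [allIn])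
    allIn_add hr hrun hs k lo len hk h

end Machine

/-! ### The procedures of the evaluator -/

namespace Evaluator

open RatEval.Expr (npow eq lt)

/-- The input length plus two. -/
def baseE : Expr := .reg 0 + 2
/-- The dimension of the linear systems. -/
def dimE : Expr := baseE.npow 5
/-- The bit length of the determinants. -/
def bitsE : Expr := baseE.npow 12
/-- The number of terms of the geometric sums. -/
def termsE : Expr := baseE.npow 6
/-- The number of bits of the arithmetic. -/
def widthE : Expr := baseE.npow 18

section

variable (u : Expr)

/-- The number of variables. -/
def varsE : Expr := u % .reg 0
/-- The size of the matrices. -/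
def sideE : Expr := u / .reg 0 % .reg 0
/-- The size of the formula. -/
def sizeE : Expr := u / (.reg 0 * .reg 0) % .reg 0
/-- The width of the binary fields. -/
def fieldE : Expr := u / (.reg 0 * .reg 0 * .reg 0)
/-- The length of the header. -/
def headE : Expr := varsE u + sideE u + sizeE u + fieldE u + 4
/-- The position of a gate. -/
def nodeE (h : Expr) : Expr := headE u + h * (2 * fieldE u + 4)
/-- The position of a matrix entry. -/
def entryE (k i j : Expr) : Expr :=
  nodeE u (sizeE u) + ((k * sideE u + i) * sideE u + j) * (2 * fieldE u + 1)

end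

/-- An arithmetic call with the parameters of the present arithmetic call. -/
def call (t : ℕ) (a b c d e f : Expr) : List Expr :=
  [.lit t, .reg 7, .reg 8, a, b, c, d, e, f]

/-- The number whose bit number `reg 2` is the value of the expression. -/
def bitLeaf (e : Expr) : AStep := .leaf (.cond e (.const true) (.const false))

/-- The arithmetic procedures. -/
def arithProcs : List AStep :=
  -- Numbers 0 to 4 are the constants `1`, `-1`, `2 ^ (bits * dim - 1)`, `-2 ^ bits` and `2 ^ bits`;
  -- 5 to 9 form a scaled matrix entry; 10 and 11 are powers of leading submatrices and their inner
  -- products; 12 and 13 the geometric sums and their product `F`; 14 to 17 the geometric sum in `1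
  -- - F`; 18 adds the rounding constant, 19 cuts out the digits of the determinant, 20 negates
  -- them.
  [bitLeaf (1 - .reg 2),
   bitLeaf 1,
   bitLeaf (eq (.reg 2) (bitsE * dimE - 1)),
   bitLeaf (1 - lt (.reg 2) bitsE),
   bitLeaf (eq (.reg 2) bitsE),
   .leaf (.lut 240 [10, .reg 7, .reg 8, .reg 9, .reg 10, .reg 2] [] []),
   .leaf (.lut 240 [11, .reg 7, .reg 8, .reg 9, .reg 10, .reg 2] [] []),
   .mul (call 3 0 0 0 0 0 0) (call 5 (.reg 9) (.reg 10) 0 0 0 0),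
   .mul (call 4 0 0 0 0 0 0) (call 6 (.reg 9) (.reg 10) 0 0 0 0),
   .add (call 7 (.reg 9) (.reg 10) 0 0 0 0) (call 8 (.reg 9) (.reg 10) 0 0 0 0),
   .cond (.reg 10)
     (.cond (.reg 10 - 1)
       (.goto (call 11 (.reg 9) (.reg 10) (.reg 11) (.reg 12) 0 (.reg 9)))
       (.goto (call 9 (.reg 11) (.reg 12) 0 0 0 0)))
     (.cond (eq (.reg 11) (.reg 12)) (.goto (call 0 0 0 0 0 0 0)) (bitLeaf 0)),
   .cond (.reg 14)
     (.cond (.reg 14 - 1)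
       (.add (call 11 (.reg 9) (.reg 10) (.reg 11) (.reg 12) (.reg 13) (.reg 14 / 2))
         (call 11 (.reg 9) (.reg 10) (.reg 11) (.reg 12) (.reg 13 + .reg 14 / 2)
           (.reg 14 - .reg 14 / 2)))
       (.mul (call 10 (.reg 9) (.reg 10 / 2) (.reg 11) (.reg 13) 0 0)
         (call 10 (.reg 9) (.reg 10 - .reg 10 / 2) (.reg 13) (.reg 12) 0 0)))
     (bitLeaf 0),
   .cond (.reg 11)
     (.cond (.reg 11 - 1)
       (.add (call 12 (.reg 9) (.reg 10) (.reg 11 / 2) 0 0 0)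
         (call 12 (.reg 9) (.reg 10 + .reg 11 / 2) (.reg 11 - .reg 11 / 2) 0 0 0))
       (.goto (call 10 (.reg 9 + 1) (.reg 10) (.reg 9) (.reg 9) 0 0)))
     (bitLeaf 0),
   .cond (.reg 10)
     (.cond (.reg 10 - 1)
       (.mul (call 13 (.reg 9) (.reg 10 / 2) 0 0 0 0)
         (call 13 (.reg 9 + .reg 10 / 2) (.reg 10 - .reg 10 / 2) 0 0 0 0))
       (.goto (call 12 (.reg 9) 0 termsE 0 0 0)))
     (.goto (call 0 0 0 0 0 0 0)),
   .mul (call 1 0 0 0 0 0 0) (call 13 0 dimE 0 0 0 0),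
   .add (call 0 0 0 0 0 0 0) (call 14 0 0 0 0 0 0),
   .cond (.reg 9)
     (.cond (.reg 9 - 1)
       (.mul (call 16 (.reg 9 / 2) 0 0 0 0 0) (call 16 (.reg 9 - .reg 9 / 2) 0 0 0 0 0))
       (.goto (call 15 0 0 0 0 0 0)))
     (.goto (call 0 0 0 0 0 0 0)),
   .cond (.reg 10)
     (.cond (.reg 10 - 1)
       (.add (call 17 (.reg 9) (.reg 10 / 2) 0 0 0 0)
         (call 17 (.reg 9 + .reg 10 / 2) (.reg 10 - .reg 10 / 2) 0 0 0 0))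
       (.goto (call 16 (.reg 9) 0 0 0 0 0)))
     (bitLeaf 0),
   .add (call 17 0 termsE 0 0 0 0) (call 2 0 0 0 0 0 0),
   .leaf (.cond (lt (.reg 2) bitsE)
     (.lut 240 (bitOf widthE (.reg 2 + bitsE * dimE) (call 18 0 0 0 0 0 0)) [] []) (.const false)),
   .mul (call 1 0 0 0 0 0 0) (call 19 0 0 0 0 0 0)]

/-- The arithmetic procedures, selected by their number in register `6`. -/
def arithBody : AStep := .switch (.reg 6) arithProcs 0

/-- Bit `i` of the arithmetic call number `t` with the parameters `u` and `q`. -/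
def arithBit (t : ℕ) (i u q : Expr) : List Expr :=
  bitOf widthE i [.lit t, u, q, 0, 0, 0, 0, 0, 0]

/-- The value of a call. -/
def copy (k : List Expr) : Step := .lut 240 k [] []

/-- The number with the only bit `s` at position `0`. -/
def atZero (t : Expr) (s : Step) : Step := .cond t (.const false) s

/-- Whether an expression has a nonzero value. -/
def test (e : Expr) : Step := .cond e (.const true) (.const false)

/-- The gate of an unknown. -/
def gateE (R : Expr) : Expr := R / (.reg 0 * .reg 0 * 3)
/-- The type of an unknown. -/
def typeE (R : Expr) : Expr := R / (.reg 0 * .reg 0) % 3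
/-- The first index of an unknown. -/
def rowE (R : Expr) : Expr := R / .reg 0 % .reg 0
/-- The second index of an unknown. -/
def colE (R : Expr) : Expr := R % .reg 0
/-- The position of an unknown. -/
def idxE (h : Expr) (t : ℕ) (i : Expr) : Expr := ((h * 3 + .lit t) * .reg 0 + i) * .reg 0
/-- The last gate of the system with number `q`. -/
def lastE (u q : Expr) : Expr := .ite (lt q (.reg 0)) q (sizeE u - 1)
/-- The column that is replaced in the system with number `q`. -/
def colUnknownE (u q : Expr) : Expr := idxE (sizeE u - 1) 0 ((q - .reg 0) / .reg 0)
/-- The equation whose right-hand side is `1` in the system with number `q`. -/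
def rhsE (u q : Expr) : Expr := idxE (sizeE u - 1) 2 ((q - .reg 0) % .reg 0)
/-- Whether a column is replaced in the system with number `q`. -/
def replacedE (u q C : Expr) : Expr := (1 - lt q (.reg 0)) * eq C (colUnknownE u q)
/-- Whether an unknown occurs in the system with number `q`. -/
def validE (u q R : Expr) : Expr := lt (gateE R) (lastE u q + 1) * lt (rowE R) (sideE u) *
  .ite (eq (typeE R) 1) (lt (colE R) (sideE u)) (eq (colE R) 0)

/-- The call for a coefficient of a system. -/
def coeffCall (t : ℕ) : List Expr :=
  [.lit t, .reg 2, lastE (.reg 2) (.reg 3), gateE (.reg 4), typeE (.reg 4), rowE (.reg 4),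
    colE (.reg 4), gateE (.reg 5), typeE (.reg 5), rowE (.reg 5), colE (.reg 5), .reg 6]

/-- The bit of the formula in position `o` of gate `h`, with the parameters in register `2`. -/
def nodeBit (h : Expr) (o : ℕ) : List Expr := [3, nodeE (.reg 2) h + .lit o]

/-- The bits of the positive part of a coefficient. -/
def posStep : Step :=
  .cond (eq (.reg 5) 0 * eq (.reg 9) 0)
    (.cond (eq (.reg 6) (.reg 10))
      (.cond (eq (.reg 4) (.reg 8)) (atZero (.reg 12) (.lut 15 (nodeBit (.reg 4) 2) [] []))
        (.cond (eq (.reg 8 + 1) (.reg 4)) (atZero (.reg 12) (copy (nodeBit (.reg 4) 2)))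
          (.const false))) (.const false))
  (.cond (eq (.reg 5) 1 * eq (.reg 9) 1)
    (.cond (eq (.reg 4) (.reg 8) * eq (.reg 6) (.reg 10) * eq (.reg 7) (.reg 11))
      -- Register `12` is the bit position. The coefficient is a denominator at a leaf and `1`
      -- elsewhere, so bit `0` is the implication with table `207`, and a higher bit is a
      -- conjunction.
      (.cond (.reg 12)
        (.lut 192 [9, .reg 2, .reg 4] [8, .reg 2, .reg 4, .reg 6, .reg 7, 1, .reg 12] [])
        (.lut 207 [9, .reg 2, .reg 4] [8, .reg 2, .reg 4, .reg 6, .reg 7, 1, .reg 12] []))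
      (.const false))
  (.cond (eq (.reg 5) 1 * eq (.reg 9) 2)
    (.cond (eq (.reg 4) (.reg 8) * eq (.reg 7) (.reg 10))
      (.lut 128 [9, .reg 2, .reg 4] [7, .reg 2, .reg 4, .reg 6, .reg 7, 0]
        [8, .reg 2, .reg 4, .reg 6, .reg 7, 0, .reg 12])
      (.const false))
  (.cond (eq (.reg 5) 2 * eq (.reg 9) 2)
    (.cond (eq (.reg 4) (.reg 8) * eq (.reg 6) (.reg 10)) (atZero (.reg 12) (.const true))
      (.const false))
    (.const false))))

/-- The bits of the negative part of a coefficient. -/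
def negStep : Step :=
  .cond (eq (.reg 5) 0 * eq (.reg 9) 0)
    (.cond (eq (.reg 6) (.reg 10))
      (.cond (eq (.reg 8 + 1) (.reg 4))
        (atZero (.reg 12) (.lut 48 (nodeBit (.reg 4) 1) (nodeBit (.reg 4) 0) []))
        (atZero (.reg 12) (.lut 192 (nodeBit (.reg 4) 1)
          [5, nodeE (.reg 2) (.reg 4) + 4, fieldE (.reg 2), .reg 8] []))) (.const false))
  (.cond (eq (.reg 5) 0 * eq (.reg 9) 1)
    (.cond (eq (.reg 4) (.reg 8) * eq (.reg 6) (.reg 10))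
      (atZero (.reg 12) (copy [9, .reg 2, .reg 4])) (.const false))
  (.cond (eq (.reg 5) 0 * eq (.reg 9) 2)
    (.cond (eq (.reg 4) (.reg 8) * eq (.reg 6) (.reg 10))
      (atZero (.reg 12) (copy (nodeBit (.reg 4) 2))) (.const false))
  (.cond (eq (.reg 5) 1 * eq (.reg 9) 2)
    (.cond (eq (.reg 4) (.reg 8) * eq (.reg 7) (.reg 10))
      (.lut 32 [9, .reg 2, .reg 4] [7, .reg 2, .reg 4, .reg 6, .reg 7, 0]
        [8, .reg 2, .reg 4, .reg 6, .reg 7, 0, .reg 12])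
      (.const false))
  (.cond (eq (.reg 5) 2 * eq (.reg 9) 2)
    (.cond (eq (.reg 6) (.reg 10))
      (.cond (eq (.reg 4 + 1) (.reg 8)) (atZero (.reg 12) (copy (nodeBit (.reg 8) 1)))
        (atZero (.reg 12) (.lut 32 (nodeBit (.reg 8) 1) (nodeBit (.reg 8) 0)
          [5, nodeE (.reg 2) (.reg 8) + 4, fieldE (.reg 2), .reg 4]))) (.const false))
  (.cond (eq (.reg 5) 2 * eq (.reg 9) 0)
    (.cond (eq (.reg 6) (.reg 10))
      (.cond (eq (.reg 4 + 1) (.reg 8))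
        (.cond (lt (.reg 8) (.reg 3))
          (atZero (.reg 12) (.lut 252 (nodeBit (.reg 8) 2) [14, .reg 2, .reg 8 + 1, .reg 4] []))
          (atZero (.reg 12) (copy (nodeBit (.reg 8) 2))))
        (.cond (lt (.reg 8) (.reg 3))
          (atZero (.reg 12) (copy [14, .reg 2, .reg 8 + 1, .reg 4])) (.const false)))
      (.const false))
    (.const false))))))

/-- The bit of a leaf that is stored in the field of the matrix entries. -/
def variableCall : List Expr :=
  [6, 0, varsE (.reg 2), .reg 2, .reg 3, .reg 4, .reg 5, .reg 6]

/-- The number of bits of the output. -/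
def numOutE : Expr := 2 + bitsE + .reg 0 * .reg 0 * (2 * bitsE + 1)

/-- The number of an entry of the result. -/
def outEntryE : Expr := (.reg 3 - bitsE - 2) / (2 * bitsE + 1)

/-- The position in an entry of the result. -/
def outPosE : Expr := (.reg 3 - bitsE - 2) % (2 * bitsE + 1)

/-- The number of the system for an entry of the result. -/
def outSystemE : Expr :=
  .reg 0 + outEntryE / sideE (.reg 2) * .reg 0 + outEntryE % sideE (.reg 2)

/-- The bits of the output for the parameters in register `2`. -/
def outStep : Step :=
  .cond (.reg 3)
    (.cond (lt (.reg 3) (bitsE + 1)) (.const true)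
    (.cond (eq (.reg 3) (bitsE + 1)) (.const false)
    (.cond (lt outEntryE (sideE (.reg 2) * sideE (.reg 2)))
      (.cond outPosE
        (.cond (lt outPosE (bitsE + 1)) (copy [21, .reg 2, outSystemE, outPosE - 1])
          (copy [21, .reg 2, sizeE (.reg 2) - 1, outPosE - 1 - bitsE]))
        (.lut 60 (arithBit 19 (bitsE - 1) (.reg 2) outSystemE)
          (arithBit 19 (bitsE - 1) (.reg 2) (sizeE (.reg 2) - 1)) []))
      (.const false))))
    (copy [16, 0, sizeE (.reg 2), .reg 2])

/-- The Boolean procedures. -/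
def procs : List Step :=
  -- 0 to 2 serve the arithmetic, 3 to 5 read bits and fields of the input, 6 to 9 give the data of
  -- leaves, 10 to 14 the matrix entries, 15 and 16 test regularity, 17 checks the header, 18 to 20
  -- form the output, and 21 is the magnitude of a determinant.
  [arithBody.bitStep widthE, arithBody.genStep widthE, arithBody.propStep widthE,
   .input (.reg 2),
   .range 192 true (fun lo len => [4, lo, len]) (.lut 15 [3, .reg 2] [] []),
   .cond (.reg 4)
     (.cond (.reg 3)
       (.cond (.reg 4 % 2)
         (.lut 192 [5, .reg 2 + 1, .reg 3 - 1, .reg 4 / 2] [3, .reg 2] [])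
         (.lut 48 [5, .reg 2 + 1, .reg 3 - 1, .reg 4 / 2] [3, .reg 2] []))
       (.const false))
     (copy [4, .reg 2, .reg 3]),
   .range 252 false (fun lo len => [6, lo, len, .reg 4, .reg 5, .reg 6, .reg 7, .reg 8])
     (.lut 192 [5, nodeE (.reg 4) (.reg 5) + 4, fieldE (.reg 4), .reg 2]
       [3, entryE (.reg 4) (.reg 2) (.reg 6) (.reg 7) + .reg 8] []),
   .cond (eq (.reg 4) (.reg 5) + eq (.reg 6) 0 + lt (fieldE (.reg 2)) (.reg 6))
     (.lut 202 (nodeBit (.reg 3) 0) variableCall [3, nodeE (.reg 2) (.reg 3) + 3 + .reg 6])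
     (.lut 192 (nodeBit (.reg 3) 0) variableCall []),
   .cond (lt (.reg 7) (fieldE (.reg 2)))
     (copy [7, .reg 2, .reg 3, .reg 4, .reg 5, 1 + .reg 6 * fieldE (.reg 2) + .reg 7])
     (.const false),
   .lut 3 (nodeBit (.reg 3) 1) (nodeBit (.reg 3) 2) [],
   .cond (replacedE (.reg 2) (.reg 3) (.reg 5))
     (atZero (.reg 6) (test (eq (.reg 4) (rhsE (.reg 2) (.reg 3)))))
     (.cond (validE (.reg 2) (.reg 3) (.reg 4) * validE (.reg 2) (.reg 3) (.reg 5))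
       (copy (coeffCall 12)) (atZero (.reg 6) (test (eq (.reg 4) (.reg 5))))),
   .cond (replacedE (.reg 2) (.reg 3) (.reg 5))
     (.const false)
     (.cond (validE (.reg 2) (.reg 3) (.reg 4) * validE (.reg 2) (.reg 3) (.reg 5))
       (copy (coeffCall 13)) (.const false)),
   posStep,
   negStep,
   .lut 128 (nodeBit (.reg 3) 0) (nodeBit (.reg 3) 1)
     [5, nodeE (.reg 2) (.reg 3) + 4, fieldE (.reg 2), .reg 4],
   .range 252 false (fun lo len => [15, lo, len, .reg 4, .reg 5])
     (copy (arithBit 19 (.reg 2) (.reg 4) (.reg 5))),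
   .range 192 true (fun lo len => [16, lo, len, .reg 4]) (copy [15, 0, bitsE, .reg 4, .reg 2]),
   .range 192 true (fun lo len => [17, lo, len, .reg 4])
     (.cond (eq (.reg 2) (varsE (.reg 4)) +
         eq (.reg 2) (varsE (.reg 4) + sideE (.reg 4) + 1) +
         eq (.reg 2) (varsE (.reg 4) + sideE (.reg 4) + sizeE (.reg 4) + 2) +
         eq (.reg 2) (varsE (.reg 4) + sideE (.reg 4) + sizeE (.reg 4) + fieldE (.reg 4) + 3))
       (.lut 15 [3, .reg 2] [] []) (copy [3, .reg 2])),
   copy [19, 0, .reg 0 * .reg 0 * .reg 0 * .reg 0, .reg 2],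
   .range 252 false (fun lo len => [19, lo, len, .reg 4])
     (.lut 192 [17, 0, headE (.reg 2), .reg 2] [20, .reg 2, .reg 4] []),
   outStep,
   .lut 202 (arithBit 19 (bitsE - 1) (.reg 2) (.reg 3)) (arithBit 20 (.reg 4) (.reg 2) (.reg 3))
     (arithBit 19 (.reg 4) (.reg 2) (.reg 3))]

/-- All procedures, selected by their number in register `1`. -/
def prog : Step := .switch (.reg 1) procs 0

theorem run_prog (x : List Bool) (V : List ℕ → Bool) (N t : ℕ) (a : List ℕ) :
    prog.run x V (regs N (t :: a)) = (procs.getD t (.const false)).run x V (regs N (t :: a)) :=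
  Step.run_switch x V _ _ procs 0 t (by simp [regs])

/-- The bit length of the determinants. -/
@[irreducible] def bits (N : ℕ) : ℕ := (N + 2) ^ 12

/-- Output positions are arguments of calls and have to be digits in base `(N + 2) ^ 19`. -/
theorem numOut_le (N : ℕ) : 2 + bits N + N * N * (2 * bits N + 1) ≤ (N + 2) ^ 19 := by
  have h1 : N * N ≤ (N + 2) ^ 2 := by nlinarith
  have h2 : 1 ≤ bits N := by rw [bits]; exact Nat.one_le_pow _ _ (by omega)
  have h3 : N * N * (2 * bits N + 1) ≤ (N + 2) ^ 2 * (3 * bits N) := Nat.mul_le_mul h1 (by omega)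
  have h4 : 2 ^ 2 ≤ (N + 2) ^ 2 := Nat.pow_le_pow_left (by omega) 2
  have h5 : 2 ^ 5 ≤ (N + 2) ^ 5 := Nat.pow_le_pow_left (by omega) 5
  have h6 : (N + 2) ^ 19 = (N + 2) ^ 5 * ((N + 2) ^ 2 * bits N) := by rw [bits]; ring
  have h7 : 2 ^ 5 * ((N + 2) ^ 2 * bits N) ≤ (N + 2) ^ 5 * ((N + 2) ^ 2 * bits N) :=
    Nat.mul_le_mul_right _ h5
  nlinarith [Nat.mul_le_mul_right (bits N) h4]

/-- The machine that evaluates formulas. -/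
def machine : ArithMachine where
  prog := prog
  -- The exponent exceeds `18`, that of the bit width, so that bit positions and lengths of ranges
  -- are single digits.
  expo := 19
  digits := 14
  -- The constant of `outTime_le`.
  speed := 1000 * 40 ^ 4
  numOut N := 2 + bits N + N * N * (2 * bits N + 1)
  numOutE := numOutE
  outTag := 18
  eval_numOutE N g := by simp [numOutE, bitsE, baseE, logRegs, bits]
  numOut_le := numOut_le
  body := arithBody
  widthE := widthE
  width N := (N + 2) ^ 18
  eval_widthE σ := by simp [widthE, baseE]
  width_lt N := Nat.pow_lt_pow_right (by omega) (by norm_num)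
  fourteen_le := le_rfl
  expo_pos := by norm_num
  run_bit x V N a := run_prog x V N 0 a
  run_gen x V N a := run_prog x V N 1 a
  run_prop x V N a := run_prog x V N 2 a

end Evaluator

end RatEval

namespace RatEval

/-! ### Gate tables as bit strings -/

/-- The number with the binary digits `f 0, …, f (len - 1)`. -/
def number (f : ℕ → Bool) (len : ℕ) : ℕ := Nat.ofBits fun i : Fin len => f i

theorem testBit_number (f : ℕ → Bool) (len t : ℕ) :
    (number f len).testBit t = (decide (t < len) && f t) := by
  by_cases h : t < len
  · simp [number, Nat.testBit_ofBits_lt _ _ h, h]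
  · simp [number, Nat.testBit_ofBits_ge _ _ (not_lt.1 h), h]

theorem number_lt (f : ℕ → Bool) (len : ℕ) : number f len < 2 ^ len := Nat.ofBits_lt_two_pow _

theorem number_succ (f : ℕ → Bool) (len : ℕ) :
    number f (len + 1) = 2 * number (fun t => f (t + 1)) len + (f 0).toNat := by
  rw [number, Nat.ofBits_succ]; rfl

/-- The parameters of an encoded instance. -/
structure Shape where
  vars : ℕ
  side : ℕ
  size : ℕ
  width : ℕ

namespace Shape

/-- The parameters as the digits of a number. -/
def decode (N u : ℕ) : Shape := ⟨u % N, u / N % N, u / (N * N) % N, u / (N * N * N)⟩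

variable (p : Shape)

/-- The length of the header. -/
def head : ℕ := p.vars + p.side + p.size + p.width + 4
/-- The position of a gate. -/
def node (h : ℕ) : ℕ := p.head + h * (2 * p.width + 4)
/-- The position of a matrix entry. -/
def entry (k i j : ℕ) : ℕ := p.node p.size + ((k * p.side + i) * p.side + j) * (2 * p.width + 1)

/-- The parameters are smaller than `N`. -/
structure Small (N : ℕ) : Prop where
  vars : p.vars < N
  side : p.side < N
  size : p.size < N
  width : p.width < N

variable {p}

theorem Small.node_lt {N h o : ℕ} (hp : p.Small N) (hh : h ≤ N) (ho : o ≤ 3 * N + 5) :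
    p.node h + o < (N + 2) ^ 19 := by
  have h1 := hp.vars
  have h2 := hp.side
  have h3 := hp.size
  have h4 := hp.width
  have h5 : h * (2 * p.width + 4) ≤ N * (2 * N + 4) := Nat.mul_le_mul hh (by omega)
  have h6 : (N + 2) ^ 6 ≤ (N + 2) ^ 19 := Nat.pow_le_pow_right (by omega) (by norm_num)
  have h7 : 2 ^ 4 ≤ (N + 2) ^ 4 := Nat.pow_le_pow_left (by omega) 4
  have h8 := Nat.mul_le_mul_right ((N + 2) ^ 2) h7
  rw [node, head]
  nlinarith

theorem Small.entry_lt {N k i j o : ℕ} (hp : p.Small N) (hk : k < p.vars) (hi : i < p.side)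
    (hj : j < p.side) (ho : o ≤ 3 * N + 5) : p.entry k i j + o < (N + 2) ^ 19 := by
  have h1 := hp.vars
  have h2 := hp.side
  have h3 := hp.size
  have h4 := hp.width
  have h5 : p.size * (2 * p.width + 4) ≤ N * (2 * N + 4) := Nat.mul_le_mul (by omega) (by omega)
  have a1 : k * p.side + i + 1 ≤ N * N := by nlinarith
  have a2 : (k * p.side + i) * p.side + j + 1 ≤ N * N * N := by nlinarith
  have a3 : ((k * p.side + i) * p.side + j) * (2 * p.width + 1) ≤ (N * N * N) * (2 * N) :=
    Nat.mul_le_mul (by omega) (by omega)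
  have h6 : (N + 2) ^ 8 ≤ (N + 2) ^ 19 := Nat.pow_le_pow_right (by omega) (by norm_num)
  have h7 : 2 ^ 4 ≤ (N + 2) ^ 4 := Nat.pow_le_pow_left (by omega) 4
  have h8 := Nat.mul_le_mul_right ((N + 2) ^ 4) h7
  have h9 : 2 ^ 2 ≤ (N + 2) ^ 2 := Nat.pow_le_pow_left (by omega) 2
  have h10 := Nat.mul_le_mul_right ((N + 2) ^ 2) h9
  have h11 : N * N * N * (2 * N) ≤ 2 * (N + 2) ^ 4 := by
    calc N * N * N * (2 * N) = 2 * N ^ 4 := by ring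
      _ ≤ 2 * (N + 2) ^ 4 := by gcongr; omega
  have h12 : N * (2 * N + 4) + 8 ≤ 2 * (N + 2) ^ 2 := by nlinarith
  have h13 : 7 * N + 5 ≤ 4 * (N + 2) ^ 2 := by nlinarith
  have h14 : (N + 2) ^ 4 = (N + 2) ^ 2 * (N + 2) ^ 2 := by ring
  have h15 : (N + 2) ^ 8 = (N + 2) ^ 4 * (N + 2) ^ 4 := by ring
  rw [entry, node, head]
  generalize ((k * p.side + i) * p.side + j) * (2 * p.width + 1) = e1 at *
  generalize p.size * (2 * p.width + 4) = e2 at *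
  generalize (N + 2) ^ 19 = e3 at *
  generalize (N + 2) ^ 2 = e5 at *
  generalize (N + 2) ^ 4 = e4 at *
  generalize (N + 2) ^ 8 = e6 at *
  generalize N * N * N * (2 * N) = e7 at *
  generalize N * (2 * N + 4) = e8 at *
  omega

end Shape

namespace Table

variable (x : List Bool) (p : Shape)

/-- Bit `o` of the entry `i, j` of leaf `h`. -/
def leafBit (h i j o : ℕ) : Bool :=
  if x.getD (p.node h) false then
    anyIn (fun k => decide (number (fun t => x.getD (p.node h + 4 + t) false) p.width = k) &&
      x.getD (p.entry k i j + o) false) 0 p.vars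
  -- Off the diagonal of a constant the numerator is masked out while sign and denominator remain,
  -- which leaves the number `0`.
  else (decide (i = j) || decide (o = 0) || decide (p.width < o)) &&
    x.getD (p.node h + 3 + o) false

/-- The table that is written in a bit string. -/
def ofBits : Table where
  k₀ h := x.getD (p.node h) false
  k₁ h := x.getD (p.node h + 1) false
  k₂ h := x.getD (p.node h + 2) false
  lft h := number (fun t => x.getD (p.node h + 4 + t) false) p.width
  neg h i j := leafBit x p h i j 0
  num h i j := number (fun t => leafBit x p h i j (1 + t)) p.width
  den h i j := number (fun t => leafBit x p h i j (1 + p.width + t)) p.width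

end Table

namespace Evaluator

section

variable (σ : ℕ → ℕ) (u h k i j : Expr)

@[simp] theorem eval_varsE : (varsE u).eval σ = (Shape.decode (σ 0) (u.eval σ)).vars := rfl
@[simp] theorem eval_sideE : (sideE u).eval σ = (Shape.decode (σ 0) (u.eval σ)).side := rfl
@[simp] theorem eval_sizeE : (sizeE u).eval σ = (Shape.decode (σ 0) (u.eval σ)).size := rfl
@[simp] theorem eval_fieldE : (fieldE u).eval σ = (Shape.decode (σ 0) (u.eval σ)).width := rfl
@[simp] theorem eval_headE : (headE u).eval σ = (Shape.decode (σ 0) (u.eval σ)).head := rfl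
@[simp] theorem eval_nodeE :
    (nodeE u h).eval σ = (Shape.decode (σ 0) (u.eval σ)).node (h.eval σ) := rfl
@[simp] theorem eval_entryE : (entryE u k i j).eval σ =
    (Shape.decode (σ 0) (u.eval σ)).entry (k.eval σ) (i.eval σ) (j.eval σ) := rfl

end

variable {x : List Bool} {k : ℕ}

theorem machine_run (x : List Bool) (V : List ℕ → Bool) (N t : ℕ) (a : List ℕ) :
    machine.prog.run x V (regs N (t :: a)) =
      (procs.getD t (.const false)).run x V (regs N (t :: a)) := run_prog x V N t a

theorem machine_base (N : ℕ) : machine.base N = (N + 2) ^ 19 := rfl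

theorem forty_lt_base (N : ℕ) : 40 < machine.base N :=
  lt_of_lt_of_le (by norm_num) (Nat.pow_le_pow_left (Nat.le_add_left 2 N) 19)

theorem hasVal_input {pos : ℕ} (h : pos < machine.base x.length) :
    machine.HasVal x 1 [3, pos] (x.getD pos false) := by
  have := forty_lt_base x.length
  refine .of_run (T := 0) ⟨by simp [machine], by simp [h]; omega⟩ fun V hV => ?_
  rw [machine_run]
  rfl

theorem run_range (V : List ℕ → Bool) (σ : ℕ → ℕ) (τ : ℕ) (v : Bool)
    (self : Expr → Expr → List Expr) (s : Step) : (Step.range τ v self s).run x V σ =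
      if σ 3 = 0 then v else if σ 3 = 1 then s.run x V σ else
        lut τ (V ((self (.reg 2) (.reg 3 / 2)).map (Expr.eval σ)))
          (V ((self (.reg 2 + .reg 3 / 2) (.reg 3 - .reg 3 / 2)).map (Expr.eval σ))) (V []) := by
  simp only [Step.range, Step.run, Expr.eval_reg', Expr.eval_sub', Expr.eval_ofNat, List.map_nil]
  by_cases h0 : σ 3 = 0
  · simp [h0]
  · by_cases h1 : σ 3 = 1
    · simp [h1]
    · rw [if_neg h0, if_neg h0, if_neg h1, if_neg (by omega)]

theorem hasVal_allZero {lo len : ℕ} (h : lo + len < machine.base x.length)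
    (hk : machine.base x.length ≤ 2 ^ k) :
    machine.HasVal x (k + 2) [4, lo, len] (allIn (fun t => !x.getD t false) lo len) := by
  have h40 := forty_lt_base x.length
  refine (Machine.hasVal_all (T := 1) (K := lo + len) (α := fun lo len => [4, lo, len])
    (s := fun V i => !V [3, i]) (fun a b hab => ⟨by simp [machine], by simp; omega⟩)
    (fun V a b => ?_) (fun i hi V hV => ?_) (k := k) (by omega) le_rfl).mono (by omega)
  · rw [machine_run]
    simp [procs, run_range, Step.run, regs]
  · rw [hV _ _ (hasVal_input (by omega))]

theorem number_eq_zero {f : ℕ → Bool} {len : ℕ} : number f len = 0 ↔ ∀ t < len, f t = false := by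
  constructor
  · intro h t ht
    have := testBit_number f len t
    rw [h] at this
    simpa [ht] using this.symm
  · intro h
    refine Nat.eq_of_testBit_eq fun t => ?_
    rw [testBit_number]
    by_cases ht : t < len <;> simp [ht, h]

/-- The recursion halves `v` and not the field: the field may be as long as the input, but `v` has
only logarithmically many digits. When `v` has become `0`, the remaining digits are tested in a
balanced way. -/
theorem hasVal_eq_aux {v j : ℕ} (hk : machine.base x.length ≤ 2 ^ k) : ∀ {pos len : ℕ},
    pos + len < machine.base x.length → v < machine.base x.length → v < 2 ^ j →
    machine.HasVal x (k + 3 + j) [5, pos, len, v]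
      (decide (number (fun t => x.getD (pos + t) false) len = v)) := by
  have h40 := forty_lt_base x.length
  induction j generalizing v with
  | zero =>
    intro pos len h hv hj
    obtain rfl : v = 0 := by omega
    refine .of_run ⟨by simp [machine], by simp; omega⟩ fun V hV => ?_
    rw [machine_run]
    simp only [procs, Step.run, regs, copy, List.getD_cons_succ, List.getD_cons_zero,
      Expr.eval_reg', List.map_cons, Expr.eval_ofNat, List.map_nil, lut_copy, if_true]
    rw [hV _ _ (hasVal_allZero h hk)]
    rw [Bool.eq_iff_iff, allIn_eq_true, decide_eq_true_eq, number_eq_zero]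
    simp
  | succ j ih =>
    intro pos len h hv hj
    by_cases hv0 : v = 0
    · exact (ih (v := v) h hv (by rw [hv0]; positivity)).mono (by omega)
    refine Machine.HasVal.of_run (T := k + 3 + j) ⟨by simp [machine], by simp; omega⟩ fun V hV => ?_
    rw [machine_run]
    cases len with
    | zero =>
      simp [procs, Step.run, regs, number, hv0, Ne.symm hv0]
    | succ len =>
      have i1 := hV _ _ (ih (v := v / 2) (pos := pos + 1) (len := len) (by omega) (by omega)
        (by rw [pow_succ] at hj; omega))
      have i2 := hV _ _ ((hasVal_input (x := x) (pos := pos) (by omega)).mono (T' := k + 3 + j) (by omega))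
      rw [number_succ]
      simp only [add_zero]
      simp only [show ∀ t, pos + 1 + t = pos + (t + 1) by intro t; omega] at i1
      generalize number (fun t => x.getD (pos + (t + 1)) false) len = w at *
      by_cases hm : v % 2 = 0
      · simp only [procs, Step.run, regs, List.getD_cons_succ, List.getD_cons_zero,
          Expr.eval_reg', List.map_cons, Expr.eval_ofNat, List.map_nil, lut_and_not, hv0, if_false,
          Expr.eval_mod', Expr.eval_add', Expr.eval_sub', Expr.eval_div', hm, if_true,
          Nat.add_sub_cancel, Nat.succ_ne_zero, i1, i2]
        cases x.getD pos false <;> simp <;> omega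
      · simp only [procs, Step.run, regs, List.getD_cons_succ, List.getD_cons_zero,
          Expr.eval_reg', List.map_cons, Expr.eval_ofNat, List.map_nil, lut_and, hv0, if_false,
          Expr.eval_mod', Expr.eval_add', Expr.eval_sub', Expr.eval_div', hm,
          Nat.add_sub_cancel, Nat.succ_ne_zero, i1, i2]
        cases x.getD pos false <;> simp <;> omega

theorem hasVal_eq {v pos len : ℕ} (hk : machine.base x.length ≤ 2 ^ k)
    (h : pos + len < machine.base x.length) (hv : v < machine.base x.length) :
    machine.HasVal x (2 * k + 3) [5, pos, len, v]
      (decide (number (fun t => x.getD (pos + t) false) len = v)) :=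
  (hasVal_eq_aux hk h hv (hv.trans_le hk)).mono (by omega)

/-- The number `u` encodes admissible parameters `p`. -/
structure IsCode (x : List Bool) (u : ℕ) (p : Shape) : Prop where
  decode : Shape.decode x.length u = p
  small : p.Small x.length
  lt : u < machine.base x.length

end Evaluator

end RatEval

/-! ### Leaf data and positive coefficients read from the input -/

namespace RatEval

namespace Evaluator

variable {x : List Bool} {k u : ℕ} {p : Shape}

section

variable (hc : IsCode x u p) (hk : machine.base x.length ≤ 2 ^ k)
include hc

theorem IsCode.node_lt {h o : ℕ} (hh : h ≤ x.length) (ho : o ≤ 3 * x.length + 5) :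
    p.node h + o < machine.base x.length := hc.small.node_lt hh ho

theorem lt_base {d : ℕ} (h : d ≤ 3 * x.length + 5) : d < machine.base x.length := by
  have := hc.node_lt (h := 0) (o := d) (Nat.zero_le _) h
  omega

theorem hasVal_node {h o : ℕ} (hh : h ≤ x.length) (ho : o ≤ 3 * x.length + 5) :
    machine.HasVal x 1 [3, p.node h + o] (x.getD (p.node h + o) false) :=
  hasVal_input (hc.node_lt hh ho)

include hk

/-- The position of an input bit cannot depend on other input bits, so indirect addressing is
replaced by a disjunction over all variables, in which the stored index is compared with each
candidate. -/
theorem hasVal_variable {h i j o : ℕ} (hh : h < x.length) (hi : i < p.side) (hj : j < p.side)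
    (ho : o ≤ 3 * x.length + 5) : machine.HasVal x (3 * k + 4) [6, 0, p.vars, u, h, i, j, o]
      (anyIn (fun k => decide (number (fun t => x.getD (p.node h + 4 + t) false) p.width = k) &&
        x.getD (p.entry k i j + o) false) 0 p.vars) := by
  have h40 := forty_lt_base x.length
  have hs := hc.small
  have b1 := lt_base hc (d := x.length) (by omega)
  have b2 := lt_base hc (d := o) (by omega)
  have := hs.side
  have := hs.vars
  have := hs.width
  have hu := hc.lt
  have hd := hc.decode
  have := (Nat.lt_two_pow_self (n := k))
  refine (Machine.hasVal_any (T := 2 * k + 3) (K := p.vars)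
    (α := fun lo len => [6, lo, len, u, h, i, j, o])
    (s := fun V l => V [5, p.node h + 4, p.width, l] && V [3, p.entry l i j + o])
    (fun a b hab => ⟨by simp [machine], by simp; omega⟩)
    (fun V a b => ?_) (fun l hl V hV => ?_) (k := k) (by omega) (by omega)).mono (by omega)
  · rw [machine_run]
    simp [procs, run_range, Step.run, regs, hd]
  · rw [hV _ _ (hasVal_eq hk (by rw [add_assoc]; exact hc.node_lt hh.le (by omega)) (by omega)),
      hV _ _ ((hasVal_input (hs.entry_lt hl hi hj ho)).mono (by omega))]

theorem hasVal_leafBit {h i j o : ℕ} (hh : h < x.length) (hi : i < p.side) (hj : j < p.side)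
    (ho : o ≤ 3 * x.length) : machine.HasVal x (3 * k + 5) [7, u, h, i, j, o]
      (Table.leafBit x p h i j o) := by
  have h40 := forty_lt_base x.length
  have hs := hc.small
  have b1 := lt_base hc (d := x.length) (by omega)
  have b2 := lt_base hc (d := o) (by omega)
  have := hs.side
  have hu := hc.lt
  have hd := hc.decode
  refine .of_run ⟨by simp [machine], by simp; omega⟩ fun V hV => ?_
  have v1 := hV _ _ ((hasVal_node hc (h := h) (o := 0) hh.le (by omega)).mono (by omega))
  have v2 := hV _ _ ((hasVal_node hc (h := h) (o := 3 + o) hh.le (by omega)).mono (by omega))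
  have v3 := hV _ _ ((hasVal_variable hc hk (o := o) hh hi hj (by omega)).mono (by omega))
  rw [← add_assoc] at v2
  rw [add_zero] at v1
  rw [machine_run, Table.leafBit]
  by_cases hcond : i = j ∨ o = 0 ∨ p.width < o
  · have e : (if i = j then 1 else 0) + (if o = 0 then 1 else 0) + (if p.width < o then 1 else 0) ≠
        0 := by
      rcases hcond with h | h | h <;> simp [h]
    have e' : (decide (i = j) || decide (o = 0) || decide (p.width < o)) = true := by
      rcases hcond with h | h | h <;> simp [h]
    simp only [procs, Step.run, regs, nodeBit, variableCall, List.getD_cons_succ,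
      List.getD_cons_zero, Expr.eval_reg', List.map_cons, Expr.eval_ofNat, List.map_nil,
      lut_mux, Expr.eval_add', Expr.eval_eq, Expr.eval_lt, eval_fieldE, eval_nodeE, eval_varsE, hd,
      e, if_false, Expr.eval_lit', add_zero, v1, v2, v3, e', Bool.true_and]
  · push Not at hcond
    obtain ⟨c1, c2, c3⟩ := hcond
    have c3' := not_lt.2 c3
    simp only [procs, Step.run, regs, nodeBit, variableCall, List.getD_cons_succ,
      List.getD_cons_zero, Expr.eval_reg', List.map_cons, Expr.eval_ofNat, List.map_nil,
      lut_and, Expr.eval_add', Expr.eval_eq, Expr.eval_lt, eval_fieldE, eval_nodeE, eval_varsE, hd,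
      Expr.eval_lit', add_zero, v1, v2, v3, c1, c2, c3', if_false, if_true]
    cases x.getD (p.node h) false <;> simp

theorem hasVal_field {h i j s t : ℕ} (hh : h < x.length) (hi : i < p.side) (hj : j < p.side)
    (hs : s ≤ 1) (ht : t < machine.base x.length) :
    machine.HasVal x (3 * k + 6) [8, u, h, i, j, s, t]
      (decide (t < p.width) && Table.leafBit x p h i j (1 + s * p.width + t)) := by
  have h40 := forty_lt_base x.length
  have hs' := hc.small
  have b1 := lt_base hc (d := x.length) (by omega)
  have := hs'.side
  have := hs'.width
  have hu := hc.lt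
  have hd := hc.decode
  refine .of_run ⟨by simp [machine], by simp; omega⟩ fun V hV => ?_
  rw [machine_run]
  by_cases hcond : t < p.width
  · have : s * p.width ≤ p.width := by nlinarith
    have v1 := hV _ _ ((hasVal_leafBit hc hk (o := 1 + s * p.width + t) hh hi hj (by omega)).mono
      (by omega))
    simp [procs, Step.run, regs, copy, hd, hcond, v1]
  · simp [procs, Step.run, regs, copy, hd, hcond]

omit hk in
theorem hasVal_leaf {h : ℕ} (hh : h < x.length) :
    machine.HasVal x 2 [9, u, h] ((Table.ofBits x p).leaf h) := by
  have h40 := forty_lt_base x.length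
  have b1 := lt_base hc (d := x.length) (by omega)
  have hu := hc.lt
  have hd := hc.decode
  refine .of_run ⟨by simp [machine], by simp; omega⟩ fun V hV => ?_
  have v1 := hV _ _ (hasVal_node hc (h := h) (o := 1) hh.le (by omega))
  have v2 := hV _ _ (hasVal_node hc (h := h) (o := 2) hh.le (by omega))
  rw [machine_run]
  simp only [procs, Step.run, regs, nodeBit, List.getD_cons_succ,
      List.getD_cons_zero, Expr.eval_reg', List.map_cons, Expr.eval_ofNat, List.map_nil,
      lut_nor, Expr.eval_add', eval_nodeE, hd, Expr.eval_lit', v1, v2]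
  rfl

theorem hasVal_left {h c : ℕ} (hh : h ≤ x.length) (hc' : c < x.length) :
    machine.HasVal x (2 * k + 3) [5, p.node h + 4, p.width, c]
      (decide ((Table.ofBits x p).lft h = c)) := by
  have := hc.small.width
  exact hasVal_eq hk (by rw [add_assoc]; exact hc.node_lt hh (by omega))
    (lt_base hc (by omega))

theorem hasVal_mulLeft {h c : ℕ} (hh : h ≤ x.length) (hc' : c < x.length) :
    machine.HasVal x (2 * k + 4) [14, u, h, c] ((Table.ofBits x p).k₀ h && (Table.ofBits x p).k₁ h &&
      decide ((Table.ofBits x p).lft h = c)) := by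
  have h40 := forty_lt_base x.length
  have b1 := lt_base hc (d := x.length) (by omega)
  have hu := hc.lt
  have hd := hc.decode
  refine .of_run ⟨by simp [machine], by simp; omega⟩ fun V hV => ?_
  have v0 := hV _ _ ((hasVal_node hc (h := h) (o := 0) hh (by omega)).mono (by omega))
  have v1 := hV _ _ ((hasVal_node hc (h := h) (o := 1) hh (by omega)).mono (by omega))
  have v2 := hV _ _ (hasVal_left hc hk hh hc')
  rw [machine_run]
  rw [add_zero] at v0
  simp only [procs, Step.run, regs, nodeBit, List.getD_cons_succ,
      List.getD_cons_zero, Expr.eval_reg', List.map_cons, Expr.eval_ofNat, List.map_nil,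
      lut_and3, Expr.eval_add', eval_nodeE, hd, Expr.eval_lit', v1, v2, eval_fieldE, add_zero, v0]
  rfl

end

theorem testBit_toNat (b : Bool) (t : ℕ) : b.toNat.testBit t = (decide (t = 0) && b) := by
  cases b <;> cases t <;> simp [Nat.testBit_succ]

theorem testBit_one (t : ℕ) : Nat.testBit 1 t = decide (t = 0) := by
  cases t <;> simp [Nat.testBit_succ]

theorem lut_imp (a b e : Bool) : lut 207 a b e = (!a || b) := by revert a b e; decide

/-- The bits of the positive part of a coefficient. -/
theorem hasVal_posCoeff (hc : IsCode x u p) (hk : machine.base x.length ≤ 2 ^ k)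
    {g h t i j h' t' i' j' s : ℕ} (hg : g < x.length) (hh : h ≤ g) (ht : t < 3)
    (hi : i < p.side) (hj : t = 1 → j < p.side) (hj0 : t ≠ 1 → j = 0)
    (hh' : h' ≤ g) (ht' : t' < 3) (hi' : i' < p.side)
    (hj' : j' < x.length) (hs : s < machine.base x.length) :
    machine.HasVal x (3 * k + 7) [12, u, g, h, t, i, j, h', t', i', j', s]
      (((Table.ofBits x p).posCoeff h t i j h' t' i' j').testBit s) := by
  have h40 := forty_lt_base x.length
  have b1 := lt_base hc (d := x.length) (by omega)
  have hu := hc.lt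
  have hd := hc.decode
  have := hc.small.side
  have hjx : j < x.length := by by_cases h1 : t = 1 <;> [have := hj h1; have := hj0 h1] <;> omega
  refine .of_run ⟨by simp [machine], by simp; omega⟩ fun V hV => ?_
  have v2 : V [3, p.node h + 2] = (Table.ofBits x p).k₂ h :=
    hV _ _ ((hasVal_node hc (h := h) (o := 2) (by omega) (by omega)).mono (by omega))
  have v3 := hV _ _ ((hasVal_leaf hc (h := h) (by omega)).mono (by omega))
  rw [machine_run]
  simp only [Table.posCoeff]
  generalize hτ : Table.ofBits x p = τ at *
  have ht3 : t = 0 ∨ t = 1 ∨ t = 2 := by omega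
  have ht3' : t' = 0 ∨ t' = 1 ∨ t' = 2 := by omega
  rcases ht3 with rfl | rfl | rfl <;> rcases ht3' with rfl | rfl | rfl
  · by_cases c2 : i = i' <;> by_cases c3 : h = h' <;> by_cases c4 : h' + 1 = h <;>
      by_cases c5 : s = 0 <;>
      simp [procs, posStep, Step.run, regs, copy, nodeBit, atZero, hd, c2, c3, c4, c5,
        testBit_toNat, -Nat.testBit_zero] <;> subst_vars <;> simp [v2]
  · simp [procs, posStep, Step.run, regs]
  · simp [procs, posStep, Step.run, regs]
  · simp [procs, posStep, Step.run, regs]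
  · have v4 := hV _ _ ((hasVal_field hc hk (h := h) (i := i) (j := j) (s := 1) (t := s) (by omega) hi
      (hj rfl) le_rfl hs).mono (by omega))
    have e : (τ.den h i j).testBit s =
        (decide (s < p.width) && Table.leafBit x p h i j (1 + 1 * p.width + s)) := by
      rw [← hτ, one_mul]
      exact testBit_number (fun t => Table.leafBit x p h i j (1 + p.width + t)) _ _
    rw [← e] at v4
    by_cases c1 : h = h' ∧ i = i' ∧ j = j'
    · obtain ⟨rfl, rfl, rfl⟩ := c1
      rcases eq_or_ne s 0 with rfl | c5 <;> cases hl : τ.leaf h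
      · simp [procs, posStep, Step.run, regs, v3, v4, hl, lut_imp]
      · simp [procs, posStep, Step.run, regs, v3, v4, hl, lut_imp]
      · simp [procs, posStep, Step.run, regs, v3, v4, c5, hl, testBit_one]
      · simp [procs, posStep, Step.run, regs, v3, v4, c5, hl]
    · by_cases d1 : h = h' <;> by_cases d2 : i = i' <;> by_cases d3 : j = j' <;>
        simp [procs, posStep, Step.run, regs, d1, d2, d3]
      omega
  · have v4 := hV _ _ ((hasVal_field hc hk (h := h) (i := i) (j := j) (s := 0) (t := s) (by omega) hi
      (hj rfl) (by omega) hs).mono (by omega))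
    have v5 := hV _ _ ((hasVal_leafBit hc hk (h := h) (i := i) (j := j) (o := 0) (by omega) hi
      (hj rfl) (by omega)).mono (by omega))
    have e : (τ.num h i j).testBit s =
        (decide (s < p.width) && Table.leafBit x p h i j (1 + 0 * p.width + s)) := by
      rw [← hτ, zero_mul, add_zero]
      exact testBit_number (fun t => Table.leafBit x p h i j (1 + t)) _ _
    have e' : τ.neg h i j = Table.leafBit x p h i j 0 := by rw [← hτ]; rfl
    rw [← e] at v4
    rw [← e'] at v5
    by_cases d1 : h = h' <;> by_cases d2 : j = i' <;>
      simp [procs, posStep, Step.run, regs, d1, d2]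
    subst d1
    subst d2
    cases hl : τ.leaf h <;> cases hn : τ.neg h i j <;> simp [v3, v4, v5, hl, hn]
  · simp [procs, posStep, Step.run, regs]
  · simp [procs, posStep, Step.run, regs]
  · by_cases d1 : h = h' <;> by_cases d2 : i = i' <;> by_cases c5 : s = 0 <;>
      simp [procs, posStep, Step.run, regs, d1, d2, c5, atZero, testBit_one]

end Evaluator

end RatEval

/-! ### Negative coefficients and the entries of the systems -/

namespace RatEval

namespace Evaluator

variable {x : List Bool} {k u : ℕ} {p : Shape}

/-- The bits of the negative part of a coefficient. -/
theorem hasVal_negCoeff (hc : IsCode x u p) (hk : machine.base x.length ≤ 2 ^ k)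
    {g h t i j h' t' i' j' s : ℕ} (hg : g < x.length) (hh : h ≤ g) (ht : t < 3)
    (hi : i < p.side) (hj : t = 1 → j < p.side) (hj0 : t ≠ 1 → j = 0)
    (hh' : h' ≤ g) (ht' : t' < 3) (hi' : i' < p.side)
    (hj' : j' < x.length) (hs : s < machine.base x.length) :
    machine.HasVal x (3 * k + 7) [13, u, g, h, t, i, j, h', t', i', j', s]
      (((Table.ofBits x p).negCoeff g h t i j h' t' i').testBit s) := by
  have h40 := forty_lt_base x.length
  have b1 := lt_base hc (d := x.length) (by omega)
  have hu := hc.lt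
  have hd := hc.decode
  have := hc.small.side
  have hjx : j < x.length := by by_cases h1 : t = 1 <;> [have := hj h1; have := hj0 h1] <;> omega
  refine .of_run ⟨by simp [machine], by simp; omega⟩ fun V hV => ?_
  have n0 : ∀ h ≤ g, V [3, p.node h] = (Table.ofBits x p).k₀ h := fun h hh =>
    hV _ _ ((hasVal_node hc (h := h) (o := 0) (by omega) (by omega)).mono (by omega))
  have n1 : ∀ h ≤ g, V [3, p.node h + 1] = (Table.ofBits x p).k₁ h := fun h hh =>
    hV _ _ ((hasVal_node hc (h := h) (o := 1) (by omega) (by omega)).mono (by omega))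
  have n2 : ∀ h ≤ g, V [3, p.node h + 2] = (Table.ofBits x p).k₂ h := fun h hh =>
    hV _ _ ((hasVal_node hc (h := h) (o := 2) (by omega) (by omega)).mono (by omega))
  have v3 := hV _ _ ((hasVal_leaf hc (h := h) (by omega)).mono (by omega))
  have v5 : ∀ h c, h ≤ g → c ≤ g → V [5, p.node h + 4, p.width, c] =
      decide ((Table.ofBits x p).lft h = c) := fun h c hh hc' =>
    hV _ _ ((hasVal_left hc hk (h := h) (c := c) (by omega) (by omega)).mono (by omega))
  have v6 : ∀ h c, h ≤ g → c ≤ g → V [14, u, h + 1, c] =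
      ((Table.ofBits x p).k₀ (h + 1) && (Table.ofBits x p).k₁ (h + 1) &&
        decide ((Table.ofBits x p).lft (h + 1) = c)) := fun h c hh hc' =>
    hV _ _ ((hasVal_mulLeft hc hk (h := h + 1) (c := c) (by omega) (by omega)).mono (by omega))
  rw [machine_run]
  simp only [Table.negCoeff]
  generalize hτ : Table.ofBits x p = τ at *
  have ht3 : t = 0 ∨ t = 1 ∨ t = 2 := by omega
  have ht3' : t' = 0 ∨ t' = 1 ∨ t' = 2 := by omega
  rcases ht3 with rfl | rfl | rfl <;> rcases ht3' with rfl | rfl | rfl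
  · by_cases c2 : i = i' <;> by_cases c4 : h' + 1 = h <;> by_cases c5 : s = 0 <;>
      simp [procs, negStep, Step.run, regs, copy, nodeBit, atZero, hd, c2, c4, c5,
        testBit_toNat, -Nat.testBit_zero, n0 h hh, n1 h hh, v5 h h' hh hh']
  · rcases eq_or_ne h h' with rfl | c4 <;> by_cases c2 : i = i' <;> by_cases c5 : s = 0 <;>
      simp [procs, negStep, Step.run, regs, copy, atZero, *, testBit_toNat, -Nat.testBit_zero]
  · by_cases c2 : i = i' <;> by_cases c4 : h = h' <;> by_cases c5 : s = 0 <;>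
      simp [procs, negStep, Step.run, regs, copy, nodeBit, atZero, hd, c2, c4, c5,
        testBit_toNat, -Nat.testBit_zero, n2 h' hh']
  · simp [procs, negStep, Step.run, regs]
  · simp [procs, negStep, Step.run, regs]
  · have v4 := hV _ _ ((hasVal_field hc hk (h := h) (i := i) (j := j) (s := 0) (t := s) (by omega) hi
      (hj rfl) (by omega) hs).mono (by omega))
    have v5 := hV _ _ ((hasVal_leafBit hc hk (h := h) (i := i) (j := j) (o := 0) (by omega) hi
      (hj rfl) (by omega)).mono (by omega))
    have e : (τ.num h i j).testBit s =
        (decide (s < p.width) && Table.leafBit x p h i j (1 + 0 * p.width + s)) := by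
      rw [← hτ, zero_mul, add_zero]
      exact testBit_number (fun t => Table.leafBit x p h i j (1 + t)) _ _
    have e' : τ.neg h i j = Table.leafBit x p h i j 0 := by rw [← hτ]; rfl
    rw [← e] at v4
    rw [← e'] at v5
    by_cases d1 : h = h' <;> by_cases d2 : j = i' <;>
      simp [procs, negStep, Step.run, regs, d1, d2]
    subst d1
    subst d2
    cases hl : τ.leaf h <;> cases hn : τ.neg h i j <;> simp [v3, v4, v5, hl, hn]
  · by_cases c2 : i = i' <;> by_cases c4 : h + 1 = h' <;> by_cases c5 : s = 0 <;>
      by_cases c6 : h' < g <;>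
      simp [procs, negStep, Step.run, regs, copy, nodeBit, atZero, hd, c2, c4, c5, c6,
        testBit_toNat, -Nat.testBit_zero, n2 h' hh', v6 h' h hh' hh, Bool.and_assoc]
  · simp [procs, negStep, Step.run, regs]
  · by_cases c2 : i = i' <;> by_cases c4 : h + 1 = h' <;> by_cases c5 : s = 0 <;>
      simp [procs, negStep, Step.run, regs, copy, nodeBit, atZero, hd, c2, c4, c5,
        testBit_toNat, -Nat.testBit_zero, n1 h' hh', n0 h' hh', v5 h' h hh' hh]

/-- The last gate of the system with number `q`. -/
def lastGate (N S q : ℕ) : ℕ := if q < N then q else S - 1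

/-- The column of the system with number `q` is replaced. -/
def Replaced (N S q C : ℕ) : Prop := N ≤ q ∧ C = idx N (S - 1) 0 ((q - N) / N) 0

instance (N S q C : ℕ) : Decidable (Replaced N S q C) := by unfold Replaced; infer_instance

/-- The positive part of an entry of the system with number `q`. -/
def posMatrix (τ : Table) (N : ℕ) (p : Shape) (q R C : ℕ) : ℕ :=
  if Replaced N p.size q C then if R = idx N (p.size - 1) 2 ((q - N) % N) 0 then 1 else 0
  else τ.posEntry N p.side (lastGate N p.size q) R C

/-- The negative part of an entry of the system with number `q`. -/
def negMatrix (τ : Table) (N : ℕ) (p : Shape) (q R C : ℕ) : ℕ :=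
  if Replaced N p.size q C then 0 else τ.negEntry N p.side (lastGate N p.size q) R C

section

variable (σ : ℕ → ℕ) (u q R C h i : Expr) (t : ℕ)

@[simp] theorem eval_gateE : (gateE R).eval σ = gateIx (σ 0) (R.eval σ) := rfl
@[simp] theorem eval_typeE : (typeE R).eval σ = typeIx (σ 0) (R.eval σ) := rfl
@[simp] theorem eval_rowE : (rowE R).eval σ = rowIx (σ 0) (R.eval σ) := rfl
@[simp] theorem eval_colE : (colE R).eval σ = colIx (σ 0) (R.eval σ) := rfl
@[simp] theorem eval_idxE : (idxE h t i).eval σ = idx (σ 0) (h.eval σ) t (i.eval σ) 0 := rfl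
@[simp] theorem eval_lastE : (lastE u q).eval σ =
    lastGate (σ 0) (Shape.decode (σ 0) (u.eval σ)).size (q.eval σ) := by
  simp only [lastE, lastGate, Expr.eval_ite, Expr.eval_lt, Expr.eval_reg', Expr.eval_sub',
    Expr.eval_ofNat, eval_sizeE]
  by_cases h : q.eval σ < σ 0 <;> simp [h]

@[simp] theorem eval_validE : (validE u q R).eval σ =
    if Table.Valid (σ 0) (Shape.decode (σ 0) (u.eval σ)).side
      (lastGate (σ 0) (Shape.decode (σ 0) (u.eval σ)).size (q.eval σ)) (R.eval σ) then 1 else 0 := by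
  simp only [validE, Table.Valid, Expr.eval_mul', Expr.eval_ite, Expr.eval_lt, Expr.eval_eq,
    Expr.eval_add', Expr.eval_ofNat, eval_lastE, eval_gateE, eval_rowE, eval_typeE, eval_colE,
    eval_sideE]
  by_cases h1 : gateIx (σ 0) (R.eval σ) ≤
    lastGate (σ 0) (Shape.decode (σ 0) (u.eval σ)).size (q.eval σ) <;>
  by_cases h2 : rowIx (σ 0) (R.eval σ) < (Shape.decode (σ 0) (u.eval σ)).side <;>
  by_cases h3 : typeIx (σ 0) (R.eval σ) = 1 <;>
  by_cases h4 : colIx (σ 0) (R.eval σ) < (Shape.decode (σ 0) (u.eval σ)).side <;>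
  by_cases h5 : colIx (σ 0) (R.eval σ) = 0 <;>
  simp [h1, h2, h3, h4, h5]

@[simp] theorem eval_replacedE : (replacedE u q C).eval σ =
    if Replaced (σ 0) (Shape.decode (σ 0) (u.eval σ)).size (q.eval σ) (C.eval σ) then 1 else 0 := by
  simp only [replacedE, Replaced, colUnknownE, Expr.eval_mul', Expr.eval_lt, Expr.eval_eq,
    Expr.eval_sub', Expr.eval_ofNat, eval_idxE, Expr.eval_div', Expr.eval_reg', eval_sizeE]
  by_cases h1 : q.eval σ < σ 0 <;> by_cases h2 : C.eval σ =
      idx (σ 0) ((Shape.decode (σ 0) (u.eval σ)).size - 1) 0 ((q.eval σ - σ 0) / σ 0) 0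
  · simp [h1, h2, not_le.2 h1]
  · simp [h2]
  · simp [h1, h2, not_lt.1 h1]
  · simp [h2]

end

/-- The bits of the positive part of an entry. -/
theorem hasVal_posMatrix (hc : IsCode x u p) (hk : machine.base x.length ≤ 2 ^ k)
    {q R C s : ℕ} (hq : q < machine.base x.length) (hR : R < machine.base x.length)
    (hC : C < machine.base x.length) (hs : s < machine.base x.length) :
    machine.HasVal x (3 * k + 8) [10, u, q, R, C, s]
      ((posMatrix (Table.ofBits x p) x.length p q R C).testBit s) := by
  have h40 := forty_lt_base x.length
  have b1 := lt_base hc (d := x.length) (by omega)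
  have hu := hc.lt
  have hd := hc.decode
  have hsz := hc.small.size
  have hg : lastGate x.length p.size q < x.length := by rw [lastGate]; split_ifs <;> omega
  refine .of_run ⟨by simp [machine], by simp; omega⟩ fun V hV => ?_
  rw [machine_run, posMatrix]
  by_cases c1 : Replaced x.length p.size q C
  · by_cases c2 : s = 0 <;>
      by_cases c3 : R = idx x.length (p.size - 1) 2 ((q - x.length) % x.length) 0 <;>
      simp [procs, Step.run, regs, hd, c1, atZero, test, rhsE, c2, c3, testBit_one,
        -Nat.testBit_zero]
  · rw [if_neg c1, Table.posEntry]
    by_cases c2 : Table.Valid x.length p.side (lastGate x.length p.size q) R ∧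
        Table.Valid x.length p.side (lastGate x.length p.size q) C
    · obtain ⟨⟨r1, r2, r3⟩, ⟨s1, s2, -⟩⟩ := id c2
      have := hV _ _ (hasVal_posCoeff hc hk hg (h := gateIx x.length R) (t := typeIx x.length R)
        (i := rowIx x.length R) (j := colIx x.length R) (h' := gateIx x.length C)
        (t' := typeIx x.length C) (i' := rowIx x.length C) (j' := colIx x.length C) r1
        (Table.typeIx_lt R) r2 (fun h => by simpa [h] using r3) (fun h => by simpa [h] using r3)
        s1 (Table.typeIx_lt C) s2 (Nat.mod_lt _ (by omega)) hs)
      rw [if_pos c2]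
      simp [procs, Step.run, regs, hd, c1, c2, copy, coeffCall, this]
    · rw [if_neg c2]
      have c2' : (if Table.Valid x.length p.side (lastGate x.length p.size q) R then 1 else 0) *
          (if Table.Valid x.length p.side (lastGate x.length p.size q) C then 1 else 0) = 0 := by
        rw [not_and_or] at c2
        rcases c2 with h | h <;> simp [h]
      rcases eq_or_ne R C with rfl | c3
      · rw [and_self] at c2
        by_cases c4 : s = 0 <;>
          simp [procs, Step.run, regs, hd, c1, c2, atZero, test, c4, testBit_one, -Nat.testBit_zero]
      · simp [procs, Step.run, regs, hd, c1, c2', atZero, test, c3, -mul_eq_zero, -mul_ite]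

/-- The bits of the negative part of an entry. -/
theorem hasVal_negMatrix (hc : IsCode x u p) (hk : machine.base x.length ≤ 2 ^ k)
    {q R C s : ℕ} (hq : q < machine.base x.length) (hR : R < machine.base x.length)
    (hC : C < machine.base x.length) (hs : s < machine.base x.length) :
    machine.HasVal x (3 * k + 8) [11, u, q, R, C, s]
      ((negMatrix (Table.ofBits x p) x.length p q R C).testBit s) := by
  have h40 := forty_lt_base x.length
  have b1 := lt_base hc (d := x.length) (by omega)
  have hu := hc.lt
  have hd := hc.decode
  have hsz := hc.small.size
  have hg : lastGate x.length p.size q < x.length := by rw [lastGate]; split_ifs <;> omega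
  refine .of_run ⟨by simp [machine], by simp; omega⟩ fun V hV => ?_
  rw [machine_run, negMatrix]
  by_cases c1 : Replaced x.length p.size q C
  · simp [procs, Step.run, regs, hd, c1]
  · rw [if_neg c1, Table.negEntry]
    by_cases c2 : Table.Valid x.length p.side (lastGate x.length p.size q) R ∧
        Table.Valid x.length p.side (lastGate x.length p.size q) C
    · obtain ⟨⟨r1, r2, r3⟩, ⟨s1, s2, -⟩⟩ := id c2
      have := hV _ _ (hasVal_negCoeff hc hk hg (h := gateIx x.length R) (t := typeIx x.length R)
        (i := rowIx x.length R) (j := colIx x.length R) (h' := gateIx x.length C)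
        (t' := typeIx x.length C) (i' := rowIx x.length C) (j' := colIx x.length C) r1
        (Table.typeIx_lt R) r2 (fun h => by simpa [h] using r3) (fun h => by simpa [h] using r3)
        s1 (Table.typeIx_lt C) s2 (Nat.mod_lt _ (by omega)) hs)
      rw [if_pos c2]
      simp [procs, Step.run, regs, hd, c1, c2, copy, coeffCall, this]
    · rw [if_neg c2]
      have c2' : (if Table.Valid x.length p.side (lastGate x.length p.size q) R then 1 else 0) *
          (if Table.Valid x.length p.side (lastGate x.length p.size q) C then 1 else 0) = 0 := by
        rw [not_and_or] at c2
        rcases c2 with h | h <;> simp [h]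
      simp [procs, Step.run, regs, hd, c1, c2', -mul_eq_zero, -mul_ite]

end Evaluator

end RatEval

/-! ### Sums, products and constants modulo a power of two -/

namespace RatEval

namespace Evaluator

open ArithMachine (opCost)

variable {x : List Bool} {k u q : ℕ}

/-- The number of bits of the arithmetic. -/
@[irreducible] def width (x : List Bool) : ℕ := (x.length + 2) ^ 18

theorem machine_width (x : List Bool) : machine.width x.length = width x := by rw [width]; rfl

/-- From round `T` on, the arithmetic call `α` has the value `r`. -/
def AV (x : List Bool) (T : ℕ) (α : List ℕ) (r : ZMod (2 ^ width x)) : Prop :=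
  ∃ v : ℕ, (v : ZMod (2 ^ width x)) = r ∧ machine.AVal x T α v

section

variable {T T' : ℕ} {α l r : List ℕ} {a b : ZMod (2 ^ width x)}

theorem AV.mono (h : AV x T α a) (hT : T ≤ T') : AV x T' α a :=
  let ⟨v, hv, h⟩ := h; ⟨v, hv, ArithMachine.PVal.mono h hT⟩

variable (hk : machine.base x.length ≤ 2 ^ k)
include hk

theorem width_le : machine.width x.length ≤ 2 ^ k := (machine.width_lt _).le.trans hk

theorem AV.add (h : machine.IsNode x α (.add l r)) (hl : AV x T l a) (hr : AV x T r b) :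
    AV x (T + opCost k) α (a + b) := by
  obtain ⟨v, rfl, h1⟩ := hl
  obtain ⟨w, rfl, h2⟩ := hr
  exact ⟨v + w, by push_cast; rfl, ArithMachine.AVal.add h (width_le hk) h1 h2⟩

theorem AV.mul (h : machine.IsNode x α (.mul l r)) (hl : AV x T l a) (hr : AV x T r b) :
    AV x (T + opCost k) α (a * b) := by
  obtain ⟨v, rfl, h1⟩ := hl
  obtain ⟨w, rfl, h2⟩ := hr
  exact ⟨v * w, by push_cast; rfl, ArithMachine.AVal.mul h (width_le hk) h1 h2⟩

omit hk in
theorem AV.goto (h : machine.IsNode x α (.goto l)) (hl : AV x T l a) :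
    AV x (T + opCost k) α a := by
  obtain ⟨v, rfl, h1⟩ := hl
  exact ⟨v, rfl, ArithMachine.AVal.goto h h1⟩

omit hk in
theorem AV.leaf {s : Step} (h : machine.IsNode x α (.leaf s)) {X : ℕ}
    (hX : ∀ i < width x, ∀ V : List ℕ → Bool, (∀ a v, machine.HasVal x T a v → V a = v) →
      s.run x V (regs x.length (0 :: i :: 0 :: 0 :: width x :: α)) = X.testBit i) :
    AV x (T + 1) α X := by
  rw [← machine_width] at hX
  exact ⟨X, rfl, ArithMachine.AVal.leaf h hX⟩

/-- A balanced tree of additions with `j` levels. -/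
theorem AV.sum {α : ℕ → ℕ → List ℕ} {f : ℕ → ZMod (2 ^ width x)} {K : ℕ}
    (h0 : ∀ lo ≤ K, AV x T (α lo 0) 0) (h1 : ∀ lo < K, AV x T (α lo 1) (f lo))
    (h2 : ∀ lo len, 2 ≤ len → lo + len ≤ K →
      machine.IsNode x (α lo len) (.add (α lo (len / 2)) (α (lo + len / 2) (len - len / 2)))) (j : ℕ) :
    ∀ lo len, len ≤ 2 ^ j → lo + len ≤ K →
      AV x (T + j * opCost k) (α lo len) (∑ i ∈ Finset.range len, f (lo + i)) := by
  have base : ∀ lo len, len ≤ 1 → lo + len ≤ K →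
      AV x T (α lo len) (∑ i ∈ Finset.range len, f (lo + i)) := by
    intro lo len hl hK
    obtain rfl | rfl : len = 0 ∨ len = 1 := by omega
    · simpa using h0 lo (by omega)
    · simpa using h1 lo (by omega)
  induction j with
  | zero => simpa using base
  | succ j ih =>
    intro lo len hl hK
    by_cases hl1 : len ≤ 1
    · exact (base lo len hl1 hK).mono (by omega)
    rw [pow_succ] at hl
    have := AV.add hk (h2 lo len (by omega) hK) (ih lo (len / 2) (by omega) (by omega))
      (ih (lo + len / 2) (len - len / 2) (by omega) (by omega))
    have e : len = len / 2 + (len - len / 2) := by omega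
    conv_rhs => rw [e]
    rw [Finset.sum_range_add]
    simpa only [add_assoc, add_mul, one_mul] using this

theorem AV.prod {α : ℕ → ℕ → List ℕ} {f : ℕ → ZMod (2 ^ width x)} {K : ℕ}
    (h0 : ∀ lo ≤ K, AV x T (α lo 0) 1) (h1 : ∀ lo < K, AV x T (α lo 1) (f lo))
    (h2 : ∀ lo len, 2 ≤ len → lo + len ≤ K →
      machine.IsNode x (α lo len) (.mul (α lo (len / 2)) (α (lo + len / 2) (len - len / 2)))) (j : ℕ) :
    ∀ lo len, len ≤ 2 ^ j → lo + len ≤ K →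
      AV x (T + j * opCost k) (α lo len) (∏ i ∈ Finset.range len, f (lo + i)) := by
  have base : ∀ lo len, len ≤ 1 → lo + len ≤ K →
      AV x T (α lo len) (∏ i ∈ Finset.range len, f (lo + i)) := by
    intro lo len hl hK
    obtain rfl | rfl : len = 0 ∨ len = 1 := by omega
    · simpa using h0 lo (by omega)
    · simpa using h1 lo (by omega)
  induction j with
  | zero => simpa using base
  | succ j ih =>
    intro lo len hl hK
    by_cases hl1 : len ≤ 1
    · exact (base lo len hl1 hK).mono (by omega)
    rw [pow_succ] at hl
    have := AV.mul hk (h2 lo len (by omega) hK) (ih lo (len / 2) (by omega) (by omega))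
      (ih (lo + len / 2) (len - len / 2) (by omega) (by omega))
    have e : len = len / 2 + (len - len / 2) := by omega
    conv_rhs => rw [e]
    rw [Finset.prod_range_add]
    simpa only [add_assoc, add_mul, one_mul] using this

end

/-- The five control registers must not influence the choice of the operation, hence the
quantification over `c₁, …, c₅`. -/
theorem isNode_of {t a b c d e f : ℕ} {n : ANode} (ht : t ≤ 20)
    (hd : ∀ v ∈ [u, q, a, b, c, d, e, f], v < machine.base x.length)
    (h : ∀ c₁ c₂ c₃ c₄ c₅, (arithProcs.getD t (.leaf (.const false))).resolve
      (regs x.length [c₁, c₂, c₃, c₄, c₅, t, u, q, a, b, c, d, e, f]) = n) :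
    machine.IsNode x [t, u, q, a, b, c, d, e, f] n := by
  have := forty_lt_base x.length
  refine ⟨⟨rfl, List.forall_mem_cons.2 ⟨by omega, hd⟩⟩, fun c₁ c₂ c₃ c₄ c₅ => ?_⟩
  rw [← h c₁ c₂ c₃ c₄ c₅]
  exact AStep.resolve_switch _ _ arithProcs 0 t (by simp [regs])

/-- A dimension bound. -/
def dim (x : List Bool) : ℕ := (x.length + 2) ^ 5
/-- The number of terms of the geometric sums. -/
def terms (x : List Bool) : ℕ := (x.length + 2) ^ 6

/-- The decisive relations are `width = bits * terms`, by which `2 ^ bits` is nilpotent of order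
`terms`, and `bits * (dim + 1) ≤ width`, by which the window of digits of the determinant lies
inside the modulus. -/
theorem sizes (x : List Bool) : width x < machine.base x.length ∧ 4 * terms x ≤ machine.base x.length ∧
    4 * dim x ≤ machine.base x.length ∧ bits x.length ≤ width x ∧ 1 ≤ bits x.length ∧ 1 ≤ dim x ∧
    bits x.length * dim x + bits x.length ≤ width x ∧ width x = bits x.length * terms x ∧
    bits x.length * (dim x + 1) ≤ width x := by
  have hB : 2 ≤ x.length + 2 := by omega
  rw [width, terms, dim, bits, machine_base]
  generalize x.length + 2 = B at *
  have p : ∀ a b, a ≤ b → B ^ a ≤ B ^ b := fun a b h => Nat.pow_le_pow_right (by omega) h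
  have q : ∀ a, 2 * B ^ a ≤ B ^ (a + 1) := fun a => by
    rw [pow_succ, mul_comm]; exact Nat.mul_le_mul_left _ hB
  have e1 : B ^ 12 * B ^ 5 = B ^ 17 := by ring
  have e2 : B ^ 12 * B ^ 6 = B ^ 18 := by ring
  have q1 : 2 * B ^ 6 ≤ B ^ 7 := q 6
  have q2 : 2 * B ^ 7 ≤ B ^ 8 := q 7
  have q3 : 2 * B ^ 5 ≤ B ^ 6 := q 5
  have q4 : 2 * B ^ 17 ≤ B ^ 18 := q 17
  have p1 := p 8 19 (by norm_num)
  have p2 := p 12 17 (by norm_num)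
  have p3 := p 12 18 (by norm_num)
  refine ⟨Nat.pow_lt_pow_right (by omega) (by norm_num), by omega, by omega, p3,
    Nat.one_le_pow _ _ (by omega), Nat.one_le_pow _ _ (by omega), by omega, e2.symm, ?_⟩
  rw [mul_add, e1, mul_one]
  omega

section constants

variable (hu : u < machine.base x.length) (hq : q < machine.base x.length)
include hu hq

theorem av_one : AV x 1 [0, u, q, 0, 0, 0, 0, 0, 0] 1 := by
  have := forty_lt_base x.length
  have h : machine.IsNode x [0, u, q, 0, 0, 0, 0, 0, 0] _ :=
    isNode_of (by norm_num) (by simp; omega) fun _ _ _ _ _ => rfl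
  have := AV.leaf (T := 0) h (X := 1) fun i _ V _ => by
    by_cases h : i = 0 <;> simp [Step.run, regs, testBit_one, h]; omega
  simpa using this

/-- All `width` bits are set. -/
theorem av_negOne : AV x 1 [1, u, q, 0, 0, 0, 0, 0, 0] (-1) := by
  have := forty_lt_base x.length
  have h : machine.IsNode x [1, u, q, 0, 0, 0, 0, 0, 0] _ :=
    isNode_of (by norm_num) (by simp; omega) fun _ _ _ _ _ => rfl
  have := AV.leaf (T := 0) h (X := 2 ^ width x - 1) fun i hi V _ => by
    simp [Step.run, Nat.testBit_two_pow_sub_one, hi]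
  rw [Nat.cast_sub Nat.one_le_two_pow] at this
  simpa using this

/-- The rounding constant of `div_mod_eq_det`. -/
theorem av_round : AV x 1 [2, u, q, 0, 0, 0, 0, 0, 0] (2 ^ (bits x.length * dim x - 1)) := by
  have := forty_lt_base x.length
  have h : machine.IsNode x [2, u, q, 0, 0, 0, 0, 0, 0] _ :=
    isNode_of (by norm_num) (by simp; omega) fun _ _ _ _ _ => rfl
  have := AV.leaf (T := 0) h (X := 2 ^ (bits x.length * dim x - 1)) fun i hi V _ => by
    rw [Nat.testBit_two_pow]
    by_cases h : i = bits x.length * dim x - 1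
    · simp [Step.run, regs, bitsE, dimE, baseE, bits, dim] at h ⊢
      simp [h]
    · have h' := h
      simp [bits, dim] at h'
      simp [Step.run, regs, h', Ne.symm h, bitsE, dimE, baseE]
  simpa using this

/-- Modulo `2 ^ W`, `-2 ^ b` is `(2 ^ (W - b) - 1) * 2 ^ b`: exactly the bits from `b` on are set.
-/
theorem av_negShift : AV x 1 [3, u, q, 0, 0, 0, 0, 0, 0] (-2 ^ bits x.length) := by
  have := forty_lt_base x.length
  have hs := sizes x
  have h : machine.IsNode x [3, u, q, 0, 0, 0, 0, 0, 0] _ :=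
    isNode_of (by norm_num) (by simp; omega) fun _ _ _ _ _ => rfl
  have := AV.leaf (T := 0) h (X := (2 ^ (width x - bits x.length) - 1) * 2 ^ bits x.length)
    fun i hi V _ => by
    rw [Nat.testBit_mul_two_pow, Nat.testBit_two_pow_sub_one]
    by_cases h : i < bits x.length
    · have h' := h
      rw [bits] at h'
      simp [Step.run, regs, not_le.2 h, h', bitsE, baseE]
    · have h' := h
      rw [bits] at h'
      simp [Step.run, regs, not_lt.1 h, h', bitsE, baseE]
      omega
  rw [Nat.sub_mul, ← pow_add, Nat.sub_add_cancel (by omega), Nat.cast_sub (by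
    rw [one_mul]; exact Nat.pow_le_pow_right (by norm_num) (by omega))] at this
  simpa using this

theorem av_shift : AV x 1 [4, u, q, 0, 0, 0, 0, 0, 0] (2 ^ bits x.length) := by
  have := forty_lt_base x.length
  have h : machine.IsNode x [4, u, q, 0, 0, 0, 0, 0, 0] _ :=
    isNode_of (by norm_num) (by simp; omega) fun _ _ _ _ _ => rfl
  have := AV.leaf (T := 0) h (X := 2 ^ bits x.length) fun i hi V _ => by
    rw [Nat.testBit_two_pow]
    by_cases h : i = bits x.length
    · simp [Step.run, regs, bitsE, baseE, bits] at h ⊢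
      simp [h]
    · have h' := h
      simp [bits] at h'
      simp [Step.run, regs, h', Ne.symm h, bitsE, baseE]
  simpa using this

end constants

end Evaluator

end RatEval

/-! ### Scaled entries and powers of leading submatrices -/

namespace RatEval

namespace Evaluator

open ArithMachine (opCost)

variable {x : List Bool} {k u q : ℕ} {p : Shape}

/-- The entries of the matrix of the system with number `q`. -/
def sysMatrix (x : List Bool) (p : Shape) (q R C : ℕ) : ℤ :=
  (posMatrix (Table.ofBits x p) x.length p q R C : ℤ) -
    negMatrix (Table.ofBits x p) x.length p q R C

/-- The scaled negative of the matrix of a system. -/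
noncomputable def scaled (x : List Bool) (p : Shape) (q R C : ℕ) : ZMod (2 ^ width x) :=
  (2 : ZMod (2 ^ width x)) ^ bits x.length * Int.cast (-sysMatrix x p q R C)

theorem av_zero_of {α : List ℕ} (h : machine.IsNode x α (.leaf (.cond 0 (.const true) (.const false)))) :
    AV x 1 α 0 := by
  have := AV.leaf (T := 0) h (X := 0) fun i hi V hV => by simp [Step.run]
  simpa using this

theorem isNode_const {t a b c d e f : ℕ} (hu : u < machine.base x.length)
    (hq : q < machine.base x.length) (ht : t ≤ 20) (h : ∀ v ∈ [a, b, c, d, e, f], v < machine.base x.length)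
    {n : ANode} (hn : ∀ c₁ c₂ c₃ c₄ c₅, (arithProcs.getD t (.leaf (.const false))).resolve
      (regs x.length [c₁, c₂, c₃, c₄, c₅, t, u, q, a, b, c, d, e, f]) = n) :
    machine.IsNode x [t, u, q, a, b, c, d, e, f] n :=
  isNode_of ht (List.forall_mem_cons.2 ⟨hu, List.forall_mem_cons.2 ⟨hq, h⟩⟩) hn

section

variable (hc : IsCode x u p) (hk : machine.base x.length ≤ 2 ^ k) (hq : q < machine.base x.length)
include hc hk hq

theorem av_pos {R C : ℕ} (hR : R < machine.base x.length) (hC : C < machine.base x.length) :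
    AV x (3 * k + 9) [5, u, q, R, C, 0, 0, 0, 0]
      (posMatrix (Table.ofBits x p) x.length p q R C : ℕ) := by
  have h40 := forty_lt_base x.length
  have h : machine.IsNode x [5, u, q, R, C, 0, 0, 0, 0] _ :=
    isNode_const hc.lt hq (by norm_num) (by simp; omega) fun _ _ _ _ _ => rfl
  refine AV.leaf (T := 3 * k + 8) h fun i hi V hV => ?_
  have := (sizes x).1
  have := hV _ _ (hasVal_posMatrix hc hk hq hR hC (s := i) (by omega))
  simp [Step.run, regs, this]

theorem av_neg {R C : ℕ} (hR : R < machine.base x.length) (hC : C < machine.base x.length) :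
    AV x (3 * k + 9) [6, u, q, R, C, 0, 0, 0, 0]
      (negMatrix (Table.ofBits x p) x.length p q R C : ℕ) := by
  have h40 := forty_lt_base x.length
  have h : machine.IsNode x [6, u, q, R, C, 0, 0, 0, 0] _ :=
    isNode_const hc.lt hq (by norm_num) (by simp; omega) fun _ _ _ _ _ => rfl
  refine AV.leaf (T := 3 * k + 8) h fun i hi V hV => ?_
  have := (sizes x).1
  have := hV _ _ (hasVal_negMatrix hc hk hq hR hC (s := i) (by omega))
  simp [Step.run, regs, this]

/-- The determinant formula is for `1 - X` while `1 + 2 ^ bits * A` is wanted, so the positive part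
is multiplied by `-2 ^ bits` and the negative part by `2 ^ bits`. -/
theorem av_scaled {R C : ℕ} (hR : R < machine.base x.length) (hC : C < machine.base x.length) :
    AV x (3 * k + 9 + 2 * opCost k) [9, u, q, R, C, 0, 0, 0, 0] (scaled x p q R C) := by
  have h40 := forty_lt_base x.length
  have h7 : machine.IsNode x [7, u, q, R, C, 0, 0, 0, 0]
      (.mul [3, u, q, 0, 0, 0, 0, 0, 0] [5, u, q, R, C, 0, 0, 0, 0]) :=
    isNode_const hc.lt hq (by norm_num) (by simp; omega) fun _ _ _ _ _ => rfl
  have h8 : machine.IsNode x [8, u, q, R, C, 0, 0, 0, 0]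
      (.mul [4, u, q, 0, 0, 0, 0, 0, 0] [6, u, q, R, C, 0, 0, 0, 0]) :=
    isNode_const hc.lt hq (by norm_num) (by simp; omega) fun _ _ _ _ _ => rfl
  have h9 : machine.IsNode x [9, u, q, R, C, 0, 0, 0, 0]
      (.add [7, u, q, R, C, 0, 0, 0, 0] [8, u, q, R, C, 0, 0, 0, 0]) :=
    isNode_const hc.lt hq (by norm_num) (by simp; omega) fun _ _ _ _ _ => rfl
  have a7 := AV.mul hk h7 ((av_negShift hc.lt hq).mono (by omega)) (av_pos hc hk hq hR hC)
  have a8 := AV.mul hk h8 ((av_shift hc.lt hq).mono (by omega)) (av_neg hc hk hq hR hC)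
  have := (AV.add hk h9 a7 a8).mono (T' := 3 * k + 9 + 2 * opCost k) (by omega)
  convert this using 1
  rw [scaled, sysMatrix]
  push_cast
  ring

/-- Repeated squaring entry by entry: the exponent is halved, and the inner product over `K ≤ 2 ^ k`
indices is a balanced sum. A level costs a multiplication, `k` levels of additions and a forwarding
step, `(k + 2) * opCost k` together. As `opCost k` is quadratic in `k`, taking `j = k` yields the
fourth power of the logarithm. -/
theorem av_pow (j : ℕ) : ∀ e r c K, e ≤ 2 ^ j → e < machine.base x.length → K + 1 < machine.base x.length →
    ∀ (hr : r < K) (hc : c < K), AV x (3 * k + 9 + 3 * opCost k + j * ((k + 2) * opCost k))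
      [10, u, q, K, e, r, c, 0, 0] ((leading (scaled x p q) K ^ e) ⟨r, hr⟩ ⟨c, hc⟩) := by
  have h40 := forty_lt_base x.length
  have hco : 1 ≤ opCost k := Nat.one_le_pow _ _ (by omega)
  have base : ∀ e r c K, e ≤ 1 → e < machine.base x.length → K + 1 < machine.base x.length →
      ∀ (hr : r < K) (hc : c < K), AV x (3 * k + 9 + 3 * opCost k)
      [10, u, q, K, e, r, c, 0, 0] ((leading (scaled x p q) K ^ e) ⟨r, hr⟩ ⟨c, hc⟩) := by
    intro e r c K he he' hK hr hc'
    obtain rfl | rfl : e = 0 ∨ e = 1 := by omega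
    · by_cases hrc : r = c
      · have h : machine.IsNode x [10, u, q, K, 0, r, c, 0, 0] (.goto [0, u, q, 0, 0, 0, 0, 0, 0]) :=
          isNode_const hc.lt hq (by norm_num) (by simp; omega) fun _ _ _ _ _ => by
            simp [arithProcs, AStep.resolve, regs, hrc, call]
        have := AV.goto (k := k) h (av_one hc.lt hq)
        rw [pow_zero, Matrix.one_apply, if_pos (Fin.ext hrc)]
        exact this.mono (by omega)
      · have h : machine.IsNode x [10, u, q, K, 0, r, c, 0, 0]
            (.leaf (.cond 0 (.const true) (.const false))) :=
          isNode_const hc.lt hq (by norm_num) (by simp; omega) fun _ _ _ _ _ => by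
            simp [arithProcs, AStep.resolve, regs, hrc, bitLeaf]
        have := av_zero_of h
        rw [pow_zero, Matrix.one_apply, if_neg fun h => hrc (Fin.mk.inj_iff.1 h)]
        exact this.mono (by omega)
    · have h : machine.IsNode x [10, u, q, K, 1, r, c, 0, 0] (.goto [9, u, q, r, c, 0, 0, 0, 0]) :=
        isNode_const hc.lt hq (by norm_num) (by simp; omega) fun _ _ _ _ _ => by
          simp [arithProcs, AStep.resolve, regs, call]
      have := AV.goto (k := k) h (av_scaled hc hk hq (R := r) (C := c) (by omega) (by omega))
      rw [pow_one]
      exact this.mono (by omega)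
  induction j with
  | zero =>
    intro e r c K he he' hK hr hc
    exact (base e r c K (by simpa using he) he' hK hr hc).mono (by omega)
  | succ j ih =>
    intro e r c K he he' hK hr hc'
    by_cases he1 : e ≤ 1
    · exact (base e r c K he1 he' hK hr hc').mono (by omega)
    rw [pow_succ] at he
    have hkk : K ≤ 2 ^ k := by omega
    set T := 3 * k + 9 + 3 * opCost k + j * ((k + 2) * opCost k) with hT
    have hsum := AV.sum (x := x) (T := T + opCost k) (α := fun lo len => [11, u, q, K, e, r, c, lo, len])
      (f := fun m => if hm : m < K then (leading (scaled x p q) K ^ (e / 2)) ⟨r, hr⟩ ⟨m, hm⟩ *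
        (leading (scaled x p q) K ^ (e - e / 2)) ⟨m, hm⟩ ⟨c, hc'⟩ else 0) (K := K) hk
      (fun lo hlo => by
        have h : machine.IsNode x [11, u, q, K, e, r, c, lo, 0]
            (.leaf (.cond 0 (.const true) (.const false))) :=
          isNode_const hc.lt hq (by norm_num) (by simp; omega) fun _ _ _ _ _ => by
            simp [arithProcs, AStep.resolve, regs, bitLeaf]
        exact (av_zero_of h).mono (by omega))
      (fun lo hlo => by
        have h : machine.IsNode x [11, u, q, K, e, r, c, lo, 1]
            (.mul [10, u, q, K, e / 2, r, lo, 0, 0] [10, u, q, K, e - e / 2, lo, c, 0, 0]) :=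
          isNode_const hc.lt hq (by norm_num) (by simp; omega) fun _ _ _ _ _ => by
            simp [arithProcs, AStep.resolve, regs, call]
        rw [dif_pos hlo]
        exact AV.mul hk h (ih (e / 2) r lo K (by omega) (by omega) hK hr hlo)
          (ih (e - e / 2) lo c K (by omega) (by omega) hK hlo hc'))
      (fun lo len h2 hlo => isNode_const hc.lt hq (by norm_num) (by simp; omega) fun _ _ _ _ _ => by
        simp [arithProcs, AStep.resolve, regs, call, show len ≠ 0 by omega, show len - 1 ≠ 0 by omega])
      k 0 K hkk (by omega)
    have h : machine.IsNode x [10, u, q, K, e, r, c, 0, 0] (.goto [11, u, q, K, e, r, c, 0, K]) :=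
      isNode_const hc.lt hq (by norm_num) (by simp; omega) fun _ _ _ _ _ => by
        simp [arithProcs, AStep.resolve, regs, call, show e ≠ 0 by omega, show e - 1 ≠ 0 by omega]
    have := (AV.goto (k := k) h hsum).mono
      (T' := 3 * k + 9 + 3 * opCost k + (j + 1) * ((k + 2) * opCost k)) (by
        rw [hT, add_mul j 1, one_mul, add_mul k 2]; omega)
    convert this using 1
    rw [Finset.sum_range, show leading (scaled x p q) K ^ e = leading (scaled x p q) K ^ (e / 2) *
      leading (scaled x p q) K ^ (e - e / 2) by rw [← pow_add]; congr 1; omega, Matrix.mul_apply]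
    simp

end

end Evaluator

end RatEval

/-! ### The determinant procedure -/

namespace RatEval

namespace Evaluator

open ArithMachine (opCost)

variable {x : List Bool} {k u q : ℕ} {p : Shape}

/-- The number of rounds for the determinants. -/
def detTime (k : ℕ) : ℕ := 3 * k + 10 + (k ^ 2 + 6 * k + 11) * opCost k

/-- The matrix of the system with number `q`. -/
def system (x : List Bool) (p : Shape) (q : ℕ) : Matrix (Fin (dim x)) (Fin (dim x)) ℤ :=
  Matrix.of fun R C => sysMatrix x p q R C

/-- Reduction modulo `2 ^ width` commutes with determinants, and the sign in `scaled` cancels that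
of `1 - X`. -/
theorem cast_det_system : (((1 + (2 ^ bits x.length : ℤ) • system x p q).det : ℤ) : ZMod (2 ^ width x)) =
    (1 - leading (scaled x p q) (dim x)).det := by
  refine (RingHom.map_det (Int.castRingHom (ZMod (2 ^ width x))) _).trans ?_
  congr 1
  ext i j
  simp [leading, scaled, system, Matrix.one_apply]

section

variable (hc : IsCode x u p) (hk : machine.base x.length ≤ 2 ^ k) (hq : q < machine.base x.length)
include hc hk hq

/-- The powers are computed independently of each other, so the sum adds only `k` levels of
additions to the time for a single power. -/
theorem av_geom {K : ℕ} (hK : K < dim x) :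
    AV x (3 * k + 9 + (k ^ 2 + 3 * k + 4) * opCost k) [12, u, q, K, 0, terms x, 0, 0, 0]
      (∑ e ∈ Finset.range (terms x),
        (leading (scaled x p q) (K + 1) ^ e) (Fin.last K) (Fin.last K)) := by
  have h40 := forty_lt_base x.length
  have hs := sizes x
  have := AV.sum (x := x) (α := fun lo len => [12, u, q, K, lo, len, 0, 0, 0]) (K := terms x)
    (f := fun e => (leading (scaled x p q) (K + 1) ^ e) (Fin.last K) (Fin.last K))
    (T := 3 * k + 9 + 3 * opCost k + k * ((k + 2) * opCost k) + opCost k) hk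
    (fun lo hlo => by
      have h : machine.IsNode x [12, u, q, K, lo, 0, 0, 0, 0]
          (.leaf (.cond 0 (.const true) (.const false))) :=
        isNode_const hc.lt hq (by norm_num) (by simp; omega) fun _ _ _ _ _ => by
          simp [arithProcs, AStep.resolve, regs, bitLeaf]
      exact (av_zero_of h).mono (by omega))
    (fun lo hlo => by
      have h : machine.IsNode x [12, u, q, K, lo, 1, 0, 0, 0] (.goto [10, u, q, K + 1, lo, K, K, 0, 0]) :=
        isNode_const hc.lt hq (by norm_num) (by simp; omega) fun _ _ _ _ _ => by
          simp [arithProcs, AStep.resolve, regs, call]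
      exact AV.goto h (av_pow hc hk hq k lo K K (K + 1) (by omega) (by omega) (by omega)
        (Nat.lt_succ_self K) (Nat.lt_succ_self K)))
    (fun lo len h2 hlo => isNode_const hc.lt hq (by norm_num) (by simp; omega) fun _ _ _ _ _ => by
      simp [arithProcs, AStep.resolve, regs, call, show len ≠ 0 by omega, show len - 1 ≠ 0 by omega])
    k 0 (terms x) (by omega) (by omega)
  simp only [zero_add] at this
  exact this.mono (by nlinarith)

theorem av_prod : AV x (3 * k + 9 + (k ^ 2 + 4 * k + 5) * opCost k) [13, u, q, 0, dim x, 0, 0, 0, 0]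
      (∏ K ∈ Finset.range (dim x), ∑ e ∈ Finset.range (terms x),
        (leading (scaled x p q) (K + 1) ^ e) (Fin.last K) (Fin.last K)) := by
  have h40 := forty_lt_base x.length
  have hs := sizes x
  have hco : 1 ≤ opCost k := Nat.one_le_pow _ _ (by omega)
  have hpos : 0 ≤ (k ^ 2 + 3 * k + 4) * opCost k := Nat.zero_le _
  obtain ⟨f, hf⟩ : ∃ f : ℕ → ZMod (2 ^ width x), f = fun K => ∑ e ∈ Finset.range (terms x),
      (leading (scaled x p q) (K + 1) ^ e) (Fin.last K) (Fin.last K) := ⟨_, rfl⟩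
  have := AV.prod (x := x) (α := fun lo len => [13, u, q, lo, len, 0, 0, 0, 0]) (K := dim x)
    (f := f) (T := 3 * k + 9 + (k ^ 2 + 3 * k + 4) * opCost k + opCost k) hk
    (fun lo hlo => by
      have h : machine.IsNode x [13, u, q, lo, 0, 0, 0, 0, 0] (.goto [0, u, q, 0, 0, 0, 0, 0, 0]) :=
        isNode_const hc.lt hq (by norm_num) (by simp; omega) fun _ _ _ _ _ => by
          simp [arithProcs, AStep.resolve, regs, call]
      exact (AV.goto (k := k) h (av_one hc.lt hq)).mono (by omega))
    (fun lo hlo => by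
      have h : machine.IsNode x [13, u, q, lo, 1, 0, 0, 0, 0] (.goto [12, u, q, lo, 0, terms x, 0, 0, 0]) :=
        isNode_const hc.lt hq (by norm_num) (by simp; omega) fun _ _ _ _ _ => by
          simp [arithProcs, AStep.resolve, regs, call, termsE, baseE, terms]
      rw [hf]
      exact AV.goto h (av_geom hc hk hq hlo))
    (fun lo len h2 hlo => isNode_const hc.lt hq (by norm_num) (by simp; omega) fun _ _ _ _ _ => by
      simp [arithProcs, AStep.resolve, regs, call, show len ≠ 0 by omega, show len - 1 ≠ 0 by omega])
    k 0 (dim x) (by omega) (by omega)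
  simp only [zero_add] at this
  rw [hf] at this
  exact this.mono (by nlinarith)

/-- From the product `F` the procedures 14 to 17 form the geometric sum in `1 - F`, with powers by
repeated squaring; `det_one_sub_eq` identifies this sum with the determinant. -/
theorem av_detRounded : AV x (3 * k + 9 + (k ^ 2 + 6 * k + 10) * opCost k) [18, u, q, 0, 0, 0, 0, 0, 0]
    ((1 - leading (scaled x p q) (dim x)).det + 2 ^ (bits x.length * dim x - 1)) := by
  have h40 := forty_lt_base x.length
  have hs := sizes x
  have hco : 1 ≤ opCost k := Nat.one_le_pow _ _ (by omega)
  set F := ∏ K ∈ Finset.range (dim x), ∑ e ∈ Finset.range (terms x),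
        (leading (scaled x p q) (K + 1) ^ e) (Fin.last K) (Fin.last K) with hF
  set T := 3 * k + 9 + (k ^ 2 + 4 * k + 5) * opCost k with hT
  have h14 : machine.IsNode x [14, u, q, 0, 0, 0, 0, 0, 0]
      (.mul [1, u, q, 0, 0, 0, 0, 0, 0] [13, u, q, 0, dim x, 0, 0, 0, 0]) :=
    isNode_const hc.lt hq (by norm_num) (by simp; omega) fun _ _ _ _ _ => by
      simp [arithProcs, AStep.resolve, regs, call, dimE, baseE, dim]
  have a14 := AV.mul hk h14 ((av_negOne hc.lt hq).mono (by omega)) (av_prod hc hk hq)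
  have h15 : machine.IsNode x [15, u, q, 0, 0, 0, 0, 0, 0]
      (.add [0, u, q, 0, 0, 0, 0, 0, 0] [14, u, q, 0, 0, 0, 0, 0, 0]) :=
    isNode_const hc.lt hq (by norm_num) (by simp; omega) fun _ _ _ _ _ => rfl
  have a15 := AV.add hk h15 ((av_one hc.lt hq).mono (by omega)) a14
  rw [← hF, ← hT, neg_one_mul, ← sub_eq_add_neg] at a15
  have a16 : ∀ j e, e ≤ 2 ^ j → e < machine.base x.length →
      AV x (T + 3 * opCost k + j * opCost k) [16, u, q, e, 0, 0, 0, 0, 0] ((1 - F) ^ e) := by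
    have base : ∀ e, e ≤ 1 → AV x (T + 3 * opCost k) [16, u, q, e, 0, 0, 0, 0, 0] ((1 - F) ^ e) := by
      intro e he
      obtain rfl | rfl : e = 0 ∨ e = 1 := by omega
      · have h : machine.IsNode x [16, u, q, 0, 0, 0, 0, 0, 0] (.goto [0, u, q, 0, 0, 0, 0, 0, 0]) :=
          isNode_const hc.lt hq (by norm_num) (by simp; omega) fun _ _ _ _ _ => by
            simp [arithProcs, AStep.resolve, regs, call]
        rw [pow_zero]
        exact (AV.goto (k := k) h (av_one hc.lt hq)).mono (by omega)
      · have h : machine.IsNode x [16, u, q, 1, 0, 0, 0, 0, 0] (.goto [15, u, q, 0, 0, 0, 0, 0, 0]) :=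
          isNode_const hc.lt hq (by norm_num) (by simp; omega) fun _ _ _ _ _ => by
            simp [arithProcs, AStep.resolve, regs, call]
        rw [pow_one]
        exact (AV.goto (k := k) h a15).mono (by omega)
    intro j
    induction j with
    | zero => exact fun e he _ => (base e (by simpa using he)).mono (by omega)
    | succ j ih =>
      intro e he he'
      by_cases he1 : e ≤ 1
      · exact (base e he1).mono (by omega)
      rw [pow_succ] at he
      have h : machine.IsNode x [16, u, q, e, 0, 0, 0, 0, 0]
          (.mul [16, u, q, e / 2, 0, 0, 0, 0, 0] [16, u, q, e - e / 2, 0, 0, 0, 0, 0]) :=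
        isNode_const hc.lt hq (by norm_num) (by simp; omega) fun _ _ _ _ _ => by
          simp [arithProcs, AStep.resolve, regs, call, show e ≠ 0 by omega, show e - 1 ≠ 0 by omega]
      have := AV.mul hk h (ih (e / 2) (by omega) (by omega)) (ih (e - e / 2) (by omega) (by omega))
      rw [← pow_add, show e / 2 + (e - e / 2) = e by omega] at this
      exact this.mono (by rw [add_mul j 1]; omega)
  have a17 := AV.sum (x := x) (α := fun lo len => [17, u, q, lo, len, 0, 0, 0, 0]) (K := terms x)
    (f := fun e => (1 - F) ^ e)
    (T := T + 3 * opCost k + k * opCost k + opCost k) hk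
    (fun lo hlo => by
      have h : machine.IsNode x [17, u, q, lo, 0, 0, 0, 0, 0]
          (.leaf (.cond 0 (.const true) (.const false))) :=
        isNode_const hc.lt hq (by norm_num) (by simp; omega) fun _ _ _ _ _ => by
          simp [arithProcs, AStep.resolve, regs, bitLeaf]
      exact (av_zero_of h).mono (by omega))
    (fun lo hlo => by
      have h : machine.IsNode x [17, u, q, lo, 1, 0, 0, 0, 0] (.goto [16, u, q, lo, 0, 0, 0, 0, 0]) :=
        isNode_const hc.lt hq (by norm_num) (by simp; omega) fun _ _ _ _ _ => by
          simp [arithProcs, AStep.resolve, regs, call]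
      exact AV.goto h (a16 k lo (by omega) (by omega)))
    (fun lo len h2 hlo => isNode_const hc.lt hq (by norm_num) (by simp; omega) fun _ _ _ _ _ => by
      simp [arithProcs, AStep.resolve, regs, call, show len ≠ 0 by omega, show len - 1 ≠ 0 by omega])
    k 0 (terms x) (by omega) (by omega)
  simp only [zero_add] at a17
  have h18 : machine.IsNode x [18, u, q, 0, 0, 0, 0, 0, 0]
      (.add [17, u, q, 0, terms x, 0, 0, 0, 0] [2, u, q, 0, 0, 0, 0, 0, 0]) :=
    isNode_const hc.lt hq (by norm_num) (by simp; omega) fun _ _ _ _ _ => by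
      simp [arithProcs, AStep.resolve, regs, call, termsE, baseE, terms]
  have a18 := AV.add hk h18 a17 ((av_round hc.lt hq).mono (by omega))
  -- This is where `bits * terms = width` is needed.
  have hz : (2 ^ bits x.length : ZMod (2 ^ width x)) ^ terms x = 0 := by
    rw [← pow_mul, ← hs.2.2.2.2.2.2.2.1]
    exact_mod_cast ZMod.natCast_self (2 ^ width x)
  have hdet := det_one_sub_eq (2 ^ bits x.length : ZMod (2 ^ width x))
    (fun i j => Int.cast (-sysMatrix x p q i j)) (terms x) (by
      rw [terms]; exact pow_ne_zero _ (by omega)) hz (dim x)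
  have e : (fun i j => (2 ^ bits x.length : ZMod (2 ^ width x)) * Int.cast (-sysMatrix x p q i j)) =
    scaled x p q := rfl
  rw [e, ← hF] at hdet
  rw [hdet] at a18
  exact a18.mono (by rw [hT]; nlinarith)

end

end Evaluator

end RatEval

/-! ### Sign and magnitude of the determinants -/

namespace RatEval

namespace Evaluator

open ArithMachine (opCost)

variable {x : List Bool} {k u q : ℕ} {p : Shape}

theorem posCoeff_le {τ : Table} {M h t i j h' t' i' j' : ℕ} (hM : 1 ≤ M)
    (hn : ∀ h i j, τ.num h i j ≤ M) (hd : ∀ h i j, τ.den h i j ≤ M) :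
    τ.posCoeff h t i j h' t' i' j' ≤ M := by
  have hb : ∀ b : Bool, b.toNat ≤ M := fun b => (Bool.toNat_le b).trans hM
  unfold Table.posCoeff
  split_ifs <;> first | exact hb _ | exact hn _ _ _ | exact hd _ _ _ | omega

theorem negCoeff_le {τ : Table} {M g h t i j h' t' i' : ℕ} (hM : 1 ≤ M)
    (hn : ∀ h i j, τ.num h i j ≤ M) : τ.negCoeff g h t i j h' t' i' ≤ M := by
  have hb : ∀ b : Bool, b.toNat ≤ M := fun b => (Bool.toNat_le b).trans hM
  unfold Table.negCoeff
  split_ifs <;> first | exact hb _ | exact hn _ _ _ | omega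

/-- Both parts of an entry are single bits or fields of `p.width` digits, and `p.width` is below the
input length; the difference of two numbers between `0` and `2 ^ N` obeys the same bound. -/
theorem abs_sysMatrix_le (hp : p.Small x.length) (R C : ℕ) :
    |sysMatrix x p q R C| ≤ 2 ^ x.length := by
  have hw : 2 ^ p.width ≤ 2 ^ x.length := Nat.pow_le_pow_right (by norm_num) hp.width.le
  have h1 : 1 ≤ 2 ^ x.length := Nat.one_le_two_pow
  have hn : ∀ h i j, (Table.ofBits x p).num h i j ≤ 2 ^ x.length := fun h i j =>
    (number_lt (fun t => Table.leafBit x p h i j (1 + t)) p.width).le.trans hw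
  have hd : ∀ h i j, (Table.ofBits x p).den h i j ≤ 2 ^ x.length := fun h i j =>
    (number_lt (fun t => Table.leafBit x p h i j (1 + p.width + t)) p.width).le.trans hw
  have a : posMatrix (Table.ofBits x p) x.length p q R C ≤ 2 ^ x.length := by
    unfold posMatrix Table.posEntry
    split_ifs <;> first | exact posCoeff_le h1 hn hd | omega
  have b : negMatrix (Table.ofBits x p) x.length p q R C ≤ 2 ^ x.length := by
    unfold negMatrix Table.negEntry
    split_ifs <;> first | exact negCoeff_le h1 hn | omega
  have e : ((2 ^ x.length : ℕ) : ℤ) = 2 ^ x.length := by push_cast; rfl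
  rw [sysMatrix, abs_le, ← e]
  omega

/-- The hypothesis on `m` in `div_mod_eq_det`, for entries bounded by `2` to the input length. -/
theorem bits_large (x : List Bool) :
    dim x ^ 2 + dim x + (x.length + 1) * dim x + 2 ≤ bits x.length := by
  rw [dim, bits]
  have h1 : (x.length + 1) * (x.length + 2) ^ 5 ≤ (x.length + 2) ^ 6 := by
    rw [pow_succ _ 5, mul_comm]; exact Nat.mul_le_mul_left _ (by omega)
  have hB : 2 ≤ x.length + 2 := by omega
  generalize x.length + 1 = A at *
  generalize x.length + 2 = B at *
  have q : ∀ a, 2 * B ^ a ≤ B ^ (a + 1) := fun a => by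
    rw [pow_succ, mul_comm]; exact Nat.mul_le_mul_left _ hB
  have p1 : B ^ 5 ≤ B ^ 6 := Nat.pow_le_pow_right (by omega) (by norm_num)
  have p2 : B ^ 7 ≤ B ^ 10 := Nat.pow_le_pow_right (by omega) (by norm_num)
  have q1 : 2 * B ^ 6 ≤ B ^ 7 := q 6
  have q2 : 2 * B ^ 10 ≤ B ^ 11 := q 10
  have q3 : 2 * B ^ 11 ≤ B ^ 12 := q 11
  have h2 : 2 ^ 6 ≤ B ^ 6 := Nat.pow_le_pow_left hB 6
  have e : (B ^ 5) ^ 2 = B ^ 10 := by ring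
  rw [e]
  omega

section

variable (hc : IsCode x u p) (hk : machine.base x.length ≤ 2 ^ k) (hq : q < machine.base x.length)
include hc hk hq

/-- Procedure 19 is the window of `div_mod_eq_det`: its bit `i` is bit `i + bits * dim` of the
rounded determinant. -/
theorem exists_residue : ∃ v : ℕ, (v : ℤ) = (system x p q).det % 2 ^ bits x.length ∧
    v < 2 ^ bits x.length ∧ machine.AVal x (detTime k) [19, u, q, 0, 0, 0, 0, 0, 0] v := by
  have h40 := forty_lt_base x.length
  obtain ⟨-, -, -, -, hb1, hD, hWi, hW, hW'⟩ := sizes x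
  obtain ⟨v, hv, h⟩ := av_detRounded hc hk hq
  have hmod : (v : ℤ) ≡ (1 + (2 ^ bits x.length : ℤ) • system x p q).det +
      2 ^ (bits x.length * dim x - 1) [ZMOD 2 ^ width x] := by
    have : ((2 ^ width x : ℕ) : ℤ) = 2 ^ width x := by push_cast; rfl
    rw [← this, ← ZMod.intCast_eq_intCast_iff, Int.cast_natCast, hv, Int.cast_add, cast_det_system]
    push_cast
    rfl
  have hdet := div_mod_eq_det (fun i j => abs_sysMatrix_le hc.small _ _) (bits_large x) hD hW' hmod
  refine ⟨_, hdet, Nat.mod_lt _ (by positivity), ?_⟩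
  have hn : machine.IsNode x [19, u, q, 0, 0, 0, 0, 0, 0] _ :=
    isNode_const hc.lt hq (by norm_num) (by simp; omega) fun _ _ _ _ _ => rfl
  have := ArithMachine.AVal.leaf (T := 3 * k + 9 + (k ^ 2 + 6 * k + 10) * opCost k) hn
    (X := v / 2 ^ (bits x.length * dim x) % 2 ^ bits x.length) fun i hi V hV => by
      rw [Nat.testBit_mod_two_pow, Nat.testBit_div_two_pow]
      have eb : ∀ σ : ℕ → ℕ, bitsE.eval σ = bits (σ 0) := fun σ => by simp [bitsE, baseE, bits]
      have ew : ∀ σ : ℕ → ℕ, widthE.eval σ = machine.width (σ 0) := machine.eval_widthE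
      have ed : ∀ σ : ℕ → ℕ, dimE.eval σ = (σ 0 + 2) ^ 5 := fun σ => by simp [dimE, baseE]
      by_cases hi' : i < bits x.length
      · have := hV _ _ (h (i + bits x.length * dim x) (by rw [machine_width]; omega))
        simp only [dim] at this ⊢
        simp [Step.run, regs, eb, ew, ed, hi', bitOf, call, this]
      · simp [Step.run, regs, eb, hi']
  exact this.mono (by rw [detTime]; have : 1 ≤ opCost k := Nat.one_le_pow _ _ (by omega); nlinarith)

/-- A negation modulo `2 ^ width` is also one modulo `2 ^ bits`, because `bits ≤ width`. -/
theorem exists_negResidue {v : ℕ}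
    (hv : machine.AVal x (detTime k) [19, u, q, 0, 0, 0, 0, 0, 0] v) :
    ∃ w : ℕ, (w : ℤ) ≡ -v [ZMOD 2 ^ bits x.length] ∧
      machine.AVal x (detTime k + opCost k) [20, u, q, 0, 0, 0, 0, 0, 0] w := by
  have h40 := forty_lt_base x.length
  have hW := (sizes x).2.2.2.1
  have hn : machine.IsNode x [20, u, q, 0, 0, 0, 0, 0, 0]
      (.mul [1, u, q, 0, 0, 0, 0, 0, 0] [19, u, q, 0, 0, 0, 0, 0, 0]) :=
    isNode_const hc.lt hq (by norm_num) (by simp; omega) fun _ _ _ _ _ => rfl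
  obtain ⟨w, hw, h⟩ := AV.mul hk hn ((av_negOne hc.lt hq).mono (T' := detTime k) (by
    rw [detTime]; omega)) ⟨v, rfl, hv⟩
  refine ⟨w, ?_, h⟩
  have h1 : (w : ℤ) ≡ -v [ZMOD ((2 ^ width x : ℕ) : ℤ)] := by
    rw [← ZMod.intCast_eq_intCast_iff, Int.cast_natCast, hw]
    push_cast
    ring
  refine h1.of_dvd ?_
  push_cast
  exact pow_dvd_pow 2 hW

/-- The sign and the magnitude of the determinant of a system. -/
theorem hasVal_det : machine.HasVal x (detTime k)
      [0, bits x.length - 1, 0, 0, width x, 19, u, q, 0, 0, 0, 0, 0, 0]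
      (decide ((system x p q).det < 0)) ∧
    (∀ t < bits x.length, machine.HasVal x (detTime k + opCost k + 1) [21, u, q, t]
      ((system x p q).det.natAbs.testBit t)) ∧
    machine.HasVal x (detTime k + k + 2) [15, 0, bits x.length, u, q]
      (decide ((system x p q).det ≠ 0)) ∧ (system x p q).det.natAbs < 2 ^ bits x.length := by
  have h40 := forty_lt_base x.length
  obtain ⟨hWb, -, -, hbW, hb1, -, -, -, -⟩ := sizes x
  obtain ⟨v, hv, hvlt, h⟩ := exists_residue hc hk hq
  obtain ⟨w, hw, h'⟩ := exists_negResidue hc hk hq h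
  have habs := abs_det_lt (A := system x p q) (fun i j => abs_sysMatrix_le hc.small _ _) (bits_large x)
  have hsign := testBit_sign hb1 habs hv
  have hmag := magnitude_eq hb1 habs hv hw
  rw [ArithMachine.AVal, machine_width] at h h'
  have eb : ∀ σ : ℕ → ℕ, bitsE.eval σ = bits (σ 0) := fun σ => by simp [bitsE, baseE, bits]
  have ew : ∀ σ : ℕ → ℕ, widthE.eval σ = machine.width (σ 0) := machine.eval_widthE
  have s1 : machine.HasVal x (detTime k)
      [0, bits x.length - 1, 0, 0, width x, 19, u, q, 0, 0, 0, 0, 0, 0]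
      (decide ((system x p q).det < 0)) := by
    rw [← hsign]
    exact h _ (by rw [machine_width]; omega)
  have hu := hc.lt
  refine ⟨s1, fun t ht => ?_, ?_, ?_⟩
  · refine .of_run ⟨by simp [machine], by simp; omega⟩ fun V hV => ?_
    have v1 := hV _ _ (s1.mono (by omega))
    have v2 := hV _ _ ((h t (by rw [machine_width]; omega)).mono (by omega))
    have v3 := hV _ _ (h' t (by rw [machine_width]; omega))
    rw [machine_run, ← hmag, Nat.testBit_mod_two_pow]
    simp only [ht, decide_true, Bool.true_and]
    by_cases hd : (system x p q).det < 0
    · simp [procs, Step.run, regs, arithBit, bitOf, eb, ew, machine_width, v1, v3, hd]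
    · simp [procs, Step.run, regs, arithBit, bitOf, eb, ew, machine_width, v1, v2, hd]
  · have := Machine.hasVal_any (M := machine.toMachine) (x := x) (T := detTime k) (K := bits x.length)
      (α := fun lo len => [15, lo, len, u, q]) (s := fun V i => V [0, i, 0, 0, width x, 19, u, q, 0, 0, 0, 0, 0, 0])
      (f := v.testBit)
      (fun a b hab => ⟨by simp [machine], by simp; omega⟩)
      (fun V a b => by
        rw [machine_run]
        simp [procs, run_range, Step.run, regs, copy, arithBit, bitOf, ew, machine_width])
      (fun i hi V hV => hV _ _ (h i (by rw [machine_width]; omega))) (k := k) (lo := 0) (len := bits x.length)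
      (by omega) (by omega)
    have e : anyIn v.testBit 0 (bits x.length) = decide ((system x p q).det ≠ 0) := by
      rw [Bool.eq_iff_iff, anyIn_eq_true, decide_eq_true_eq]
      simp only [zero_add]
      -- The determinant is smaller than the modulus in absolute value, so it vanishes together with
      -- its residue.
      have h0 : v = 0 ↔ (system x p q).det = 0 := by
        rw [← Int.natCast_eq_zero, hv]
        constructor
        · intro h
          have h2 : (2 : ℤ) ^ (bits x.length - 1) ≤ 2 ^ bits x.length :=
            pow_le_pow_right₀ (by norm_num) (by omega)
          exact Int.eq_zero_of_abs_lt_dvd (Int.dvd_of_emod_eq_zero h) (habs.trans_le h2)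
        · intro h; simp [h]
      rw [ne_eq, ← h0]
      constructor
      · rintro ⟨i, -, hi⟩ rfl
        simp at hi
      · intro h
        obtain ⟨i, hi⟩ := Nat.exists_testBit_of_ne_zero h
        refine ⟨i, ?_, hi⟩
        by_contra hlt
        rw [Nat.testBit_lt_two_pow (hvlt.trans_le (Nat.pow_le_pow_right (by norm_num) (not_lt.1 hlt)))] at hi
        exact Bool.false_ne_true hi
    rw [← e]
    exact this.mono (by omega)
  · zify
    refine habs.trans_le (pow_le_pow_right₀ (by norm_num) (by omega))

end

end Evaluator

end RatEval

/-! ### Assembling the output bits -/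

namespace RatEval

namespace Evaluator

open ArithMachine (opCost)

/-- Whether the parameters agree with the header of the input. -/
def header (x : List Bool) (p : Shape) : Bool :=
  allIn (fun i => if i = p.vars ∨ i = p.vars + p.side + 1 ∨ i = p.vars + p.side + p.size + 2 ∨
    i = p.vars + p.side + p.size + p.width + 3 then !x.getD i false else x.getD i false) 0 p.head

/-- Whether all systems of the gates are regular. -/
def regular (x : List Bool) (p : Shape) : Bool :=
  allIn (fun g => decide ((system x p g).det ≠ 0)) 0 p.size

/-- The number of the system for entry `e` of the result. -/
def outSystem (N ℓ e : ℕ) : ℕ := N + e / ℓ * N + e % ℓ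

/-- Bit `o` of a quotient. -/
def quotBit (w : ℕ) (c d : ℤ) (o : ℕ) : Bool :=
  if o = 0 then decide (c < 0) ^^ decide (d < 0)
  else if o < w + 1 then c.natAbs.testBit (o - 1) else d.natAbs.testBit (o - 1 - w)

/-- Bit `o` of entry `e` of the result. -/
def entryBit (x : List Bool) (p : Shape) (e o : ℕ) : Bool :=
  decide (e < p.side * p.side) && quotBit (bits x.length)
    (system x p (outSystem x.length p.side e)).det (system x p (p.size - 1)).det o

/-- Bit `j` of the output for the parameters `p`. -/
def outBit (x : List Bool) (p : Shape) (j : ℕ) : Bool :=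
  if j = 0 then regular x p else if j < bits x.length + 1 then true
  else if j = bits x.length + 1 then false
  else entryBit x p ((j - bits x.length - 2) / (2 * bits x.length + 1))
    ((j - bits x.length - 2) % (2 * bits x.length + 1))

/-- The time for the output of the evaluator with a given code. -/
def outTime (k : ℕ) : ℕ := detTime k + opCost k + 2 * k + 5

variable {x : List Bool} {k u j : ℕ} {p : Shape}

theorem pow_four_le (N : ℕ) : N * N * N * N ≤ (N + 2) ^ 19 := by
  calc N * N * N * N = N ^ 4 := by ring
    _ ≤ (N + 2) ^ 4 := Nat.pow_le_pow_left (by omega) 4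
    _ ≤ (N + 2) ^ 19 := Nat.pow_le_pow_right (by omega) (by norm_num)

theorem four_mul_add_lt (N : ℕ) : 4 * N + 8 < (N + 2) ^ 19 := by
  have h : (N + 2) ^ 4 ≤ (N + 2) ^ 19 := Nat.pow_le_pow_right (by omega) (by norm_num)
  have h2 : 2 ^ 3 ≤ (N + 2) ^ 3 := Nat.pow_le_pow_left (by omega) 3
  have h3 := Nat.mul_le_mul_right (N + 2) h2
  have h4 : (N + 2) ^ 4 = (N + 2) ^ 3 * (N + 2) := pow_succ _ _
  omega

/-- Below `N ^ 4` the last parameter, a plain quotient, is a digit in base `N` as well. -/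
theorem isCode_decode (hu : u < x.length * x.length * x.length * x.length) :
    IsCode x u (Shape.decode x.length u) := by
  have hN : 0 < x.length := by
    rcases Nat.eq_zero_or_pos x.length with h | h
    · simp [h] at hu
    · exact h
  refine ⟨rfl, ⟨Nat.mod_lt _ hN, Nat.mod_lt _ hN, Nat.mod_lt _ hN, ?_⟩,
    hu.trans_le (pow_four_le _)⟩
  exact Nat.div_lt_of_lt_mul (by linarith)

theorem hasVal_header (hc : IsCode x u p) (hk : machine.base x.length ≤ 2 ^ k) :
    machine.HasVal x (k + 2) [17, 0, p.head, u] (header x p) := by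
  have h40 := forty_lt_base x.length
  have h4 := four_mul_add_lt x.length
  rw [← machine_base] at h4
  obtain ⟨h1, h2, h3, h5⟩ := hc.small
  have hh : p.head < machine.base x.length := by rw [Shape.head]; omega
  have hu := hc.lt
  refine (Machine.hasVal_all (M := machine.toMachine) (T := 1) (K := p.head)
    (α := fun lo len => [17, lo, len, u])
    (s := fun V i => if i = p.vars ∨ i = p.vars + p.side + 1 ∨ i = p.vars + p.side + p.size + 2 ∨
      i = p.vars + p.side + p.size + p.width + 3 then !V [3, i] else V [3, i])
    (fun a b hab => ⟨by simp [machine], by simp; omega⟩)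
    (fun V a b => ?_) (fun i hi V hV => ?_) (k := k) (by omega) (by omega)).mono (by omega)
  · rw [machine_run]
    simp [procs, run_range, Step.run, regs, copy, hc.decode]
    split_ifs <;> simp_all
  · rw [hV _ _ (hasVal_input (by omega))]

theorem hasVal_regular (hc : IsCode x u p) (hk : machine.base x.length ≤ 2 ^ k) :
    machine.HasVal x (detTime k + 2 * k + 3) [16, 0, p.size, u] (regular x p) := by
  have h40 := forty_lt_base x.length
  have h4 := four_mul_add_lt x.length
  rw [← machine_base] at h4
  have h3 := hc.small.size
  have hu := hc.lt
  have hb : bits x.length < machine.base x.length :=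
    (sizes x).2.2.2.1.trans_lt (sizes x).1
  have eb : ∀ σ : ℕ → ℕ, bitsE.eval σ = bits (σ 0) := fun σ => by simp [bitsE, baseE, bits]
  refine (Machine.hasVal_all (M := machine.toMachine) (T := detTime k + k + 2) (K := p.size)
    (α := fun lo len => [16, lo, len, u])
    (s := fun V i => V [15, 0, bits x.length, u, i])
    (fun a b hab => ⟨by simp [machine], by simp; omega⟩)
    (fun V a b => ?_) (fun i hi V hV => ?_) (k := k) (by omega) (by omega)).mono (by omega)
  · rw [machine_run]
    simp [procs, run_range, Step.run, regs, copy, eb]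
  · exact hV _ _ (hasVal_det hc hk (by omega)).2.2.1

theorem outSystem_lt {N ℓ e : ℕ} (hℓ : ℓ < N) (he : e < ℓ * ℓ) :
    outSystem N ℓ e < (N + 2) ^ 19 := by
  have h0 : 0 < ℓ := Nat.pos_of_ne_zero fun h => by simp [h] at he
  have h1 : e / ℓ < ℓ := Nat.div_lt_of_lt_mul he
  have h2 : e % ℓ < ℓ := Nat.mod_lt _ h0
  have h3 : e / ℓ * N ≤ N * N := Nat.mul_le_mul_right _ (by omega)
  have h4 : (N + 2) ^ 2 ≤ (N + 2) ^ 19 := Nat.pow_le_pow_right (by omega) (by norm_num)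
  rw [outSystem]
  nlinarith

/-- An entry of the value is the quotient of the determinants of the system `outSystem`, with one
column replaced, and of the system `p.size - 1`, which is the complete one. -/
theorem hasVal_outBit (hc : IsCode x u p) (hk : machine.base x.length ≤ 2 ^ k)
    (hj : j < machine.numOut x.length) :
    machine.HasVal x (outTime k) [20, u, j] (outBit x p j) := by
  have h40 := forty_lt_base x.length
  have h4 := four_mul_add_lt x.length
  rw [← machine_base] at h4
  have hu := hc.lt
  have hp := hc.small
  have h3 := hp.size
  have hjb : j < machine.base x.length := hj.trans_le (numOut_le _)
  have eb : ∀ σ : ℕ → ℕ, bitsE.eval σ = bits (σ 0) := fun σ => by simp [bitsE, baseE, bits]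
  have ew : ∀ σ : ℕ → ℕ, widthE.eval σ = machine.width (σ 0) := machine.eval_widthE
  refine Machine.HasVal.of_run (T := detTime k + opCost k + 2 * k + 4)
    ⟨by simp [machine], by simp; omega⟩ fun V hV => ?_
  rw [machine_run]
  by_cases h0 : j = 0
  · have v := hV _ _ ((hasVal_regular hc hk).mono (by omega))
    simp [procs, outStep, Step.run, regs, copy, h0, hc.decode, v, outBit]
  by_cases h1 : j < bits x.length + 1
  · simp [procs, outStep, Step.run, regs, eb, h0, h1, outBit]
  by_cases h2 : j = bits x.length + 1
  · simp [procs, outStep, Step.run, regs, eb, h2, outBit]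
  generalize he : (j - bits x.length - 2) / (2 * bits x.length + 1) = e at *
  generalize ho : (j - bits x.length - 2) % (2 * bits x.length + 1) = o at *
  have hob : o < 2 * bits x.length + 1 := ho ▸ Nat.mod_lt _ (by omega)
  have ee : outEntryE.eval (regs x.length [20, u, j]) = e := by
    simp [outEntryE, eb, regs, he]
  have eo : outPosE.eval (regs x.length [20, u, j]) = o := by
    simp [outPosE, eb, regs, ho]
  have es : outSystemE.eval (regs x.length [20, u, j]) = outSystem x.length p.side e := by
    simp [outSystemE, ee, outSystem, regs, hc.decode]
  have r0 : regs x.length [20, u, j] 0 = x.length := rfl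
  have r2 : regs x.length [20, u, j] 2 = u := rfl
  have r3 : regs x.length [20, u, j] 3 = j := rfl
  rw [outBit, if_neg h0, if_neg h1, if_neg h2, he, ho, entryBit, quotBit]
  by_cases hs : e < p.side * p.side
  · have d1 := hasVal_det hc hk (outSystem_lt hp.side hs)
    have d2 := hasVal_det hc hk (q := p.size - 1) (by omega)
    have s1 := hV _ _ (d1.1.mono (by omega))
    have s2 := hV _ _ (d2.1.mono (by omega))
    by_cases ho0 : o = 0
    · simp [procs, outStep, Step.run, arithBit, bitOf, machine_width, ew, eb, ee, eo, es, r0, r2, r3,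
        h0, h1, h2, hs, ho0, hc.decode, s1, s2]
    by_cases ho1 : o < bits x.length + 1
    · have m1 := hV _ _ ((d1.2.1 (o - 1) (by omega)).mono (by omega))
      simp [procs, outStep, Step.run, copy, eb, ee, eo, es, r0, r2, r3, h0, h1, h2, hs, ho0, ho1,
        hc.decode, m1]
    · have m2 := hV _ _ ((d2.2.1 (o - 1 - bits x.length) (by omega)).mono (by omega))
      simp [procs, outStep, Step.run, copy, eb, ee, eo, r0, r2, r3, h0, h1, h2, hs, ho0, ho1,
        hc.decode, m2]
  · simp [procs, outStep, Step.run, eb, ee, r0, r2, r3, h0, h1, h2, hs, hc.decode]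

/-- The bits of the output. -/
def answer (x : List Bool) (j : ℕ) : Bool :=
  anyIn (fun u => header x (Shape.decode x.length u) && outBit x (Shape.decode x.length u) j) 0
    (x.length * x.length * x.length * x.length)

/-- The circuit does not know the parameters of the instance: all codes below `N ^ 4` are processed
in parallel, and those with a wrong header are masked out. -/
theorem hasVal_answer (hk : machine.base x.length ≤ 2 ^ k) (hj : j < machine.numOut x.length) :
    machine.HasVal x (outTime k + k + 2) [18, j] (answer x j) := by
  have h40 := forty_lt_base x.length
  have hjb : j < machine.base x.length := hj.trans_le (numOut_le _)
  have h4 := pow_four_le x.length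
  have h5 := four_mul_add_lt x.length
  rw [← machine_base] at h4 h5
  have h6 : x.length * x.length * x.length * x.length < machine.base x.length := by
    refine lt_of_lt_of_le ?_ (Nat.pow_le_pow_right (by omega) (by norm_num : 4 ≤ 19))
    calc x.length * x.length * x.length * x.length = x.length ^ 4 := by ring
      _ < (x.length + 2) ^ 4 := Nat.pow_lt_pow_left (by omega) (by norm_num)
  generalize hU : x.length * x.length * x.length * x.length = U at *
  have hr := Machine.hasVal_any (M := machine.toMachine) (T := outTime k) (K := U) (x := x)
    (α := fun lo len => [19, lo, len, j])
    (s := fun V u => V [17, 0, (Shape.decode x.length u).head, u] && V [20, u, j])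
    (f := fun u => header x (Shape.decode x.length u) && outBit x (Shape.decode x.length u) j)
    (fun a b hab => ⟨by simp [machine], by simp; omega⟩)
    (fun V a b => by
      rw [machine_run]
      simp [procs, run_range, Step.run, regs])
    (fun u hu V hV => by
      have hc : IsCode x u _ := isCode_decode (by omega)
      rw [hV _ _ ((hasVal_header hc hk).mono (by rw [outTime]; omega)),
        hV _ _ (hasVal_outBit hc hk hj)]) (k := k) (lo := 0) (len := U) (by omega) (by omega)
  refine Machine.HasVal.of_run (T := outTime k + k + 1)
    ⟨by simp [machine], by simp; omega⟩ fun V hV => ?_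
  have v := hV _ _ hr
  rw [machine_run, answer, hU]
  simpa [procs, Step.run, regs, copy, hU] using v

/-- The time is a polynomial of degree four in `k = 19 (L + 2)`, and `k + 2 ≤ 40 (L + 1)`; this
fixes the speed of `machine`. -/
theorem outTime_le (L : ℕ) :
    outTime (19 * (L + 2)) + 19 * (L + 2) + 2 ≤ 1000 * 40 ^ 4 * (L + 1) ^ 4 := by
  have h1 : 19 * (L + 2) + 2 ≤ 40 * (L + 1) := by omega
  generalize 19 * (L + 2) = k at *
  calc outTime k + k + 2 ≤ 1000 * (k + 2) ^ 4 := by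
        rw [outTime, detTime, opCost]
        nlinarith [sq_nonneg k]
    _ ≤ 1000 * (40 * (L + 1)) ^ 4 := Nat.mul_le_mul_left _ (Nat.pow_le_pow_left h1 4)
    _ = 1000 * 40 ^ 4 * (L + 1) ^ 4 := by rw [mul_pow, mul_assoc]

/-- The output of the evaluator. -/
theorem output_machine (x : List Bool) :
    machine.circuits.output x = (List.range (machine.numOut x.length)).map (answer x) := by
  -- The nineteenth power of `N + 2 ≤ 2 ^ (log N + 2)`.
  have hk : machine.base x.length ≤ 2 ^ (19 * (Nat.log 2 x.length + 2)) := by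
    rw [machine_base, mul_comm, pow_mul]
    have := Nat.lt_pow_succ_log_self (b := 2) (by norm_num) x.length
    have h2 := Nat.one_le_pow (Nat.log 2 x.length) 2 (by norm_num)
    refine Nat.pow_le_pow_left ?_ 19
    rw [Nat.succ_eq_add_one, pow_succ] at this
    rw [pow_add]
    omega
  refine machine.output_circuits (by simp) fun j hj => ?_
  rw [List.getD_eq_getElem _ _ (by simpa using hj), List.getElem_map, List.getElem_range]
  exact (hasVal_answer hk hj).mono (outTime_le _)

end Evaluator

end RatEval

namespace RatEval

/-! ### Lists of words of the same length -/

/-- Random access in a concatenation of words of equal length, which is how `Shape.node` and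
`Shape.entry` locate their words. -/
theorem getD_flatten {α : Type*} (d : α) {c : ℕ} : ∀ {l : List (List α)} {k o : ℕ},
    (∀ w ∈ l, w.length = c) → o < c → l.flatten.getD (k * c + o) d = (l.getD k []).getD o d
  | [], k, o, _, _ => by simp
  | w :: l, 0, o, h, ho => by
    rw [List.flatten_cons, Nat.zero_mul, zero_add,
      List.getD_append _ _ _ _ (by rwa [h w (by simp)]), List.getD_cons_zero]
  | w :: l, k + 1, o, h, ho => by
    have hw : w.length = c := h w (by simp)
    rw [List.flatten_cons, List.getD_append_right _ _ _ _ (by rw [hw, Nat.succ_mul]; omega), hw,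
      show (k + 1) * c + o - c = k * c + o by rw [Nat.succ_mul]; omega,
      getD_flatten d (fun v hv => h v (by simp [hv])) ho, List.getD_cons_succ]

theorem length_flatten {α : Type*} {c : ℕ} {l : List (List α)} (h : ∀ w ∈ l, w.length = c) :
    l.flatten.length = l.length * c := by
  induction l with
  | nil => simp
  | cons w l ih =>
    rw [List.flatten_cons, List.length_append, h w (by simp), ih fun v hv => h v (by simp [hv]),
      List.length_cons, Nat.succ_mul, add_comm]

theorem getD_finRange_map {α : Type*} {n : ℕ} (f : Fin n → α) (d : α) (i : Fin n) :
    ((List.finRange n).map f).getD i d = f i := by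
  rw [List.getD_eq_getElem _ _ (by simp)]; simp

theorem length_entries {ℓ : ℕ} (A : Matrix (Fin ℓ) (Fin ℓ) ℚ) : (entries A).length = ℓ * ℓ := by
  rw [entries, List.flatMap, length_flatten (c := ℓ) (by simp)]; simp

theorem getD_entries {ℓ : ℕ} (A : Matrix (Fin ℓ) (Fin ℓ) ℚ) (i j : Fin ℓ) :
    (entries A).getD (i * ℓ + j) 0 = A i j := by
  rw [entries, List.flatMap, getD_flatten 0 (c := ℓ) (by simp) j.2, getD_finRange_map,
    getD_finRange_map]

theorem getD_tuple {n ℓ : ℕ} (P : Fin n → Matrix (Fin ℓ) (Fin ℓ) ℚ) (k : Fin n) (i j : Fin ℓ) :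
    ((List.finRange n).flatMap fun k => entries (P k)).getD ((k * ℓ + i) * ℓ + j) 0 = P k i j := by
  have h : (i : ℕ) * ℓ + j < ℓ * ℓ := by have := i.2; have := j.2; nlinarith
  rw [show (k * ℓ + i) * ℓ + j = k * (ℓ * ℓ) + (i * ℓ + j) by ring, List.flatMap,
    getD_flatten 0 (c := ℓ * ℓ) (by simp [length_entries]) h, getD_finRange_map, getD_entries]

theorem length_tuple {n ℓ : ℕ} (P : Fin n → Matrix (Fin ℓ) (Fin ℓ) ℚ) :
    ((List.finRange n).flatMap fun k => entries (P k)).length = n * (ℓ * ℓ) := by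
  rw [List.flatMap, length_flatten (c := ℓ * ℓ) (by simp [length_entries])]; simp

theorem _root_.List.Forall₂.getD {α β : Type*} {R : α → β → Prop} {l : List α} {m : List β}
    (h : List.Forall₂ R l m) {k : ℕ} (hk : k < l.length) (a : α) (b : β) :
    R (l.getD k a) (m.getD k b) := by
  have h2 : k < m.length := h.length_eq ▸ hk
  rw [List.getD_eq_getElem _ _ hk, List.getD_eq_getElem _ _ h2]
  exact (List.forall₂_iff_get.1 h).2 k hk h2

theorem getD_unary_append (v : ℕ) (r : List Bool) (i : ℕ) : (unary v ++ r).getD i false =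
    if i < v then true else if i = v then false else r.getD (i - v - 1) false := by
  rw [unary, List.append_assoc]
  split_ifs with h1 h2
  · rw [List.getD_append _ _ _ _ (by simpa using h1), List.getD_replicate _ h1]
  · rw [List.getD_append_right _ _ _ _ (by simp [h2])]
    simp [h2]
  · rw [List.getD_append_right _ _ _ _ (by simp; omega), List.length_replicate,
      show i - v = (i - v - 1) + 1 by omega, List.singleton_append, List.getD_cons_succ]
    simp

/-! ### Words for rational numbers and gates -/

theorem number_eq {f : ℕ → Bool} {b v : ℕ} (hv : v < 2 ^ b) (h : ∀ t < b, f t = v.testBit t) :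
    number f b = v := by
  refine Nat.eq_of_testBit_eq fun t => ?_
  rw [testBit_number]
  by_cases ht : t < b
  · simp [ht, h t ht]
  · simp [ht, Nat.testBit_lt_two_pow (hv.trans_le (Nat.pow_le_pow_right (by norm_num) (not_lt.1 ht)))]

theorem length_natBits (b v : ℕ) : (natBits b v).length = b := by simp [natBits]

theorem getD_natBits {b v t : ℕ} (h : t < b) : (natBits b v).getD t false = v.testBit t := by
  rw [List.getD_eq_getElem _ _ (by simpa [natBits] using h)]; simp [natBits]

theorem getD_fst {b p q t : ℕ} {s : Bool} (h : t < b) :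
    (s :: (natBits b p ++ natBits b q)).getD (1 + t) false = p.testBit t := by
  rw [add_comm, List.getD_cons_succ, List.getD_append _ _ _ _ (by rwa [length_natBits]),
    getD_natBits h]

theorem getD_snd {b p q t : ℕ} {s : Bool} (h : t < b) :
    (s :: (natBits b p ++ natBits b q)).getD (1 + b + t) false = q.testBit t := by
  rw [show 1 + b + t = b + t + 1 by omega, List.getD_cons_succ,
    List.getD_append_right _ _ _ _ (by rw [length_natBits]; omega), length_natBits,
    Nat.add_sub_cancel_left, getD_natBits h]

theorem EncodesRat.length {b : ℕ} {c : ℚ} {w : List Bool} (h : EncodesRat b c w) :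
    w.length = 2 * b + 1 := by
  obtain ⟨s, p, q, -, -, -, -, rfl⟩ := h
  simp [length_natBits]; omega

theorem EncodesNode.length {n b : ℕ} {d : Node n} {w : List Bool} (h : EncodesNode b d w) :
    w.length = 2 * b + 4 := by
  cases d with
  | const c =>
    obtain ⟨u, hu, rfl⟩ := h
    simp [hu.length]
  | var i => obtain ⟨-, rfl⟩ := h; simp [length_natBits]; omega
  | add l r => obtain ⟨-, -, rfl⟩ := h; simp [length_natBits]; omega
  | mul l r => obtain ⟨-, -, rfl⟩ := h; simp [length_natBits]; omega
  | inv a => obtain ⟨-, rfl⟩ := h; simp [length_natBits]; omega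

/-- A rational number is read off from the digits of its word. -/
theorem EncodesRat.eq {b : ℕ} {c : ℚ} {w : List Bool} (h : EncodesRat b c w) {f : ℕ → Bool}
    (hf : ∀ o < 2 * b + 1, f o = w.getD o false) :
    number (fun t => f (1 + b + t)) b ≠ 0 ∧
      (if f 0 then -(number (fun t => f (1 + t)) b : ℚ) else number (fun t => f (1 + t)) b) /
        number (fun t => f (1 + b + t)) b = c := by
  obtain ⟨s, p, q, hp, hq0, hq, rfl, rfl⟩ := h
  have h1 : number (fun t => f (1 + t)) b = p := number_eq hp fun t ht => by
    rw [hf _ (by omega), getD_fst ht]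
  have h2 : number (fun t => f (1 + b + t)) b = q := number_eq hq fun t ht => by
    rw [hf _ (by omega), getD_snd ht]
  have h3 : f 0 = s := by rw [hf _ (by omega)]; rfl
  rw [h1, h2, h3]
  exact ⟨by omega, rfl⟩

theorem Formula.length_nodes {n : ℕ} (Φ : Formula n) (k : ℕ) : (Φ.nodes k).length = Φ.size := by
  induction Φ generalizing k <;> simp [Formula.nodes, Formula.size, add_assoc, *]

theorem getElem?_append_of_left {α : Type*} {l m : List α} {i : ℕ} {d : α} (h : l[i]? = some d) :
    (l ++ m)[i]? = some d := by
  rwa [List.getElem?_append_left (List.getElem?_eq_some_iff.1 h).1]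

theorem getElem?_append_of_right {α : Type*} {l m : List α} {c i : ℕ} {d : α} (hl : l.length = c)
    (h : m[i]? = some d) : (l ++ m)[c + i]? = some d := by
  rwa [List.getElem?_append_right (by omega), hl, Nat.add_sub_cancel_left]

/-! ### Instances as gate tables -/

/-- The bit string `x` holds the gates of `Φ` from number `k` on and the matrices `P` in the layout
with the parameters `p`. -/
structure Holds (x : List Bool) (p : Shape) {n ℓ : ℕ} (P : Fin n → Matrix (Fin ℓ) (Fin ℓ) ℚ)
    (Φ : Formula n) (k : ℕ) : Prop where
  vars : p.vars = n
  entry : ∀ (v : Fin n) (i j : Fin ℓ), ∃ w, EncodesRat p.width (P v i j) w ∧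
    ∀ o < 2 * p.width + 1, x.getD (p.entry v i j + o) false = w.getD o false
  node : ∀ h d, (Φ.nodes k)[h]? = some d → ∃ w, EncodesNode p.width d w ∧
    ∀ o < 2 * p.width + 4, x.getD (p.node (k + h) + o) false = w.getD o false

namespace Holds

variable {x : List Bool} {p : Shape} {n ℓ : ℕ} {P : Fin n → Matrix (Fin ℓ) (Fin ℓ) ℚ}

theorem sub {Φ Ψ : Formula n} {k m : ℕ} (h : Holds x p P Φ k)
    (hn : ∀ i d, (Ψ.nodes (k + m))[i]? = some d → (Φ.nodes k)[m + i]? = some d) :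
    Holds x p P Ψ (k + m) where
  vars := h.vars
  entry := h.entry
  node i d hd := by
    rw [add_assoc]
    exact h.node _ _ (hn i d hd)

theorem last {Φ : Formula n} {k m : ℕ} {d : Node n} (h : Holds x p P Φ k)
    (hm : (Φ.nodes k)[m]? = some d) : ∃ w, EncodesNode p.width d w ∧
      ∀ o < 2 * p.width + 4, x.getD (p.node (k + m) + o) false = w.getD o false := h.node m d hm

/-- The first number in the field of a gate. -/
theorem lft_eq {h v v' : ℕ} {w : List Bool} {a b c : Bool}
    (hw : w = [a, b, c] ++ false :: (natBits p.width v ++ natBits p.width v'))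
    (hv : v < 2 ^ p.width)
    (hx : ∀ o < 2 * p.width + 4, x.getD (p.node h + o) false = w.getD o false) :
    (Table.ofBits x p).lft h = v ∧ (Table.ofBits x p).k₀ h = a ∧ (Table.ofBits x p).k₁ h = b ∧
      (Table.ofBits x p).k₂ h = c := by
  subst hw
  refine ⟨(number_eq hv fun t ht => ?_ :
    number (fun t => x.getD (p.node h + 4 + t) false) p.width = v), hx 0 (by omega), hx 1 (by omega), hx 2 (by omega)⟩
  rw [add_assoc, hx _ (by omega), show 4 + t = 1 + t + 1 + 1 + 1 by omega]
  simp only [List.cons_append, List.nil_append, List.getD_cons_succ]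
  exact getD_fst ht

theorem fits {Φ : Formula n} {k : ℕ} (h : Holds x p P Φ k) : (Table.ofBits x p).Fits P Φ k := by
  induction Φ generalizing k with
  | const c =>
    obtain ⟨w, ⟨u, hu, rfl⟩, hx⟩ := h.node 0 _ rfl
    rw [add_zero] at hx
    have k0 : x.getD (p.node k) false = false := hx 0 (by omega)
    refine ⟨hx 1 (by omega), hx 2 (by omega), fun i j => ?_⟩
    have hb : ∀ o < 2 * p.width + 1, x.getD (p.node k + 3 + o) false = u.getD o false := fun o ho => by
      rw [add_assoc, hx _ (by omega), show 3 + o = o + 1 + 1 + 1 by omega]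
      rfl
    by_cases hij : i = j
    · subst hij
      have := hu.eq (f := Table.leafBit x p k i i) fun o ho => by
        rw [Table.leafBit, k0, hb o ho]; simp
      rw [Matrix.scalar_apply, Matrix.diagonal_apply_eq]
      exact this
    · obtain ⟨s, a, b, ha, hb0, hb', -, rfl⟩ := hu
      have hij' : (i : ℕ) ≠ j := fun e => hij (Fin.ext e)
      -- Off the diagonal the masked word encodes `0` with the sign and denominator of the constant.
      have h0 : EncodesRat p.width 0 (s :: (natBits p.width 0 ++ natBits p.width b)) :=
        ⟨s, 0, b, by positivity, hb0, hb', by simp, rfl⟩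
      have := h0.eq (f := Table.leafBit x p k i j) fun o ho => by
        rw [Table.leafBit, k0, hb o ho, if_neg (by simp), decide_eq_false hij', Bool.false_or]
        rcases Nat.eq_zero_or_pos o with rfl | ho0
        · simp
        by_cases how : o < p.width + 1
        · obtain ⟨t, rfl⟩ := Nat.exists_eq_add_of_le ho0
          rw [getD_fst (by omega), decide_eq_false (by omega), decide_eq_false (by omega),
            show Nat.succ 0 + t = 1 + t from rfl, getD_fst (by omega)]
          simp
        · obtain ⟨t, rfl⟩ := Nat.exists_eq_add_of_le (show 1 + p.width ≤ o by omega)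
          rw [getD_snd (by omega), getD_snd (by omega), decide_eq_true (by omega : p.width < _)]
          simp
      rw [Matrix.scalar_apply, Matrix.diagonal_apply_ne _ hij]
      exact this
  | var v =>
    obtain ⟨w, ⟨hv, hw⟩, hx⟩ := h.node 0 _ rfl
    rw [add_zero] at hx
    obtain ⟨h1, h2, h3, h4⟩ := lft_eq hw hv hx
    refine ⟨h3, h4, fun i j => ?_⟩
    obtain ⟨u, hu, hux⟩ := h.entry v i j
    refine hu.eq (f := Table.leafBit x p k i j) fun o ho => ?_
    have h2' : x.getD (p.node k) false = true := h2
    have h1' : number (fun t => x.getD (p.node k + 4 + t) false) p.width = v := h1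
    -- The stored index is `v`, so only the term of `v` can survive in the disjunction over the
    -- variables.
    rw [Table.leafBit, h2', if_pos rfl, h1', ← hux o ho, Bool.eq_iff_iff, anyIn_eq_true]
    have := h.vars
    have := v.2
    constructor
    · rintro ⟨l, -, hl⟩
      simp only [zero_add, Bool.and_eq_true, decide_eq_true_eq] at hl
      rw [hl.1]; exact hl.2
    · intro hl
      exact ⟨v, by omega, by simpa using hl⟩
  | add Φ Ψ ih₁ ih₂ =>
    obtain ⟨w, ⟨hl, hr, hw⟩, hx⟩ := h.last (m := Φ.size + Ψ.size + 0) (getElem?_append_of_right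
      (by rw [List.length_append, Formula.length_nodes, Formula.length_nodes]) rfl)
    obtain ⟨h1, h2, h3, h4⟩ := lft_eq hw hl hx
    rw [add_zero, ← add_assoc] at h1 h2 h3 h4
    exact ⟨ih₁ (h.sub (m := 0) fun i d hd => by
        rw [zero_add]; exact getElem?_append_of_left (getElem?_append_of_left hd)),
      ih₂ (h.sub fun i d hd => getElem?_append_of_left
        (getElem?_append_of_right (Formula.length_nodes _ _) hd)), h2, h3, h4, h1⟩
  | mul Φ Ψ ih₁ ih₂ =>
    obtain ⟨w, ⟨hl, hr, hw⟩, hx⟩ := h.last (m := Φ.size + Ψ.size + 0) (getElem?_append_of_right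
      (by rw [List.length_append, Formula.length_nodes, Formula.length_nodes]) rfl)
    obtain ⟨h1, h2, h3, h4⟩ := lft_eq hw hl hx
    rw [add_zero, ← add_assoc] at h1 h2 h3 h4
    exact ⟨ih₁ (h.sub (m := 0) fun i d hd => by
        rw [zero_add]; exact getElem?_append_of_left (getElem?_append_of_left hd)),
      ih₂ (h.sub fun i d hd => getElem?_append_of_left
        (getElem?_append_of_right (Formula.length_nodes _ _) hd)), h2, h3, h4, h1⟩
  | inv Φ ih =>
    obtain ⟨w, ⟨hl, hw⟩, hx⟩ := h.last (m := Φ.size) (getElem?_append_of_right (i := 0)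
      (Formula.length_nodes _ _) rfl)
    obtain ⟨h1, h2, h3, h4⟩ := lft_eq hw hl hx
    exact ⟨ih (h.sub (m := 0) fun i d hd => by rw [zero_add]; exact getElem?_append_of_left hd),
      h3, h4⟩

end Holds

/-- A header has exactly four zeros, which close the unary numbers. Compare the parameters in order:
if one were smaller in one header, its closing zero would stand where the other header demands a
one. -/
theorem header_unique {x : List Bool} {p p' : Shape} (h : Evaluator.header x p = true)
    (h' : Evaluator.header x p' = true) : p = p' := by
  obtain ⟨a, b, c, d⟩ := p
  obtain ⟨a', b', c', d'⟩ := p'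
  simp only [Evaluator.header, allIn_eq_true, zero_add, Shape.head] at h h'
  have e : ∀ i < a + b + c + d + 4, (x.getD i false = false ↔
      i = a ∨ i = a + b + 1 ∨ i = a + b + c + 2 ∨ i = a + b + c + d + 3) := fun i hi => by
    have := h i hi
    split_ifs at this with h1 <;> simp_all
  have e' : ∀ i < a' + b' + c' + d' + 4, (x.getD i false = false ↔
      i = a' ∨ i = a' + b' + 1 ∨ i = a' + b' + c' + 2 ∨ i = a' + b' + c' + d' + 3) := fun i hi => by
    have := h' i hi
    split_ifs at this with h1 <;> simp_all
  have ha : a = a' := by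
    rcases lt_trichotomy a a' with hl | hl | hl
    · have := (e' a (by omega)).1 ((e a (by omega)).2 (by omega)); omega
    · exact hl
    · have := (e a' (by omega)).1 ((e' a' (by omega)).2 (by omega)); omega
  subst ha
  have hb : b = b' := by
    rcases lt_trichotomy b b' with hl | hl | hl
    · have := (e' (a + b + 1) (by omega)).1 ((e _ (by omega)).2 (by omega)); omega
    · exact hl
    · have := (e (a + b' + 1) (by omega)).1 ((e' _ (by omega)).2 (by omega)); omega
  subst hb
  have hc : c = c' := by
    rcases lt_trichotomy c c' with hl | hl | hl
    · have := (e' (a + b + c + 2) (by omega)).1 ((e _ (by omega)).2 (by omega)); omega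
    · exact hl
    · have := (e (a + b + c' + 2) (by omega)).1 ((e' _ (by omega)).2 (by omega)); omega
  subst hc
  have hd : d = d' := by
    rcases lt_trichotomy d d' with hl | hl | hl
    · have := (e' (a + b + c + d + 3) (by omega)).1 ((e _ (by omega)).2 (by omega)); omega
    · exact hl
    · have := (e (a + b + c + d' + 3) (by omega)).1 ((e' _ (by omega)).2 (by omega)); omega
  rw [hd]

/-- An encoded instance determines parameters with which its bit string holds the instance. -/
theorem EncodesInstance.exists_shape {x : List Bool} {n ℓ : ℕ} {Φ : Formula n}
    {P : Fin n → Matrix (Fin ℓ) (Fin ℓ) ℚ} (h : EncodesInstance x Φ P) :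
    ∃ b, (⟨n, ℓ, Φ.size, b⟩ : Shape).Small x.length ∧
      Evaluator.header x ⟨n, ℓ, Φ.size, b⟩ = true ∧ Holds x ⟨n, ℓ, Φ.size, b⟩ P Φ 0 := by
  obtain ⟨b, gs, m, hgs, ⟨ws, hws, rfl⟩, rfl⟩ := h
  have hg : ∀ w ∈ gs, w.length = 2 * b + 4 := fun w hw => by
    obtain ⟨i, hi, rfl⟩ := List.getElem_of_mem hw
    exact ((List.forall₂_iff_get.1 hgs).2 i (by rw [hgs.length_eq]; exact hi) hi).length
  have hw : ∀ w ∈ ws, w.length = 2 * b + 1 := fun w hw => by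
    obtain ⟨i, hi, rfl⟩ := List.getElem_of_mem hw
    exact ((List.forall₂_iff_get.1 hws).2 i (by rw [hws.length_eq]; exact hi) hi).length
  have hgl : gs.length = Φ.size := by rw [← hgs.length_eq, Formula.length_nodes]
  have hx : ∀ i, (unary n ++ unary ℓ ++ unary Φ.size ++ unary b ++ gs.flatten ++ ws.flatten).getD
      (n + ℓ + Φ.size + b + 4 + i) false = (gs.flatten ++ ws.flatten).getD i false := fun i => by
    simp only [List.append_assoc, getD_unary_append]
    rw [if_neg (by omega), if_neg (by omega), if_neg (by omega), if_neg (by omega),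
      if_neg (by omega), if_neg (by omega), if_neg (by omega), if_neg (by omega)]
    congr 1
    omega
  refine ⟨b, ⟨?_, ?_, ?_, ?_⟩, ?_, ⟨rfl, fun v i j => ?_, fun h d hd => ?_⟩⟩
  · simp only [List.length_append, unary, List.length_replicate, List.length_singleton]; omega
  · simp only [List.length_append, unary, List.length_replicate, List.length_singleton]; omega
  · simp only [List.length_append, unary, List.length_replicate, List.length_singleton]; omega
  · simp only [List.length_append, unary, List.length_replicate, List.length_singleton]; omega
  · rw [Evaluator.header, allIn_eq_true]
    intro i hi
    simp only [Shape.head] at hi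
    simp only [List.append_assoc, getD_unary_append, zero_add]
    split_ifs <;> first | rfl | omega
  · have hi : ((v : ℕ) * ℓ + i) * ℓ + j < n * (ℓ * ℓ) := by
      have := v.2; have := i.2; have := j.2
      have h1 : (v : ℕ) * ℓ + i + 1 ≤ n * ℓ := by nlinarith
      nlinarith
    have := hws.getD (by rwa [length_tuple]) 0 []
    rw [getD_tuple] at this
    refine ⟨_, this, fun o ho => ?_⟩
    simp only [Shape.entry, Shape.node, Shape.head] at ho ⊢
    rw [add_assoc, add_assoc, hx,
      List.getD_append_right _ _ _ _ (by rw [length_flatten hg, hgl]; omega), length_flatten hg,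
      hgl, Nat.add_sub_cancel_left, getD_flatten _ hw ho]
  · have hh : h < (Φ.nodes 0).length := (List.getElem?_eq_some_iff.1 hd).1
    have := hgs.getD hh d []
    rw [List.getD_eq_getElem?_getD (l := Φ.nodes 0), hd, Option.getD_some] at this
    refine ⟨_, this, fun o ho => ?_⟩
    rw [Formula.length_nodes, ← hgl] at hh
    rw [Shape.node, Shape.head, zero_add, add_assoc, hx, List.getD_append _ _ _ _ (by
      rw [length_flatten hg]
      simp only at ho
      nlinarith), getD_flatten _ hg ho]

end RatEval

namespace RatEval

/-! ### The output of the evaluator -/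

theorem range_mul_map {α : Type*} (f : ℕ → α) (c : ℕ) : ∀ a : ℕ, (List.range (a * c)).map f =
    ((List.range a).map fun e => (List.range c).map fun o => f (e * c + o)).flatten
  | 0 => by simp
  | a + 1 => by
    rw [Nat.succ_mul, List.range_add, List.map_append, range_mul_map f c a, List.range_succ,
      List.map_append, List.flatten_append, List.map_map]
    simp [Function.comp_def]

theorem quotBit_map (w : ℕ) (c d : ℤ) : (List.range (2 * w + 1)).map (Evaluator.quotBit w c d) =
    (decide (c < 0) ^^ decide (d < 0)) :: (natBits w c.natAbs ++ natBits w d.natAbs) := by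
  rw [show 2 * w + 1 = (w + w) + 1 by ring, List.range_succ_eq_map, List.map_cons, List.range_add,
    List.map_append, List.map_append, List.map_map, List.map_map, List.map_map, natBits, natBits]
  congr 2
  · refine List.map_congr_left fun t ht => ?_
    have := List.mem_range.1 ht
    simp [Evaluator.quotBit, this]
  · refine List.map_congr_left fun t ht => ?_
    simp [Evaluator.quotBit]

/-- Signs and absolute values of two integers encode their quotient. -/
theorem encodesRat_quotBit {w : ℕ} {c d : ℤ} {a : ℚ} (hd : d ≠ 0) (h : (c : ℚ) = d * a)
    (hc : c.natAbs < 2 ^ w) (hdw : d.natAbs < 2 ^ w) :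
    EncodesRat w a ((List.range (2 * w + 1)).map (Evaluator.quotBit w c d)) := by
  refine ⟨_, c.natAbs, d.natAbs, hc, Int.natAbs_pos.2 hd, hdw, ?_, quotBit_map w c d⟩
  have hd' : (d : ℚ) ≠ 0 := by exact_mod_cast hd
  rw [Nat.cast_natAbs, Nat.cast_natAbs]
  push_cast
  rw [eq_div_iff (abs_ne_zero.2 hd')]
  have s : ∀ z : ℤ, (|(z : ℚ)|) = if z < 0 then -(z : ℚ) else z := fun z => by
    split_ifs with hz
    · exact abs_of_neg (by exact_mod_cast hz)
    · exact abs_of_nonneg (by exact_mod_cast not_lt.1 hz)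
  rw [s c, s d, h]
  by_cases h1 : c < 0 <;> by_cases h2 : d < 0 <;> simp [h1, h2] <;> ring

namespace Evaluator

variable {x : List Bool} {p : Shape}

theorem exists_code {N : ℕ} (hp : p.Small N) :
    ∃ u < N * N * N * N, Shape.decode N u = p := by
  obtain ⟨n, ℓ, S, b⟩ := p
  obtain ⟨h1, h2, h3, h4⟩ := hp
  simp only at h1 h2 h3 h4
  have hN : 0 < N := by omega
  refine ⟨n + N * (ℓ + N * (S + N * b)), ?_, ?_⟩
  · have a1 : S + N * b + 1 ≤ N * N := by nlinarith
    have a2 : ℓ + N * (S + N * b) + 1 ≤ N * (N * N) := by nlinarith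
    nlinarith
  · have e1 : (n + N * (ℓ + N * (S + N * b))) / N = ℓ + N * (S + N * b) := by
      rw [Nat.add_mul_div_left _ _ hN, Nat.div_eq_of_lt h1, zero_add]
    have e2 : (ℓ + N * (S + N * b)) / N = S + N * b := by
      rw [Nat.add_mul_div_left _ _ hN, Nat.div_eq_of_lt h2, zero_add]
    have e3 : (S + N * b) / N = b := by
      rw [Nat.add_mul_div_left _ _ hN, Nat.div_eq_of_lt h3, zero_add]
    simp only [Shape.decode, ← Nat.div_div_eq_div_mul, e1, e2, e3, Nat.add_mul_mod_self_left,
      Nat.mod_eq_of_lt h1, Nat.mod_eq_of_lt h2, Nat.mod_eq_of_lt h3]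

/-- By `header_unique` all candidates that pass the header test agree, so the disjunction is the
output for the true parameters. -/
theorem answer_eq (hp : p.Small x.length) (h : header x p = true) (j : ℕ) :
    answer x j = outBit x p j := by
  obtain ⟨u, hlt, hu⟩ := exists_code hp
  rw [Bool.eq_iff_iff, answer, anyIn_eq_true]
  simp only [zero_add, Bool.and_eq_true]
  constructor
  · rintro ⟨u, -, h', ho⟩
    rwa [header_unique h' h] at ho
  · intro ho
    exact ⟨_, hlt, by rw [hu]; exact ⟨h, ho⟩⟩

/-- The output bits, cut into the parts of a result. -/
theorem map_outBit (x : List Bool) (p : Shape) (r : ℕ) :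
    (List.range (bits x.length + 1 + (p.side * p.side * (2 * bits x.length + 1) + r) + 1)).map
      (outBit x p) = regular x p :: (unary (bits x.length) ++ ((List.range (p.side * p.side)).map
        fun e => (List.range (2 * bits x.length + 1)).map (quotBit (bits x.length)
          (system x p (outSystem x.length p.side e)).det (system x p (p.size - 1)).det)).flatten ++
        (List.range r).map fun t => outBit x p
          (bits x.length + 1 + (p.side * p.side * (2 * bits x.length + 1) + t) + 1)) := by
  generalize hw : bits x.length = w
  rw [List.range_succ_eq_map, List.map_cons, List.map_map, List.range_add (n := w + 1), List.range_add (m := r),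
    List.map_append, List.map_append, List.map_append, List.map_map, List.map_map, List.map_map,
    range_mul_map, ← List.append_assoc]
  congr 1
  congr 1
  congr 1
  · rw [List.range_succ, List.map_append, unary]
    congr 1
    · rw [List.eq_replicate_iff]
      refine ⟨by simp, fun b hb => ?_⟩
      obtain ⟨t, ht, rfl⟩ := List.mem_map.1 hb
      have := List.mem_range.1 ht
      simp [outBit, hw, this]
    · simp [outBit, hw]
  · congr 1
    refine List.map_congr_left fun e he => List.map_congr_left fun o ho => ?_
    have he' := List.mem_range.1 he
    have ho' := List.mem_range.1 ho
    have h1 : w + 1 + (e * (2 * w + 1) + o) + 1 - w - 2 = (2 * w + 1) * e + o := by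
      rw [mul_comm]; omega
    have h2 : ((2 * w + 1) * e + o) / (2 * w + 1) = e := by
      rw [Nat.mul_add_div (by omega), Nat.div_eq_of_lt ho', add_zero]
    have h3 : ((2 * w + 1) * e + o) % (2 * w + 1) = o := by
      rw [Nat.mul_add_mod, Nat.mod_eq_of_lt ho']
    simp only [Function.comp_apply, Nat.succ_eq_add_one, outBit, hw]
    rw [if_neg (by omega), if_neg (by omega), if_neg (by omega), h1, h2, h3, entryBit, hw,
      decide_eq_true he', Bool.true_and]

theorem system_eq_matrix {q : ℕ} (hq : q < x.length) : system x p q =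
    (Table.ofBits x p).matrix x.length p.side q (dim x) := by
  ext R C
  have : ∀ C, ¬ Replaced x.length p.size q C := fun C h => absurd h.1 (by omega)
  simp [system, sysMatrix, posMatrix, negMatrix, this, lastGate, hq, Table.matrix, Table.entry]

/-- The digits of `q - N` in base `N` are the indices `i` and `j` of the entry. -/
theorem system_eq_cramer {i j : ℕ} (hj : j < x.length) : system x p (x.length + i * x.length + j) =
    (Table.ofBits x p).cramer x.length p.side (p.size - 1) (dim x) i j := by
  have h1 : (x.length + i * x.length + j - x.length) / x.length = i := by
    rw [add_assoc, Nat.add_sub_cancel_left, mul_comm, Nat.mul_add_div (by omega),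
      Nat.div_eq_of_lt hj, add_zero]
  have h2 : (x.length + i * x.length + j - x.length) % x.length = j := by
    rw [add_assoc, Nat.add_sub_cancel_left, mul_comm, Nat.mul_add_mod, Nat.mod_eq_of_lt hj]
  ext R C
  by_cases hC : (C : ℕ) = idx x.length (p.size - 1) 0 i 0
  · have : Replaced x.length p.size (x.length + i * x.length + j)
        (idx x.length (p.size - 1) 0 i 0) := ⟨by omega, by rw [h1]⟩
    simp [system, sysMatrix, posMatrix, negMatrix, this, Table.cramer, hC, h2]
  · have : ¬ Replaced x.length p.size (x.length + i * x.length + j) C := fun h => hC (by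
      rw [h.2, h1])
    have hl : ¬ x.length + i * x.length + j < x.length := by omega
    simp [system, sysMatrix, posMatrix, negMatrix, this, Table.cramer, hC, lastGate, hl, Table.entry]

/-- Each of fewer than `N` gates takes `3 * N ^ 2` positions. -/
theorem dim_large {S : ℕ} (h : S < x.length) : S * 3 * x.length * x.length ≤ dim x := by
  rw [dim]
  generalize x.length = N at *
  calc S * 3 * N * N ≤ (N + 2) * (N + 2) ^ 2 * (N + 2) * (N + 2) := by
        gcongr
        · omega
        · nlinarith
        · omega
        · omega
    _ = (N + 2) ^ 5 := by ring

/-- The output of the evaluator on an encoded instance is correct. -/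
theorem encodesResult {n ℓ : ℕ} {Φ : Formula n} {P : Fin n → Matrix (Fin ℓ) (Fin ℓ) ℚ}
    (h : EncodesInstance x Φ P) : EncodesResult (machine.circuits.output x) (Φ.eval P) := by
  obtain ⟨b, hp, hh, hold⟩ := h.exists_shape
  have hf := hold.fits
  obtain ⟨u, hlt, hu⟩ := exists_code hp
  have hc := isCode_decode hlt
  rw [hu] at hc
  have hS := Φ.size_pos
  have hSN : Φ.size < x.length := hp.size
  have hℓ : ℓ < x.length := hp.side
  have hD := dim_large hSN
  have hreg : regular x ⟨n, ℓ, Φ.size, b⟩ = true ↔ ∀ g < Φ.size,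
      ((Table.ofBits x ⟨n, ℓ, Φ.size, b⟩).matrix x.length ℓ g (dim x)).det ≠ 0 := by
    rw [regular, allIn_eq_true]
    refine forall₂_congr fun g hg => ?_
    rw [zero_add, decide_eq_true_eq, system_eq_matrix (hg.trans hSN)]
  -- The number of outputs depends on `N` only; what exceeds the `ℓ * ℓ` entries is padding.
  obtain ⟨r, hr⟩ : ∃ r, x.length * x.length * (2 * bits x.length + 1) =
      ℓ * ℓ * (2 * bits x.length + 1) + r := Nat.exists_eq_add_of_le (by gcongr)
  have hout : machine.numOut x.length =
      bits x.length + 1 + (ℓ * ℓ * (2 * bits x.length + 1) + r) + 1 := by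
    rw [← hr]; simp only [machine]; omega
  rw [output_machine, List.map_congr_left fun j _ => answer_eq hp hh j, hout, map_outBit]
  cases hA : Φ.eval P with
  | none =>
    obtain ⟨g, hg, h0⟩ := Table.exists_det_eq_zero hℓ hf hA hD
    -- A single singular system turns the first output bit off, and all further bits then count as
    -- padding.
    rw [Bool.eq_false_iff.2 fun h => hreg.1 h g hg h0]
    exact ⟨_, rfl⟩
  | some A =>
    have hreg' := hreg.2 fun g hg => Table.det_ne_zero hℓ hf (by simp [hA]) hg
      (le_trans (by gcongr; omega) hD)
    rw [hreg']
    refine ⟨_, _, _, ⟨_, List.forall₂_iff_get.2 ⟨by simp [length_entries], fun e h1 h2 => ?_⟩, rfl⟩, rfl⟩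
    have he : e < ℓ * ℓ := by rwa [length_entries] at h1
    have h0 : 0 < ℓ := Nat.pos_of_ne_zero fun h => by simp [h] at he
    have hi : e / ℓ < ℓ := Nat.div_lt_of_lt_mul he
    have hj : e % ℓ < ℓ := Nat.mod_lt _ h0
    have hget : (entries A).get ⟨e, h1⟩ = A ⟨e / ℓ, hi⟩ ⟨e % ℓ, hj⟩ := by
      have := getD_entries A ⟨e / ℓ, hi⟩ ⟨e % ℓ, hj⟩
      simp only [mul_comm (e / ℓ), Nat.div_add_mod] at this
      rw [← this, List.getD_eq_getElem _ _ h1, List.get_eq_getElem]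
    rw [hget]
    simp only [List.get_eq_getElem, List.getElem_map, List.getElem_range]
    have hb := forty_lt_base x.length
    -- Only the bound on the magnitude is taken from `hasVal_det` here, so any `k` with `base ≤ 2 ^
    -- k` serves.
    have hq1 := hasVal_det hc (Nat.lt_two_pow_self).le (outSystem_lt hℓ he)
    have hq2 := hasVal_det hc (Nat.lt_two_pow_self).le (q := Φ.size - 1) (by
      have := four_mul_add_lt x.length
      rw [machine_base]; omega)
    refine encodesRat_quotBit ?_ ?_ hq1.2.2.2 hq2.2.2.2
    · rw [system_eq_matrix (by omega)]
      exact hreg.1 hreg' _ (by omega)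
    · rw [outSystem, system_eq_cramer (by omega), system_eq_matrix (by omega)]
      exact Table.det_cramer hℓ hf hA hD ⟨e / ℓ, hi⟩ ⟨e % ℓ, hj⟩

end Evaluator

end RatEval

theorem mainTheorem10 : RatEval.SolvableInNC 4 RatEval.EvaluationProblem :=
  RatEval.Evaluator.machine.solvableInNC fun _ _ _ _ _ h =>
    RatEval.Evaluator.encodesResult h
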